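/- Let $V$ be a complex vector space of dimension $2n$ with a symplectic form $\Omega$, let $1\le k<n$, and let $X=G_\omega(k,2n)$ be the Grassmannian of isotropic $k$-planes of $V$, in its minimal embedding $E\mapsto[\Lambda^kE]$ in $\mathbb P(\Lambda^{\langle k\rangle}V)$. Here, for a symplectic vector space $(W,\omega)$, $\Lambda^{\langle a\rangle}W=\Lambda^aW/(\omega^\sharp\wedge\Lambda^{a-2}W)$, where $\omega^\sharp\in\Lambda^2W$ is the bivector corresponding to $\omega$. For $x\in X$, $\hat T^{(p)}\subset\Lambda^{\langle k\rangle}V$ is the (cone over the) $p$-th osculating space of $X$ at $x$, $N_p=\hat T^{(p)}/\hat T^{(p-1)}$ is the $p$-th normal space ($N_1=T$ is the tangent space; twists by $\hat x$ are ignored), $\mathbb{FF}^p:S^pT\to N_p$ is the $p$-th fundamental form, and ${\rm Base}\,|\mathbb{FF}^p|\subset\mathbb P T$ is the zero locus of the polynomials $l\circ\mathbb{FF}^p$, $l\in N_p^*$. Let $E\in X$ and let $U=E^\perp/E$ with its induced symplectic form. Choose an isotropic complement $F$ of $E^\perp$ in $V$; the group $H$ of the symplectic automorphisms of $V$ that preserve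 $E$ and $F$ and have determinant $1$ on $E$ is isomorphic, by its actions on $E$ and on $U$, to $SL(E)\times Sp(U)\cong SL_k\times Sp_{2n-2k}$; it is the semisimple part of a Levi subgroup of the stabiliser of $E$. Let $S_{2^e1^d}$ denote the Schur functor of the partition with $e$ parts equal to $2$ and $d$ parts equal to $1$. All spaces below are taken at the point $E$. (1) As an $H$-module $T=T_1\oplus T_2$ with $T_1=E^*\otimes U$ and $T_2=S^2E^*$, where $T_i$ is the sum of the root spaces of the roots in which the simple root defining the parabolic has coefficient $-i$. (2) For every $p\ge1$, as $H$-modules, $$N_p\simeq\bigoplus_{d+e=p}\Lambda^dU\otimes S_{2^e1^d}E^*\simeq\bigoplus_{\substack{a+b+c=p\\ c\le b,\ a+c\le n-k}}\Lambda^{\langle a\rangle}U\otimes S_{2^{b-c}1^{a+2c}}E^*.$$ In particular $N_2\simeq\Lambda^2U\otimes\Lambda^2E^*\oplus U\otimes S_{21}E^*\oplus S_{22}E^*$. The length of the normal graduation is $k$: $N_p=0$ for $p>k$, and the last nonzero term is $N_k\simeq\Lambda^k(E^*\oplus U)$. (3) Under a suitable $H$-isomorphism $T\simeq (E^*\otimes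 U)\oplus S^2E^*$ as in (1), for every $p\ge2$, $${\rm Base}\,|\mathbb{FF}^p|=\mathbb P\,\overline{\{e_1\otimes u_1+\cdots+e_{p-1}\otimes u_{p-1}\oplus e_1^2+\cdots+e_{p-1}^2\mid e_j\in E^*,\ u_j\in U\}},$$ and for $p=2$ $${\rm Base}\,|\mathbb{FF}^2|=\mathbb P\,\overline{\{e\otimes u\oplus e^2\mid e\in E^*\setminus\{0\},\ u\in U\setminus\{0\}\}}$$ (Zariski closures). (4) The points $[e\otimes u\oplus e^2]$ with $e\ne0$ and $u\neq0$ form a single $H$-orbit, which is open and dense in ${\rm Base}\,|\mathbb{FF}^2|$. Its boundary is the union of two disjoint closed $H$-orbits, the Segre variety $Y_1=\{[e\otimes u]\}\subset\mathbb P(T_1)$ and the Veronese variety $Y_2=\{[e^2]\}\subset\mathbb P(T_2)$. The Segre map $([e],[u])\mapsto[e\otimes u]$ and the Veronese map $[e]\mapsto[e^2]$ are isomorphisms $\mathbb P^{k-1}\times\mathbb P^{2n-2k-1}=\mathbb P(E^*)\times\mathbb P(U)\simeq Y_1$ and $\mathbb P^{k-1}=\mathbb P(E^*)\simeq v_2(\mathbb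 P^{k-1})=Y_2$. -/

import Mathlib

open scoped TensorProduct DirectSum LinearAlgebra.Projectivization Topology

noncomputable section

namespace SympGrass

/-! ## Multilinear algebra and representations -/

section Functors

variable {G W : Type*} [Group G] [AddCommGroup W] [Module ℂ W]

/-- The `n`-th exterior power `Λ^n W`, as a type of its own. -/
def Ext (n : ℕ) (W : Type*) [AddCommGroup W] [Module ℂ W] : Type _ := ⋀[ℂ]^n W

instance (n : ℕ) (W : Type*) [AddCommGroup W] [Module ℂ W] : AddCommGroup (Ext n W) :=
  inferInstanceAs (AddCommGroup (⋀[ℂ]^n W))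

instance (n : ℕ) (W : Type*) [AddCommGroup W] [Module ℂ W] : Module ℂ (Ext n W) :=
  inferInstanceAs (Module ℂ (⋀[ℂ]^n W))

/-- The product `w_1 ∧ ⋯ ∧ w_n`. -/
def wedge (n : ℕ) : W [⋀^Fin n]→ₗ[ℂ] Ext n W := exteriorPower.ιMulti ℂ n

/-- The map `Λ^n f`. -/
def extMap (n : ℕ) (f : W →ₗ[ℂ] W) : Ext n W →ₗ[ℂ] Ext n W := exteriorPower.map n f

theorem extMap_wedge (n : ℕ) (f : W →ₗ[ℂ] W) (w : Fin n → W) :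
    extMap n f (wedge n w) = wedge n (fun i => f (w i)) :=
  exteriorPower.map_apply_ιMulti f w

theorem extMap_comp (n : ℕ) (f g : W →ₗ[ℂ] W) :
    extMap n (f ∘ₗ g) = extMap n f ∘ₗ extMap n g :=
  exteriorPower.map_comp g f

/-- The `n`-th exterior power of a representation. -/
def extRep (ρ : Representation ℂ G W) (n : ℕ) : Representation ℂ G (Ext n W) where
  toFun g := extMap n (ρ g)
  map_one' := by
    rw [map_one]
    exact exteriorPower.map_id
  map_mul' g h := by
    rw [map_mul]
    exact extMap_comp n (ρ g) (ρ h)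

theorem extRep_wedge (ρ : Representation ℂ G W) (n : ℕ) (g : G) (w : Fin n → W) :
    extRep ρ n g (wedge n w) = wedge n (fun i => ρ g (w i)) :=
  extMap_wedge n (ρ g) w

/-- The exchange relations on `Λ^{d+e} W ⊗ Λ^e W`: a vector `y_j` of the second column is
exchanged in turn with every vector `x_i` of the first column. -/
def exchangeRel (W : Type*) [AddCommGroup W] [Module ℂ W] (d e : ℕ) :
    Submodule ℂ (Ext (d + e) W ⊗[ℂ] Ext e W) :=
  Submodule.span ℂ {t | ∃ (x : Fin (d + e) → W) (y : Fin e → W) (j : Fin e),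
    t = wedge (d + e) x ⊗ₜ[ℂ] wedge e y
      - ∑ i, wedge (d + e) (Function.update x i (y j)) ⊗ₜ[ℂ]
          wedge e (Function.update y j (x i))}

/-- The Schur module `S_{2^e 1^d} W` of the partition with `e` parts equal to `2` and `d` parts
equal to `1`, that is, of the Young diagram whose two columns have lengths `d + e` and `e`:
the quotient of `Λ^{d+e} W ⊗ Λ^e W` by the exchange relations (over a field of characteristic
zero the exchanges of single boxes generate all of them). -/
abbrev Schur (W : Type*) [AddCommGroup W] [Module ℂ W] (d e : ℕ) : Type _ :=
  (Ext (d + e) W ⊗[ℂ] Ext e W) ⧸ exchangeRel W d e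

theorem exchangeRel_le (ρ : Representation ℂ G W) (d e : ℕ) (g : G) :
    exchangeRel W d e ≤
      (exchangeRel W d e).comap (((extRep ρ (d + e)).tprod (extRep ρ e)) g) := by
  refine Submodule.span_le.2 ?_
  rintro _ ⟨x, y, j, rfl⟩
  refine Submodule.subset_span ⟨ρ g ∘ x, ρ g ∘ y, j, ?_⟩
  simp only [map_sub, map_sum, Representation.tprod_apply, TensorProduct.map_tmul, extRep_wedge,
    Function.comp_apply]
  refine congrArg₂ _ rfl (Finset.sum_congr rfl fun i _ => ?_)
  exact congrArg₂ _ (congrArg _ (Function.comp_update (ρ g) x i (y j)))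
    (congrArg _ (Function.comp_update (ρ g) y j (x i)))

/-- `S_{2^e 1^d}` of a representation. -/
def schurRep (ρ : Representation ℂ G W) (d e : ℕ) : Representation ℂ G (Schur W d e) :=
  ((extRep ρ (d + e)).tprod (extRep ρ e)).quotient (exchangeRel W d e) (exchangeRel_le ρ d e)

/-- `Ω ∧ Λ^{a-2} W` inside `Λ^a W`, where `Ω = ∑ b_i ∧ b'_i` is the bivector given by the
symplectic form `ω`; here `b` is a basis of `W` and `b'` is the `ω`-dual basis. -/
def omegaWedge (ω : LinearMap.BilinForm ℂ W) : (a : ℕ) → Submodule ℂ (Ext a W)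
  | 0 => ⊥
  | 1 => ⊥
  | m + 2 => Submodule.span ℂ {t | ∃ (N : ℕ) (b : Module.Basis (Fin N) ℂ W) (b' : Fin N → W)
      (w : Fin m → W), (∀ i j, ω (b i) (b' j) = if i = j then 1 else 0) ∧
      t = ∑ i, wedge (m + 2) (Matrix.vecCons (b i) (Matrix.vecCons (b' i) w))}

/-- The reduced exterior power `Λ^{⟨a⟩} W = Λ^a W / (Ω ∧ Λ^{a-2} W)`. -/
abbrev RedExt (ω : LinearMap.BilinForm ℂ W) (a : ℕ) : Type _ := (Ext a W) ⧸ omegaWedge ω a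

theorem omegaWedge_le (ρ : Representation ℂ G W) (ω : LinearMap.BilinForm ℂ W)
    (hρ : ∀ g x y, ω (ρ g x) (ρ g y) = ω x y) (a : ℕ) (g : G) :
    omegaWedge ω a ≤ (omegaWedge ω a).comap (extRep ρ a g) := by
  match a with
  | 0 => exact bot_le
  | 1 => exact bot_le
  | m + 2 =>
    refine Submodule.span_le.2 ?_
    rintro _ ⟨N, b, b', w, hb, rfl⟩
    have hinv : ∀ x, ρ g⁻¹ (ρ g x) = x := fun x => by
      rw [← Module.End.mul_apply, ← map_mul]; simp
    have hinv' : ∀ x, ρ g (ρ g⁻¹ x) = x := fun x => by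
      rw [← Module.End.mul_apply, ← map_mul]; simp
    let e : W ≃ₗ[ℂ] W := LinearEquiv.ofLinearMap (ρ g) (ρ g⁻¹)
      (LinearMap.ext hinv') (LinearMap.ext hinv)
    have he : ∀ x, e x = ρ g x := fun x => rfl
    refine Submodule.subset_span ⟨N, b.map e, ρ g ∘ b', ρ g ∘ w, ?_, ?_⟩
    · intro i j
      simp [he, hρ, hb]
    · simp only [map_sum, extRep_wedge, Module.Basis.map_apply, he]
      refine Finset.sum_congr rfl fun i _ => congrArg _ (funext fun j => ?_)
      refine Fin.cases rfl (fun j => Fin.cases rfl (fun j => rfl) j) j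

/-- The reduced exterior power of a representation that preserves the symplectic form. -/
def redExtRep (ρ : Representation ℂ G W) (ω : LinearMap.BilinForm ℂ W)
    (hρ : ∀ g x y, ω (ρ g x) (ρ g y) = ω x y) (a : ℕ) : Representation ℂ G (RedExt ω a) :=
  (extRep ρ a).quotient (omegaWedge ω a) (omegaWedge_le ρ ω hρ a)

/-- `S²(W^*)`, realised as the space of symmetric bilinear forms on `W`. -/
def symForms (W : Type*) [AddCommGroup W] [Module ℂ W] :
    Submodule ℂ (W →ₗ[ℂ] Module.Dual ℂ W) where
  carrier := {B | ∀ x y, B x y = B y x}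
  zero_mem' := by simp
  add_mem' {a b} ha hb x y := by simp [ha x y, hb x y]
  smul_mem' c a ha x y := by simp [ha x y]

/-- The square `e² ∈ S²(W^*)` of a linear form, `(x, y) ↦ e(x) e(y)`. -/
def sq (e : Module.Dual ℂ W) : symForms W :=
  ⟨LinearMap.smulRight e e, fun x y => by simp [mul_comm]⟩

/-- `S²` of the dual of a representation. -/
def symRep (ρ : Representation ℂ G W) : Representation ℂ G (symForms W) :=
  (Representation.linHom ρ ρ.dual).subrepresentation (symForms W) fun g B hB x y => by
    simpa [Module.Dual.transpose_apply] using hB (ρ g⁻¹ x) (ρ g⁻¹ y)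

end Functors

/-! ## Subsets of projective spaces -/

section Projective

variable {W W' A B : Type*} [AddCommGroup W] [Module ℂ W] [AddCommGroup W'] [Module ℂ W']
  [AddCommGroup A] [Module ℂ A] [AddCommGroup B] [Module ℂ B]

/-- The Zariski closure in `ℙ(W)`: the common zeros of all homogeneous polynomials that vanish
on the set. A homogeneous polynomial of degree `d` is `w ↦ M(w, …, w)` with `M` multilinear. -/
def zariskiClosure (S : Set (ℙ ℂ W)) : Set (ℙ ℂ W) :=
  {x | ∀ (d : ℕ) (M : MultilinearMap ℂ (fun _ : Fin d => W) ℂ),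
    (∀ y ∈ S, M (fun _ => y.rep) = 0) → M (fun _ => x.rep) = 0}

/-- Zariski closed subsets of `ℙ(W)`. -/
def IsZariskiClosed (S : Set (ℙ ℂ W)) : Prop := zariskiClosure S = S

/-- The orbits of the action of `G` on `ℙ(W)` induced by a representation. -/
def IsProjOrbit {G : Type*} [Group G] (ρ : Representation ℂ G W) (O : Set (ℙ ℂ W)) : Prop :=
  ∃ x : ℙ ℂ W, O = {y | ∃ g, y.submodule = x.submodule.map (ρ g)}

/-- A map from a subset `r : X → ℙ(W)` to `ℙ(W')` is regular if near each point it is given by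
homogeneous polynomials of the same degree without common zero. -/
def IsRegular {X : Type*} (r : X → ℙ ℂ W) (f : X → ℙ ℂ W') : Prop :=
  ∀ x, ∃ (d : ℕ) (q : MultilinearMap ℂ (fun _ : Fin d => W) W'),
    q (fun _ => (r x).rep) ≠ 0 ∧
    ∀ (y : X) (h : q (fun _ => (r y).rep) ≠ 0), f y = Projectivization.mk ℂ _ h

/-- A map from `ℙ(A) × ℙ(B)` to `ℙ(W')` is regular if near each point it is given by
bihomogeneous polynomials of the same bidegree without common zero. -/
def IsRegularProd (f : ℙ ℂ A × ℙ ℂ B → ℙ ℂ W') : Prop :=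
  ∀ x : ℙ ℂ A × ℙ ℂ B, ∃ (c d : ℕ) (q : MultilinearMap ℂ (fun _ : Fin c => A)
      (MultilinearMap ℂ (fun _ : Fin d => B) W')),
    q (fun _ => x.1.rep) (fun _ => x.2.rep) ≠ 0 ∧
    ∀ (y : ℙ ℂ A × ℙ ℂ B) (h : q (fun _ => y.1.rep) (fun _ => y.2.rep) ≠ 0),
      f y = Projectivization.mk ℂ _ h

end Projective

/-! ## Osculating spaces and fundamental forms

`C` is the punctured affine cone over a subset `X` of `ℙ(W)`, and `v ∈ C` represents a
point `x` of `X`. Twists by line bundles are ignored, by fixing `v`. -/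

section Osculation

variable {W : Type*} [AddCommGroup W] [Module ℂ W]

/-- A germ at `0` of a holomorphic curve in the cone `C`, with value `v` at `0`. -/
structure IsArc (C : Set W) (v : W) (γ : ℂ → W) : Prop where
  analytic : ∀ l : Module.Dual ℂ W, AnalyticAt ℂ (fun s => l (γ s)) 0
  base : γ 0 = v
  mem : ∀ᶠ s in 𝓝 (0 : ℂ), γ s ∈ C

/-- `w` is the `j`-th derivative of `γ` at `0`. -/
def HasDer (γ : ℂ → W) (j : ℕ) (w : W) : Prop :=
  ∀ l : Module.Dual ℂ W, iteratedDeriv j (fun s => l (γ s)) 0 = l w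

/-- The cone over the `p`-th osculating space: the span of the derivatives of order at most `p`
of the curves in `C` through `v`. For `p = 0` it is the line of `v`, for `p = 1` the affine
tangent space. -/
def osc (C : Set W) (v : W) (p : ℕ) : Submodule ℂ W :=
  Submodule.span ℂ {w | ∃ γ j, IsArc C v γ ∧ j ≤ p ∧ HasDer γ j w}

/-- The `p`-th normal space `N_p` (for `p = 1` it is the tangent space of `X` at `x`):
the quotient of the `p`-th osculating space by the previous one. -/
abbrev NormalSpace (C : Set W) (v : W) (p : ℕ) : Type _ :=
  osc C v p ⧸ (osc C v (p - 1)).submoduleOf (osc C v p)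

/-- The class in `N_p` of a vector of the `p`-th osculating space. -/
def nmk (C : Set W) (v : W) (p : ℕ) : osc C v p →ₗ[ℂ] NormalSpace C v p :=
  ((osc C v (p - 1)).submoduleOf (osc C v p)).mkQ

/-- `F` is the `p`-th fundamental form of `X` at `x`: the symmetric multilinear map from the
tangent space to `N_p` such that `F(γ', …, γ') = γ^{(p)}` for every curve `γ` through `v`. -/
def IsFundForm (C : Set W) (v : W) (p : ℕ)
    (F : MultilinearMap ℂ (fun _ : Fin p => NormalSpace C v 1) (NormalSpace C v p)) : Prop :=
  (∀ (σ : Equiv.Perm (Fin p)) t, F (t ∘ σ) = F t) ∧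
  ∀ (γ : ℂ → W) (t : osc C v 1) (w : osc C v p), IsArc C v γ → HasDer γ 1 t → HasDer γ p w →
    F (fun _ => nmk C v 1 t) = nmk C v p w

/-- The base locus, in the projectivised tangent space, of the linear system `|F|` spanned by
the polynomials `l ∘ F`, where `l` is a linear form on `N_p`. -/
def baseLocus {T N : Type*} [AddCommGroup T] [Module ℂ T] [AddCommGroup N] [Module ℂ N] {p : ℕ}
    (F : MultilinearMap ℂ (fun _ : Fin p => T) N) : Set (ℙ ℂ T) :=
  {x | ∀ l : Module.Dual ℂ N, l (F fun _ => x.rep) = 0}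

variable {G : Type*} [Group G]

theorem osc_le (C : Set W) (v : W) (ρ : Representation ℂ G W)
    (hC : ∀ g, ∀ w ∈ C, ρ g w ∈ C) (hv : ∀ g, ρ g v = v) (p : ℕ) (g : G) :
    osc C v p ≤ (osc C v p).comap (ρ g) := by
  refine Submodule.span_le.2 ?_
  rintro w ⟨γ, j, hγ, hj, hw⟩
  refine Submodule.subset_span ⟨fun s => ρ g (γ s), j, ⟨fun l => hγ.analytic (l ∘ₗ ρ g), ?_, ?_⟩,
    hj, fun l => hw (l ∘ₗ ρ g)⟩
  · simp [hγ.base, hv]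
  · exact hγ.mem.mono fun s hs => hC g _ hs

/-- The action on `N_p` of a group that preserves the cone `C` and fixes `v`. -/
def normalRep (C : Set W) (v : W) (ρ : Representation ℂ G W)
    (hC : ∀ g, ∀ w ∈ C, ρ g w ∈ C) (hv : ∀ g, ρ g v = v) (p : ℕ) :
    Representation ℂ G (NormalSpace C v p) :=
  (ρ.subrepresentation (osc C v p) (osc_le C v ρ hC hv p)).quotient
    ((osc C v (p - 1)).submoduleOf (osc C v p))
    (fun g _ hx => osc_le C v ρ hC hv (p - 1) g hx)

end Osculation

/-! ## Symplectic Grassmannians -/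

section Symplectic

variable {V : Type*} [AddCommGroup V] [Module ℂ V]

/-- The symplectic group. -/
def spGroup (ω : LinearMap.BilinForm ℂ V) : Subgroup (V ≃ₗ[ℂ] V) where
  carrier := {g | ∀ x y, ω (g x) (g y) = ω x y}
  one_mem' := fun _ _ => rfl
  mul_mem' {a b} ha hb x y := by
    rw [LinearEquiv.mul_apply, LinearEquiv.mul_apply, ha, hb]
  inv_mem' {a} ha x y := by
    have h := ha (a⁻¹ x) (a⁻¹ y)
    have e : ∀ z, a (a⁻¹ z) = z := fun z => a.apply_symm_apply z
    rw [e, e] at h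
    exact h.symm

/-- The standard representation of the symplectic group. -/
def spRep (ω : LinearMap.BilinForm ℂ V) : Representation ℂ (spGroup ω) V where
  toFun g := (g : V ≃ₗ[ℂ] V).toLinearMap
  map_one' := rfl
  map_mul' _ _ := rfl

theorem spRep_form (ω : LinearMap.BilinForm ℂ V) (g : spGroup ω) (x y : V) :
    ω (spRep ω g x) (spRep ω g y) = ω x y := g.2 x y

/-- The punctured affine cone over the Grassmannian of isotropic `k`-planes of `V`, in its
minimal embedding in `ℙ(Λ^{⟨k⟩} V)`: the classes of the products `v_1 ∧ ⋯ ∧ v_k`, where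
`v_1, …, v_k` is a basis of an isotropic `k`-plane. -/
def isoCone (ω : LinearMap.BilinForm ℂ V) (k : ℕ) : Set (RedExt ω k) :=
  {w | ∃ v : Fin k → V, LinearIndependent ℂ v ∧ (∀ i j, ω (v i) (v j) = 0) ∧
    w = (omegaWedge ω k).mkQ (wedge k v)}

/-- A symplectic form `ω` on `V`, an isotropic subspace `E`, and the choice of a Levi subgroup
of the stabiliser of `E`, which is the choice of an isotropic complement `F` of `E^⊥`. -/
structure IsotropicFlag (V : Type*) [AddCommGroup V] [Module ℂ V] where
  ω : LinearMap.BilinForm ℂ V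
  alt : ω.IsAlt
  nondeg : ω.Nondegenerate
  E : Submodule ℂ V
  F : Submodule ℂ V
  isotropic_E : ∀ x ∈ E, ∀ y ∈ E, ω x y = 0
  isotropic_F : ∀ x ∈ F, ∀ y ∈ F, ω x y = 0
  compl : IsCompl (ω.orthogonal E) F

namespace IsotropicFlag

variable (S : IsotropicFlag V)

/-- `E^⊥`. -/
abbrev perp : Submodule ℂ V := S.ω.orthogonal S.E

/-- `U = E^⊥ / E`. -/
abbrev U : Type _ := S.perp ⧸ S.E.submoduleOf S.perp

/-- The form induced by `ω` on `U = E^⊥ / E`. -/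
def formU : LinearMap.BilinForm ℂ S.U :=
  (S.E.submoduleOf S.perp).liftQ
    (LinearMap.flip ((S.E.submoduleOf S.perp).liftQ
      (LinearMap.flip (S.ω.domRestrict₁₂ S.perp S.perp))
      (fun y hy => by
        ext x
        exact S.alt.isRefl _ _ (x.2 y hy))))
    (fun x hx => by
      ext y
      exact y.2 x hx)

@[simp]
theorem formU_mk (x y : S.perp) :
    S.formU (Submodule.Quotient.mk x) (Submodule.Quotient.mk y) = S.ω (x : V) (y : V) := rfl

/-- The semisimple part `H` of the Levi subgroup: the symplectic automorphisms of `V` that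
preserve `E`, with determinant one on `E`, and preserve `F`. -/
def H : Subgroup (spGroup S.ω) where
  carrier := {g | (∃ a : SpecialLinearGroup ℂ S.E, ∀ x : S.E, spRep S.ω g x = (a x : S.E)) ∧
    S.F.map (spRep S.ω g) = S.F}
  one_mem' := ⟨⟨1, fun _ => rfl⟩, by rw [map_one]; exact Submodule.map_id _⟩
  mul_mem' {g h} hg hh := by
    obtain ⟨⟨a, ha⟩, hg⟩ := hg
    obtain ⟨⟨b, hb⟩, hh⟩ := hh
    refine ⟨⟨a * b, fun x => ?_⟩, ?_⟩
    · rw [map_mul, Module.End.mul_apply, hb, ha]; rfl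
    · rw [map_mul, Module.End.mul_eq_comp, Submodule.map_comp, hh, hg]
  inv_mem' {g} hg := by
    obtain ⟨⟨a, ha⟩, hg⟩ := hg
    have e : ∀ z, spRep S.ω g⁻¹ (spRep S.ω g z) = z := fun z => by
      rw [← Module.End.mul_apply, ← map_mul]; simp
    refine ⟨⟨a⁻¹, fun x => ?_⟩, ?_⟩
    · have h := ha (a⁻¹ x)
      have h2 : a (a⁻¹ x) = x := a.1.apply_symm_apply x
      rw [h2] at h
      rw [← h, e]
    · conv_lhs => rw [← hg]
      rw [← Submodule.map_comp]
      have : spRep S.ω g⁻¹ ∘ₗ spRep S.ω g = LinearMap.id := LinearMap.ext e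
      rw [this, Submodule.map_id]

/-- `V` as an `H`-module. -/
def repV : Representation ℂ S.H V := (spRep S.ω).comp S.H.subtype

theorem repV_form (h : S.H) (x y : V) : S.ω (S.repV h x) (S.repV h y) = S.ω x y :=
  spRep_form S.ω h.1 x y

theorem le_comap_E (h : S.H) : S.E ≤ S.E.comap (S.repV h) := by
  intro x hx
  obtain ⟨⟨a, ha⟩, -⟩ := h.2
  have h2 := ha ⟨x, hx⟩
  change S.repV h x ∈ S.E
  have h3 : S.repV h x = (a ⟨x, hx⟩ : S.E) := h2
  rw [h3]
  exact (a ⟨x, hx⟩).2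

theorem le_comap_perp (h : S.H) : S.perp ≤ S.perp.comap (S.repV h) := by
  intro y hy x hx
  have e : S.repV h (S.repV h⁻¹ x) = x := by
    rw [← Module.End.mul_apply, ← map_mul]; simp
  have h1 := hy _ (S.le_comap_E h⁻¹ hx)
  change S.ω x (S.repV h y) = 0
  rw [← e, S.repV_form]
  exact h1

/-- `E` as an `H`-module. -/
def repE : Representation ℂ S.H S.E := S.repV.subrepresentation S.E S.le_comap_E

/-- `U = E^⊥ / E` as an `H`-module. -/
def repU : Representation ℂ S.H S.U :=
  (S.repV.subrepresentation S.perp S.le_comap_perp).quotient (S.E.submoduleOf S.perp)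
    (fun h _ hx => S.le_comap_E h hx)

theorem repU_form (h : S.H) (u u' : S.U) :
    S.formU (S.repU h u) (S.repU h u') = S.formU u u' := by
  induction u using Submodule.Quotient.induction_on with
  | _ x =>
    induction u' using Submodule.Quotient.induction_on with
    | _ y => exact S.repV_form h x y

/-- `Λ^{⟨k⟩} V` as an `H`-module. -/
def repRed (k : ℕ) : Representation ℂ S.H (RedExt S.ω k) :=
  redExtRep S.repV S.ω S.repV_form k

/-- The class of `e_1 ∧ ⋯ ∧ e_k` for a basis of `E`: a representative of the point `E` of the
Grassmannian. -/
def point {k : ℕ} (b : Module.Basis (Fin k) ℂ S.E) : RedExt S.ω k :=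
  (omegaWedge S.ω k).mkQ (wedge k fun i => (b i : V))

theorem repRed_mem (k : ℕ) (h : S.H) (w : RedExt S.ω k) (hw : w ∈ isoCone S.ω k) :
    S.repRed k h w ∈ isoCone S.ω k := by
  obtain ⟨v, hv, hiso, rfl⟩ := hw
  refine ⟨fun i => S.repV h (v i), ?_, fun i j => by rw [S.repV_form, hiso], ?_⟩
  · refine hv.map' (S.repV h) (LinearMap.ker_eq_bot.2 ?_)
    exact (h.1.1 : V ≃ₗ[ℂ] V).injective
  · exact congrArg (omegaWedge S.ω k).mkQ (extRep_wedge S.repV k h v)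

theorem repRed_point {k : ℕ} (b : Module.Basis (Fin k) ℂ S.E) (h : S.H) :
    S.repRed k h (S.point b) = S.point b := by
  obtain ⟨⟨a, ha⟩, -⟩ := h.2
  have key : wedge k (fun i => S.repV h (b i : V)) =
      wedge k (fun i => (b i : V)) := by
    rw [← sub_eq_zero, ← Module.forall_dual_apply_eq_zero_iff ℂ]
    intro l
    rw [map_sub, sub_eq_zero]
    let f : S.E [⋀^Fin k]→ₗ[ℂ] ℂ :=
      l.compAlternatingMap ((wedge k).compLinearMap S.E.subtype)
    have h1 : f ((a : S.E ≃ₗ[ℂ] S.E).toLinearMap ∘ b) = f b := by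
      rw [f.eq_smul_basis_det b]
      have hdet : LinearMap.det (a : S.E ≃ₗ[ℂ] S.E).toLinearMap = 1 :=
        SpecialLinearGroup.det_eq_one a
      simp only [AlternatingMap.smul_apply, Module.Basis.det_comp, hdet, one_mul]
    have h2 : (fun i => S.repV h (b i : V)) = fun i => ((a (b i) : S.E) : V) :=
      funext fun i => ha (b i)
    rw [h2]
    exact h1
  exact congrArg (omegaWedge S.ω k).mkQ ((extRep_wedge S.repV k h _).trans key)

section Normal

variable {k : ℕ} (b : Module.Basis (Fin k) ℂ S.E)

/-- The `p`-th normal space of the symplectic Grassmannian at `E`; for `p = 1` the tangent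
space. -/
abbrev N (p : ℕ) : Type _ := NormalSpace (isoCone S.ω k) (S.point b) p

/-- `N_p` as an `H`-module. -/
def repN (p : ℕ) : Representation ℂ S.H (S.N b p) :=
  normalRep (isoCone S.ω k) (S.point b) (S.repRed k) (S.repRed_mem k) (S.repRed_point b) p

/-- The piece `T_i` of the tangent space, the sum of the root spaces of the roots in which the
simple root defining the parabolic has coefficient `-i`. Equivalently, it is the piece of weight
`-i` (up to the weight `k` of `e_1 ∧ ⋯ ∧ e_k`, which is the twist that is ignored) for the
one-parameter group acting by `t` on `E`, by `1` on `E^⊥ ∩ F^⊥` and by `t⁻¹` on `F`. -/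
def gradedTangent (i : ℕ) : Submodule ℂ (S.N b 1) :=
  Submodule.map (nmk (isoCone S.ω k) (S.point b) 1)
    { carrier := {w | ∀ (t : ℂˣ) (z : spGroup S.ω),
        (∀ x ∈ S.E, spRep S.ω z x = (t : ℂ) • x) →
        (∀ x ∈ S.perp ⊓ S.ω.orthogonal S.F, spRep S.ω z x = x) →
        (∀ x ∈ S.F, spRep S.ω z x = ((t⁻¹ : ℂˣ) : ℂ) • x) →
        redExtRep (spRep S.ω) S.ω (spRep_form S.ω) k z (w : RedExt S.ω k) =
          ((t ^ k * t⁻¹ ^ i : ℂˣ) : ℂ) • (w : RedExt S.ω k)}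
      zero_mem' := fun t z _ _ _ => by simp
      add_mem' := fun {w w'} hw hw' t z h1 h2 h3 => by
        rw [Submodule.coe_add, map_add, hw t z h1 h2 h3, hw' t z h1 h2 h3, smul_add]
      smul_mem' := fun c w hw t z h1 h2 h3 => by
        rw [Submodule.coe_smul, map_smul, hw t z h1 h2 h3, smul_comm] }

/-- The model `(E^* ⊗ U) ⊕ S² E^*` of the tangent space. -/
abbrev TModel : Type _ := (Module.Dual ℂ S.E ⊗[ℂ] S.U) × symForms S.E

/-- The action of `H` on `(E^* ⊗ U) ⊕ S² E^*`. -/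
def repT : Representation ℂ S.H S.TModel := (S.repE.dual.tprod S.repU).prod (symRep S.repE)

/-- The subset of `ℙ((E^* ⊗ U) ⊕ S² E^*)` of the points
`[∑_{j ≤ r} e_j ⊗ u_j ⊕ ∑_{j ≤ r} e_j²]`. -/
def sumLocus (r : ℕ) : Set (ℙ ℂ S.TModel) :=
  {x | ∃ (e : Fin r → Module.Dual ℂ S.E) (u : Fin r → S.U)
    (h : ((∑ j, e j ⊗ₜ[ℂ] u j, ∑ j, sq (e j)) : S.TModel) ≠ 0), x = Projectivization.mk ℂ _ h}

/-- The points `[e ⊗ u ⊕ e²]` with `e` and `u` nonzero. -/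
def openOrbit : Set (ℙ ℂ S.TModel) :=
  {x | ∃ (e : Module.Dual ℂ S.E) (u : S.U) (h : ((e ⊗ₜ[ℂ] u, sq e) : S.TModel) ≠ 0),
    e ≠ 0 ∧ u ≠ 0 ∧ x = Projectivization.mk ℂ _ h}

/-- The Segre variety in `ℙ(E^* ⊗ U) = ℙ(T_1)`. -/
def Y₁ : Set (ℙ ℂ S.TModel) :=
  {x | ∃ (e : Module.Dual ℂ S.E) (u : S.U) (h : ((e ⊗ₜ[ℂ] u, 0) : S.TModel) ≠ 0),
    x = Projectivization.mk ℂ _ h}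

/-- The Veronese variety in `ℙ(S² E^*) = ℙ(T_2)`. -/
def Y₂ : Set (ℙ ℂ S.TModel) :=
  {x | ∃ (e : Module.Dual ℂ S.E) (h : ((0, sq e) : S.TModel) ≠ 0),
    x = Projectivization.mk ℂ _ h}

end Normal

end IsotropicFlag

end Symplectic

end SympGrass

end

/-! Everything is read off from one explicit coordinate system on Λ^{⟨k⟩}V centred at the point E.
The flag splits V isometrically as U ⊕ E ⊕ D, where D = E^* is realised by F. Put Q = U ⊕ D ⊕ D. The
algebra ΛQ acts on Λ(U ⊕ E ⊕ D): U and the second copy of D by multiplication, the first copy of D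
by contraction against E. Applied to the vacuum e_1 ∧ ⋯ ∧ e_k, this gives the Fock space isomorphism
`fock` from ΛQ to Λ(U ⊕ E ⊕ D). As k does not exceed half the dimension of V, sl_2-theory identifies
Λ^{⟨k⟩}V with the primitive part of Λ^k V. In the coordinate t ∈ ΛQ this part satisfies two
equations: twice the number of generators from the first copy of D is the degree
(`two_smul_der_pr1_coord`), and the contraction of t with the form of U is twice the image of t
under the derivation `shift`, which moves the second copy of D to the first (`contrSymbol_coord`).

An isotropic plane whose coordinate has nonzero constant term is the graph of some Y : E → U ⊕ D,
and its coordinate is a multiple of exp θ(Y), where θ(Y) = ∑ e^i ∧ Y(e_i) has degree two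
(`isoCone_exp`). Along a curve through E with tangent X, the component of degree 2q therefore
vanishes to order q, and its q-th derivative is θ(X)^q (`arc_hasDer`). So the osculating spaces are
the filtration by degree (`mem_osc_iff`), N_p is the space `symbols` of leading terms of degree 2p,
and the p-th fundamental form is X ↦ θ(X)^p. Two facts carry this. Leading terms are killed by
`shift`, because the contraction with the form of U lowers the degree by two (`comp_mem_symbols`).
Conversely, the powers θ(X)^p, with X having a symmetric component E → E^*, span all such elements
(`symbols_le_span_pow`).

The module structure is then multilinear algebra. The tridegree splits the symbols into products of
Λ^d U with the kernel of the raising operator on Λ^{d+e}D ⊗ Λ^e D, d + e = p, and this kernel is the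
Schur module (`highest_mkQ_bijective`). The Lefschetz decomposition of Λ^d U (`lefschetz_equiv`)
gives the second form. For p = k the generators of the first copy of D use up its volume element,
which leaves Λ^k(D ⊕ U).

The power θ(X)^p vanishes exactly when X has rank less than p (`theta_pow_eq_zero_iff`), so the base
loci are determinantal. Diagonalising the symmetric component of X on a complement of the kernel of
X writes X as ∑ (f_j ⊗ u_j ⊕ d_j f_j²). The d_j can be perturbed to nonzero squares and absorbed
into f_j and u_j, which gives the closures. In rank one only f ⊗ u ⊕ d f² is left; the cases d = 0,
u = 0 and neither are the three orbits, by the transitivity of SL(E) and Sp(U) on nonzero vectors up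
to scalars. -/

set_option linter.unusedSectionVars false

noncomputable section

namespace SympGrass


/-! ## Operators on exterior algebras -/

section ExteriorOperators

/-- The exterior algebra of a complex vector space. -/
abbrev EA (W : Type*) [AddCommGroup W] [Module ℂ W] : Type _ := ExteriorAlgebra ℂ W

variable {W W' N : Type*} [AddCommGroup W] [Module ℂ W] [AddCommGroup W'] [Module ℂ W']
  [AddCommGroup N] [Module ℂ N]

/-- A vector as an element of degree one. -/
abbrev gen : W →ₗ[ℂ] EA W := ExteriorAlgebra.ι ℂ

/-- The contraction with a covector, an antiderivation. -/
def con : Module.Dual ℂ W →ₗ[ℂ] EA W →ₗ[ℂ] EA W :=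
  CliffordAlgebra.contractLeft (Q := (0 : QuadraticForm ℂ W))

@[simp]
theorem con_gen_mul (α : Module.Dual ℂ W) (v : W) (a : EA W) :
    con α (gen v * a) = α v • a - gen v * con α a :=
  CliffordAlgebra.contractLeft_ι_mul ..

@[simp]
theorem con_one (α : Module.Dual ℂ W) : con α (1 : EA W) = 0 :=
  CliffordAlgebra.contractLeft_one ..

@[simp]
theorem con_gen (α : Module.Dual ℂ W) (v : W) : con α (gen v) = α v • (1 : EA W) := by
  have := con_gen_mul α v 1
  simpa using this

theorem con_con (α : Module.Dual ℂ W) (a : EA W) : con α (con α a) = 0 :=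
  CliffordAlgebra.contractLeft_contractLeft ..

theorem con_comm (α β : Module.Dual ℂ W) (a : EA W) : con α (con β a) = -con β (con α a) :=
  CliffordAlgebra.contractLeft_comm ..

theorem gen_mul_gen (v w : W) : gen v * gen w = -(gen w * gen v) :=
  eq_neg_of_add_eq_zero_left (ExteriorAlgebra.ι_add_mul_swap v w)

theorem gen_mul_gen_mul (v w : W) (a : EA W) :
    gen v * (gen w * a) = -(gen w * (gen v * a)) := by
  rw [← mul_assoc, gen_mul_gen, neg_mul, mul_assoc]

@[simp]
theorem gen_mul_self (v : W) : gen v * gen v = 0 := ExteriorAlgebra.ι_sq_zero v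

@[simp]
theorem gen_mul_gen_self_mul (v : W) (a : EA W) : gen v * (gen v * a) = 0 := by
  rw [← mul_assoc, gen_mul_self, zero_mul]

-- Nearly all operator identities below are checked on 1 and carried through left multiplication by
-- a vector.
@[elab_as_elim]
theorem EA.ind {P : EA W → Prop} (one : P 1) (smul : ∀ (r : ℂ) a, P a → P (r • a))
    (add : ∀ a b, P a → P b → P (a + b)) (mul : ∀ v a, P a → P (gen v * a)) (a : EA W) : P a := by
  refine CliffordAlgebra.left_induction (Q := (0 : QuadraticForm ℂ W)) (P := P) ?_ ?_ ?_ a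
  · intro r
    rw [Algebra.algebraMap_eq_smul_one]
    exact smul r _ one
  · exact add
  · intro a v h
    exact mul v a h

/-- The sign from moving the contraction past `gen v` cancels the sign from exchanging two vectors,
so a sum of operators "multiply by w_i after contracting with α_i" obeys the Leibniz rule of a
derivation. -/
theorem sum_gen_mul_con_gen_mul {κ : Type*} (s : Finset κ) (w : κ → W)
    (α : κ → Module.Dual ℂ W) (v : W) (a : EA W) :
    ∑ i ∈ s, gen (w i) * con (α i) (gen v * a) =
      gen (∑ i ∈ s, α i v • w i) * a + gen v * ∑ i ∈ s, gen (w i) * con (α i) a := by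
  rw [map_sum, Finset.sum_mul, Finset.mul_sum, ← Finset.sum_add_distrib]
  refine Finset.sum_congr rfl fun i _ => ?_
  rw [con_gen_mul, mul_sub, gen_mul_gen_mul, map_smul, smul_mul_assoc, mul_smul_comm, sub_neg_eq_add]

theorem map_con (g : W →ₗ[ℂ] W') (α : Module.Dual ℂ W') (a : EA W) :
    con α (ExteriorAlgebra.map g a) = ExteriorAlgebra.map g (con (α ∘ₗ g) a) := by
  induction a using EA.ind with
  | one => simp
  | smul r a ha => simp only [map_smul, ha]
  | add a c ha hc => simp only [map_add, ha, hc]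
  | mul v a ha => simp [ha]

/-- A contraction kills everything in degrees where the covector vanishes. -/
theorem con_map_eq_zero (g : W →ₗ[ℂ] W') (α : Module.Dual ℂ W') (h : ∀ v, α (g v) = 0)
    (a : EA W) : con α (ExteriorAlgebra.map g a) = 0 := by
  have : α ∘ₗ g = 0 := LinearMap.ext h
  rw [map_con, this]
  simp

/-! ### Degrees -/

/-- The homogeneous component of degree `n`. -/
def proj (n : ℕ) : EA W →ₗ[ℂ] EA W :=
  GradedAlgebra.proj (fun i : ℕ => ⋀[ℂ]^i W) n

theorem proj_mem (n : ℕ) (a : EA W) : proj n a ∈ ⋀[ℂ]^n W := by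
  rw [proj, GradedAlgebra.proj_apply]
  exact SetLike.coe_mem _

theorem proj_of_mem {n : ℕ} {a : EA W} (h : a ∈ ⋀[ℂ]^n W) : proj n a = a := by
  rw [proj, GradedAlgebra.proj_apply]
  exact DirectSum.decompose_of_mem_same (fun i : ℕ => ⋀[ℂ]^i W) h

theorem proj_of_mem_ne {n m : ℕ} {a : EA W} (h : a ∈ ⋀[ℂ]^n W) (hn : n ≠ m) : proj m a = 0 := by
  rw [proj, GradedAlgebra.proj_apply]
  exact DirectSum.decompose_of_mem_ne (fun i : ℕ => ⋀[ℂ]^i W) h hn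

theorem eq_of_proj {a b : EA W} (h : ∀ n, proj n a = proj n b) : a = b := by
  apply (DirectSum.decompose (fun i : ℕ => ⋀[ℂ]^i W)).injective
  ext n
  have := h n
  rw [proj, GradedAlgebra.proj_apply, GradedAlgebra.proj_apply] at this
  exact this

theorem one_mem_zero : (1 : EA W) ∈ ⋀[ℂ]^0 W := SetLike.GradedOne.one_mem

theorem gen_mem (v : W) : gen v ∈ ⋀[ℂ]^1 W := by
  simp

theorem mul_mem_pow {m n : ℕ} {a b : EA W} (ha : a ∈ ⋀[ℂ]^m W) (hb : b ∈ ⋀[ℂ]^n W) :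
    a * b ∈ ⋀[ℂ]^(m + n) W := SetLike.GradedMul.mul_mem ha hb

theorem gen_mul_mem {n : ℕ} (v : W) {b : EA W} (hb : b ∈ ⋀[ℂ]^n W) :
    gen v * b ∈ ⋀[ℂ]^(n + 1) W := by
  rw [add_comm]
  exact mul_mem_pow (gen_mem v) hb

@[elab_as_elim]
theorem pow_succ_induction {n : ℕ} {P : EA W → Prop}
    (add : ∀ a b, P a → P b → P (a + b))
    (mul : ∀ v a, a ∈ ⋀[ℂ]^n W → P (gen v * a)) (a : EA W) (h : a ∈ ⋀[ℂ]^(n + 1) W) : P a := by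
  have h' : a ∈ (LinearMap.range (gen (W := W))) * (⋀[ℂ]^n W) := by
    change a ∈ (LinearMap.range (gen (W := W))) ^ (n + 1) at h
    rwa [pow_succ'] at h
  induction h' using Submodule.mul_induction_on' with
  | mem_mul_mem x hx y hy => obtain ⟨v, rfl⟩ := hx; exact mul v y hy
  | add x hx y hy h1 h2 =>
    refine add _ _ (h1 ?_) (h2 ?_)
    · change x ∈ (LinearMap.range (gen (W := W))) ^ (n + 1)
      rwa [pow_succ']
    · change y ∈ (LinearMap.range (gen (W := W))) ^ (n + 1)
      rwa [pow_succ']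

theorem mem_zero_iff {a : EA W} : a ∈ ⋀[ℂ]^0 W ↔ ∃ c : ℂ, a = c • 1 := by
  change a ∈ (LinearMap.range (gen (W := W))) ^ 0 ↔ _
  rw [pow_zero, Submodule.mem_one]
  simp only [Algebra.algebraMap_eq_smul_one, eq_comm]

@[elab_as_elim]
theorem homogeneous_induction {P : EA W → Prop} (hom : ∀ n, ∀ a ∈ ⋀[ℂ]^n W, P a)
    (add : ∀ a b, P a → P b → P (a + b)) (a : EA W) : P a := by
  induction a using DirectSum.Decomposition.inductionOn (fun i : ℕ => ⋀[ℂ]^i W) with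
  | zero => exact hom 0 0 (Submodule.zero_mem _)
  | homogeneous m => exact hom _ _ m.2
  | add a b ha hb => exact add a b ha hb

theorem proj_succ_gen_mul (n : ℕ) (v : W) (a : EA W) :
    proj (n + 1) (gen v * a) = gen v * proj n a := by
  induction a using homogeneous_induction with
  | hom m a ha =>
    by_cases h : m = n
    · subst h; rw [proj_of_mem (gen_mul_mem v ha), proj_of_mem ha]
    · rw [proj_of_mem_ne ha h, proj_of_mem_ne (gen_mul_mem v ha) (by omega), mul_zero]
  | add a b ha hb => rw [mul_add, map_add, ha, hb, map_add, mul_add]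

theorem proj_mul_of_mem {m : ℕ} {a : EA W} (ha : a ∈ ⋀[ℂ]^m W) (n : ℕ) (b : EA W) :
    proj (m + n) (a * b) = a * proj n b := by
  induction b using homogeneous_induction with
  | hom l b hb =>
    by_cases h : l = n
    · subst h; rw [proj_of_mem (mul_mem_pow ha hb), proj_of_mem hb]
    · rw [proj_of_mem_ne hb h, proj_of_mem_ne (mul_mem_pow ha hb) (by omega), mul_zero]
  | add b c hb hc => rw [mul_add, map_add, hb, hc, map_add, mul_add]

theorem proj_one (n : ℕ) (hn : n ≠ 0) : proj n (1 : EA W) = 0 :=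
  proj_of_mem_ne one_mem_zero hn.symm

theorem con_of_mem_zero (α : Module.Dual ℂ W) {a : EA W} (ha : a ∈ ⋀[ℂ]^0 W) : con α a = 0 := by
  obtain ⟨c, rfl⟩ := mem_zero_iff.1 ha
  simp

theorem con_mem (α : Module.Dual ℂ W) {n : ℕ} {a : EA W} (ha : a ∈ ⋀[ℂ]^(n + 1) W) :
    con α a ∈ ⋀[ℂ]^n W := by
  induction n generalizing a with
  | zero =>
    refine pow_succ_induction (fun a b h1 h2 => by rw [map_add]; exact add_mem h1 h2)
      (fun v a ha => ?_) a ha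
    rw [con_gen_mul, con_of_mem_zero α ha, mul_zero, sub_zero]
    exact Submodule.smul_mem _ _ ha
  | succ n ih =>
    refine pow_succ_induction (fun a b h1 h2 => by rw [map_add]; exact add_mem h1 h2)
      (fun v a ha => ?_) a ha
    rw [con_gen_mul]
    exact sub_mem (Submodule.smul_mem _ _ ha) (gen_mul_mem v (ih ha))

theorem con_proj_succ (α : Module.Dual ℂ W) (n : ℕ) (a : EA W) :
    con α (proj (n + 1) a) = proj n (con α a) := by
  induction a using homogeneous_induction with
  | hom m a ha =>
    cases m with
    | zero =>
      rw [con_of_mem_zero α ha, map_zero, proj_of_mem_ne ha (by omega), map_zero]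
    | succ m =>
      by_cases h : m = n
      · subst h; rw [proj_of_mem ha, proj_of_mem (con_mem α ha)]
      · rw [proj_of_mem_ne ha (by omega), proj_of_mem_ne (con_mem α ha) h, map_zero]
  | add a b ha hb => simp only [map_add, ha, hb]

theorem map_mem (g : W →ₗ[ℂ] W') {n : ℕ} {a : EA W} (ha : a ∈ ⋀[ℂ]^n W) :
    ExteriorAlgebra.map g a ∈ ⋀[ℂ]^n W' := by
  induction n generalizing a with
  | zero =>
    obtain ⟨c, rfl⟩ := mem_zero_iff.1 ha
    exact mem_zero_iff.2 ⟨c, by simp⟩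
  | succ n ih =>
    refine pow_succ_induction (fun a b h1 h2 => by rw [map_add]; exact add_mem h1 h2)
      (fun v a ha => ?_) a ha
    rw [map_mul, ExteriorAlgebra.map_apply_ι]
    exact gen_mul_mem _ (ih ha)

theorem map_proj (g : W →ₗ[ℂ] W') (n : ℕ) (a : EA W) :
    ExteriorAlgebra.map g (proj n a) = proj n (ExteriorAlgebra.map g a) := by
  induction a using homogeneous_induction with
  | hom m a ha =>
    by_cases h : m = n
    · subst h; rw [proj_of_mem ha, proj_of_mem (map_mem g ha)]
    · rw [proj_of_mem_ne ha h, proj_of_mem_ne (map_mem g ha) h, map_zero]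
  | add a b ha hb => simp only [map_add, ha, hb]

theorem ιMulti_mem {n : ℕ} (v : Fin n → W) : ExteriorAlgebra.ιMulti ℂ n v ∈ ⋀[ℂ]^n W :=
  ExteriorAlgebra.ιMulti_range ℂ n (Set.mem_range_self v)

theorem pow_eq_span (n : ℕ) :
    (⋀[ℂ]^n W : Submodule ℂ (EA W)) =
      Submodule.span ℂ (Set.range (ExteriorAlgebra.ιMulti ℂ n (M := W))) :=
  (ExteriorAlgebra.ιMulti_span_fixedDegree ℂ n).symm

variable [FiniteDimensional ℂ W] [FiniteDimensional ℂ W']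

/-- The derivation of the exterior algebra that extends an endomorphism. -/
def der (T : W →ₗ[ℂ] W) : EA W →ₗ[ℂ] EA W :=
  ∑ i, LinearMap.mulLeft ℂ (gen (T (Module.finBasis ℂ W i))) ∘ₗ
    con ((Module.finBasis ℂ W).coord i)

@[simp]
theorem der_one (T : W →ₗ[ℂ] W) : der T 1 = 0 := by
  simp [der]

@[simp]
theorem der_gen_mul (T : W →ₗ[ℂ] W) (v : W) (a : EA W) :
    der T (gen v * a) = gen (T v) * a + gen v * der T a := by
  have h := sum_gen_mul_con_gen_mul Finset.univ (fun i => T (Module.finBasis ℂ W i))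
    (fun i => (Module.finBasis ℂ W).coord i) v a
  have h2 : ∑ i, (Module.finBasis ℂ W).coord i v • T (Module.finBasis ℂ W i) = T v := by
    simp_rw [← map_smul]
    rw [← map_sum]
    congr 1
    exact (Module.finBasis ℂ W).sum_repr v
  rw [h2] at h
  simpa [der] using h

@[simp]
theorem der_gen (T : W →ₗ[ℂ] W) (v : W) : der T (gen v) = gen (T v) := by
  simpa using der_gen_mul T v 1

/-- Both sides are derivations that vanish on 1, so only their values on vectors matter. This frees
`der` from the basis in its definition. -/
theorem sum_gen_mul_con {κ : Type*} (s : Finset κ) (w : κ → W) (α : κ → Module.Dual ℂ W)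
    (T : W →ₗ[ℂ] W) (hT : ∀ v, T v = ∑ i ∈ s, α i v • w i) (a : EA W) :
    ∑ i ∈ s, gen (w i) * con (α i) a = der T a := by
  induction a using EA.ind with
  | one => simp
  | smul r a ha => simp [← ha, Finset.smul_sum]
  | add a b ha hb => simp [← ha, ← hb, mul_add, Finset.sum_add_distrib]
  | mul v a ha => rw [sum_gen_mul_con_gen_mul, ha, der_gen_mul, hT]

theorem der_mul (T : W →ₗ[ℂ] W) (a b : EA W) : der T (a * b) = der T a * b + a * der T b := by
  induction a using EA.ind with
  | one => simp
  | smul r a ha => simp [ha]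
  | add a c ha hc => simp [add_mul, ha, hc]; abel
  | mul v a ha => rw [mul_assoc, der_gen_mul, ha, der_gen_mul]; noncomm_ring

theorem map_der (g : W →ₗ[ℂ] W') (T : W →ₗ[ℂ] W) (T' : W' →ₗ[ℂ] W')
    (h : ∀ v, g (T v) = T' (g v)) (a : EA W) :
    ExteriorAlgebra.map g (der T a) = der T' (ExteriorAlgebra.map g a) := by
  induction a using EA.ind with
  | one => simp
  | smul r a ha => simp only [map_smul, ha]
  | add a c ha hc => simp only [map_add, ha, hc]
  | mul v a ha => simp [ha, h]

theorem con_der (α : Module.Dual ℂ W) (T : W →ₗ[ℂ] W) (a : EA W) :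
    con α (der T a) = der T (con α a) + con (α ∘ₗ T) a := by
  induction a using EA.ind with
  | one => simp
  | smul r a ha => simp only [map_smul, ha, smul_add]
  | add a c ha hc => simp only [map_add, ha, hc]; abel
  | mul v a ha =>
    simp only [der_gen_mul, con_gen_mul, map_add, map_sub, ha, map_smul, LinearMap.comp_apply,
      mul_add]
    abel

theorem der_mem (T : W →ₗ[ℂ] W) {n : ℕ} {a : EA W} (ha : a ∈ ⋀[ℂ]^n W) :
    der T a ∈ ⋀[ℂ]^n W := by
  induction n generalizing a with
  | zero =>
    obtain ⟨c, rfl⟩ := mem_zero_iff.1 ha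
    simp
  | succ n ih =>
    refine pow_succ_induction (fun a b h1 h2 => by rw [map_add]; exact add_mem h1 h2)
      (fun v a ha => ?_) a ha
    rw [der_gen_mul]
    exact add_mem (gen_mul_mem _ ha) (gen_mul_mem v (ih ha))

theorem der_proj (T : W →ₗ[ℂ] W) (n : ℕ) (a : EA W) :
    der T (proj n a) = proj n (der T a) := by
  induction a using homogeneous_induction with
  | hom m a ha =>
    by_cases h : m = n
    · subst h; rw [proj_of_mem ha, proj_of_mem (der_mem T ha)]
    · rw [proj_of_mem_ne ha h, proj_of_mem_ne (der_mem T ha) h, map_zero]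
  | add a b ha hb => simp only [map_add, ha, hb]

theorem der_id_of_mem {n : ℕ} {a : EA W} (ha : a ∈ ⋀[ℂ]^n W) :
    der LinearMap.id a = (n : ℂ) • a := by
  induction n generalizing a with
  | zero =>
    obtain ⟨c, rfl⟩ := mem_zero_iff.1 ha
    simp
  | succ n ih =>
    refine pow_succ_induction (fun a b h1 h2 => by rw [map_add, h1, h2, smul_add])
      (fun v a ha => ?_) a ha
    rw [der_gen_mul, ih ha, LinearMap.id_apply, mul_smul_comm]
    push_cast
    rw [add_smul, one_smul, add_comm]

instance : Module.Finite ℂ (EA W) :=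
  Module.Finite.of_basis (Module.finBasis ℂ W).ExteriorAlgebra

theorem finrank_EA : Module.finrank ℂ (EA W) = 2 ^ Module.finrank ℂ W := by
  rw [Module.finrank_eq_card_basis (Module.finBasis ℂ W).ExteriorAlgebra]
  simp

end ExteriorOperators

/-- The ladder lemma: if `[D, D']` is a positive scalar `c i` in each degree `i` and `D` vanishes
in degree `0`, then the eigenvalues of `D D'` are positive. -/
theorem ladder_pos {M : Type*} [AddCommGroup M] [Module ℂ M] (G : ℕ → Submodule ℂ M)
    (D D' : M →ₗ[ℂ] M) (c : ℕ → ℝ) (h0 : ∀ z ∈ G 0, D z = 0) (j : ℕ) (hc : ∀ i ≤ j, 0 < c i)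
    (hD : ∀ i < j, ∀ z ∈ G (i + 1), D z ∈ G i)
    (hcomm : ∀ i ≤ j, ∀ z ∈ G i, D (D' z) - D' (D z) = (c i : ℂ) • z)
    (z : M) (hz : z ∈ G j) (hz0 : z ≠ 0) (μ : ℂ) (h : D (D' z) = μ • z) :
    ∃ r : ℝ, 0 < r ∧ μ = r := by
  induction j generalizing z μ with
  | zero =>
    refine ⟨c 0, hc 0 le_rfl, ?_⟩
    have := hcomm 0 le_rfl z hz
    rw [h0 z hz, map_zero, sub_zero, h] at this
    exact smul_left_injective ℂ hz0 this
  | succ j ih =>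
    have h1 := hcomm (j + 1) le_rfl z hz
    rw [h, sub_eq_iff_eq_add, ← sub_eq_iff_eq_add', ← sub_smul] at h1
    have hpos := hc (j + 1) le_rfl
    -- Here `h1` reads D'(Dz) = (μ - c)z. If Dz = 0 then μ = c; otherwise Dz is an eigenvector of
    -- DD' one degree lower, for the eigenvalue μ - c.
    by_cases hDz : D z = 0
    · rw [hDz, map_zero, smul_eq_zero, or_iff_left hz0, sub_eq_zero] at h1
      exact ⟨c (j + 1), hpos, h1⟩
    · obtain ⟨r, hr, e⟩ := ih (fun i hi => hc i (by omega)) (fun i hi => hD i (by omega))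
        (fun i hi => hcomm i (by omega)) (D z) (hD j (by omega) z hz)
        hDz (μ - c (j + 1)) (by rw [← h1, map_smul])
      refine ⟨r + c (j + 1), add_pos hr hpos, ?_⟩
      rw [sub_eq_iff_eq_add] at e
      rw [e]; push_cast; rfl

theorem ladder_injective {M : Type*} [AddCommGroup M] [Module ℂ M] (G : ℕ → Submodule ℂ M)
    (D D' : M →ₗ[ℂ] M) (c : ℕ → ℝ) (h0 : ∀ z ∈ G 0, D z = 0) (j : ℕ) (hc : ∀ i ≤ j, 0 < c i)
    (hD : ∀ i < j, ∀ z ∈ G (i + 1), D z ∈ G i)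
    (hcomm : ∀ i ≤ j, ∀ z ∈ G i, D (D' z) - D' (D z) = (c i : ℂ) • z)
    (z : M) (hz : z ∈ G j) (h : D (D' z) = 0) : z = 0 := by
  by_contra hz0
  obtain ⟨r, hr, e⟩ := ladder_pos G D D' c h0 j hc hD hcomm z hz hz0 0 (by rw [h, zero_smul])
  exact hr.ne' (by exact_mod_cast e.symm)

/-- Eigenvectors for distinct eigenvalues are independent. -/
theorem toModule_injective_of_eigen {ι X : Type*} [DecidableEq ι] {M : ι → Type*}
    [∀ i, AddCommGroup (M i)] [∀ i, Module ℂ (M i)] [AddCommGroup X] [Module ℂ X]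
    (f : ∀ i, M i →ₗ[ℂ] X) (T : X →ₗ[ℂ] X) (c : ι → ℂ) (hc : Function.Injective c)
    (hT : ∀ i x, T (f i x) = c i • f i x) (hf : ∀ i, Function.Injective (f i)) :
    Function.Injective (DirectSum.toModule ℂ ι X f) := by
  have hind : iSupIndep fun i => Module.End.eigenspace T (c i) :=
    (Module.End.eigenspaces_iSupIndep T).comp hc
  let g : ∀ i, M i →ₗ[ℂ] Module.End.eigenspace T (c i) := fun i =>
    (f i).codRestrict _ fun x => Module.End.mem_eigenspace_iff.2 (hT i x)
  have e : DirectSum.toModule ℂ ι X f =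
      (DirectSum.toModule ℂ ι X fun i => (Module.End.eigenspace T (c i)).subtype) ∘ₗ
        DirectSum.lmap g := by
    refine DirectSum.linearMap_ext ℂ fun i => LinearMap.ext fun x => ?_
    rw [LinearMap.comp_apply, DirectSum.toModule_lof, LinearMap.comp_apply, LinearMap.comp_apply,
      DirectSum.lmap_lof, DirectSum.toModule_lof]
    rfl
  rw [e, LinearMap.coe_comp]
  have hinj : Function.Injective (DirectSum.toModule ℂ ι X
      fun i => (Module.End.eigenspace T (c i)).subtype) := hind.dfinsupp_lsum_injective
  refine hinj.comp ((DirectSum.lmap_injective _).2 fun i => ?_)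
  exact fun x y hxy => hf i (congrArg Subtype.val hxy)

/-! ## Exterior algebras of products -/

section ExteriorProduct

variable {W W' : Type*} [AddCommGroup W] [Module ℂ W] [AddCommGroup W'] [Module ℂ W']

/-- The multiplication `Λ W ⊗ Λ W' → Λ (W × W')`. -/
def mulProd (W W' : Type*) [AddCommGroup W] [Module ℂ W] [AddCommGroup W'] [Module ℂ W'] :
    EA W ⊗[ℂ] EA W' →ₗ[ℂ] EA (W × W') :=
  TensorProduct.lift ((LinearMap.mul ℂ (EA (W × W'))).compl₁₂
    (ExteriorAlgebra.map (LinearMap.inl ℂ W W')).toLinearMap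
    (ExteriorAlgebra.map (LinearMap.inr ℂ W W')).toLinearMap)

@[simp]
theorem mulProd_tmul (a : EA W) (b : EA W') : mulProd W W' (a ⊗ₜ b) =
    ExteriorAlgebra.map (LinearMap.inl ℂ W W') a * ExteriorAlgebra.map (LinearMap.inr ℂ W W') b :=
  rfl

/-- Elements of even and odd degree commute up to a sign. -/
theorem gen_mul_eq_involute_mul (v : W) (a : EA W) :
    gen v * a = CliffordAlgebra.involute (Q := (0 : QuadraticForm ℂ W)) a * gen v := by
  induction a using EA.ind with
  | one => simp
  | smul r a ha => simp [ha]
  | add a b ha hb => simp [mul_add, add_mul, ha, hb]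
  | mul w a ha =>
    rw [gen_mul_gen_mul, ha, map_mul, CliffordAlgebra.involute_ι]
    simp [mul_assoc]

/-- A vector of the first factor joins the left tensor factor; a vector of the second has to pass
the left factor first, which costs its parity sign, the involution. -/
theorem mulProd_surjective : Function.Surjective (mulProd W W') := by
  intro a
  induction a using EA.ind with
  | one => exact ⟨1 ⊗ₜ 1, by simp⟩
  | smul r a ha => obtain ⟨t, rfl⟩ := ha; exact ⟨r • t, by simp⟩
  | add a b ha hb =>
    obtain ⟨t, rfl⟩ := ha
    obtain ⟨s, rfl⟩ := hb
    exact ⟨t + s, by simp⟩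
  | mul v a ha =>
    obtain ⟨t, rfl⟩ := ha
    obtain ⟨w, w'⟩ := v
    induction t using TensorProduct.induction_on with
    | zero => exact ⟨0, by simp⟩
    | tmul x y =>
      refine ⟨(gen w * x) ⊗ₜ y + CliffordAlgebra.involute (Q := (0 : QuadraticForm ℂ W)) x ⊗ₜ
        (gen w' * y), ?_⟩
      have e : ((w, w') : W × W') = (w, 0) + (0, w') := by simp
      rw [e, map_add, map_add, add_mul, mulProd_tmul, mulProd_tmul, mulProd_tmul, map_mul, map_mul,
        ExteriorAlgebra.map_apply_ι, ExteriorAlgebra.map_apply_ι, mul_assoc]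
      congr 1
      rw [← mul_assoc, ← mul_assoc, LinearMap.inr_apply]
      congr 1
      rw [gen_mul_eq_involute_mul]
      congr 1
      induction x using EA.ind with
      | one => simp
      | smul r a ha => simp [ha]
      | add a b ha hb => simp [ha, hb]
      | mul w a ha => simp [ha]
    | add t s ht hs =>
      obtain ⟨t', ht⟩ := ht
      obtain ⟨s', hs⟩ := hs
      exact ⟨t' + s', by rw [map_add, ht, hs, map_add, mul_add]⟩

/-- A surjection between spaces of the same dimension, 2 to the power dim W + dim W'. -/
theorem mulProd_injective [FiniteDimensional ℂ W] [FiniteDimensional ℂ W'] :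
    Function.Injective (mulProd W W') := by
  refine (LinearMap.injective_iff_surjective_of_finrank_eq_finrank ?_).2 mulProd_surjective
  rw [Module.finrank_tensorProduct, finrank_EA, finrank_EA, finrank_EA, Module.finrank_prod,
    pow_add]

end ExteriorProduct


/-! ## The Lefschetz operators of a symplectic form -/

section Lefschetz

variable {W : Type*} [AddCommGroup W] [Module ℂ W] (ω : LinearMap.BilinForm ℂ W)
  {κ : Type*} [Fintype κ] [DecidableEq κ] (b : Module.Basis κ ℂ W) (b' : κ → W)

/-- The bivector `∑ b_i ∧ b'_i`. -/
def bivec {κ : Type*} [Fintype κ] (b b' : κ → W) : EA W := ∑ i, gen (b i) * gen (b' i)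

/-- The contraction with the form `ω`. -/
def contr (b b' : κ → W) : EA W →ₗ[ℂ] EA W := -∑ i, con (ω (b i)) ∘ₗ con (ω (b' i))

theorem contr_apply (a : EA W) :
    contr ω b b' a = -∑ i, con (ω (b i)) (con (ω (b' i)) a) := by
  simp [contr]

variable {ω b b'}

theorem repr_eq_of_dual (h : ∀ i j, ω (b i) (b' j) = if i = j then 1 else 0) (x : W) (i : κ) :
    b.repr x i = ω x (b' i) := by
  have : ω x (b' i) = ω (∑ j, b.repr x j • b j) (b' i) := by rw [b.sum_repr]
  rw [this]
  simp only [map_sum, map_smul, LinearMap.sum_apply, LinearMap.smul_apply, h]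
  simp

theorem sum_dual_left (h : ∀ i j, ω (b i) (b' j) = if i = j then 1 else 0) (x : W) :
    ∑ i, ω x (b' i) • b i = x := by
  simp_rw [← repr_eq_of_dual h]
  exact b.sum_repr x

theorem eq_of_forall_basis (hn : ω.Nondegenerate) {x y : W} (h : ∀ i, ω (b i) x = ω (b i) y) :
    x = y := by
  rw [← sub_eq_zero]
  refine hn.2 _ fun z => ?_
  have : ω.flip (x - y) = 0 := b.ext fun i => by simp [h]
  exact LinearMap.congr_fun this z

theorem sum_dual_right (hn : ω.Nondegenerate)
    (h : ∀ i j, ω (b i) (b' j) = if i = j then 1 else 0) (y : W) :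
    ∑ i, ω (b i) y • b' i = y := by
  refine eq_of_forall_basis (b := b) hn fun i => ?_
  simp [h]

/-- Expanding b_i in the basis c and resumming in the other slot replaces one dual pair by another.
This is needed because `omegaWedge` admits all dual pairs. -/
theorem bivec_independent (hn : ω.Nondegenerate)
    (h : ∀ i j, ω (b i) (b' j) = if i = j then 1 else 0)
    {κ' : Type*} [Fintype κ'] [DecidableEq κ'] {c : Module.Basis κ' ℂ W} {c' : κ' → W}
    (h' : ∀ i j, ω (c i) (c' j) = if i = j then 1 else 0) :
    bivec b b' = bivec c c' := by
  unfold bivec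
  calc ∑ i, gen (b i) * gen (b' i)
      = ∑ i, gen (∑ j, ω (b i) (c' j) • c j) * gen (b' i) := by
        simp_rw [sum_dual_left h']
    _ = ∑ j, gen (c j) * gen (∑ i, ω (b i) (c' j) • b' i) := by
        simp only [map_sum, map_smul, Finset.sum_mul, Finset.mul_sum, smul_mul_assoc,
          mul_smul_comm]
        rw [Finset.sum_comm]
    _ = ∑ j, gen (c j) * gen (c' j) := by
        simp_rw [sum_dual_right hn h]

theorem sum_dual_skew (ha : ω.IsAlt) (hn : ω.Nondegenerate)
    (h : ∀ i j, ω (b i) (b' j) = if i = j then 1 else 0) (x : W) :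
    ∑ i, ω x (b i) • b' i = -x := by
  have : ∀ i, ω x (b i) • b' i = -(ω (b i) x • b' i) := fun i => by
    rw [← ha.neg_eq (b i) x, neg_smul]
  simp_rw [this]
  rw [Finset.sum_neg_distrib, sum_dual_right hn h]

/-- The two factors b_i and b'_i contribute -x each. As the sum runs over a full basis of W, the
bivector is twice the usual one of a Darboux basis; this is the source of the factors 2 and 4 below.
-/
theorem con_bivec_mul (ha : ω.IsAlt) (hn : ω.Nondegenerate)
    (h : ∀ i j, ω (b i) (b' j) = if i = j then 1 else 0) (x : W) (a : EA W) :
    con (ω x) (bivec b b' * a) = bivec b b' * con (ω x) a - (2 : ℂ) • (gen x * a) := by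
  have key : ∀ i, con (ω x) (gen (b i) * gen (b' i) * a) =
      gen (b i) * gen (b' i) * con (ω x) a + gen (ω x (b i) • b' i) * a
        - gen (ω x (b' i) • b i) * a := fun i => by
    rw [mul_assoc, con_gen_mul, con_gen_mul, map_smul, map_smul]
    simp only [mul_sub, smul_mul_assoc, mul_smul_comm, mul_assoc]
    abel
  unfold bivec
  rw [Finset.sum_mul, map_sum, Finset.sum_congr rfl fun i _ => key i,
    Finset.sum_sub_distrib, Finset.sum_add_distrib, ← Finset.sum_mul, ← Finset.sum_mul,
    ← Finset.sum_mul, ← map_sum, ← map_sum, sum_dual_left h, sum_dual_skew ha hn h, map_neg,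
    two_smul]
  noncomm_ring

theorem contr_gen_mul (ha : ω.IsAlt) (hn : ω.Nondegenerate)
    (h : ∀ i j, ω (b i) (b' j) = if i = j then 1 else 0) (v : W) (a : EA W) :
    contr ω b b' (gen v * a) = gen v * contr ω b b' a + (2 : ℂ) • con (ω v) a := by
  have key : ∀ i, con (ω (b i)) (con (ω (b' i)) (gen v * a)) =
      con (ω (ω (b' i) v • b i)) a - con (ω (ω (b i) v • b' i)) a +
        gen v * con (ω (b i)) (con (ω (b' i)) a) := fun i => by
    simp only [con_gen_mul, map_sub, map_smul, LinearMap.smul_apply]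
    abel
  rw [contr_apply, contr_apply, Finset.sum_congr rfl fun i _ => key i, Finset.sum_add_distrib,
    Finset.sum_sub_distrib, ← Finset.mul_sum]
  have e1 : ∑ i, con (ω (ω (b' i) v • b i)) a = -con (ω v) a := by
    have : ∑ i, ω (b' i) v • b i = -v := by
      have : ∀ i, ω (b' i) v • b i = -(ω v (b' i) • b i) := fun i => by
        rw [← ha.neg_eq v (b' i), neg_smul]
      simp_rw [this]
      rw [Finset.sum_neg_distrib, sum_dual_left h]
    rw [← LinearMap.neg_apply, ← map_neg, ← map_neg, ← this]
    simp only [map_sum, LinearMap.sum_apply]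
  have e2 : ∑ i, con (ω (ω (b i) v • b' i)) a = con (ω v) a := by
    conv_rhs => rw [← sum_dual_right hn h v]
    simp only [map_sum, LinearMap.sum_apply]
  rw [e1, e2, two_smul]
  noncomm_ring

theorem contr_one : contr ω b b' 1 = 0 := by
  simp [contr_apply]

theorem contr_mem {n : ℕ} {a : EA W} (h : a ∈ ⋀[ℂ]^(n + 2) W) :
    contr ω b b' a ∈ ⋀[ℂ]^n W := by
  rw [contr_apply]
  exact neg_mem (sum_mem fun i _ => con_mem _ (con_mem _ h))

theorem contr_eq_zero_of_mem {n : ℕ} (hn : n < 2) {a : EA W} (h : a ∈ ⋀[ℂ]^n W) :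
    contr ω b b' a = 0 := by
  rw [contr_apply, neg_eq_zero]
  refine Finset.sum_eq_zero fun i _ => ?_
  interval_cases n
  · rw [con_of_mem_zero _ h, map_zero]
  · exact con_of_mem_zero _ (con_mem _ h)

theorem bivec_mem : bivec b b' ∈ ⋀[ℂ]^2 W :=
  sum_mem fun i _ => mul_mem_pow (gen_mem (b i)) (gen_mem (b' i))

theorem bivec_mul_mem {n : ℕ} {a : EA W} (h : a ∈ ⋀[ℂ]^n W) :
    bivec b b' * a ∈ ⋀[ℂ]^(n + 2) W := by
  rw [add_comm]
  exact mul_mem_pow bivec_mem h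

variable [FiniteDimensional ℂ W]

theorem contr_bivec_mul (ha : ω.IsAlt) (hn : ω.Nondegenerate)
    (h : ∀ i j, ω (b i) (b' j) = if i = j then 1 else 0) (a : EA W) :
    contr ω b b' (bivec b b' * a) = bivec b b' * contr ω b b' a +
      (2 * Fintype.card κ : ℂ) • a - (4 : ℂ) • der LinearMap.id a := by
  have key : ∀ i, con (ω (b i)) (con (ω (b' i)) (bivec b b' * a)) =
      bivec b b' * con (ω (b i)) (con (ω (b' i)) a)
        - (2 : ℂ) • (gen (b i) * con (ω (b' i)) a) - (2 : ℂ) • a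
        + (2 : ℂ) • (gen (b' i) * con (ω (b i)) a) := fun i => by
    rw [con_bivec_mul ha hn h, map_sub, con_bivec_mul ha hn h, map_smul, con_gen_mul, smul_sub]
    rw [h i i, if_pos rfl, one_smul]
    abel
  have e1 : ∑ i, gen (b i) * con (ω (b' i)) a = -der LinearMap.id a := by
    have : ∀ i, gen (b i) * con (ω (b' i)) a = -(gen (b i) * con (ω.flip (b' i)) a) := fun i => by
      have : ω (b' i) = -ω.flip (b' i) := by
        ext x
        exact (ha.neg_eq x (b' i)).symm
      rw [this, map_neg]
      simp
    simp_rw [this]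
    rw [Finset.sum_neg_distrib, sum_gen_mul_con Finset.univ _ _ LinearMap.id]
    exact fun v => (sum_dual_left h v).symm
  have e2 : ∑ i, gen (b' i) * con (ω (b i)) a = der LinearMap.id a := by
    rw [sum_gen_mul_con Finset.univ _ _ LinearMap.id]
    exact fun v => (sum_dual_right hn h v).symm
  rw [contr_apply, contr_apply, Finset.sum_congr rfl fun i _ => key i, Finset.sum_add_distrib,
    Finset.sum_sub_distrib, Finset.sum_sub_distrib, ← Finset.mul_sum, ← Finset.smul_sum,
    ← Finset.smul_sum (f := fun i => gen (b' i) * con (ω (b i)) a), e1, e2]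
  simp only [Finset.sum_const, Finset.card_univ]
  rw [← Nat.cast_smul_eq_nsmul ℂ, smul_smul, mul_neg]
  module

/-- The relation of sl_2, up to scale: the weight is positive below the middle degree, zero there
and negative above. -/
theorem contr_bivec_comm (ha : ω.IsAlt) (hn : ω.Nondegenerate)
    (h : ∀ i j, ω (b i) (b' j) = if i = j then 1 else 0) {d : ℕ} {a : EA W}
    (hd : a ∈ ⋀[ℂ]^d W) :
    contr ω b b' (bivec b b' * a) - bivec b b' * contr ω b b' a =
      (2 * Fintype.card κ - 4 * d : ℂ) • a := by
  rw [contr_bivec_mul ha hn h, der_id_of_mem hd]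
  module

theorem pow_eq_bot {d : ℕ} (h : Module.finrank ℂ W < d) : (⋀[ℂ]^d W : Submodule ℂ (EA W)) = ⊥ := by
  rw [← Submodule.finrank_eq_zero (R := ℂ) (M := EA W),
    exteriorPower.finrank_eq, Nat.choose_eq_zero_of_lt h]

/-- `Λ L` is injective below the middle degree. -/
theorem contr_bivec_injective (ha : ω.IsAlt) (hn : ω.Nondegenerate)
    (h : ∀ i j, ω (b i) (b' j) = if i = j then 1 else 0) {d : ℕ} (hd : 2 * d < Fintype.card κ)
    {a : EA W} (hmem : a ∈ ⋀[ℂ]^d W) (h0 : contr ω b b' (bivec b b' * a) = 0) : a = 0 := by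
  -- The ladder climbs through the degrees of the parity of d; it starts at 0 or 1, where the
  -- contraction vanishes for reasons of degree.
  refine ladder_injective (fun j => ⋀[ℂ]^(d % 2 + 2 * j) W) (contr ω b b')
    (LinearMap.mulLeft ℂ (bivec b b')) (fun j => 2 * Fintype.card κ - 4 * ((d % 2 + 2 * j : ℕ) : ℝ))
    (fun z hz => contr_eq_zero_of_mem (n := d % 2 + 2 * 0) (by omega) hz)
    (d / 2) ?_ ?_ ?_ a ?_ ?_
  · intro i hi
    have : 2 * (d % 2 + 2 * i) < Fintype.card κ := by omega
    have : (2 * (d % 2 + 2 * i : ℕ) : ℝ) < Fintype.card κ := by exact_mod_cast this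
    linarith
  · intro i _ z hz
    exact contr_mem hz
  · intro i _ z hz
    rw [LinearMap.mulLeft_apply, LinearMap.mulLeft_apply, contr_bivec_comm ha hn h hz]
    push_cast
    rfl
  · have : d % 2 + 2 * (d / 2) = d := Nat.mod_add_div d 2
    simpa only [this] using hmem
  · exact h0

/-- `L Λ` is injective above the middle degree. -/
theorem bivec_contr_injective (ha : ω.IsAlt) (hn : ω.Nondegenerate)
    (h : ∀ i j, ω (b i) (b' j) = if i = j then 1 else 0) {d : ℕ} (hd : Fintype.card κ < 2 * d)
    {a : EA W} (hmem : a ∈ ⋀[ℂ]^d W) (h0 : bivec b b' * contr ω b b' a = 0) : a = 0 := by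
  have hcard : Module.finrank ℂ W = Fintype.card κ := Module.finrank_eq_card_basis b
  -- The same ladder upside down: it starts in degree d + 2 dim W, where nothing is left, and
  -- reaches degree d after dim W steps.
  refine ladder_injective (fun j => ⋀[ℂ]^(d + 2 * (Fintype.card κ - j)) W)
    (LinearMap.mulLeft ℂ (bivec b b')) (contr ω b b')
    (fun j => 4 * ((d + 2 * (Fintype.card κ - j) : ℕ) : ℝ) - 2 * Fintype.card κ)
    ?_ (Fintype.card κ) ?_ ?_ ?_ a ?_ ?_
  · intro z hz
    have h1 := bivec_mul_mem (b := b) (b' := b') hz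
    have : (⋀[ℂ]^(d + 2 * (Fintype.card κ - 0) + 2) W : Submodule ℂ (EA W)) = ⊥ :=
      pow_eq_bot (by omega)
    rw [this] at h1
    exact (Submodule.mem_bot ℂ).1 h1
  · intro i hi
    have : Fintype.card κ < 2 * (d + 2 * (Fintype.card κ - i)) := by omega
    have : (Fintype.card κ : ℝ) < 2 * (d + 2 * (Fintype.card κ - i) : ℕ) := by exact_mod_cast this
    linarith
  · intro i hi z hz
    have e : d + 2 * (Fintype.card κ - i) = d + 2 * (Fintype.card κ - (i + 1)) + 2 := by omega
    rw [e]
    exact bivec_mul_mem hz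
  · intro i _ z hz
    have h1 := contr_bivec_comm ha hn h hz
    rw [LinearMap.mulLeft_apply, LinearMap.mulLeft_apply, ← neg_sub, h1, ← neg_smul]
    push_cast
    congr 1
    ring
  · simpa using hmem
  · exact h0

theorem contr_injective (ha : ω.IsAlt) (hn : ω.Nondegenerate)
    (h : ∀ i j, ω (b i) (b' j) = if i = j then 1 else 0) {d : ℕ} (hd : Fintype.card κ < 2 * d)
    {a : EA W} (hmem : a ∈ ⋀[ℂ]^d W) (h0 : contr ω b b' a = 0) : a = 0 :=
  bivec_contr_injective ha hn h hd hmem (by rw [h0, mul_zero])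

/-- The decomposition of `Λ^{d+2}` below the middle degree. -/
theorem exists_primitive_decomposition (ha : ω.IsAlt) (hn : ω.Nondegenerate)
    (h : ∀ i j, ω (b i) (b' j) = if i = j then 1 else 0) {d : ℕ} (hd : 2 * d < Fintype.card κ)
    {a : EA W} (hmem : a ∈ ⋀[ℂ]^(d + 2) W) :
    ∃ y ∈ ⋀[ℂ]^d W, contr ω b b' (a - bivec b b' * y) = 0 := by
  let T : (⋀[ℂ]^d W) →ₗ[ℂ] (⋀[ℂ]^d W) :=
    (contr ω b b' ∘ₗ LinearMap.mulLeft ℂ (bivec b b')).restrict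
      fun x hx => contr_mem (bivec_mul_mem hx)
  have hT : Function.Injective T := by
    rw [injective_iff_map_eq_zero]
    intro x hx
    exact Subtype.ext (contr_bivec_injective ha hn h hd x.2 (congrArg Subtype.val hx))
  obtain ⟨y, hy⟩ := LinearMap.injective_iff_surjective.1 hT ⟨_, contr_mem (ω := ω) (b := b) (b' := b') hmem⟩
  refine ⟨y, y.2, ?_⟩
  have : contr ω b b' (bivec b b' * y) = contr ω b b' a := congrArg Subtype.val hy
  rw [map_sub, this, sub_self]

/-- Above the middle, contracting and multiplying back is an injective endomorphism of a
finite-dimensional space, hence onto. -/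
theorem exists_bivec_mul_eq (ha : ω.IsAlt) (hn : ω.Nondegenerate)
    (h : ∀ i j, ω (b i) (b' j) = if i = j then 1 else 0) {d : ℕ} (hd : Fintype.card κ < 2 * (d + 2))
    {a : EA W} (hmem : a ∈ ⋀[ℂ]^(d + 2) W) :
    ∃ y ∈ ⋀[ℂ]^d W, bivec b b' * y = a := by
  let T : (⋀[ℂ]^(d + 2) W) →ₗ[ℂ] (⋀[ℂ]^(d + 2) W) :=
    (LinearMap.mulLeft ℂ (bivec b b') ∘ₗ contr ω b b').restrict
      fun x hx => bivec_mul_mem (contr_mem hx)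
  have hT : Function.Injective T := by
    rw [injective_iff_map_eq_zero]
    intro x hx
    exact Subtype.ext (bivec_contr_injective ha hn h hd x.2 (congrArg Subtype.val hx))
  obtain ⟨y, hy⟩ := LinearMap.injective_iff_surjective.1 hT ⟨_, hmem⟩
  exact ⟨contr ω b b' (y : EA W), contr_mem (ω := ω) (b := b) (b' := b') y.2,
    congrArg Subtype.val hy⟩

/-! ### Strings of primitive elements -/

/-- The coefficient is the sum of the c + 1 commutators met while the contraction passes the powers
of the bivector. It vanishes exactly at c = dim W / 2 - d, the end of the string. -/
theorem contr_bivec_pow (ha : ω.IsAlt) (hn : ω.Nondegenerate)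
    (h : ∀ i j, ω (b i) (b' j) = if i = j then 1 else 0) {d : ℕ} {a : EA W}
    (hd : a ∈ ⋀[ℂ]^d W) (h0 : contr ω b b' a = 0) (c : ℕ) :
    contr ω b b' (bivec b b' ^ (c + 1) * a) =
      (2 * (c + 1) * (Fintype.card κ - 2 * d - 2 * c) : ℂ) • (bivec b b' ^ c * a) := by
  have hpow : ∀ c, bivec b b' ^ c * a ∈ ⋀[ℂ]^(2 * c + d) W := fun c => by
    refine mul_mem_pow ?_ hd
    have := SetLike.pow_mem_graded (A := fun i : ℕ => ⋀[ℂ]^i W) c (bivec_mem (b := b) (b' := b'))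
    rwa [nsmul_eq_mul, Nat.cast_id, mul_comm] at this
  induction c with
  | zero =>
    have := contr_bivec_comm ha hn h hd
    rw [h0, mul_zero, sub_zero] at this
    rw [zero_add, pow_one, pow_zero, one_mul, this]
    congr 1
    push_cast
    ring
  | succ c ih =>
    have h1 := contr_bivec_comm ha hn h (hpow (c + 1))
    rw [sub_eq_iff_eq_add, ih, mul_smul_comm, ← mul_assoc, ← mul_assoc, ← pow_succ',
      ← pow_succ', ← add_smul] at h1
    rw [h1]
    congr 1
    push_cast
    ring

theorem bivec_pow_mem {c d : ℕ} {a : EA W} (hd : a ∈ ⋀[ℂ]^d W) :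
    bivec b b' ^ c * a ∈ ⋀[ℂ]^(d + 2 * c) W := by
  rw [add_comm d]
  refine mul_mem_pow ?_ hd
  have := SetLike.pow_mem_graded (A := fun i : ℕ => ⋀[ℂ]^i W) c (bivec_mem (b := b) (b' := b'))
  rwa [nsmul_eq_mul, Nat.cast_id, mul_comm] at this

/-- Before the end of the string the coefficient in `contr_bivec_pow` is nonzero, so contracting
undoes one power at a time. -/
theorem bivec_pow_injective (ha : ω.IsAlt) (hn : ω.Nondegenerate)
    (h : ∀ i j, ω (b i) (b' j) = if i = j then 1 else 0) {m : ℕ} (hm : Fintype.card κ = 2 * m)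
    {d c : ℕ} {a : EA W} (hd : a ∈ ⋀[ℂ]^d W) (h0 : contr ω b b' a = 0) (hc : d + c ≤ m)
    (hz : bivec b b' ^ c * a = 0) : a = 0 := by
  induction c with
  | zero => simpa using hz
  | succ c ih =>
    refine ih (by omega) ?_
    have := contr_bivec_pow ha hn h hd h0 c
    rw [hz, map_zero, eq_comm, smul_eq_zero] at this
    refine this.resolve_left ?_
    obtain ⟨r, hr⟩ : ∃ r : ℕ, m = d + c + r + 1 := ⟨m - d - c - 1, by omega⟩
    have e : (2 * (c + 1) * (Fintype.card κ - 2 * d - 2 * c) : ℂ) =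
        ((2 * (c + 1) * (2 * (r + 1)) : ℕ) : ℂ) := by
      rw [hm, hr]; push_cast; ring
    rw [e]
    refine Nat.cast_ne_zero.2 ?_
    positivity

/-- At the end of the string the coefficient is zero, so the next element is primitive; it lies
above the middle degree, where the contraction is injective. -/
theorem bivec_pow_eq_zero (ha : ω.IsAlt) (hn : ω.Nondegenerate)
    (h : ∀ i j, ω (b i) (b' j) = if i = j then 1 else 0) {m : ℕ} (hm : Fintype.card κ = 2 * m)
    {d c : ℕ} {a : EA W} (hd : a ∈ ⋀[ℂ]^d W) (h0 : contr ω b b' a = 0) (hc : d + c = m) :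
    bivec b b' ^ (c + 1) * a = 0 := by
  refine contr_injective ha hn h (d := d + 2 * (c + 1)) (by omega) (bivec_pow_mem hd) ?_
  rw [contr_bivec_pow ha hn h hd h0, hm, ← hc]
  push_cast
  convert zero_smul ℂ _ using 2
  ring

end Lefschetz


/-! ## Exterior powers inside the exterior algebra -/

section ToEA

variable {W : Type*} [AddCommGroup W] [Module ℂ W]

/-- The inclusion of an exterior power in the exterior algebra. -/
def toEA (n : ℕ) : Ext n W →ₗ[ℂ] EA W := (⋀[ℂ]^n W).subtype

theorem toEA_injective (n : ℕ) : Function.Injective (toEA n (W := W)) := Subtype.val_injective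

theorem toEA_mem {n : ℕ} (x : Ext n W) : toEA n x ∈ ⋀[ℂ]^n W := Subtype.property (p := (· ∈ ⋀[ℂ]^n W)) x

/-- An element of degree `n` as an element of the exterior power. -/
def ofEA {n : ℕ} (a : EA W) (h : a ∈ ⋀[ℂ]^n W) : Ext n W := (⟨a, h⟩ : ⋀[ℂ]^n W)

@[simp]
theorem toEA_ofEA {n : ℕ} (a : EA W) (h : a ∈ ⋀[ℂ]^n W) : toEA n (ofEA a h) = a := rfl

@[simp]
theorem toEA_wedge {n : ℕ} (w : Fin n → W) : toEA n (wedge n w) = ExteriorAlgebra.ιMulti ℂ n w :=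
  rfl

theorem ext_span (n : ℕ) : Submodule.span ℂ (Set.range (wedge n (W := W))) = ⊤ :=
  exteriorPower.ιMulti_span ℂ n W

@[elab_as_elim]
theorem ext_induction {n : ℕ} {P : Ext n W → Prop} (wedge : ∀ w, P (wedge n w))
    (add : ∀ a b, P a → P b → P (a + b)) (smul : ∀ (c : ℂ) a, P a → P (c • a))
    (x : Ext n W) : P x := by
  have hx : x ∈ Submodule.span ℂ (Set.range (SympGrass.wedge n (W := W))) := by
    rw [ext_span]; trivial
  induction hx using Submodule.span_induction with
  | mem x h => obtain ⟨w, rfl⟩ := h; exact wedge w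
  | zero =>
    have := smul 0 _ (wedge (fun _ => 0))
    rwa [zero_smul] at this
  | add x y _ _ h1 h2 => exact add _ _ h1 h2
  | smul c x _ h => exact smul c _ h

theorem toEA_extMap (n : ℕ) (f : W →ₗ[ℂ] W) (x : Ext n W) :
    toEA n (extMap n f x) = ExteriorAlgebra.map f (toEA n x) := by
  induction x using ext_induction with
  | wedge w =>
    rw [extMap_wedge, toEA_wedge, toEA_wedge, ExteriorAlgebra.map_apply_ιMulti]
    rfl
  | add a b ha hb => simp only [map_add, ha, hb]
  | smul c a ha => simp only [map_smul, ha]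

theorem toEA_extRep {G : Type*} [Group G] (ρ : Representation ℂ G W) (n : ℕ) (g : G)
    (x : Ext n W) : toEA n (extRep ρ n g x) = ExteriorAlgebra.map (ρ g) (toEA n x) :=
  toEA_extMap n (ρ g) x

instance [FiniteDimensional ℂ W] (n : ℕ) : FiniteDimensional ℂ (Ext n W) :=
  inferInstanceAs (FiniteDimensional ℂ (⋀[ℂ]^n W))

end ToEA

/-! ### Reduced exterior powers as spaces of primitive elements. -/

section Primitive

variable {W : Type*} [AddCommGroup W] [Module ℂ W] {ω : LinearMap.BilinForm ℂ W}
  {κ : Type*} [Fintype κ] [DecidableEq κ] {b : Module.Basis κ ℂ W} {b' : κ → W}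

/-- Since the bivector is the same for all dual pairs, the span over all of them is the image of
multiplication by a single element. -/
theorem mem_omegaWedge (hn : ω.Nondegenerate)
    (h : ∀ i j, ω (b i) (b' j) = if i = j then 1 else 0) {m : ℕ} (x : Ext (m + 2) W) :
    x ∈ omegaWedge ω (m + 2) ↔ ∃ y ∈ ⋀[ℂ]^m W, toEA (m + 2) x = bivec b b' * y := by
  have key : ∀ {N : ℕ} (c c' : Fin N → W) (w : Fin m → W),
      toEA (m + 2) (∑ i, wedge (m + 2) (Matrix.vecCons (c i) (Matrix.vecCons (c' i) w))) =
        bivec c c' * ExteriorAlgebra.ιMulti ℂ m w := fun c c' w => by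
    rw [map_sum, bivec, Finset.sum_mul]
    refine Finset.sum_congr rfl fun i _ => ?_
    rw [toEA_wedge, ExteriorAlgebra.ιMulti_succ_apply, ExteriorAlgebra.ιMulti_succ_apply, mul_assoc]
    rfl
  constructor
  · intro hx
    have hx' : x ∈ Submodule.span ℂ _ := hx
    clear hx
    induction hx' using Submodule.span_induction with
    | mem t ht =>
      obtain ⟨N, c, c', w, hc, rfl⟩ := ht
      refine ⟨_, ιMulti_mem w, ?_⟩
      rw [key, bivec_independent hn h hc]
    | zero => exact ⟨0, zero_mem _, by simp⟩
    | add x y _ _ hx hy =>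
      obtain ⟨x', hx', ex⟩ := hx
      obtain ⟨y', hy', ey⟩ := hy
      exact ⟨x' + y', add_mem hx' hy', by rw [map_add, ex, ey, mul_add]⟩
    | smul c x _ hx =>
      obtain ⟨x', hx', ex⟩ := hx
      exact ⟨c • x', Submodule.smul_mem _ _ hx', by rw [map_smul, ex, mul_smul_comm]⟩
  · rintro ⟨y, hy, e⟩
    rw [pow_eq_span] at hy
    induction hy using Submodule.span_induction generalizing x with
    | mem t ht =>
      obtain ⟨w, rfl⟩ := ht
      let f := Fintype.equivFin κ
      refine Submodule.subset_span ⟨Fintype.card κ, b.reindex f, b' ∘ f.symm, w, ?_, ?_⟩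
      · intro i j
        simp [h]
      · refine toEA_injective _ ?_
        rw [key, e]
        congr 1
        unfold bivec
        rw [← f.symm.sum_comp]
        simp
    | zero =>
      rw [mul_zero, ← map_zero (toEA (m + 2))] at e
      rw [toEA_injective _ e]
      exact zero_mem _
    | add y z hy hz h1 h2 =>
      rw [← pow_eq_span] at hy hz
      have hy2 := h1 (ofEA _ (bivec_mul_mem (b := b) (b' := b') hy)) rfl
      have hz2 := h2 (ofEA _ (bivec_mul_mem (b := b) (b' := b') hz)) rfl
      have : x = ofEA _ (bivec_mul_mem (b := b) (b' := b') hy) +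
          ofEA _ (bivec_mul_mem (b := b) (b' := b') hz) := by
        refine toEA_injective _ ?_
        rw [e, map_add, toEA_ofEA, toEA_ofEA, mul_add]
      rw [this]
      exact add_mem hy2 hz2
    | smul c y hy h1 =>
      rw [← pow_eq_span] at hy
      have hy2 := h1 (ofEA _ (bivec_mul_mem (b := b) (b' := b') hy)) rfl
      have : x = c • ofEA _ (bivec_mul_mem (b := b) (b' := b') hy) := by
        refine toEA_injective _ ?_
        rw [e, map_smul, toEA_ofEA, mul_smul_comm]
      rw [this]
      exact Submodule.smul_mem _ _ hy2

/-- Isometries commute with the contractions. -/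
theorem map_contr (ha : ω.IsAlt) (hn : ω.Nondegenerate)
    (h : ∀ i j, ω (b i) (b' j) = if i = j then 1 else 0)
    {W' : Type*} [AddCommGroup W'] [Module ℂ W'] {ω' : LinearMap.BilinForm ℂ W'}
    {κ' : Type*} [Fintype κ'] [DecidableEq κ'] {c : Module.Basis κ' ℂ W'} {c' : κ' → W'}
    (ha' : ω'.IsAlt) (hn' : ω'.Nondegenerate)
    (h' : ∀ i j, ω' (c i) (c' j) = if i = j then 1 else 0)
    (g : W →ₗ[ℂ] W') (hg : ∀ x y, ω' (g x) (g y) = ω x y) (a : EA W) :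
    contr ω' c c' (ExteriorAlgebra.map g a) = ExteriorAlgebra.map g (contr ω b b' a) := by
  induction a using EA.ind with
  | one => rw [map_one, contr_one, contr_one, map_zero]
  | smul r a ha => simp only [map_smul, ha]
  | add a c ha hc => simp only [map_add, ha, hc]
  | mul v a ih =>
    have e : ω' (g v) ∘ₗ g = ω v := LinearMap.ext fun x => hg v x
    rw [map_mul, ExteriorAlgebra.map_apply_ι, contr_gen_mul ha' hn' h', contr_gen_mul ha hn h, ih,
      map_con, e, map_add, map_smul, map_mul, ExteriorAlgebra.map_apply_ι]

/-- The product of isotropic vectors is primitive. -/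
theorem contr_ιMulti (ha : ω.IsAlt) (hn : ω.Nondegenerate)
    (h : ∀ i j, ω (b i) (b' j) = if i = j then 1 else 0) {n : ℕ} (v : Fin n → W)
    (hv : ∀ i j, ω (v i) (v j) = 0) :
    contr ω b b' (ExteriorAlgebra.ιMulti ℂ n v) = 0 := by
  have hcon : ∀ (m : ℕ) (u : Fin m → W) (α : Module.Dual ℂ W), (∀ i, α (u i) = 0) →
      con α (ExteriorAlgebra.ιMulti ℂ m u) = 0 := by
    intro m
    induction m with
    | zero => intro u α _; rw [ExteriorAlgebra.ιMulti_zero_apply, con_one]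
    | succ m ih =>
      intro u α hu
      rw [ExteriorAlgebra.ιMulti_succ_apply, con_gen_mul, hu, zero_smul,
        ih (Matrix.vecTail u) α fun i => hu _, mul_zero, sub_zero]
  induction n with
  | zero => rw [ExteriorAlgebra.ιMulti_zero_apply, contr_one]
  | succ n ih =>
    rw [ExteriorAlgebra.ιMulti_succ_apply, contr_gen_mul ha hn h,
      ih (Matrix.vecTail v) fun i j => hv _ _, mul_zero, zero_add,
      hcon _ (Matrix.vecTail v) _ fun i => hv 0 i.succ, smul_zero]

variable (ω b b')

/-- The primitive elements of `Λ^a W`. -/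
def primitive (a : ℕ) : Submodule ℂ (Ext a W) := LinearMap.ker (contr ω b b' ∘ₗ toEA a)

variable {ω b b'}

theorem mem_primitive {a : ℕ} {x : Ext a W} :
    x ∈ primitive ω b b' a ↔ contr ω b b' (toEA a x) = 0 := Iff.rfl

variable [FiniteDimensional ℂ W]

/-- The bound says that degree a - 2 lies below the middle, where contraction after multiplication
by the bivector is injective. -/
theorem disjoint_primitive_omegaWedge (ha : ω.IsAlt) (hn : ω.Nondegenerate)
    (h : ∀ i j, ω (b i) (b' j) = if i = j then 1 else 0) {a : ℕ}
    (hd : 2 * a < Fintype.card κ + 4) {x : Ext a W} (hx : x ∈ primitive ω b b' a)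
    (hx' : x ∈ omegaWedge ω a) : x = 0 := by
  match a with
  | 0 => exact hx'
  | 1 => exact hx'
  | a + 2 =>
    obtain ⟨y, hy, e⟩ := (mem_omegaWedge hn h x).1 hx'
    rw [mem_primitive, e] at hx
    have := contr_bivec_injective ha hn h (by omega) hy hx
    rw [this, mul_zero, ← map_zero (toEA (a + 2))] at e
    exact toEA_injective _ e

theorem exists_primitive_sub_mem (ha : ω.IsAlt) (hn : ω.Nondegenerate)
    (h : ∀ i j, ω (b i) (b' j) = if i = j then 1 else 0) {a : ℕ}
    (hd : 2 * a < Fintype.card κ + 4) (x : Ext a W) :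
    ∃ y ∈ primitive ω b b' a, x - y ∈ omegaWedge ω a := by
  match a with
  | 0 => exact ⟨x, contr_eq_zero_of_mem (n := 0) (by omega) (toEA_mem x), by rw [sub_self]; exact zero_mem _⟩
  | 1 => exact ⟨x, contr_eq_zero_of_mem (n := 1) (by omega) (toEA_mem x), by rw [sub_self]; exact zero_mem _⟩
  | a + 2 =>
    obtain ⟨y, hy, e⟩ := exists_primitive_decomposition ha hn h (d := a) (by omega) (toEA_mem x)
    refine ⟨x - ofEA _ (bivec_mul_mem (b := b) (b' := b') hy), ?_, ?_⟩
    · rw [mem_primitive, map_sub, toEA_ofEA, e]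
    · rw [sub_sub_cancel]
      exact (mem_omegaWedge hn h _).2 ⟨y, hy, rfl⟩

/-- The reduced exterior power is isomorphic to the space of primitive elements. -/
theorem primitive_mkQ_bijective (ha : ω.IsAlt) (hn : ω.Nondegenerate)
    (h : ∀ i j, ω (b i) (b' j) = if i = j then 1 else 0) {a : ℕ}
    (hd : 2 * a < Fintype.card κ + 4) :
    Function.Bijective ((omegaWedge ω a).mkQ ∘ₗ (primitive ω b b' a).subtype) := by
  constructor
  · rw [injective_iff_map_eq_zero]
    intro x hx
    have hx' : (x : Ext a W) ∈ omegaWedge ω a := (Submodule.Quotient.mk_eq_zero _).1 hx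
    exact Subtype.ext (disjoint_primitive_omegaWedge ha hn h hd x.2 hx')
  · intro x
    obtain ⟨x, rfl⟩ := Submodule.mkQ_surjective _ x
    obtain ⟨y, hy, e⟩ := exists_primitive_sub_mem ha hn h hd x
    exact ⟨⟨y, hy⟩, ((Submodule.Quotient.eq _).2 e).symm⟩

end Primitive

/-! ### The Lefschetz decomposition as an isomorphism of representations. -/

section LefschetzDecomposition

variable {W : Type*} [AddCommGroup W] [Module ℂ W] [FiniteDimensional ℂ W]
  {ω : LinearMap.BilinForm ℂ W}
  {κ : Type*} [Fintype κ] [DecidableEq κ] {b : Module.Basis κ ℂ W} {b' : κ → W}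

/-- Up to the middle degree an element is a primitive one plus a multiple of the bivector; above it,
it is such a multiple. Either way the rest is two degrees lower. -/
theorem le_iSup_strings (ha : ω.IsAlt) (hn : ω.Nondegenerate)
    (h : ∀ i j, ω (b i) (b' j) = if i = j then 1 else 0) {m : ℕ} (hm : Fintype.card κ = 2 * m)
    (d : ℕ) {x : EA W} (hx : x ∈ ⋀[ℂ]^d W) :
    x ∈ Submodule.span ℂ {z | ∃ a c y, a + 2 * c = d ∧ a + c ≤ m ∧ y ∈ ⋀[ℂ]^a W ∧
      contr ω b b' y = 0 ∧ z = bivec b b' ^ c * y} := by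
  induction d using Nat.strong_induction_on generalizing x with
  | _ d ih =>
    -- Multiplication by the bivector lengthens a string, or kills it when a + c = m.
    have step : ∀ d' y, d' + 2 = d → y ∈ ⋀[ℂ]^d' W →
        bivec b b' * y ∈ Submodule.span ℂ {z | ∃ a c y, a + 2 * c = d ∧ a + c ≤ m ∧
          y ∈ ⋀[ℂ]^a W ∧ contr ω b b' y = 0 ∧ z = bivec b b' ^ c * y} := by
      intro d' y hd' hy
      have := ih d' (by omega) hy
      clear hy
      induction this using Submodule.span_induction with
      | mem z hz =>
        obtain ⟨a, c, y, e1, e2, hy, h0, rfl⟩ := hz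
        rw [← mul_assoc, ← pow_succ']
        by_cases hc : a + c = m
        · rw [bivec_pow_eq_zero ha hn h hm hy h0 hc]
          exact zero_mem _
        · exact Submodule.subset_span ⟨a, c + 1, y, by omega, by omega, hy, h0, rfl⟩
      | zero => rw [mul_zero]; exact zero_mem _
      | add y z _ _ h1 h2 => rw [mul_add]; exact add_mem h1 h2
      | smul c y _ h1 => rw [mul_smul_comm]; exact Submodule.smul_mem _ _ h1
    by_cases hdm : d ≤ m
    · match d with
      | 0 =>
        refine Submodule.subset_span ⟨0, 0, x, rfl, by omega, hx, ?_, by simp⟩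
        exact contr_eq_zero_of_mem (n := 0) (by omega) hx
      | 1 =>
        refine Submodule.subset_span ⟨1, 0, x, rfl, by omega, hx, ?_, by simp⟩
        exact contr_eq_zero_of_mem (n := 1) (by omega) hx
      | d + 2 =>
        obtain ⟨y, hy, e⟩ := exists_primitive_decomposition ha hn h (d := d) (by omega) hx
        rw [← sub_add_cancel x (bivec b b' * y)]
        refine add_mem (Submodule.subset_span ⟨d + 2, 0, _, rfl, by omega, ?_, e, by simp⟩)
          (step d y rfl hy)
        exact sub_mem hx (bivec_mul_mem hy)
    · match d with
      | 0 => omega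
      | 1 =>
        have : m = 0 := by omega
        have := pow_eq_bot (W := W) (d := 1) (by rw [Module.finrank_eq_card_basis b]; omega)
        rw [this, Submodule.mem_bot] at hx
        rw [hx]
        exact zero_mem _
      | d + 2 =>
        obtain ⟨y, hy, rfl⟩ := exists_bivec_mul_eq ha hn h (d := d) (by omega) hx
        exact step d y rfl hy

variable {G : Type*} [Group G]

theorem equiv_of_bijective {M N : Type*} [AddCommGroup M] [Module ℂ M] [AddCommGroup N]
    [Module ℂ N] {ρ : Representation ℂ G M} {σ : Representation ℂ G N} (f : M →ₗ[ℂ] N)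
    (hf : Function.Bijective f) (he : ∀ g x, f (ρ g x) = σ g (f x)) : Nonempty (ρ.Equiv σ) :=
  ⟨Representation.Equiv.mk (LinearEquiv.ofBijective f hf) fun g => LinearMap.ext (he g)⟩

theorem directSum_equiv_of_bijective {ι : Type*} [DecidableEq ι] {M : ι → Type*} {N : Type*}
    [∀ i, AddCommGroup (M i)] [∀ i, Module ℂ (M i)] [AddCommGroup N] [Module ℂ N]
    {ρ : ∀ i, Representation ℂ G (M i)} {σ : Representation ℂ G N} (f : ∀ i, M i →ₗ[ℂ] N)
    (hf : Function.Bijective (DirectSum.toModule ℂ ι N f))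
    (he : ∀ i g x, f i (ρ i g x) = σ g (f i x)) :
    Nonempty ((Representation.directSum ρ).Equiv σ) := by
  refine equiv_of_bijective _ hf fun g x => ?_
  induction x using DirectSum.induction_on with
  | zero => simp only [map_zero]
  | of i x =>
    change DirectSum.toModule ℂ ι N f (DirectSum.lmap (fun i => ρ i g) (DirectSum.lof ℂ ι M i x)) =
      σ g (DirectSum.toModule ℂ ι N f (DirectSum.lof ℂ ι M i x))
    rw [DirectSum.lmap_lof, DirectSum.toModule_lof, DirectSum.toModule_lof, he]
  | add x y hx hy => simp only [map_add, hx, hy]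

theorem exists_dual_family (ha : ω.IsAlt) (hn : ω.Nondegenerate) (b : Module.Basis κ ℂ W) :
    ∃ b' : κ → W, ∀ i j, ω (b i) (b' j) = if i = j then 1 else 0 := by
  refine ⟨fun j => - ω.dualBasis hn b j, fun i j => ?_⟩
  rw [map_neg, LinearMap.IsAlt.neg ha, LinearMap.BilinForm.apply_dualBasis_left]

/-- These eigenvalues tell apart the strings that meet one degree, and so make their sum direct. -/
theorem bivec_contr_bivec_pow (ha : ω.IsAlt) (hn : ω.Nondegenerate)
    (h : ∀ i j, ω (b i) (b' j) = if i = j then 1 else 0) {d : ℕ} {a : EA W}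
    (hd : a ∈ ⋀[ℂ]^d W) (h0 : contr ω b b' a = 0) (c : ℕ) :
    bivec b b' * contr ω b b' (bivec b b' ^ c * a) =
      (2 * c * (Fintype.card κ - 2 * d - 2 * c + 2) : ℂ) • (bivec b b' ^ c * a) := by
  cases c with
  | zero => simp [h0]
  | succ c =>
    rw [contr_bivec_pow ha hn h hd h0, mul_smul_comm, ← mul_assoc, ← pow_succ']
    congr 1
    push_cast
    ring

/-- The Lefschetz decomposition of the exterior powers. -/
theorem lefschetz_equiv (ha : ω.IsAlt) (hn : ω.Nondegenerate) {m : ℕ}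
    (hm : Module.finrank ℂ W = 2 * m) (ρ : Representation ℂ G W)
    (hρ : ∀ g x y, ω (ρ g x) (ρ g y) = ω x y) (d : ℕ) :
    Nonempty ((Representation.directSum fun q : {q : ℕ × ℕ // q.1 + 2 * q.2 = d ∧ q.1 + q.2 ≤ m} =>
      redExtRep ρ ω hρ q.1.1).Equiv (extRep ρ d)) := by
  classical
  let b := Module.finBasis ℂ W
  obtain ⟨b', h⟩ := exists_dual_family ha hn b
  have hcard : Fintype.card (Fin (Module.finrank ℂ W)) = 2 * m := by rw [Fintype.card_fin, hm]
  have hbij : ∀ q : {q : ℕ × ℕ // q.1 + 2 * q.2 = d ∧ q.1 + q.2 ≤ m}, Function.Bijective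
      ((omegaWedge ω q.1.1).mkQ ∘ₗ (primitive ω b b' q.1.1).subtype) := fun q =>
    primitive_mkQ_bijective ha hn h (by have := q.2.2; omega)
  have hdeg : ∀ (q : {q : ℕ × ℕ // q.1 + 2 * q.2 = d ∧ q.1 + q.2 ≤ m}) (a : EA W),
      a ∈ ⋀[ℂ]^q.1.1 W → bivec b b' ^ q.1.2 * a ∈ ⋀[ℂ]^d W := fun q a hq => by
    have := bivec_pow_mem (b := b) (b' := b') (c := q.1.2) hq
    rwa [q.2.1] at this
  let lift : ∀ q : {q : ℕ × ℕ // q.1 + 2 * q.2 = d ∧ q.1 + q.2 ≤ m}, Ext q.1.1 W →ₗ[ℂ] Ext d W :=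
    fun q => (LinearMap.mulLeft ℂ (bivec b b' ^ q.1.2) ∘ₗ toEA q.1.1).codRestrict (⋀[ℂ]^d W)
      fun x => hdeg q _ (toEA_mem x)
  have hlift : ∀ q x, toEA d (lift q x) = bivec b b' ^ q.1.2 * toEA q.1.1 x := fun q x => rfl
  let f : ∀ q : {q : ℕ × ℕ // q.1 + 2 * q.2 = d ∧ q.1 + q.2 ≤ m}, RedExt ω q.1.1 →ₗ[ℂ] Ext d W :=
    fun q => (lift q ∘ₗ (primitive ω b b' q.1.1).subtype) ∘ₗ
      (LinearEquiv.ofBijective _ (hbij q)).symm.toLinearMap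
  have hf : ∀ q, ∀ y : Ext q.1.1 W, y ∈ primitive ω b b' q.1.1 →
      toEA d (f q ((omegaWedge ω q.1.1).mkQ y)) = bivec b b' ^ q.1.2 * toEA q.1.1 y := by
    intro q y hy
    have : (LinearEquiv.ofBijective _ (hbij q)).symm ((omegaWedge ω q.1.1).mkQ y) = ⟨y, hy⟩ := by
      rw [LinearEquiv.symm_apply_eq]
      rfl
    change toEA d (lift q ((LinearEquiv.ofBijective _ (hbij q)).symm
      ((omegaWedge ω q.1.1).mkQ y) : primitive ω b b' q.1.1)) = _
    rw [this, hlift]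
  have hprim : ∀ (q : {q : ℕ × ℕ // q.1 + 2 * q.2 = d ∧ q.1 + q.2 ≤ m})
      (x : RedExt ω q.1.1), ∃ y : Ext q.1.1 W, y ∈ primitive ω b b' q.1.1 ∧
        x = (omegaWedge ω q.1.1).mkQ y := fun q x => by
    obtain ⟨y, hy⟩ := (hbij q).2 x
    exact ⟨y, y.2, hy.symm⟩
  have hbi : ∀ g, ExteriorAlgebra.map (ρ g) (bivec b b') = bivec b b' := by
    intro g
    let e : W ≃ₗ[ℂ] W := LinearEquiv.ofLinearMap (ρ g) (ρ g⁻¹)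
      (by rw [← Module.End.mul_eq_comp, ← map_mul]; simp; rfl)
      (by rw [← Module.End.mul_eq_comp, ← map_mul]; simp; rfl)
    have he : ∀ x, e x = ρ g x := fun _ => rfl
    conv_rhs => rw [bivec_independent hn h (c := b.map e) (c' := ρ g ∘ b')
      (fun i j => by simp [he, hρ, h])]
    simp only [bivec, map_sum, map_mul, ExteriorAlgebra.map_apply_ι, Module.Basis.map_apply, he,
      Function.comp_apply]
  refine directSum_equiv_of_bijective f ⟨?_, ?_⟩ ?_
  · have hinj : Function.Injective (DirectSum.toModule ℂ _ _ fun q => toEA d ∘ₗ f q) := by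
      refine toModule_injective_of_eigen _ (LinearMap.mulLeft ℂ (bivec b b') ∘ₗ contr ω b b')
        (fun q => (2 * q.1.2 * (2 * m - 2 * q.1.1 - 2 * q.1.2 + 2) : ℂ)) ?_ ?_ ?_
      · rintro ⟨⟨a, c⟩, h1, h2⟩ ⟨⟨a', c'⟩, h3, h4⟩ hq
        dsimp only at h1 h2 h3 h4 hq
        have hq' : (2 * c * (2 * m - 2 * a - 2 * c + 2) : ℤ) =
          2 * c' * (2 * m - 2 * a' - 2 * c' + 2) := by exact_mod_cast hq
        have e1 : (a : ℤ) = d - 2 * c := by omega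
        have e2 : (a' : ℤ) = d - 2 * c' := by omega
        rw [e1, e2] at hq'
        -- The difference of the two eigenvalues is four times this product. As a + c ≤ m means d -
        -- c ≤ m, the second factor is positive.
        have h5 : ((c : ℤ) - c') * (m - d + 1 + c + c') = 0 := by linarith
        rcases mul_eq_zero.1 h5 with h6 | h6
        · have : c = c' := by omega
          subst this
          have : a = a' := by omega
          subst this
          rfl
        · omega
      · intro q x
        obtain ⟨y, hy, rfl⟩ := hprim q x
        change bivec b b' * contr ω b b' (toEA d (f q _)) = _ • toEA d (f q _)
        rw [hf q y hy, bivec_contr_bivec_pow ha hn h (toEA_mem y) hy, hcard]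
        push_cast
        rfl
      · intro q
        rw [injective_iff_map_eq_zero]
        intro x hx
        obtain ⟨y, hy, rfl⟩ := hprim q x
        change toEA d (f q _) = 0 at hx
        rw [hf q y hy] at hx
        have := bivec_pow_injective ha hn h hcard (toEA_mem y) hy q.2.2 hx
        rw [← map_zero (toEA q.1.1)] at this
        rw [toEA_injective _ this, map_zero]
    have : (DirectSum.toModule ℂ _ _ fun q => toEA d ∘ₗ f q) =
        toEA d ∘ₗ DirectSum.toModule ℂ _ _ f := by
      refine DirectSum.linearMap_ext ℂ fun i => LinearMap.ext fun x => ?_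
      simp
    rw [this, LinearMap.coe_comp] at hinj
    exact hinj.of_comp
  · rw [← LinearMap.range_eq_top, eq_top_iff]
    intro x _
    have hx := le_iSup_strings ha hn h hcard d (toEA_mem x)
    obtain ⟨z, hz⟩ : toEA d x ∈ LinearMap.range (toEA d ∘ₗ DirectSum.toModule ℂ _ _ f) := by
      refine Submodule.span_le.2 ?_ hx
      rintro _ ⟨a, c, y, e1, e2, hy, h0, rfl⟩
      refine ⟨DirectSum.lof ℂ _ _ ⟨(a, c), e1, e2⟩ ((omegaWedge ω a).mkQ (ofEA y hy)), ?_⟩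
      rw [LinearMap.comp_apply, DirectSum.toModule_lof]
      exact hf ⟨(a, c), e1, e2⟩ (ofEA y hy) h0
    exact ⟨z, toEA_injective _ hz⟩
  · intro q g x
    obtain ⟨y, hy, rfl⟩ := hprim q x
    refine toEA_injective _ ?_
    have hgy : extRep ρ q.1.1 g y ∈ primitive ω b b' q.1.1 := by
      rw [mem_primitive, toEA_extRep, map_contr ha hn h ha hn h _ (hρ g), mem_primitive.1 hy,
        map_zero]
    change toEA d (f q ((omegaWedge ω q.1.1).mkQ (extRep ρ q.1.1 g y))) = _
    rw [hf q _ hgy, toEA_extRep, toEA_extRep, hf q y hy, map_mul, map_pow, hbi]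

end LefschetzDecomposition


/-! ## Two-column Schur modules as highest weight spaces -/

section TwoColumns

variable {W : Type*} [AddCommGroup W] [Module ℂ W]

/-- Multiplication by a vector in the first column. -/
def mulL (v : W) : EA W ⊗[ℂ] EA W →ₗ[ℂ] EA W ⊗[ℂ] EA W :=
  LinearMap.rTensor _ (LinearMap.mulLeft ℂ (gen v))

/-- Multiplication by a vector in the second column. -/
def mulR (v : W) : EA W ⊗[ℂ] EA W →ₗ[ℂ] EA W ⊗[ℂ] EA W :=
  LinearMap.lTensor _ (LinearMap.mulLeft ℂ (gen v))

@[simp]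
theorem mulL_tmul (v : W) (a b : EA W) : mulL v (a ⊗ₜ b) = (gen v * a) ⊗ₜ b := rfl

@[simp]
theorem mulR_tmul (v : W) (a b : EA W) : mulR v (a ⊗ₜ b) = a ⊗ₜ (gen v * b) := rfl

theorem mulL_mulL (v w : W) (t : EA W ⊗[ℂ] EA W) : mulL v (mulL w t) = -mulL w (mulL v t) := by
  induction t using TensorProduct.induction_on with
  | zero => simp
  | tmul a b =>
    rw [mulL_tmul, mulL_tmul, mulL_tmul, mulL_tmul, gen_mul_gen_mul, TensorProduct.neg_tmul]
  | add s t hs ht => simp only [map_add, hs, ht, neg_add]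

variable (W) in
/-- The tensors of bidegree `(p, e)`. -/
def bideg (p e : ℕ) : Submodule ℂ (EA W ⊗[ℂ] EA W) :=
  LinearMap.range (TensorProduct.map (toEA p (W := W)) (toEA e (W := W)))

theorem tmul_mem_bideg {p e : ℕ} {a b : EA W} (ha : a ∈ ⋀[ℂ]^p W) (hb : b ∈ ⋀[ℂ]^e W) :
    a ⊗ₜ b ∈ bideg W p e := ⟨ofEA a ha ⊗ₜ ofEA b hb, rfl⟩

@[elab_as_elim]
theorem bideg_induction {p e : ℕ} {P : EA W ⊗[ℂ] EA W → Prop} (zero : P 0)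
    (tmul : ∀ a ∈ ⋀[ℂ]^p W, ∀ b ∈ ⋀[ℂ]^e W, P (a ⊗ₜ b))
    (add : ∀ s t, P s → P t → P (s + t)) {t : EA W ⊗[ℂ] EA W} (ht : t ∈ bideg W p e) : P t := by
  obtain ⟨t, rfl⟩ := ht
  induction t using TensorProduct.induction_on with
  | zero => rw [map_zero]; exact zero
  | tmul a b => exact tmul _ (toEA_mem a) _ (toEA_mem b)
  | add s t hs ht => rw [map_add]; exact add _ _ hs ht

@[elab_as_elim]
theorem bideg_span_induction {p e : ℕ} {P : EA W ⊗[ℂ] EA W → Prop} (zero : P 0)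
    (tmul : ∀ (x : Fin p → W) (y : Fin e → W),
      P (ExteriorAlgebra.ιMulti ℂ p x ⊗ₜ ExteriorAlgebra.ιMulti ℂ e y))
    (smul : ∀ (c : ℂ) t, P t → P (c • t))
    (add : ∀ s t, P s → P t → P (s + t)) {t : EA W ⊗[ℂ] EA W} (ht : t ∈ bideg W p e) : P t := by
  refine bideg_induction zero (fun a ha b hb => ?_) add ht
  have h1 : ∀ x : Ext p W, ∀ y : Ext e W, P (toEA p x ⊗ₜ toEA e y) := by
    intro x y
    induction x using ext_induction with
    | wedge x =>
      induction y using ext_induction with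
      | wedge y => exact tmul x y
      | add y z hy hz => rw [map_add, TensorProduct.tmul_add]; exact add _ _ hy hz
      | smul c y hy => rw [map_smul, TensorProduct.tmul_smul]; exact smul _ _ hy
    | add x z hy hz => rw [map_add, TensorProduct.add_tmul]; exact add _ _ hy hz
    | smul c y hy => rw [map_smul, ← TensorProduct.smul_tmul']; exact smul _ _ hy
  exact h1 (ofEA a ha) (ofEA b hb)

variable [FiniteDimensional ℂ W]

/-- The raising operator, which moves boxes from the second column to the first. -/
def raise : EA W ⊗[ℂ] EA W →ₗ[ℂ] EA W ⊗[ℂ] EA W :=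
  ∑ i, TensorProduct.map (LinearMap.mulLeft ℂ (gen (Module.finBasis ℂ W i)))
    (con ((Module.finBasis ℂ W).coord i))

/-- The lowering operator, which moves boxes from the first column to the second. -/
def lower : EA W ⊗[ℂ] EA W →ₗ[ℂ] EA W ⊗[ℂ] EA W :=
  ∑ i, TensorProduct.map (con ((Module.finBasis ℂ W).coord i))
    (LinearMap.mulLeft ℂ (gen (Module.finBasis ℂ W i)))

theorem raise_tmul (a b : EA W) : raise (a ⊗ₜ b) =
    ∑ i, (gen (Module.finBasis ℂ W i) * a) ⊗ₜ con ((Module.finBasis ℂ W).coord i) b := by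
  simp [raise]

theorem lower_tmul (a b : EA W) : lower (a ⊗ₜ b) =
    ∑ i, con ((Module.finBasis ℂ W).coord i) a ⊗ₜ (gen (Module.finBasis ℂ W i) * b) := by
  simp [lower]

theorem raise_mulL (v : W) (t : EA W ⊗[ℂ] EA W) : raise (mulL v t) = -mulL v (raise t) := by
  induction t using TensorProduct.induction_on with
  | zero => simp
  | tmul a b =>
    rw [mulL_tmul, raise_tmul, raise_tmul, map_sum, ← Finset.sum_neg_distrib]
    refine Finset.sum_congr rfl fun i _ => ?_
    rw [mulL_tmul, gen_mul_gen_mul, TensorProduct.neg_tmul]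
  | add s t hs ht => simp only [map_add, hs, ht, neg_add]

theorem lower_mulR (v : W) (t : EA W ⊗[ℂ] EA W) : lower (mulR v t) = -mulR v (lower t) := by
  induction t using TensorProduct.induction_on with
  | zero => simp
  | tmul a b =>
    rw [mulR_tmul, lower_tmul, lower_tmul, map_sum, ← Finset.sum_neg_distrib]
    refine Finset.sum_congr rfl fun i _ => ?_
    rw [mulR_tmul, gen_mul_gen_mul, TensorProduct.tmul_neg]
  | add s t hs ht => simp only [map_add, hs, ht, neg_add]

theorem sum_coord_smul_gen (v : W) :
    ∑ i, (Module.finBasis ℂ W).coord i v • gen (Module.finBasis ℂ W i) = gen v := by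
  conv_rhs => rw [← (Module.finBasis ℂ W).sum_repr v, map_sum]
  simp

theorem raise_mulR (v : W) (t : EA W ⊗[ℂ] EA W) :
    raise (mulR v t) = mulL v t - mulR v (raise t) := by
  induction t using TensorProduct.induction_on with
  | zero => simp
  | tmul a b =>
    have hv : (gen v * a) ⊗ₜ[ℂ] b = ∑ i, ((Module.finBasis ℂ W).coord i v •
        gen (Module.finBasis ℂ W i) * a) ⊗ₜ[ℂ] b := by
      rw [← TensorProduct.sum_tmul, ← Finset.sum_mul, sum_coord_smul_gen]
    rw [mulR_tmul, raise_tmul, raise_tmul, map_sum, mulL_tmul, hv, ← Finset.sum_sub_distrib]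
    refine Finset.sum_congr rfl fun i _ => ?_
    rw [mulR_tmul, con_gen_mul, TensorProduct.tmul_sub, smul_mul_assoc, TensorProduct.smul_tmul]
  | add s t hs ht => simp only [map_add, hs, ht]; abel

theorem lower_mulL (v : W) (t : EA W ⊗[ℂ] EA W) :
    lower (mulL v t) = mulR v t - mulL v (lower t) := by
  induction t using TensorProduct.induction_on with
  | zero => simp
  | tmul a b =>
    have hv : a ⊗ₜ[ℂ] (gen v * b) = ∑ i, a ⊗ₜ[ℂ] ((Module.finBasis ℂ W).coord i v •
        gen (Module.finBasis ℂ W i) * b) := by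
      rw [← TensorProduct.tmul_sum, ← Finset.sum_mul, sum_coord_smul_gen]
    rw [mulL_tmul, lower_tmul, lower_tmul, map_sum, mulR_tmul, hv, ← Finset.sum_sub_distrib]
    refine Finset.sum_congr rfl fun i _ => ?_
    rw [mulL_tmul, con_gen_mul, TensorProduct.sub_tmul, smul_mul_assoc, TensorProduct.smul_tmul]
  | add s t hs ht => simp only [map_add, hs, ht]; abel

theorem raise_tmul_one (a : EA W) : raise (a ⊗ₜ (1 : EA W)) = 0 := by simp [raise_tmul]

theorem lower_one_tmul (a : EA W) : lower ((1 : EA W) ⊗ₜ a) = 0 := by simp [lower_tmul]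

/-- The two columns form a representation of gl_2 that commutes with GL(W) (skew Howe duality),
whose weight is the difference of the column lengths. The induction peels vectors off the first
column, then off the second. -/
theorem raise_lower_comm {p e : ℕ} {t : EA W ⊗[ℂ] EA W} (ht : t ∈ bideg W p e) :
    raise (lower t) - lower (raise t) = ((p : ℂ) - e) • t := by
  refine bideg_induction (by simp) (fun a ha b hb => ?_)
    (fun s t hs ht => by rw [smul_add, ← hs, ← ht]; simp only [map_add]; abel) ht
  clear ht t
  induction p generalizing a with
  | zero =>
    obtain ⟨c, rfl⟩ := mem_zero_iff.1 ha
    rw [← TensorProduct.smul_tmul']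
    simp only [map_smul, ← smul_sub]
    rw [smul_comm]
    congr 1
    induction e generalizing b with
    | zero =>
      obtain ⟨c, rfl⟩ := mem_zero_iff.1 hb
      simp [raise_tmul_one, lower_one_tmul]
    | succ e ih =>
      refine pow_succ_induction (P := fun b => raise (lower ((1 : EA W) ⊗ₜ b)) -
        lower (raise ((1 : EA W) ⊗ₜ b)) = (((0 : ℕ) : ℂ) - ((e + 1 : ℕ) : ℂ)) • (1 : EA W) ⊗ₜ[ℂ] b)
        (fun s t hs ht => by
          rw [TensorProduct.tmul_add, smul_add, ← hs, ← ht]; simp only [map_add]; abel)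
        (fun v b hb => ?_) b hb
      have h := ih b hb
      rw [← mulR_tmul, lower_mulR, map_neg, raise_mulR, raise_mulR, map_sub, lower_mulL,
        lower_mulR, ← map_smul]
      rw [lower_one_tmul] at h ⊢
      rw [map_zero, zero_sub, neg_eq_iff_eq_neg] at h
      rw [h]
      simp only [map_zero, map_neg, map_smul, mulR_tmul]
      push_cast
      module
  | succ p ih =>
    refine pow_succ_induction (P := fun a => raise (lower (a ⊗ₜ b)) -
        lower (raise (a ⊗ₜ b)) = (((p + 1 : ℕ) : ℂ) - (e : ℂ)) • a ⊗ₜ[ℂ] b)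
        (fun s t hs ht => by
          rw [TensorProduct.add_tmul, smul_add, ← hs, ← ht]; simp only [map_add]; abel)
        (fun v a ha => ?_) a ha
    have h := ih a ha
    rw [sub_eq_iff_eq_add] at h
    rw [← mulL_tmul, lower_mulL, map_sub, raise_mulL, raise_mulL, raise_mulR, map_neg, lower_mulL,
      h]
    simp only [map_add, map_smul]
    push_cast
    module

theorem raise_mem {p e : ℕ} {t : EA W ⊗[ℂ] EA W} (ht : t ∈ bideg W p (e + 1)) :
    raise t ∈ bideg W (p + 1) e := by
  refine bideg_induction (by simp) (fun a ha b hb => ?_)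
    (fun s t hs ht => by rw [map_add]; exact add_mem hs ht) ht
  rw [raise_tmul]
  exact sum_mem fun i _ => tmul_mem_bideg (gen_mul_mem _ ha) (con_mem _ hb)

theorem raise_eq_zero {p : ℕ} {t : EA W ⊗[ℂ] EA W} (ht : t ∈ bideg W p 0) : raise t = 0 := by
  refine bideg_induction (by simp) (fun a ha b hb => ?_)
    (fun s t hs ht => by rw [map_add, hs, ht, add_zero]) ht
  obtain ⟨c, rfl⟩ := mem_zero_iff.1 hb
  rw [TensorProduct.tmul_smul, map_smul, raise_tmul_one, smul_zero]

theorem lower_mem {p e : ℕ} {t : EA W ⊗[ℂ] EA W} (ht : t ∈ bideg W (p + 1) e) :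
    lower t ∈ bideg W p (e + 1) := by
  refine bideg_induction (by simp) (fun a ha b hb => ?_)
    (fun s t hs ht => by rw [map_add]; exact add_mem hs ht) ht
  rw [lower_tmul]
  exact sum_mem fun i _ => tmul_mem_bideg (con_mem _ ha) (gen_mul_mem _ hb)

/-- The ladder lemma along the bidegrees of fixed sum p + e: the weights p + e - 2i are positive for
i ≤ e because e < p. -/
theorem raise_lower_injective {p e : ℕ} (h : e < p) {t : EA W ⊗[ℂ] EA W}
    (ht : t ∈ bideg W p e) (h0 : raise (lower t) = 0) : t = 0 := by
  refine ladder_injective (fun i => bideg W (p + e - i) i) raise lower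
    (fun i => (p + e : ℝ) - 2 * i) (fun z hz => raise_eq_zero hz) e ?_ ?_ ?_ t
    (by rwa [Nat.add_sub_cancel]) h0
  · intro i hi
    have : 2 * i < p + e := by omega
    have : (2 * i : ℝ) < p + e := by exact_mod_cast this
    linarith
  · intro i hi z hz
    have := raise_mem hz
    have e1 : p + e - (i + 1) + 1 = p + e - i := by omega
    rwa [e1] at this
  · intro i hi z hz
    rw [raise_lower_comm hz, Nat.cast_sub (by omega)]
    congr 1
    push_cast
    ring

variable (W) in
/-- The inclusion of `Λ^p W ⊗ Λ^e W`. -/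
def toTwo (p e : ℕ) : Ext p W ⊗[ℂ] Ext e W →ₗ[ℂ] EA W ⊗[ℂ] EA W :=
  TensorProduct.map (toEA p) (toEA e)

theorem toTwo_mem {p e : ℕ} (t : Ext p W ⊗[ℂ] Ext e W) : toTwo W p e t ∈ bideg W p e := ⟨t, rfl⟩

theorem toTwo_injective (p e : ℕ) : Function.Injective (toTwo W p e) :=
  TensorProduct.map_injective_of_flat_flat _ _ (toEA_injective p) (toEA_injective e)

/-- Lowering leaves a hole in the first column with a sign; multiplying by v fills it, and the signs
disappear. -/
theorem mulL_lower_ιMulti {p : ℕ} (v : W) (x : Fin p → W) (b : EA W) :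
    mulL v (lower (ExteriorAlgebra.ιMulti ℂ p x ⊗ₜ b)) =
      ∑ i, ExteriorAlgebra.ιMulti ℂ p (Function.update x i v) ⊗ₜ (gen (x i) * b) := by
  induction p with
  | zero => rw [ExteriorAlgebra.ιMulti_zero_apply, lower_one_tmul]; simp
  | succ p ih =>
    have hx : ExteriorAlgebra.ιMulti ℂ (p + 1) x =
        gen (x 0) * ExteriorAlgebra.ιMulti ℂ p (Matrix.vecTail x) :=
      ExteriorAlgebra.ιMulti_succ_apply ..
    rw [Fin.sum_univ_succ, hx, ← mulL_tmul, lower_mulL, map_sub, mulL_mulL, ih, sub_neg_eq_add,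
      map_sum]
    congr 1
    · rw [mulR_tmul, mulL_tmul, ExteriorAlgebra.ιMulti_succ_apply, Function.update_self]
      congr 3
    · refine Finset.sum_congr rfl fun i _ => ?_
      rw [mulL_tmul, ExteriorAlgebra.ιMulti_succ_apply, Function.update_of_ne (Fin.succ_ne_zero i).symm]
      congr 3
      ext j
      simp only [Matrix.vecTail, Function.comp_apply, Function.update_apply, Fin.succ_inj]

/-- Moving slot j to the front puts its sign into the fixed cofactor c, so that the formula is
linear in v without signs. -/
theorem exists_update_eq {e : ℕ} (y : Fin (e + 1) → W) (j : Fin (e + 1)) :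
    ∃ c ∈ ⋀[ℂ]^e W, ∀ v, ExteriorAlgebra.ιMulti ℂ (e + 1) (Function.update y j v) = gen v * c := by
  refine ⟨(-1 : ℤ) ^ (j : ℕ) • ExteriorAlgebra.ιMulti ℂ e (j.removeNth y), ?_, fun v => ?_⟩
  · exact zsmul_mem (ιMulti_mem _) _
  · rw [← Fin.insertNth_removeNth, AlternatingMap.map_insertNth, mul_smul_comm,
      ExteriorAlgebra.ιMulti_succ_apply]
    simp [Matrix.vecTail, Function.comp_def]

/-- With y = y_j ∧ c, the element y_j ∧ x ⊗ c has the longer first column. Lowering y_j itself gives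
the leading term of the relation; lowering the x_i gives the exchanged terms. -/
theorem toTwo_exchange {p e : ℕ} (x : Fin p → W) (y : Fin (e + 1) → W) (j : Fin (e + 1)) :
    ∃ c ∈ ⋀[ℂ]^e W, toTwo W p (e + 1) (wedge p x ⊗ₜ[ℂ] wedge (e + 1) y
      - ∑ i, wedge p (Function.update x i (y j)) ⊗ₜ[ℂ]
          wedge (e + 1) (Function.update y j (x i))) =
      lower ((gen (y j) * ExteriorAlgebra.ιMulti ℂ p x) ⊗ₜ c) := by
  obtain ⟨c, hc, h⟩ := exists_update_eq y j
  refine ⟨c, hc, ?_⟩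
  have hy := h (y j)
  rw [Function.update_eq_self] at hy
  rw [← mulL_tmul, lower_mulL, mulL_lower_ιMulti, mulR_tmul, ← hy, map_sub, map_sum]
  congr 1
  refine Finset.sum_congr rfl fun i _ => ?_
  rw [← h]
  rfl

theorem exists_lower_of_mem_exchangeRel {d e : ℕ} {t : Ext (d + (e + 1)) W ⊗[ℂ] Ext (e + 1) W}
    (ht : t ∈ exchangeRel W d (e + 1)) :
    ∃ z ∈ bideg W (d + (e + 1) + 1) e, toTwo W _ _ t = lower z := by
  have ht' : t ∈ Submodule.span ℂ _ := ht
  clear ht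
  induction ht' using Submodule.span_induction with
  | mem t ht =>
    obtain ⟨x, y, j, rfl⟩ := ht
    obtain ⟨c, hc, h⟩ := toTwo_exchange x y j
    exact ⟨_, tmul_mem_bideg (gen_mul_mem _ (ιMulti_mem x)) hc, h⟩
  | zero => exact ⟨0, zero_mem _, by simp⟩
  | add s t _ _ hs ht =>
    obtain ⟨s', hs', es⟩ := hs
    obtain ⟨t', ht', et⟩ := ht
    exact ⟨s' + t', add_mem hs' ht', by rw [map_add, map_add, es, et]⟩
  | smul c t _ ht =>
    obtain ⟨t', ht', et⟩ := ht
    exact ⟨c • t', Submodule.smul_mem _ _ ht', by rw [map_smul, map_smul, et]⟩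

/-- Together with `exists_lower_of_mem_exchangeRel` this makes the exchange relations equal to the
image of the lowering operator: the first vector of the longer column plays the role of y_j. -/
theorem exists_mem_exchangeRel_of_lower {d e : ℕ} {z : EA W ⊗[ℂ] EA W}
    (hz : z ∈ bideg W (d + (e + 1) + 1) e) :
    ∃ t ∈ exchangeRel W d (e + 1), toTwo W _ _ t = lower z := by
  refine bideg_span_induction ⟨0, zero_mem _, by simp⟩ (fun x y => ?_) (fun c t ht => ?_)
    (fun s t hs ht => ?_) hz
  · refine ⟨_, Submodule.subset_span ⟨Matrix.vecTail x, Matrix.vecCons (x 0) y, 0, rfl⟩, ?_⟩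
    have hy : ∀ v, ExteriorAlgebra.ιMulti ℂ (e + 1) (Function.update (Matrix.vecCons (x 0) y) 0 v) =
        gen v * ExteriorAlgebra.ιMulti ℂ e y := fun v => by
      rw [ExteriorAlgebra.ιMulti_succ_apply, Function.update_self]
      congr 2
    have hx : ExteriorAlgebra.ιMulti ℂ (d + (e + 1) + 1) x =
        gen (x 0) * ExteriorAlgebra.ιMulti ℂ (d + (e + 1)) (Matrix.vecTail x) :=
      ExteriorAlgebra.ιMulti_succ_apply ..
    have hy' : ExteriorAlgebra.ιMulti ℂ (e + 1) (Matrix.vecCons (x 0) y) =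
        gen (x 0) * ExteriorAlgebra.ιMulti ℂ e y := by
      rw [← hy (x 0)]
      exact congrArg _ (Function.update_eq_self 0 (Matrix.vecCons (x 0) y)).symm
    rw [hx, ← mulL_tmul, lower_mulL, mulL_lower_ιMulti, mulR_tmul, ← hy', map_sub, map_sum]
    congr 1
    refine Finset.sum_congr rfl fun i _ => ?_
    rw [← hy]
    rfl
  · obtain ⟨t', ht', et⟩ := ht
    exact ⟨c • t', Submodule.smul_mem _ _ ht', by rw [map_smul, map_smul, et]⟩
  · obtain ⟨s', hs', es⟩ := hs
    obtain ⟨t', ht', et⟩ := ht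
    exact ⟨s' + t', add_mem hs' ht', by rw [map_add, map_add, es, et]⟩

variable (W) in
/-- The highest weight vectors in `Λ^p W ⊗ Λ^e W`. -/
def highest (p e : ℕ) : Submodule ℂ (Ext p W ⊗[ℂ] Ext e W) :=
  LinearMap.ker (raise ∘ₗ toTwo W p e)

theorem mem_highest {p e : ℕ} {t : Ext p W ⊗[ℂ] Ext e W} :
    t ∈ highest W p e ↔ raise (toTwo W p e t) = 0 := Iff.rfl

/-- The Schur module is isomorphic to the space of highest weight vectors. -/
theorem highest_mkQ_bijective (d e : ℕ) :
    Function.Bijective ((exchangeRel W d e).mkQ ∘ₗ (highest W (d + e) e).subtype) := by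
  constructor
  · rw [injective_iff_map_eq_zero]
    intro x hx
    have hx' : (x : Ext (d + e) W ⊗[ℂ] Ext e W) ∈ exchangeRel W d e :=
      (Submodule.Quotient.mk_eq_zero _).1 hx
    refine Subtype.ext ?_
    obtain ⟨x, h0⟩ := x
    rw [mem_highest] at h0
    change x = 0
    match e with
    | 0 =>
      refine Submodule.span_induction (p := fun x _ => x = 0) ?_ rfl ?_ ?_ hx'
      · rintro _ ⟨_, _, j, _⟩
        exact j.elim0
      · rintro _ _ _ _ rfl rfl
        exact add_zero 0
      · rintro c _ _ rfl
        exact smul_zero c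
    | e + 1 =>
      -- An element lowered from z and killed by raising is zero, as raising after lowering is
      -- injective in the bidegree of z.
      obtain ⟨z, hz, h⟩ := exists_lower_of_mem_exchangeRel hx'
      rw [h] at h0
      have := raise_lower_injective (by omega) hz h0
      rw [this, map_zero] at h
      exact toTwo_injective _ _ (h.trans (map_zero _).symm)
  · intro x
    obtain ⟨x, rfl⟩ := Submodule.mkQ_surjective _ x
    match e with
    | 0 => exact ⟨⟨x, raise_eq_zero (toTwo_mem x)⟩, rfl⟩
    | e + 1 =>
      -- An injective endomorphism of a finite-dimensional space: it solves raise(lower z) = raise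
      -- x, and subtracting lower z makes x a highest weight vector without changing its class.
      let T : bideg W (d + (e + 1) + 1) e →ₗ[ℂ] bideg W (d + (e + 1) + 1) e :=
        (raise ∘ₗ lower).restrict fun t ht => raise_mem (lower_mem ht)
      have hT : Function.Injective T := by
        rw [injective_iff_map_eq_zero]
        intro t ht
        exact Subtype.ext (raise_lower_injective (by omega) t.2 (congrArg Subtype.val ht))
      have : FiniteDimensional ℂ (bideg W (d + (e + 1) + 1) e) := inferInstance
      obtain ⟨z, hz⟩ := LinearMap.injective_iff_surjective.1 hT
        ⟨raise (toTwo W _ _ x), raise_mem (toTwo_mem x)⟩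
      obtain ⟨t, ht, e1⟩ := exists_mem_exchangeRel_of_lower z.2
      refine ⟨⟨x - t, ?_⟩, ?_⟩
      · rw [mem_highest, map_sub, map_sub, e1, sub_eq_zero]
        exact (congrArg Subtype.val hz).symm
      · refine (Submodule.Quotient.eq _).2 ?_
        rw [Submodule.subtype_apply, sub_sub_cancel_left]
        exact neg_mem ht

variable (W) in
/-- The realisation of the Schur module by highest weight vectors. -/
def schurLift (d e : ℕ) : Schur W d e →ₗ[ℂ] Ext (d + e) W ⊗[ℂ] Ext e W :=
  (highest W (d + e) e).subtype ∘ₗ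
    (LinearEquiv.ofBijective _ (highest_mkQ_bijective d e)).symm.toLinearMap

theorem schurLift_mkQ {d e : ℕ} {t : Ext (d + e) W ⊗[ℂ] Ext e W} (ht : t ∈ highest W (d + e) e) :
    schurLift W d e ((exchangeRel W d e).mkQ t) = t := by
  have : (LinearEquiv.ofBijective _ (highest_mkQ_bijective d e)).symm
      ((exchangeRel W d e).mkQ t) = ⟨t, ht⟩ := by
    rw [LinearEquiv.symm_apply_eq]
    rfl
  exact congrArg Subtype.val this

theorem exists_highest {d e : ℕ} (x : Schur W d e) :
    ∃ t ∈ highest W (d + e) e, x = (exchangeRel W d e).mkQ t := by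
  obtain ⟨t, ht⟩ := (highest_mkQ_bijective d e).2 x
  exact ⟨t, t.2, ht.symm⟩

theorem schurLift_mem {d e : ℕ} (x : Schur W d e) : schurLift W d e x ∈ highest W (d + e) e := by
  obtain ⟨t, ht, rfl⟩ := exists_highest x
  rwa [schurLift_mkQ ht]

theorem schurLift_injective (d e : ℕ) : Function.Injective (schurLift W d e) := by
  rw [injective_iff_map_eq_zero]
  intro x hx
  obtain ⟨t, ht, rfl⟩ := exists_highest x
  rw [schurLift_mkQ ht] at hx
  rw [hx, map_zero]

/-- The operator is defined through a basis but is determined by `raise_tmul_one`, `raise_mulR` and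
linearity, none of which mentions the basis. -/
theorem raise_map (g : W →ₗ[ℂ] W) (t : EA W ⊗[ℂ] EA W) :
    raise (TensorProduct.map (ExteriorAlgebra.map g).toLinearMap
      (ExteriorAlgebra.map g).toLinearMap t) = TensorProduct.map (ExteriorAlgebra.map g).toLinearMap
      (ExteriorAlgebra.map g).toLinearMap (raise t) := by
  have hL : ∀ v t, TensorProduct.map (ExteriorAlgebra.map g).toLinearMap
      (ExteriorAlgebra.map g).toLinearMap (mulL v t) = mulL (g v)
        (TensorProduct.map (ExteriorAlgebra.map g).toLinearMap
          (ExteriorAlgebra.map g).toLinearMap t) := fun v t => by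
    induction t using TensorProduct.induction_on with
    | zero => simp
    | tmul a b => simp
    | add s t hs ht => simp only [map_add, hs, ht]
  have hR : ∀ v t, TensorProduct.map (ExteriorAlgebra.map g).toLinearMap
      (ExteriorAlgebra.map g).toLinearMap (mulR v t) = mulR (g v)
        (TensorProduct.map (ExteriorAlgebra.map g).toLinearMap
          (ExteriorAlgebra.map g).toLinearMap t) := fun v t => by
    induction t using TensorProduct.induction_on with
    | zero => simp
    | tmul a b => simp
    | add s t hs ht => simp only [map_add, hs, ht]
  induction t using TensorProduct.induction_on with
  | zero => simp
  | tmul a b =>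
    induction b using EA.ind with
    | one => simp [raise_tmul_one]
    | smul r b hb => rw [TensorProduct.tmul_smul]; simp only [map_smul, hb]
    | add b c hb hc => rw [TensorProduct.tmul_add]; simp only [map_add, hb, hc]
    | mul v b hb => rw [← mulR_tmul, hR, raise_mulR, hb, raise_mulR, map_sub, hL, hR]
  | add s t hs ht => simp only [map_add, hs, ht]

variable {G : Type*} [Group G]

theorem toTwo_tprod (ρ : Representation ℂ G W) (p e : ℕ) (g : G) (t : Ext p W ⊗[ℂ] Ext e W) :
    toTwo W p e ((extRep ρ p).tprod (extRep ρ e) g t) =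
      TensorProduct.map (ExteriorAlgebra.map (ρ g)).toLinearMap
        (ExteriorAlgebra.map (ρ g)).toLinearMap (toTwo W p e t) := by
  induction t using TensorProduct.induction_on with
  | zero => simp
  | tmul a b =>
    rw [Representation.tprod_apply, TensorProduct.map_tmul]
    change toEA p (extRep ρ p g a) ⊗ₜ toEA e (extRep ρ e g b) = _
    rw [toEA_extRep, toEA_extRep]
    rfl
  | add s t hs ht => simp only [map_add, hs, ht]

theorem schurLift_rep (ρ : Representation ℂ G W) (d e : ℕ) (g : G) (x : Schur W d e) :
    schurLift W d e (schurRep ρ d e g x) =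
      (extRep ρ (d + e)).tprod (extRep ρ e) g (schurLift W d e x) := by
  obtain ⟨t, ht, rfl⟩ := exists_highest x
  rw [schurLift_mkQ ht]
  refine schurLift_mkQ ?_
  rw [mem_highest, toTwo_tprod, raise_map, mem_highest.1 ht, map_zero]

end TwoColumns


/-! ### Generators of the spaces of highest weight vectors. -/

section HighestSpan

variable {W : Type*} [AddCommGroup W] [Module ℂ W]

/-- Multiplication by a vector in both columns. -/
def mulB (v : W) : EA W ⊗[ℂ] EA W →ₗ[ℂ] EA W ⊗[ℂ] EA W := mulL v ∘ₗ mulR v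

theorem mulB_apply (v : W) (t : EA W ⊗[ℂ] EA W) : mulB v t = mulL v (mulR v t) := rfl

theorem mulL_add (v w : W) (t : EA W ⊗[ℂ] EA W) : mulL (v + w) t = mulL v t + mulL w t := by
  induction t using TensorProduct.induction_on with
  | zero => simp
  | tmul a b => simp [add_mul, TensorProduct.add_tmul]
  | add s t hs ht => simp only [map_add, hs, ht]; abel

theorem mulR_add (v w : W) (t : EA W ⊗[ℂ] EA W) : mulR (v + w) t = mulR v t + mulR w t := by
  induction t using TensorProduct.induction_on with
  | zero => simp
  | tmul a b => simp [add_mul, TensorProduct.tmul_add]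
  | add s t hs ht => simp only [map_add, hs, ht]; abel

theorem mulB_polar (v w : W) (t : EA W ⊗[ℂ] EA W) :
    mulB (v + w) t - mulB v t - mulB w t = mulL v (mulR w t) + mulL w (mulR v t) := by
  simp only [mulB_apply, mulL_add, mulR_add, map_add]
  abel

theorem mulL_mulL_self (v : W) (t : EA W ⊗[ℂ] EA W) : mulL v (mulL v t) = 0 := by
  induction t using TensorProduct.induction_on with
  | zero => simp
  | tmul a b => simp
  | add s t hs ht => simp only [map_add, hs, ht, add_zero]

theorem mulR_mulR_self (v : W) (t : EA W ⊗[ℂ] EA W) : mulR v (mulR v t) = 0 := by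
  induction t using TensorProduct.induction_on with
  | zero => simp
  | tmul a b => simp
  | add s t hs ht => simp only [map_add, hs, ht, add_zero]

/-- Multiplication by several vectors in both columns. -/
def mulBs (s : List W) (t : EA W ⊗[ℂ] EA W) : EA W ⊗[ℂ] EA W := s.foldr (fun v t => mulB v t) t

@[simp]
theorem mulBs_cons (v : W) (s : List W) (t : EA W ⊗[ℂ] EA W) :
    mulBs (v :: s) t = mulB v (mulBs s t) := rfl

theorem mulBs_add (s : List W) (t t' : EA W ⊗[ℂ] EA W) :
    mulBs s (t + t') = mulBs s t + mulBs s t' := by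
  induction s with
  | nil => rfl
  | cons v s ih => rw [mulBs_cons, ih, map_add]; rfl

theorem mulBs_smul (s : List W) (c : ℂ) (t : EA W ⊗[ℂ] EA W) :
    mulBs s (c • t) = c • mulBs s t := by
  induction s with
  | nil => rfl
  | cons v s ih => rw [mulBs_cons, ih, map_smul]; rfl

/-- `mulBs` as a linear map. -/
def mulBsHom (s : List W) : EA W ⊗[ℂ] EA W →ₗ[ℂ] EA W ⊗[ℂ] EA W where
  toFun := mulBs s
  map_add' := mulBs_add s
  map_smul' := mulBs_smul s

theorem mulBs_append (s s' : List W) (t : EA W ⊗[ℂ] EA W) :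
    mulBs (s ++ s') t = mulBs s (mulBs s' t) := by
  simp [mulBs]

theorem mulBs_mem (s : List W) {p e : ℕ} {t : EA W ⊗[ℂ] EA W} (ht : t ∈ bideg W p e) :
    mulBs s t ∈ bideg W (p + s.length) (e + s.length) := by
  induction s with
  | nil => exact ht
  | cons v s ih =>
    refine bideg_induction (by simp) (fun a ha b hb => ?_)
      (fun s t hs ht => by rw [map_add]; exact add_mem hs ht) ih (P := fun t => mulB v t ∈ _)
    exact tmul_mem_bideg (gen_mul_mem _ ha) (gen_mul_mem _ hb)

variable [FiniteDimensional ℂ W]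

/-- The term in which v is moved has v twice in one column and vanishes; the same happens for
raising. -/
theorem lower_mulB (v : W) (t : EA W ⊗[ℂ] EA W) : lower (mulB v t) = mulB v (lower t) := by
  rw [mulB_apply, lower_mulL, mulR_mulR_self, lower_mulR, map_neg, sub_neg_eq_add, zero_add]
  rfl

theorem raise_mulB (v : W) (t : EA W ⊗[ℂ] EA W) : raise (mulB v t) = mulB v (raise t) := by
  rw [mulB_apply, raise_mulL, raise_mulR, map_sub, mulL_mulL_self, zero_sub, neg_neg]
  rfl

theorem lower_mulBs (s : List W) (t : EA W ⊗[ℂ] EA W) : lower (mulBs s t) = mulBs s (lower t) := by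
  induction s with
  | nil => rfl
  | cons v s ih => rw [mulBs_cons, lower_mulB, ih]; rfl

theorem raise_mulBs (s : List W) (t : EA W ⊗[ℂ] EA W) : raise (mulBs s t) = mulBs s (raise t) := by
  induction s with
  | nil => rfl
  | cons v s ih => rw [mulBs_cons, raise_mulB, ih]; rfl

variable (W) in
/-- The span of the products `(s ∧ a) ⊗ s`. -/
def repeated (d e : ℕ) : Submodule ℂ (EA W ⊗[ℂ] EA W) :=
  Submodule.span ℂ {t | ∃ (s : List W) (a : EA W), s.length = e ∧ a ∈ ⋀[ℂ]^d W ∧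
    t = mulBs s (a ⊗ₜ 1)}

theorem raise_repeated {d e : ℕ} {t : EA W ⊗[ℂ] EA W} (ht : t ∈ repeated W d e) :
    raise t = 0 := by
  induction ht using Submodule.span_induction with
  | mem t ht =>
    obtain ⟨s, a, -, -, rfl⟩ := ht
    rw [raise_mulBs, raise_tmul_one]
    exact (mulBsHom s).map_zero
  | zero => rw [map_zero]
  | add s t _ _ hs ht => rw [map_add, hs, ht, add_zero]
  | smul c t _ ht => rw [map_smul, ht, smul_zero]

/-- The induction is on the number r of second-column vectors not yet repeated in the first. Modulo
the image of lowering and the products with one more repetition, a nonzero multiple of the product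
vanishes. -/
theorem mulBs_mem_repeated_sup {d e : ℕ} (r : ℕ) (s : List W) (hs : s.length + r = e + 1)
    {a c : EA W} (ha : a ∈ ⋀[ℂ]^(d + r) W) (hc : c ∈ ⋀[ℂ]^r W) :
    mulBs s (a ⊗ₜ c) ∈ repeated W d (e + 1) ⊔ (bideg W (d + e + 2) e).map lower := by
  induction r generalizing s a c with
  | zero =>
    obtain ⟨z, rfl⟩ := mem_zero_iff.1 hc
    rw [TensorProduct.tmul_smul, mulBs_smul]
    exact Submodule.smul_mem _ _
      (Submodule.mem_sup_left (Submodule.subset_span ⟨s, a, hs, ha, rfl⟩))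
  | succ r ih =>
    refine pow_succ_induction (P := fun c => mulBs s (a ⊗ₜ c) ∈ repeated W d (e + 1) ⊔
      (bideg W (d + e + 2) e).map lower) (fun c c' h h' => ?_) (fun w c hc => ?_) c hc
    · rw [TensorProduct.tmul_add, mulBs_add]
      exact add_mem h h'
    · have hpol : ∀ v x, x ∈ ⋀[ℂ]^(d + r) W →
          mulBs s (mulL w (mulR v (x ⊗ₜ c))) + mulBs s (mulL v (mulR w (x ⊗ₜ c))) ∈
            repeated W d (e + 1) ⊔ (bideg W (d + e + 2) e).map lower := by
        intro v x hx
        have h : ∀ u, mulBs s (mulB u (x ⊗ₜ c)) ∈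
            repeated W d (e + 1) ⊔ (bideg W (d + e + 2) e).map lower := fun u => by
          have := ih (s ++ [u]) (by simp; omega) hx hc
          rwa [mulBs_append] at this
        have h1 := sub_mem (sub_mem (h (w + v)) (h w)) (h v)
        have e1 : mulBs s (mulB (w + v) (x ⊗ₜ c)) - mulBs s (mulB w (x ⊗ₜ c)) -
            mulBs s (mulB v (x ⊗ₜ c)) =
            mulBs s (mulB (w + v) (x ⊗ₜ c) - mulB w (x ⊗ₜ c) - mulB v (x ⊗ₜ c)) := by
          change mulBsHom s _ - mulBsHom s _ - mulBsHom s _ = mulBsHom s _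
          rw [map_sub, map_sub]
        rwa [e1, mulB_polar, mulBs_add] at h1
      -- Expanded, this is s·(a ⊗ wc) minus s·w·lower(a ⊗ c).
      have h1 : lower (mulBs s ((gen w * a) ⊗ₜ c)) ∈
          repeated W d (e + 1) ⊔ (bideg W (d + e + 2) e).map lower := by
        refine Submodule.mem_sup_right (Submodule.mem_map_of_mem ?_)
        have := mulBs_mem s (tmul_mem_bideg (gen_mul_mem w ha) hc)
        have e1 : d + (r + 1) + 1 + s.length = d + e + 2 := by omega
        have e2 : r + s.length = e := by omega
        rwa [e1, e2] at this
      -- The exchange relation applied to each term of lower(a ⊗ c) puts the basis vector back into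
      -- a; by Euler's formula ∑ e_i ∧ (e^i ⌟ a) is deg a = d + r + 1 times a.
      have h2 : mulBs s (mulL w (lower (a ⊗ₜ c))) + ((d + r + 1 : ℕ) : ℂ) • mulBs s (a ⊗ₜ (gen w * c)) ∈
          repeated W d (e + 1) ⊔ (bideg W (d + e + 2) e).map lower := by
        have e1 : mulBs s (mulL w (lower (a ⊗ₜ c))) =
            ∑ i, mulBs s (mulL w (mulR (Module.finBasis ℂ W i)
              (con ((Module.finBasis ℂ W).coord i) a ⊗ₜ c))) := by
          change mulBsHom s _ = ∑ i, mulBsHom s _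
          rw [lower_tmul, map_sum, map_sum]
          rfl
        have e2 : ((d + r + 1 : ℕ) : ℂ) • mulBs s (a ⊗ₜ (gen w * c)) =
            ∑ i, mulBs s (mulL (Module.finBasis ℂ W i) (mulR w
              (con ((Module.finBasis ℂ W).coord i) a ⊗ₜ c))) := by
          change _ = ∑ i, mulBsHom s _
          rw [← map_sum]
          change _ = mulBs s _
          rw [← mulBs_smul]
          congr 1
          simp only [mulR_tmul, mulL_tmul]
          rw [← TensorProduct.sum_tmul, sum_gen_mul_con Finset.univ _ _ LinearMap.id
            (fun v => ((Module.finBasis ℂ W).sum_repr v).symm), der_id_of_mem ha,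
            TensorProduct.smul_tmul']
          rfl
        rw [e1, e2, ← Finset.sum_add_distrib]
        exact sum_mem fun i _ => hpol _ _ (con_mem _ ha)
      rw [lower_mulBs, ← mulL_tmul, lower_mulL, mulR_tmul] at h1
      have h3 := add_mem h1 h2
      have e3 : mulBs s (a ⊗ₜ (gen w * c) - mulL w (lower (a ⊗ₜ c))) +
          (mulBs s (mulL w (lower (a ⊗ₜ c))) + ((d + r + 1 : ℕ) : ℂ) • mulBs s (a ⊗ₜ (gen w * c))) =
          ((d + r + 2 : ℕ) : ℂ) • mulBs s (a ⊗ₜ (gen w * c)) := by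
        change mulBsHom s _ + (mulBsHom s _ + _ • mulBsHom s _) = _ • mulBsHom s _
        rw [map_sub]
        push_cast
        module
      rw [e3] at h3
      exact (Submodule.smul_mem_iff _ (Nat.cast_ne_zero.2 (by omega))).1 h3

/-- Highest weight vectors are combinations of the products `(s ∧ a) ⊗ s`. -/
theorem mem_repeated {d e : ℕ} {t : EA W ⊗[ℂ] EA W} (ht : t ∈ bideg W (d + e) e)
    (h0 : raise t = 0) : t ∈ repeated W d e := by
  cases e with
  | zero =>
    refine bideg_induction (zero_mem _) (fun a ha b hb => ?_) (fun s t hs ht => add_mem hs ht) ht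
    obtain ⟨z, rfl⟩ := mem_zero_iff.1 hb
    rw [TensorProduct.tmul_smul]
    exact Submodule.smul_mem _ _ (Submodule.subset_span ⟨[], a, rfl, ha, rfl⟩)
  | succ e =>
    have h : t ∈ repeated W d (e + 1) ⊔ (bideg W (d + e + 2) e).map lower := by
      refine bideg_induction (zero_mem _) (fun a ha b hb => ?_) (fun s t hs ht => add_mem hs ht) ht
      exact mulBs_mem_repeated_sup (e + 1) [] (by simp) ha hb
    -- Raising kills t and the repeated products, hence also the lowered part, which must then
    -- vanish.
    obtain ⟨s, hs, _, ⟨z, hz, rfl⟩, rfl⟩ := Submodule.mem_sup.1 h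
    rw [map_add, raise_repeated hs, zero_add] at h0
    rw [raise_lower_injective (by omega) hz h0, map_zero, add_zero]
    exact hs

end HighestSpan


/-! ## The graded model of the normal spaces -/

section General

variable {W W' : Type*} [AddCommGroup W] [Module ℂ W] [AddCommGroup W'] [Module ℂ W']

theorem involute_of_mem {n : ℕ} {a : EA W} (ha : a ∈ ⋀[ℂ]^n W) :
    CliffordAlgebra.involute (Q := (0 : QuadraticForm ℂ W)) a = (-1 : ℂ) ^ n • a := by
  induction n generalizing a with
  | zero =>
    obtain ⟨c, rfl⟩ := mem_zero_iff.1 ha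
    simp
  | succ n ih =>
    refine pow_succ_induction (P := fun a => CliffordAlgebra.involute
      (Q := (0 : QuadraticForm ℂ W)) a = (-1 : ℂ) ^ (n + 1) • a)
      (fun a b h1 h2 => by rw [map_add, h1, h2, smul_add]) (fun v a ha => ?_) a ha
    rw [map_mul, CliffordAlgebra.involute_ι, ih ha, mul_smul_comm, pow_succ, mul_smul]
    simp

theorem map_involute (g : W →ₗ[ℂ] W') (a : EA W) :
    ExteriorAlgebra.map g (CliffordAlgebra.involute (Q := (0 : QuadraticForm ℂ W)) a) =
      CliffordAlgebra.involute (Q := (0 : QuadraticForm ℂ W')) (ExteriorAlgebra.map g a) := by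
  induction a using EA.ind with
  | one => simp
  | smul r a ha => simp [ha]
  | add a b ha hb => simp [ha, hb]
  | mul w a ha => simp [ha]

theorem con_mul (α : Module.Dual ℂ W) (a b : EA W) : con α (a * b) =
    con α a * b + CliffordAlgebra.involute (Q := (0 : QuadraticForm ℂ W)) a * con α b := by
  induction a using EA.ind with
  | one => simp
  | smul r a ha => simp [ha]
  | add a b ha hb => simp only [add_mul, map_add, ha, hb]; abel
  | mul w a ha =>
    rw [mul_assoc, con_gen_mul, con_gen_mul, ha, map_mul, CliffordAlgebra.involute_ι]
    simp only [sub_mul, smul_mul_assoc, mul_add, mul_assoc, neg_mul]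
    abel

theorem gen_mul_involute (v : W) (a : EA W) :
    gen v * CliffordAlgebra.involute (Q := (0 : QuadraticForm ℂ W)) a = a * gen v := by
  rw [gen_mul_eq_involute_mul, CliffordAlgebra.involute_involute]

/-- An inclusion of kernels is turned into a factorisation because a factorisation survives
tensoring with another space. -/
theorem exists_comp_eq_of_ker_le {M N P : Type*} [AddCommGroup M] [Module ℂ M] [AddCommGroup N]
    [Module ℂ N] [AddCommGroup P] [Module ℂ P] (f : M →ₗ[ℂ] N) (g : M →ₗ[ℂ] P)
    (h : LinearMap.ker f ≤ LinearMap.ker g) : ∃ k : N →ₗ[ℂ] P, g = k ∘ₗ f := by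
  obtain ⟨k, hk⟩ := LinearMap.exists_extend
    ((LinearMap.ker f).liftQ g h ∘ₗ f.quotKerEquivRange.symm.toLinearMap)
  refine ⟨k, LinearMap.ext fun x => ?_⟩
  have := LinearMap.congr_fun hk ⟨f x, LinearMap.mem_range_self f x⟩
  rw [LinearMap.comp_apply, Submodule.subtype_apply] at this
  rw [LinearMap.comp_apply, this, LinearMap.comp_apply]
  have e : f.quotKerEquivRange.symm ⟨f x, LinearMap.mem_range_self f x⟩ =
      (LinearMap.ker f).mkQ x := by
    rw [LinearEquiv.symm_apply_eq]
    rfl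
  rw [LinearEquiv.coe_coe, e]
  rfl

variable [FiniteDimensional ℂ W] [FiniteDimensional ℂ W']

variable (W) in
theorem sum_proj {n : ℕ} (hn : Module.finrank ℂ W < n) : ∑ i ∈ Finset.range n, proj i = (LinearMap.id : EA W →ₗ[ℂ] EA W) := by
  refine LinearMap.ext fun a => eq_of_proj fun m => ?_
  rw [LinearMap.sum_apply, map_sum, LinearMap.id_apply]
  by_cases hm : m < n
  · rw [Finset.sum_eq_single_of_mem m (Finset.mem_range.2 hm)
      (fun j _ hj => proj_of_mem_ne (proj_mem j a) hj), proj_of_mem (proj_mem m a)]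
  · have h0 : proj m a = 0 := by
      have := proj_mem m a
      rwa [pow_eq_bot (by omega), Submodule.mem_bot] at this
    rw [h0]
    refine Finset.sum_eq_zero fun j hj => proj_of_mem_ne (proj_mem j a) ?_
    rintro rfl
    exact hm (Finset.mem_range.1 hj)

theorem der_map_eq_zero (g : W →ₗ[ℂ] W') (T : W' →ₗ[ℂ] W') (h : ∀ v, T (g v) = 0) (a : EA W) :
    der T (ExteriorAlgebra.map g a) = 0 := by
  induction a using EA.ind with
  | one => simp
  | smul r a ha => simp only [map_smul, ha, smul_zero]
  | add a b ha hb => simp only [map_add, ha, hb, add_zero]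
  | mul v a ha => simp [ha, h]

theorem der_map_eq_self (g : W →ₗ[ℂ] W') (T : W' →ₗ[ℂ] W') (h : ∀ v, T (g v) = g v) (a : EA W) :
    der T (ExteriorAlgebra.map g a) = ExteriorAlgebra.map g (der LinearMap.id a) :=
  (map_der g LinearMap.id T (fun v => (h v).symm) a).symm

/-- Compatibility of the raising operator with the product. -/
theorem der_mulProd_raise (a b : EA W) :
    der (LinearMap.inl ℂ W W ∘ₗ LinearMap.snd ℂ W W) (mulProd W W (a ⊗ₜ b)) =
      mulProd W W (raise (CliffordAlgebra.involute (Q := (0 : QuadraticForm ℂ W)) a ⊗ₜ b)) := by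
  rw [mulProd_tmul, der_mul, der_map_eq_zero _ _ (by simp), zero_mul, zero_add, raise_tmul, map_sum,
    ← sum_gen_mul_con Finset.univ (fun i => ((Module.finBasis ℂ W i, 0) : W × W))
      (fun i => (Module.finBasis ℂ W).coord i ∘ₗ LinearMap.snd ℂ W W), Finset.mul_sum]
  · refine Finset.sum_congr rfl fun i _ => ?_
    rw [map_con, mulProd_tmul, map_mul, map_involute, ExteriorAlgebra.map_apply_ι,
      gen_mul_involute, mul_assoc]
    rfl
  · rintro ⟨v, w⟩
    have : w = ∑ i, (Module.finBasis ℂ W).coord i w • Module.finBasis ℂ W i :=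
      ((Module.finBasis ℂ W).sum_repr w).symm
    refine Prod.ext ?_ ?_
    · simp only [Prod.fst_sum, Prod.smul_fst]
      exact this
    · simp [Prod.snd_sum]

end General

section Model

variable (U D : Type*) [AddCommGroup U] [Module ℂ U] [AddCommGroup D] [Module ℂ D]

/-- The space whose exterior algebra contains the models of all normal spaces. -/
abbrev QSp : Type _ := U × (D × D)

/-- The inclusion of `U`. -/
abbrev inU : U →ₗ[ℂ] QSp U D := LinearMap.inl ℂ U (D × D)

/-- The inclusion of the first copy of `D`. -/
abbrev in1 : D →ₗ[ℂ] QSp U D := LinearMap.inr ℂ U (D × D) ∘ₗ LinearMap.inl ℂ D D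

/-- The inclusion of the second copy of `D`. -/
abbrev in2 : D →ₗ[ℂ] QSp U D := LinearMap.inr ℂ U (D × D) ∘ₗ LinearMap.inr ℂ D D

/-- The inclusion of `U × D`, with the second copy of `D`. -/
abbrev inM : U × D →ₗ[ℂ] QSp U D := LinearMap.id.prodMap (LinearMap.inr ℂ D D)

/-- The projection to `U`. -/
abbrev prU : QSp U D →ₗ[ℂ] QSp U D := inU U D ∘ₗ LinearMap.fst ℂ U (D × D)

/-- The projection to the first copy of `D`. -/
abbrev pr1 : QSp U D →ₗ[ℂ] QSp U D :=
  in1 U D ∘ₗ LinearMap.fst ℂ D D ∘ₗ LinearMap.snd ℂ U (D × D)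

/-- The map from the second to the first copy of `D`. -/
abbrev shift : QSp U D →ₗ[ℂ] QSp U D :=
  in1 U D ∘ₗ LinearMap.snd ℂ D D ∘ₗ LinearMap.snd ℂ U (D × D)

/-- The multiplication `Λ U ⊗ (Λ D ⊗ Λ D) → Λ (U × (D × D))`. -/
def triMul : EA U ⊗[ℂ] (EA D ⊗[ℂ] EA D) →ₗ[ℂ] EA (QSp U D) :=
  mulProd U (D × D) ∘ₗ LinearMap.lTensor _ (mulProd D D)

variable {U D}

@[simp]
theorem triMul_tmul (x : EA U) (a b : EA D) : triMul U D (x ⊗ₜ (a ⊗ₜ b)) =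
    ExteriorAlgebra.map (inU U D) x * (ExteriorAlgebra.map (in1 U D) a *
      ExteriorAlgebra.map (in2 U D) b) := by
  change mulProd U (D × D) (x ⊗ₜ mulProd D D (a ⊗ₜ b)) = _
  rw [mulProd_tmul, mulProd_tmul, map_mul]
  simp only [in1, in2, ← ExteriorAlgebra.map_comp_map]
  rfl

variable [FiniteDimensional ℂ U] [FiniteDimensional ℂ D]

theorem triMul_bijective : Function.Bijective (triMul U D) := by
  refine ⟨?_, ?_⟩
  · exact mulProd_injective.comp (Module.Flat.lTensor_preserves_injective_linearMap _
      mulProd_injective)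
  · exact mulProd_surjective.comp (LinearMap.lTensor_surjective _ mulProd_surjective)

/-- The sign of the first column. -/
def signL : EA D ⊗[ℂ] EA D →ₗ[ℂ] EA D ⊗[ℂ] EA D :=
  LinearMap.rTensor _ (CliffordAlgebra.involute (Q := (0 : QuadraticForm ℂ D))).toLinearMap

theorem signL_of_mem {p e : ℕ} {t : EA D ⊗[ℂ] EA D} (ht : t ∈ bideg D p e) :
    signL t = (-1 : ℂ) ^ p • t := by
  refine bideg_induction (by simp) (fun a ha b hb => ?_)
    (fun s t hs ht => by rw [map_add, hs, ht, smul_add]) ht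
  change CliffordAlgebra.involute a ⊗ₜ b = _
  rw [involute_of_mem ha, TensorProduct.smul_tmul']

/-- Moving a vector from the second copy of D to the first is the raising operator; passing the
first column costs its parity. -/
theorem der_shift_triMul (t : EA U ⊗[ℂ] (EA D ⊗[ℂ] EA D)) :
    der (shift U D) (triMul U D t) =
      triMul U D (LinearMap.lTensor _ (raise ∘ₗ signL) t) := by
  induction t using TensorProduct.induction_on with
  | zero => simp
  | tmul x t =>
    induction t using TensorProduct.induction_on with
    | zero => simp
    | tmul a b =>
      rw [LinearMap.lTensor_tmul]
      change der _ (mulProd U (D × D) (x ⊗ₜ mulProd D D (a ⊗ₜ b))) = mulProd U (D × D)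
        (x ⊗ₜ mulProd D D (raise (CliffordAlgebra.involute (Q := (0 : QuadraticForm ℂ D)) a ⊗ₜ b)))
      rw [← der_mulProd_raise, mulProd_tmul x, mulProd_tmul x, der_mul, der_map_eq_zero _ _ (by simp),
        zero_mul, zero_add, map_der _ _ (shift U D)]
      exact fun v => rfl
    | add s t hs ht =>
      rw [TensorProduct.tmul_add]
      simp only [map_add, hs, ht]
  | add s t hs ht => simp only [map_add, hs, ht]

theorem der_prU_triMul (t : EA U ⊗[ℂ] (EA D ⊗[ℂ] EA D)) :
    der (prU U D) (triMul U D t) =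
      triMul U D (LinearMap.rTensor _ (der LinearMap.id) t) := by
  induction t using TensorProduct.induction_on with
  | zero => simp
  | tmul x t =>
    induction t using TensorProduct.induction_on with
    | zero => simp
    | tmul a b =>
      rw [LinearMap.rTensor_tmul, triMul_tmul, triMul_tmul, der_mul, der_mul,
        der_map_eq_self _ _ (by simp), der_map_eq_zero (in1 U D) _ (by simp),
        der_map_eq_zero (in2 U D) _ (by simp), zero_mul, mul_zero, add_zero, mul_zero, add_zero]
    | add s t hs ht =>
      rw [TensorProduct.tmul_add]
      simp only [map_add, hs, ht]
  | add s t hs ht => simp only [map_add, hs, ht]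

theorem der_pr1_triMul (t : EA U ⊗[ℂ] (EA D ⊗[ℂ] EA D)) :
    der (pr1 U D) (triMul U D t) =
      triMul U D (LinearMap.lTensor _ (LinearMap.rTensor _ (der LinearMap.id)) t) := by
  induction t using TensorProduct.induction_on with
  | zero => simp
  | tmul x t =>
    induction t using TensorProduct.induction_on with
    | zero => simp
    | tmul a b =>
      rw [LinearMap.lTensor_tmul, LinearMap.rTensor_tmul, triMul_tmul, triMul_tmul, der_mul, der_mul,
        der_map_eq_self (in1 U D) _ (by simp), der_map_eq_zero (inU U D) _ (by simp),
        der_map_eq_zero (in2 U D) _ (by simp), zero_mul, mul_zero, add_zero, zero_add]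
    | add s t hs ht =>
      rw [TensorProduct.tmul_add]
      simp only [map_add, hs, ht]
  | add s t hs ht => simp only [map_add, hs, ht]

/-- The projection to a tridegree. -/
def triProj (d p e : ℕ) : EA U ⊗[ℂ] (EA D ⊗[ℂ] EA D) →ₗ[ℂ] EA U ⊗[ℂ] (EA D ⊗[ℂ] EA D) :=
  TensorProduct.map (proj d) (TensorProduct.map (proj p) (proj e))

@[simp]
theorem triProj_tmul (d p e : ℕ) (x : EA U) (a b : EA D) :
    triProj d p e (x ⊗ₜ (a ⊗ₜ b)) = proj d x ⊗ₜ (proj p a ⊗ₜ proj e b) := rfl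

@[elab_as_elim]
theorem tri_induction {P : EA U ⊗[ℂ] (EA D ⊗[ℂ] EA D) → Prop} (zero : P 0)
    (tmul : ∀ x a b, P (x ⊗ₜ (a ⊗ₜ b))) (add : ∀ s t, P s → P t → P (s + t)) (t) : P t := by
  induction t using TensorProduct.induction_on with
  | zero => exact zero
  | tmul x t =>
    induction t using TensorProduct.induction_on with
    | zero => rwa [TensorProduct.tmul_zero]
    | tmul a b => exact tmul x a b
    | add s t hs ht => rw [TensorProduct.tmul_add]; exact add _ _ hs ht
  | add s t hs ht => exact add _ _ hs ht

theorem sum_triProj {n : ℕ} (hU : Module.finrank ℂ U < n) (hD : Module.finrank ℂ D < n)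
    (t : EA U ⊗[ℂ] (EA D ⊗[ℂ] EA D)) :
    t = ∑ d ∈ Finset.range n, ∑ p ∈ Finset.range n, ∑ e ∈ Finset.range n, triProj d p e t := by
  induction t using tri_induction with
  | zero => simp
  | tmul x a b =>
    simp only [triProj_tmul]
    have h : ∀ a : EA D, ∑ i ∈ Finset.range n, proj i a = a := fun a => by
      rw [← LinearMap.sum_apply, sum_proj D hD, LinearMap.id_apply]
    have hx : ∑ i ∈ Finset.range n, proj i x = x := by
      rw [← LinearMap.sum_apply, sum_proj U hU, LinearMap.id_apply]
    conv_lhs => rw [← hx, ← h a, ← h b]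
    rw [TensorProduct.sum_tmul]
    refine Finset.sum_congr rfl fun d _ => ?_
    rw [TensorProduct.sum_tmul, TensorProduct.tmul_sum]
    refine Finset.sum_congr rfl fun p _ => ?_
    rw [TensorProduct.tmul_sum, TensorProduct.tmul_sum]
  | add s t hs ht =>
    simp only [map_add, Finset.sum_add_distrib]
    rw [← hs, ← ht]

theorem triProj_pr1 (d p e : ℕ) (t : EA U ⊗[ℂ] (EA D ⊗[ℂ] EA D)) :
    triProj d p e (LinearMap.lTensor _ (LinearMap.rTensor _ (der LinearMap.id)) t) =
      (p : ℂ) • triProj d p e t := by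
  induction t using tri_induction with
  | zero => simp
  | tmul x a b =>
    rw [LinearMap.lTensor_tmul, LinearMap.rTensor_tmul, triProj_tmul, triProj_tmul, ← der_proj,
      der_id_of_mem (proj_mem _ _), ← TensorProduct.smul_tmul', TensorProduct.tmul_smul]
  | add s t hs ht => simp only [map_add, hs, ht, smul_add]

/-- The derivation extending the identity counts generators, and it is the sum of the three counting
operators on the tensor factors. -/
theorem degree_eq_of_triProj_ne_zero (d p e : ℕ) (t : EA U ⊗[ℂ] (EA D ⊗[ℂ] EA D)) (n : ℕ)
    (ht : triMul U D t ∈ ⋀[ℂ]^n (QSp U D)) (h : triProj d p e t ≠ 0) : d + (p + e) = n := by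
  by_contra hn
  have key : ∀ t : EA U ⊗[ℂ] (EA D ⊗[ℂ] EA D), der LinearMap.id (triMul U D t) =
      triMul U D (LinearMap.rTensor _ (der LinearMap.id) t +
        LinearMap.lTensor _ (LinearMap.rTensor _ (der LinearMap.id)) t +
        LinearMap.lTensor _ (LinearMap.lTensor _ (der LinearMap.id)) t) := by
    intro t
    induction t using tri_induction with
    | zero => simp
    | tmul x a b =>
      simp only [map_add, LinearMap.lTensor_tmul, LinearMap.rTensor_tmul, triMul_tmul, der_mul,
        mul_add]
      rw [map_der (inU U D) LinearMap.id LinearMap.id fun _ => rfl,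
        map_der (in1 U D) LinearMap.id LinearMap.id fun _ => rfl,
        map_der (in2 U D) LinearMap.id LinearMap.id fun _ => rfl, add_assoc]
    | add s t hs ht => simp only [map_add, hs, ht]; abel
  have h1 := key t
  rw [der_id_of_mem ht, ← map_smul] at h1
  have h2 := congrArg (triProj d p e) (triMul_bijective.1 h1)
  have h3 : ∀ t : EA U ⊗[ℂ] (EA D ⊗[ℂ] EA D),
      triProj d p e (LinearMap.rTensor _ (der LinearMap.id) t) = (d : ℂ) • triProj d p e t := by
    intro t
    induction t using tri_induction with
    | zero => simp
    | tmul x a b =>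
      rw [LinearMap.rTensor_tmul, triProj_tmul, triProj_tmul, ← der_proj,
        der_id_of_mem (proj_mem _ _), ← TensorProduct.smul_tmul']
    | add s t hs ht => simp only [map_add, hs, ht, smul_add]
  have h4 : ∀ t : EA U ⊗[ℂ] (EA D ⊗[ℂ] EA D),
      triProj d p e (LinearMap.lTensor _ (LinearMap.lTensor _ (der LinearMap.id)) t) =
        (e : ℂ) • triProj d p e t := by
    intro t
    induction t using tri_induction with
    | zero => simp
    | tmul x a b =>
      rw [LinearMap.lTensor_tmul, LinearMap.lTensor_tmul, triProj_tmul, triProj_tmul, ← der_proj,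
        der_id_of_mem (proj_mem _ _), TensorProduct.tmul_smul, TensorProduct.tmul_smul]
    | add s t hs ht => simp only [map_add, hs, ht, smul_add]
  rw [map_smul, map_add, map_add, h3, triProj_pr1, h4, ← add_smul, ← add_smul] at h2
  have := smul_left_injective ℂ h h2
  refine hn ?_
  have h5 : ((d + (p + e) : ℕ) : ℂ) = n := by rw [this]; push_cast; ring
  exact_mod_cast h5

end Model


/-! ### The model as a sum of products of exterior powers and Schur modules. -/

section Model

variable {U D : Type*} [AddCommGroup U] [Module ℂ U] [AddCommGroup D] [Module ℂ D]
  [FiniteDimensional ℂ U] [FiniteDimensional ℂ D]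

variable (U D) in
/-- The model of the `p`-th normal space. -/
def symbols (p : ℕ) : Submodule ℂ (EA (QSp U D)) :=
  (⋀[ℂ]^(2 * p) (QSp U D)) ⊓ LinearMap.ker (der (pr1 U D) - (p : ℂ) • LinearMap.id) ⊓
    LinearMap.ker (der (shift U D))

theorem mem_symbols {p : ℕ} {t : EA (QSp U D)} : t ∈ symbols U D p ↔
    t ∈ ⋀[ℂ]^(2 * p) (QSp U D) ∧ der (pr1 U D) t = (p : ℂ) • t ∧ der (shift U D) t = 0 := by
  simp [symbols, sub_eq_zero, and_assoc]

/-- Counting the first copy of D fixes the middle degree to p; as the total degree is 2p, the other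
two add up to p. -/
theorem triProj_decomp {p : ℕ} {t : EA U ⊗[ℂ] (EA D ⊗[ℂ] EA D)}
    (h1 : triMul U D t ∈ ⋀[ℂ]^(2 * p) (QSp U D))
    (h2 : der (pr1 U D) (triMul U D t) = (p : ℂ) • triMul U D t) :
    t = ∑ q ∈ Finset.HasAntidiagonal.antidiagonal p, triProj q.1 (q.1 + q.2) q.2 t := by
  have hpr : ∀ d p' e, triProj d p' e t ≠ 0 → p' = p := by
    intro d p' e h
    rw [der_pr1_triMul, ← map_smul] at h2
    have h3 := congrArg (triProj d p' e) (triMul_bijective.1 h2)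
    rw [triProj_pr1, map_smul] at h3
    exact_mod_cast smul_left_injective ℂ h h3
  let N := Module.finrank ℂ U + Module.finrank ℂ D + p + 1
  conv_lhs => rw [sum_triProj (n := N) (by omega) (by omega) t]
  have e1 : ∀ d, ∑ p' ∈ Finset.range N, ∑ e ∈ Finset.range N, triProj d p' e t =
      ∑ e ∈ Finset.range N, triProj d p e t := fun d => by
    refine Finset.sum_eq_single_of_mem p (Finset.mem_range.2 (by omega)) fun p' _ hp' => ?_
    refine Finset.sum_eq_zero fun e _ => ?_
    by_contra h
    exact hp' (hpr d p' e h)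
  simp_rw [e1]
  rw [← Finset.sum_product']
  have hsub : Finset.HasAntidiagonal.antidiagonal p ⊆ Finset.range N ×ˢ Finset.range N := fun q hq => by
    have := Finset.HasAntidiagonal.mem_antidiagonal.1 hq
    exact Finset.mem_product.2 ⟨Finset.mem_range.2 (by omega), Finset.mem_range.2 (by omega)⟩
  rw [← Finset.sum_subset hsub]
  · refine Finset.sum_congr rfl fun q hq => ?_
    rw [Finset.HasAntidiagonal.mem_antidiagonal.1 hq]
  · intro q _ hq
    by_contra h
    have := degree_eq_of_triProj_ne_zero q.1 p q.2 t (2 * p) h1 h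
    exact hq (Finset.HasAntidiagonal.mem_antidiagonal.2 (by omega))

theorem triProj_mem_range (d p e : ℕ) (t : EA U ⊗[ℂ] (EA D ⊗[ℂ] EA D)) :
    ∃ s : Ext d U ⊗[ℂ] (Ext p D ⊗[ℂ] Ext e D),
      triProj d p e t = TensorProduct.map (toEA d) (toTwo D p e) s := by
  induction t using tri_induction with
  | zero => exact ⟨0, by simp⟩
  | tmul x a b =>
    exact ⟨ofEA _ (proj_mem d x) ⊗ₜ (ofEA _ (proj_mem p a) ⊗ₜ ofEA _ (proj_mem e b)), rfl⟩
  | add s t hs ht =>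
    obtain ⟨s', hs⟩ := hs
    obtain ⟨t', ht⟩ := ht
    exact ⟨s' + t', by simp only [map_add, hs, ht]⟩

variable (U D) in
/-- The summands of the model of the normal space. -/
def symbolPart (d e : ℕ) : Ext d U ⊗[ℂ] Schur D d e →ₗ[ℂ] EA (QSp U D) :=
  triMul U D ∘ₗ TensorProduct.map (toEA d) (toTwo D (d + e) e ∘ₗ schurLift D d e)

theorem symbolPart_tmul {d e : ℕ} (x : Ext d U) (y : Schur D d e) : symbolPart U D d e (x ⊗ₜ y) =
    triMul U D (toEA d x ⊗ₜ toTwo D (d + e) e (schurLift D d e y)) := rfl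

theorem symbolPart_injective (d e : ℕ) : Function.Injective (symbolPart U D d e) :=
  triMul_bijective.1.comp (TensorProduct.map_injective_of_flat_flat _ _ (toEA_injective d)
    ((toTwo_injective _ _).comp (schurLift_injective _ _)))

theorem symbolPart_mem {d e : ℕ} (x : Ext d U ⊗[ℂ] Schur D d e) :
    symbolPart U D d e x ∈ symbols U D (d + e) := by
  induction x using TensorProduct.induction_on with
  | zero => rw [map_zero]; exact zero_mem _
  | tmul x y =>
    rw [symbolPart_tmul]
    have hx := toEA_mem x
    have hy := toTwo_mem (schurLift D d e y)
    have h0 := mem_highest.1 (schurLift_mem y)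
    generalize toTwo D (d + e) e (schurLift D d e y) = t at hy h0
    generalize toEA d x = a at hx
    refine mem_symbols.2 ⟨?_, ?_, ?_⟩
    · refine bideg_induction (by simp) (fun b hb c hc => ?_) (fun s t hs ht => by
        rw [TensorProduct.tmul_add, map_add]; exact add_mem hs ht) hy
      rw [triMul_tmul, show 2 * (d + e) = d + ((d + e) + e) by ring]
      exact mul_mem_pow (map_mem _ hx) (mul_mem_pow (map_mem _ hb) (map_mem _ hc))
    · rw [der_pr1_triMul, LinearMap.lTensor_tmul, ← map_smul, ← TensorProduct.tmul_smul]
      congr 2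
      refine bideg_induction (by simp) (fun b hb c hc => ?_) (fun s t hs ht => by
        rw [map_add, hs, ht, smul_add]) hy
      rw [LinearMap.rTensor_tmul, der_id_of_mem hb, TensorProduct.smul_tmul']
    · rw [der_shift_triMul, LinearMap.lTensor_tmul, LinearMap.comp_apply, signL_of_mem hy,
        map_smul, h0, smul_zero, TensorProduct.tmul_zero, map_zero]
  | add s t hs ht => rw [map_add]; exact add_mem hs ht

/-- Each tridegree component is killed by raising separately, hence lies in Λ^d U times the highest
weight vectors. -/
theorem mem_iSup_symbolPart {p : ℕ} {t : EA (QSp U D)} (ht : t ∈ symbols U D p) :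
    ∃ f : ∀ q : ℕ × ℕ, Ext q.1 U ⊗[ℂ] Schur D q.1 q.2,
      t = ∑ q ∈ Finset.HasAntidiagonal.antidiagonal p, symbolPart U D q.1 q.2 (f q) := by
  obtain ⟨t, rfl⟩ := triMul_bijective.2 t
  obtain ⟨h1, h2, h3⟩ := mem_symbols.1 ht
  have hdec := triProj_decomp h1 h2
  have hzero : ∀ q ∈ Finset.HasAntidiagonal.antidiagonal p,
      LinearMap.lTensor _ (raise ∘ₗ signL) (triProj q.1 (q.1 + q.2) q.2 t) = 0 := by
    intro q hq
    rw [der_shift_triMul, ← map_zero (triMul U D)] at h3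
    have h4 := triMul_bijective.1 h3
    rw [hdec, map_sum] at h4
    -- Raising does not touch the factor ΛU, so the degree in U separates the components.
    have h5 := congrArg (LinearMap.rTensor _ (proj q.1)) h4
    rw [map_sum, map_zero] at h5
    have key : ∀ d p' e, ∀ s : EA U ⊗[ℂ] (EA D ⊗[ℂ] EA D),
        LinearMap.rTensor _ (proj q.1) (LinearMap.lTensor _ (raise ∘ₗ signL) (triProj d p' e s)) =
          if d = q.1 then LinearMap.lTensor _ (raise ∘ₗ signL) (triProj d p' e s) else 0 := by
      intro d p' e s
      induction s using tri_induction with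
      | zero => simp
      | tmul x a b =>
        rw [triProj_tmul, LinearMap.lTensor_tmul, LinearMap.rTensor_tmul]
        split_ifs with h
        · rw [← h, proj_of_mem (proj_mem d x)]
        · rw [proj_of_mem_ne (proj_mem d x) h, TensorProduct.zero_tmul]
      | add s t hs ht =>
        simp only [map_add, hs, ht]
        split_ifs <;> simp
    simp_rw [key] at h5
    rw [Finset.sum_eq_single_of_mem q hq, if_pos rfl] at h5
    · exact h5
    · intro q' hq' hne
      rw [if_neg]
      intro h
      have e1 := Finset.HasAntidiagonal.mem_antidiagonal.1 hq
      have e2 := Finset.HasAntidiagonal.mem_antidiagonal.1 hq'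
      exact hne (Prod.ext h (by omega))
  have hf : ∀ q : ℕ × ℕ, ∃ f : Ext q.1 U ⊗[ℂ] Schur D q.1 q.2, q ∈ Finset.HasAntidiagonal.antidiagonal p →
      triMul U D (triProj q.1 (q.1 + q.2) q.2 t) = symbolPart U D q.1 q.2 f := by
    intro q
    by_cases hq : q ∈ Finset.HasAntidiagonal.antidiagonal p
    swap
    · exact ⟨0, fun h => absurd h hq⟩
    obtain ⟨s, hs⟩ := triProj_mem_range q.1 (q.1 + q.2) q.2 t
    have h4 := hzero q hq
    rw [hs] at h4
    have h5 : LinearMap.lTensor (Ext q.1 U) (raise ∘ₗ toTwo D (q.1 + q.2) q.2) s = 0 := by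
      have hinj : Function.Injective (LinearMap.rTensor (EA D ⊗[ℂ] EA D) (toEA q.1 (W := U))) :=
        Module.Flat.rTensor_preserves_injective_linearMap _ (toEA_injective _)
      refine hinj ?_
      rw [map_zero]
      have e1 : ∀ s : Ext q.1 U ⊗[ℂ] (Ext (q.1 + q.2) D ⊗[ℂ] Ext q.2 D),
          LinearMap.lTensor _ (raise ∘ₗ signL) (TensorProduct.map (toEA q.1) (toTwo D _ _) s) =
          (-1 : ℂ) ^ (q.1 + q.2) • LinearMap.rTensor (EA D ⊗[ℂ] EA D) (toEA q.1 (W := U))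
            (LinearMap.lTensor (Ext q.1 U) (raise ∘ₗ toTwo D (q.1 + q.2) q.2) s) := by
        intro s
        induction s using TensorProduct.induction_on with
        | zero => simp
        | tmul x y =>
          rw [TensorProduct.map_tmul, LinearMap.lTensor_tmul, LinearMap.lTensor_tmul,
            LinearMap.rTensor_tmul, LinearMap.comp_apply, signL_of_mem (toTwo_mem y), map_smul,
            TensorProduct.tmul_smul]
          rfl
        | add s t hs ht => simp only [map_add, hs, ht, smul_add]
      rw [e1, smul_eq_zero] at h4
      exact h4.resolve_left (pow_ne_zero _ (by norm_num))
    -- Highest weight vectors are fixed by "pass to the Schur module and lift back". The difference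
    -- from the identity thus factors through raising, so after tensoring with Λ^d U it kills s.
    obtain ⟨k, hk⟩ := exists_comp_eq_of_ker_le (raise ∘ₗ toTwo D (q.1 + q.2) q.2)
      (LinearMap.id - schurLift D q.1 q.2 ∘ₗ (exchangeRel D q.1 q.2).mkQ) fun y hy => by
        have : y ∈ highest D (q.1 + q.2) q.2 := hy
        rw [LinearMap.mem_ker, LinearMap.sub_apply, LinearMap.comp_apply, schurLift_mkQ this]
        exact sub_self _
    have h6 : s = LinearMap.lTensor (Ext q.1 U) (schurLift D q.1 q.2)
        (LinearMap.lTensor (Ext q.1 U) (exchangeRel D q.1 q.2).mkQ s) := by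
      rw [← sub_eq_zero, ← LinearMap.lTensor_comp_apply]
      have h7 := congrArg (fun f => LinearMap.lTensor (Ext q.1 U) f s) hk
      simp only [LinearMap.lTensor_sub, LinearMap.lTensor_id, LinearMap.sub_apply,
        LinearMap.id_apply] at h7
      rw [h7, LinearMap.lTensor_comp_apply, h5, map_zero]
    refine ⟨LinearMap.lTensor (Ext q.1 U) (exchangeRel D q.1 q.2).mkQ s, fun _ => ?_⟩
    rw [hs]
    conv_lhs => rw [h6]
    generalize LinearMap.lTensor (Ext q.1 U) (exchangeRel D q.1 q.2).mkQ s = r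
    induction r using TensorProduct.induction_on with
    | zero => simp
    | tmul x y => rfl
    | add s t hs ht => simp only [map_add, hs, ht]
  choose f hf using hf
  refine ⟨f, ?_⟩
  conv_lhs => rw [hdec, map_sum]
  exact Finset.sum_congr rfl fun q hq => hf q hq

variable (U D) in
/-- The sum of the components of the model of the normal space. -/
def symbolSum (p : ℕ) : (⨁ q : {q : ℕ × ℕ // q.1 + q.2 = p}, Ext q.1.1 U ⊗[ℂ] Schur D q.1.1 q.1.2)
    →ₗ[ℂ] EA (QSp U D) :=
  DirectSum.toModule ℂ _ _ fun q => symbolPart U D q.1.1 q.1.2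

/-- The summands are eigenspaces for the number of generators from U, which determines the pair (d,
e) because d + e = p. -/
theorem symbolSum_injective (p : ℕ) : Function.Injective (symbolSum U D p) := by
  refine toModule_injective_of_eigen _ (der (prU U D)) (fun q => (q.1.1 : ℂ)) ?_ ?_
    fun q => symbolPart_injective _ _
  · rintro ⟨⟨d, e⟩, h⟩ ⟨⟨d', e'⟩, h'⟩ hd
    have hd : d = d' := Nat.cast_injective (R := ℂ) hd
    subst hd
    have : e = e' := by dsimp only at h h'; omega
    subst this
    rfl
  · intro q x
    induction x using TensorProduct.induction_on with
    | zero => simp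
    | tmul x y =>
      rw [symbolPart_tmul, der_prU_triMul, LinearMap.rTensor_tmul, der_id_of_mem (toEA_mem x),
        ← TensorProduct.smul_tmul', map_smul]
    | add s t hs ht => simp only [map_add, hs, ht, smul_add]

theorem range_symbolSum (p : ℕ) : LinearMap.range (symbolSum U D p) = symbols U D p := by
  refine le_antisymm ?_ ?_
  · rintro _ ⟨x, rfl⟩
    induction x using DirectSum.induction_on with
    | zero => rw [map_zero]; exact zero_mem _
    | of q x =>
      change symbolSum U D p (DirectSum.lof ℂ _ _ q x) ∈ _
      rw [symbolSum, DirectSum.toModule_lof]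
      have h : symbols U D (q.1.1 + q.1.2) = symbols U D p := congrArg _ q.2
      rw [← h]
      exact symbolPart_mem x
    | add x y hx hy => rw [map_add]; exact add_mem hx hy
  · intro t ht
    obtain ⟨f, rfl⟩ := mem_iSup_symbolPart ht
    have hmem : ∀ (q : {q : ℕ × ℕ // q.1 + q.2 = p}) (x : Ext q.1.1 U ⊗[ℂ] Schur D q.1.1 q.1.2),
        symbolPart U D q.1.1 q.1.2 x ∈ LinearMap.range (symbolSum U D p) := fun q x =>
      ⟨DirectSum.lof ℂ _ (fun q : {q : ℕ × ℕ // q.1 + q.2 = p} =>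
        Ext q.1.1 U ⊗[ℂ] Schur D q.1.1 q.1.2) q x, by rw [symbolSum, DirectSum.toModule_lof]⟩
    exact sum_mem fun q hq => hmem ⟨q, Finset.HasAntidiagonal.mem_antidiagonal.1 hq⟩ (f q)

variable {G : Type*} [Group G]

/-- The action on the exterior algebra that contains the models. -/
def actQ (ρ : Representation ℂ G U) (σ : Representation ℂ G D) (g : G) :
    QSp U D →ₗ[ℂ] QSp U D := (ρ g).prodMap ((σ g).prodMap (σ g))

theorem map_map_comm {W W' : Type*} [AddCommGroup W] [Module ℂ W] [AddCommGroup W'] [Module ℂ W']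
    {i : W →ₗ[ℂ] W'} {f : W →ₗ[ℂ] W} {g : W' →ₗ[ℂ] W'} (h : g ∘ₗ i = i ∘ₗ f) (a : EA W) :
    ExteriorAlgebra.map i (ExteriorAlgebra.map f a) =
      ExteriorAlgebra.map g (ExteriorAlgebra.map i a) := by
  rw [← AlgHom.comp_apply, ← AlgHom.comp_apply, ExteriorAlgebra.map_comp_map,
    ExteriorAlgebra.map_comp_map, h]

theorem symbolPart_rep (ρ : Representation ℂ G U) (σ : Representation ℂ G D) (d e : ℕ) (g : G)
    (x : Ext d U ⊗[ℂ] Schur D d e) :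
    symbolPart U D d e ((extRep ρ d).tprod (schurRep σ d e) g x) =
      ExteriorAlgebra.map (actQ ρ σ g) (symbolPart U D d e x) := by
  induction x using TensorProduct.induction_on with
  | zero => simp
  | tmul x y =>
    rw [Representation.tprod_apply, TensorProduct.map_tmul, symbolPart_tmul, symbolPart_tmul,
      toEA_extRep, schurLift_rep, toTwo_tprod]
    generalize toTwo D (d + e) e (schurLift D d e y) = t
    induction t using TensorProduct.induction_on with
    | zero => simp
    | tmul a b =>
      rw [TensorProduct.map_tmul]
      simp only [AlgHom.coe_toLinearMap, triMul_tmul, map_mul]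
      rw [map_map_comm (g := actQ ρ σ g) (f := ρ g), map_map_comm (g := actQ ρ σ g) (f := σ g),
        map_map_comm (g := actQ ρ σ g) (f := σ g)]
      all_goals exact LinearMap.ext fun v => by simp [actQ]
    | add s t hs ht => rw [TensorProduct.tmul_add]; simp only [map_add, TensorProduct.tmul_add, hs, ht]
  | add s t hs ht => simp only [map_add, hs, ht]

end Model


/-! ## The symbols of tangent vectors -/

section Nilpotent

variable {A : Type*} [Ring A] [Algebra ℂ A]

/-- Powers of sums of commuting elements of square zero. -/
theorem sum_pow_of_sq_zero (l : List A) (hsq : ∀ a ∈ l, a * a = 0)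
    (hcomm : ∀ a ∈ l, ∀ b, a * b = b * a) :
    l.sum ^ l.length = (l.length.factorial : ℂ) • l.prod ∧ l.sum ^ (l.length + 1) = 0 := by
  induction l with
  | nil => simp
  | cons a l ih =>
    obtain ⟨h1, h2⟩ := ih (fun b hb => hsq b (by simp [hb])) (fun b hb => hcomm b (by simp [hb]))
    have hc : ∀ b, a * b = b * a := hcomm a (by simp)
    -- The binomial formula, cut off after the linear term in a because a² = 0.
    have hexp : ∀ n : ℕ, (a + l.sum) ^ (n + 1) =
        l.sum ^ (n + 1) + ((n + 1 : ℕ) : ℂ) • (a * l.sum ^ n) := by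
      intro n
      induction n with
      | zero => simp [add_comm]
      | succ n ih =>
        rw [pow_succ', ih, add_mul, mul_add, mul_add, ← pow_succ', mul_smul_comm, mul_smul_comm,
          ← mul_assoc, hsq a (by simp), zero_mul, smul_zero, add_zero, ← mul_assoc l.sum a, ← hc,
          mul_assoc, ← pow_succ']
        push_cast
        module
    rw [List.sum_cons, List.length_cons, List.prod_cons]
    constructor
    · rw [hexp, h2, zero_add, h1, mul_smul_comm, smul_smul, Nat.factorial_succ]
      push_cast
      rfl
    · rw [hexp, h2, pow_succ, h2, zero_mul, zero_add, mul_zero, smul_zero]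

end Nilpotent

section SymbolAlgebra

variable {U D : Type*} [AddCommGroup U] [Module ℂ U] [AddCommGroup D] [Module ℂ D]
  [FiniteDimensional ℂ U] [FiniteDimensional ℂ D]

/-- The two vectors of a product of degree two each contribute the same parity sign. -/
theorem even_comm {W : Type*} [AddCommGroup W] [Module ℂ W] {s : EA W}
    (hs : s ∈ ⋀[ℂ]^2 W) (a : EA W) : s * a = a * s := by
  refine pow_succ_induction (P := fun s => s * a = a * s)
    (fun s t h1 h2 => by rw [add_mul, mul_add, h1, h2]) (fun v s hs => ?_) s hs
  have hs' : s ∈ LinearMap.range (gen (W := W)) := by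
    rw [← pow_one (LinearMap.range (gen (W := W)))]
    exact hs
  obtain ⟨w, rfl⟩ := hs'
  rw [mul_assoc, gen_mul_eq_involute_mul w, ← mul_assoc, gen_mul_involute, mul_assoc]

end SymbolAlgebra

theorem eq_zero_of_eq_neg {M : Type*} [AddCommGroup M] [Module ℂ M] {x : M} (h : x = -x) :
    x = 0 := by
  have h2 : (2 : ℂ) • x = 0 := by
    rw [two_smul]
    exact eq_neg_iff_add_eq_zero.1 h
  exact (smul_eq_zero.1 h2).resolve_left two_ne_zero

/-! ### Symbols of homomorphisms E → U ⊕ E^*, and the span of their powers. -/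

section Theta

variable (U E : Type*) [AddCommGroup U] [Module ℂ U] [AddCommGroup E] [Module ℂ E]
  [FiniteDimensional ℂ U] [FiniteDimensional ℂ E]

/-- The space in whose exterior algebra the normal spaces are modelled. -/
abbrev QE : Type _ := QSp U (Module.Dual ℂ E)

/-- The space `U × E^*`, which is a complement of `E`. -/
abbrev MSp : Type _ := U × Module.Dual ℂ E

/-- The symbol of a homomorphism `E → U × E^*`. -/
def theta : (E →ₗ[ℂ] MSp U E) →ₗ[ℂ] EA (QE U E) where
  toFun X := ∑ i, gen (in1 U (Module.Dual ℂ E) ((Module.finBasis ℂ E).coord i)) *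
    gen (inM U (Module.Dual ℂ E) (X (Module.finBasis ℂ E i)))
  map_add' X Y := by
    simp only [LinearMap.add_apply, map_add, mul_add, Finset.sum_add_distrib]
  map_smul' c X := by
    simp only [LinearMap.smul_apply, map_smul, mul_smul_comm, Finset.smul_sum, RingHom.id_apply]

/-- The homomorphisms with symmetric component `E → E^*`. -/
def symHom : Submodule ℂ (E →ₗ[ℂ] MSp U E) where
  carrier := {X | ∀ x y, (X x).2 y = (X y).2 x}
  zero_mem' := by simp
  add_mem' {a b} ha hb x y := by simp [ha x y, hb x y]
  smul_mem' c a ha x y := by simp [ha x y]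

variable {U E}

theorem theta_apply (X : E →ₗ[ℂ] MSp U E) : theta U E X =
    ∑ i, gen (in1 U (Module.Dual ℂ E) ((Module.finBasis ℂ E).coord i)) *
    gen (inM U (Module.Dual ℂ E) (X (Module.finBasis ℂ E i))) := rfl

theorem mem_symHom {X : E →ₗ[ℂ] MSp U E} : X ∈ symHom U E ↔ ∀ x y, (X x).2 y = (X y).2 x := Iff.rfl

/-- A vector of `E` as a linear form on the first copy of `E^*`. -/
def ev1 (x : E) : Module.Dual ℂ (QE U E) :=
  Module.Dual.eval ℂ E x ∘ₗ LinearMap.fst ℂ _ _ ∘ₗ LinearMap.snd ℂ U _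

theorem theta_mem_two (X : E →ₗ[ℂ] MSp U E) : theta U E X ∈ ⋀[ℂ]^2 (QE U E) := by
  rw [theta_apply]
  exact sum_mem fun i _ => gen_mul_mem (n := 1) _ (gen_mem _)

theorem theta_comm (X : E →ₗ[ℂ] MSp U E) (a : EA (QE U E)) : theta U E X * a = a * theta U E X :=
  even_comm (theta_mem_two X) a

theorem finBasis_sum_coord (x : E) :
    ∑ i, (Module.finBasis ℂ E).coord i x • Module.finBasis ℂ E i = x :=
  (Module.finBasis ℂ E).sum_repr x

/-- Contraction in the first copy of E^* recovers X from its symbol; this gives injectivity and,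
later, the rank. -/
theorem con_theta (x : E) (X : E →ₗ[ℂ] MSp U E) :
    con (ev1 x) (theta U E X) = gen (inM U (Module.Dual ℂ E) (X x)) := by
  rw [theta_apply, map_sum]
  conv_rhs => rw [← finBasis_sum_coord x]
  simp only [map_sum, map_smul]
  refine Finset.sum_congr rfl fun i _ => ?_
  rw [con_gen_mul, con_gen]
  simp [ev1]

theorem theta_smulRight (β : Module.Dual ℂ E) (m : MSp U E) :
    theta U E (β.smulRight m) = gen (in1 U (Module.Dual ℂ E) β) *
      gen (inM U (Module.Dual ℂ E) m) := by
  have : β = ∑ i, β (Module.finBasis ℂ E i) • (Module.finBasis ℂ E).coord i := by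
    refine (Module.finBasis ℂ E).ext fun j => ?_
    simp
  conv_rhs => rw [this]
  rw [theta_apply]
  simp only [map_sum, map_smul, Finset.sum_mul, smul_mul_assoc, LinearMap.smulRight_apply,
    mul_smul_comm]

/-- Shifting turns the symbol into ∑ B_ij e^i ∧ e^j, where B is the component E → E^*; this vanishes
when B is symmetric. -/
theorem theta_mem_symbols {X : E →ₗ[ℂ] MSp U E} (hX : X ∈ symHom U E) :
    theta U E X ∈ symbols U (Module.Dual ℂ E) 1 := by
  refine mem_symbols.2 ⟨theta_mem_two X, ?_, ?_⟩
  · rw [theta_apply, map_sum, Nat.cast_one, one_smul]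
    refine Finset.sum_congr rfl fun i _ => ?_
    have h1 : ∀ m, pr1 U (Module.Dual ℂ E) (inM U (Module.Dual ℂ E) m) = in1 U _ 0 := fun _ => rfl
    have h2 : ∀ β, pr1 U (Module.Dual ℂ E) (in1 U (Module.Dual ℂ E) β) = in1 U _ β := fun _ => rfl
    rw [der_gen_mul, der_gen, h1, h2, map_zero, map_zero, mul_zero, add_zero]
  · rw [theta_apply, map_sum]
    have h1 : ∀ i, der (shift U (Module.Dual ℂ E))
        (gen (in1 U (Module.Dual ℂ E) ((Module.finBasis ℂ E).coord i)) *
          gen (inM U (Module.Dual ℂ E) (X (Module.finBasis ℂ E i)))) =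
        ∑ j, (X (Module.finBasis ℂ E i)).2 (Module.finBasis ℂ E j) •
          (gen (in1 U (Module.Dual ℂ E) ((Module.finBasis ℂ E).coord i)) *
            gen (in1 U (Module.Dual ℂ E) ((Module.finBasis ℂ E).coord j))) := by
      intro i
      have h2 : (X (Module.finBasis ℂ E i)).2 = ∑ j, (X (Module.finBasis ℂ E i)).2
          (Module.finBasis ℂ E j) • (Module.finBasis ℂ E).coord j := by
        refine (Module.finBasis ℂ E).ext fun j => ?_
        simp
      have h3 : shift U (Module.Dual ℂ E) (inM U (Module.Dual ℂ E) (X (Module.finBasis ℂ E i))) =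
          in1 U (Module.Dual ℂ E) (X (Module.finBasis ℂ E i)).2 := rfl
      have h4 : shift U (Module.Dual ℂ E)
          (in1 U (Module.Dual ℂ E) ((Module.finBasis ℂ E).coord i)) = in1 U _ 0 := rfl
      rw [der_gen_mul, der_gen, h3, h4, map_zero, map_zero, zero_mul, zero_add]
      conv_lhs => rw [h2]
      simp only [map_sum, map_smul, Finset.mul_sum, mul_smul_comm]
    rw [Finset.sum_congr rfl fun i _ => h1 i]
    -- Exchanging the summation indices changes the sign of e^i ∧ e^j and leaves the symmetric
    -- coefficient alone.
    refine eq_zero_of_eq_neg ?_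
    conv => enter [1]; rw [Finset.sum_comm]
    rw [← Finset.sum_neg_distrib]
    refine Finset.sum_congr rfl fun i _ => ?_
    rw [← Finset.sum_neg_distrib]
    refine Finset.sum_congr rfl fun j _ => ?_
    rw [gen_mul_gen, smul_neg, hX]

/-- The homomorphisms of rank one that span the symmetric ones. -/
def IsSimple (X : E →ₗ[ℂ] MSp U E) : Prop :=
  (∃ (β : Module.Dual ℂ E) (u : U), X = β.smulRight ((u, 0) : MSp U E)) ∨
    ∃ f : Module.Dual ℂ E, X = f.smulRight ((0, f) : MSp U E)

theorem IsSimple.mem_symHom {X : E →ₗ[ℂ] MSp U E} (h : IsSimple X) : X ∈ symHom U E := by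
  obtain ⟨β, u, rfl⟩ | ⟨f, rfl⟩ := h
  · intro x y; simp
  · intro x y; simp [mul_comm]

theorem theta_smulRight_sq (β : Module.Dual ℂ E) (m : MSp U E) :
    theta U E (β.smulRight m) * theta U E (β.smulRight m) = 0 := by
  rw [theta_smulRight, mul_assoc, gen_mul_gen_mul]
  simp

theorem IsSimple.sq {X : E →ₗ[ℂ] MSp U E} (h : IsSimple X) : theta U E X * theta U E X = 0 := by
  obtain ⟨β, u, rfl⟩ | ⟨f, rfl⟩ := h <;> exact theta_smulRight_sq _ _

variable (U E) in
/-- The span of the products of symbols of simple homomorphisms. -/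
def simpleSpan (p : ℕ) : Submodule ℂ (EA (QE U E)) :=
  Submodule.span ℂ {t | ∃ l : List (E →ₗ[ℂ] MSp U E), l.length = p ∧ (∀ X ∈ l, IsSimple X) ∧
    t = (l.map (theta U E)).prod}

theorem theta_mul_mem_simpleSpan {p : ℕ} {X : E →ₗ[ℂ] MSp U E} (hX : IsSimple X)
    {t : EA (QE U E)} (ht : t ∈ simpleSpan U E p) : theta U E X * t ∈ simpleSpan U E (p + 1) := by
  induction ht using Submodule.span_induction with
  | mem t ht =>
    obtain ⟨l, rfl, hl, rfl⟩ := ht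
    exact Submodule.subset_span ⟨X :: l, rfl, by simpa [hX] using hl, by simp⟩
  | zero => rw [mul_zero]; exact zero_mem _
  | add s t _ _ hs ht => rw [mul_add]; exact add_mem hs ht
  | smul c t _ ht => rw [mul_smul_comm]; exact Submodule.smul_mem _ _ ht

/-- Symbols of simple homomorphisms commute and have square zero, so the product of p of them is the
p-th power of their sum divided by p!. -/
theorem simpleSpan_le_span_pow (p : ℕ) : simpleSpan U E p ≤
    Submodule.span ℂ {t | ∃ X ∈ symHom U E, t = theta U E X ^ p} := by
  refine Submodule.span_le.2 ?_
  rintro _ ⟨l, rfl, hl, rfl⟩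
  have h := (sum_pow_of_sq_zero (l.map (theta U E)) (by
    intro a ha
    obtain ⟨X, hX, rfl⟩ := List.mem_map.1 ha
    exact (hl X hX).sq) (by
    intro a ha
    obtain ⟨X, hX, rfl⟩ := List.mem_map.1 ha
    exact theta_comm X)).1
  rw [List.length_map] at h
  have hf : (l.length.factorial : ℂ) ≠ 0 := Nat.cast_ne_zero.2 l.length.factorial_ne_zero
  refine (Submodule.smul_mem_iff _ hf).1 ?_
  rw [← h]
  refine Submodule.subset_span ⟨l.sum, ?_, ?_⟩
  · exact list_sum_mem fun X hX => (hl X hX).mem_symHom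
  · rw [map_list_sum]

/-- Adding v to both columns is multiplication by the symbol of v², up to the parity of the first
column. -/
theorem triMul_mulB (x : EA U) (v : Module.Dual ℂ E)
    (t : EA (Module.Dual ℂ E) ⊗[ℂ] EA (Module.Dual ℂ E)) :
    triMul U _ (x ⊗ₜ mulB v t) = theta U E (v.smulRight ((0, v) : MSp U E)) *
      triMul U _ (x ⊗ₜ signL t) := by
  induction t using TensorProduct.induction_on with
  | zero => simp
  | tmul a b =>
    have h1 : signL (a ⊗ₜ[ℂ] b) =
      (CliffordAlgebra.involute (Q := (0 : QuadraticForm ℂ (Module.Dual ℂ E))) a) ⊗ₜ b := rfl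
    have h2 : inM U (Module.Dual ℂ E) ((0, v) : MSp U E) = in2 U _ v := rfl
    have h3 : ∀ X Y : EA (QE U E), theta U E (v.smulRight ((0, v) : MSp U E)) * (X * Y) =
        X * (theta U E (v.smulRight ((0, v) : MSp U E)) * Y) := fun X Y => by
      rw [← mul_assoc, theta_comm, mul_assoc]
    rw [mulB_apply, mulR_tmul, mulL_tmul, h1, triMul_tmul, triMul_tmul, h3, theta_smulRight, h2,
      map_mul, map_mul, ExteriorAlgebra.map_apply_ι, ExteriorAlgebra.map_apply_ι, mul_assoc,
      mul_assoc, map_involute, ← mul_assoc (gen (in2 U _ v)), gen_mul_involute, mul_assoc]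
  | add s t hs ht => simp only [map_add, TensorProduct.tmul_add, hs, ht, mul_add]

/-- Equal degrees allow the vectors of U and of the first copy of E^* to be paired off, each pair
being the symbol of an element v ⊗ u. -/
theorem triMul_mem_simpleSpan (d : ℕ) {x : EA U} (hx : x ∈ ⋀[ℂ]^d U)
    {a : EA (Module.Dual ℂ E)} (ha : a ∈ ⋀[ℂ]^d (Module.Dual ℂ E)) :
    triMul U _ (x ⊗ₜ (a ⊗ₜ 1)) ∈ simpleSpan U E d := by
  induction d generalizing x a with
  | zero =>
    obtain ⟨c, rfl⟩ := mem_zero_iff.1 hx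
    obtain ⟨c', rfl⟩ := mem_zero_iff.1 ha
    rw [triMul_tmul]
    simp only [map_smul, map_one, smul_mul_assoc, mul_smul_comm, one_mul]
    exact Submodule.smul_mem _ _ (Submodule.smul_mem _ _
      (Submodule.subset_span ⟨[], rfl, by simp, by simp⟩))
  | succ d ih =>
    refine pow_succ_induction (P := fun x => triMul U (Module.Dual ℂ E) (x ⊗ₜ (a ⊗ₜ 1)) ∈
      simpleSpan U E (d + 1)) (fun x y hx hy => by
        rw [TensorProduct.add_tmul, map_add]; exact add_mem hx hy) (fun u x hx => ?_) x hx
    refine pow_succ_induction (P := fun a => triMul U (Module.Dual ℂ E) ((gen u * x) ⊗ₜ (a ⊗ₜ 1)) ∈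
      simpleSpan U E (d + 1)) (fun a b ha hb => by
        rw [TensorProduct.add_tmul, TensorProduct.tmul_add, map_add]; exact add_mem ha hb)
        (fun v a ha => ?_) a ha
    have h := theta_mul_mem_simpleSpan (Or.inl ⟨v, u, rfl⟩) (ih hx ha)
    have h2 : inM U (Module.Dual ℂ E) ((u, 0) : MSp U E) = inU U _ u := rfl
    have e : triMul U (Module.Dual ℂ E) ((gen u * x) ⊗ₜ ((gen v * a) ⊗ₜ 1)) =
        -(-1 : ℂ) ^ d • (theta U E (v.smulRight ((u, 0) : MSp U E)) *
          triMul U (Module.Dual ℂ E) (x ⊗ₜ (a ⊗ₜ 1))) := by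
      rw [theta_smulRight, h2, gen_mul_gen, neg_mul, smul_neg, neg_smul, neg_neg, triMul_tmul,
        triMul_tmul, map_mul, map_mul, ExteriorAlgebra.map_apply_ι, ExteriorAlgebra.map_apply_ι,
        map_one, mul_one, mul_one, mul_assoc, mul_assoc, ← mul_smul_comm, ← mul_assoc _ (gen _),
        ← gen_mul_involute, involute_of_mem (map_mem _ hx)]
      simp only [mul_smul_comm, smul_mul_assoc, mul_assoc]
    rw [e]
    exact Submodule.smul_mem _ _ h

theorem triMul_mulBs_mem_simpleSpan (d : ℕ) {x : EA U} (hx : x ∈ ⋀[ℂ]^d U)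
    {a : EA (Module.Dual ℂ E)} (ha : a ∈ ⋀[ℂ]^d (Module.Dual ℂ E))
    (s : List (Module.Dual ℂ E)) :
    triMul U _ (x ⊗ₜ mulBs s (a ⊗ₜ 1)) ∈ simpleSpan U E (d + s.length) := by
  induction s with
  | nil => exact triMul_mem_simpleSpan d hx ha
  | cons v s ih =>
    rw [mulBs_cons, triMul_mulB, signL_of_mem (mulBs_mem s (tmul_mem_bideg ha one_mem_zero)),
      TensorProduct.tmul_smul, map_smul, mul_smul_comm]
    exact Submodule.smul_mem _ _ (theta_mul_mem_simpleSpan (Or.inr ⟨v, rfl⟩) ih)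

/-- The model of the normal space is spanned by the powers of the symbols. -/
theorem symbols_le_span_pow (p : ℕ) : symbols U (Module.Dual ℂ E) p ≤
    Submodule.span ℂ {t | ∃ X ∈ symHom U E, t = theta U E X ^ p} := by
  refine le_trans ?_ (simpleSpan_le_span_pow p)
  intro t ht
  obtain ⟨f, rfl⟩ := mem_iSup_symbolPart ht
  refine sum_mem fun q hq => ?_
  rw [← Finset.HasAntidiagonal.mem_antidiagonal.1 hq]
  generalize f q = y
  induction y using TensorProduct.induction_on with
  | zero => rw [map_zero]; exact zero_mem _
  | tmul x y =>
    rw [symbolPart_tmul]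
    have h := mem_repeated (toTwo_mem _) (mem_highest.1 (schurLift_mem y))
    generalize toTwo (Module.Dual ℂ E) (q.1 + q.2) q.2 (schurLift _ q.1 q.2 y) = t at h
    induction h using Submodule.span_induction with
    | mem t ht =>
      obtain ⟨s, a, h1, ha, rfl⟩ := ht
      rw [← h1]
      exact triMul_mulBs_mem_simpleSpan q.1 (toEA_mem x) ha s
    | zero => rw [TensorProduct.tmul_zero, map_zero]; exact zero_mem _
    | add s t _ _ hs ht => rw [TensorProduct.tmul_add, map_add]; exact add_mem hs ht
    | smul c t _ ht => rw [TensorProduct.tmul_smul, map_smul]; exact Submodule.smul_mem _ _ ht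
  | add x y hx hy => rw [map_add]; exact add_mem hx hy

theorem inM_injective : Function.Injective (inM U (Module.Dual ℂ E)) := by
  rintro ⟨u, f⟩ ⟨u', f'⟩ h
  simpa using h

theorem gen_injective {W : Type*} [AddCommGroup W] [Module ℂ W] :
    Function.Injective (gen (W := W)) := (ExteriorAlgebra.ι_leftInverse (R := ℂ) (M := W)).injective

theorem theta_injective : Function.Injective (theta U E) := by
  intro X Y h
  refine LinearMap.ext fun x => inM_injective (gen_injective ?_)
  rw [← con_theta, ← con_theta, h]

/-- For p = 1 the spanning powers already form a linear subspace. -/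
theorem exists_theta_eq {t : EA (QE U E)} (ht : t ∈ symbols U (Module.Dual ℂ E) 1) :
    ∃ X ∈ symHom U E, theta U E X = t := by
  have h := symbols_le_span_pow 1 ht
  simp only [pow_one] at h
  have h2 : Submodule.span ℂ {t | ∃ X ∈ symHom U E, t = theta U E X} ≤
      (symHom U E).map (theta U E) := by
    refine Submodule.span_le.2 ?_
    rintro _ ⟨X, hX, rfl⟩
    exact ⟨X, hX, rfl⟩
  exact h2 h

end Theta


/-! ### Nonvanishing of decomposable elements. -/

section Decomposable

variable {W : Type*} [AddCommGroup W] [Module ℂ W]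

theorem ιMulti_succ_eq {n : ℕ} (v : Fin (n + 1) → W) : ExteriorAlgebra.ιMulti ℂ (n + 1) v =
    gen (v 0) * ExteriorAlgebra.ιMulti ℂ n (fun i => v i.succ) :=
  ExteriorAlgebra.ιMulti_succ_apply ..

theorem con_ιMulti_eq_zero {n : ℕ} (v : Fin n → W) (α : Module.Dual ℂ W) (h : ∀ i, α (v i) = 0) :
    con α (ExteriorAlgebra.ιMulti ℂ n v) = 0 := by
  induction n with
  | zero => rw [ExteriorAlgebra.ιMulti_zero_apply, con_one]
  | succ n ih =>
    rw [ιMulti_succ_eq, con_gen_mul, h, zero_smul, ih _ fun i => h _, mul_zero, sub_zero]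

/-- A covector that kills all vectors but the first strips that one off by contraction. -/
theorem ιMulti_ne_zero {n : ℕ} {v : Fin n → W} (h : LinearIndependent ℂ v) :
    ExteriorAlgebra.ιMulti ℂ n v ≠ 0 := by
  induction n with
  | zero => rw [ExteriorAlgebra.ιMulti_zero_apply]; exact one_ne_zero
  | succ n ih =>
    obtain ⟨h1, h2⟩ := linearIndependent_finSucc.1 h
    obtain ⟨α, h3, h4⟩ := Submodule.exists_le_ker_of_notMem h2
    have h5 : ∀ i, α (v (Fin.succ i)) = 0 := fun i =>
      h4 (Submodule.subset_span ⟨i, rfl⟩)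
    intro h6
    have h7 := congrArg (con α) h6
    rw [ιMulti_succ_eq, con_gen_mul, con_ιMulti_eq_zero _ _ h5, mul_zero, sub_zero, map_zero,
      smul_eq_zero] at h7
    exact h7.elim h3 (ih h1)

end Decomposable

/-! ### Powers of a symbol and the rank of the homomorphism. -/

section Rank

variable {U E : Type*} [AddCommGroup U] [Module ℂ U] [AddCommGroup E] [Module ℂ E]
  [FiniteDimensional ℂ U] [FiniteDimensional ℂ E]

theorem con_theta_pow (x : E) (X : E →ₗ[ℂ] MSp U E) (q : ℕ) :
    con (ev1 x) (theta U E X ^ (q + 1)) =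
      ((q + 1 : ℕ) : ℂ) • (theta U E X ^ q * gen (inM U (Module.Dual ℂ E) (X x))) := by
  induction q with
  | zero => simp [con_theta]
  | succ q ih =>
    rw [pow_succ', con_mul, con_theta, ih, involute_of_mem (theta_mem_two X)]
    have h : gen (inM U (Module.Dual ℂ E) (X x)) * theta U E X ^ (q + 1) =
        theta U E X ^ (q + 1) * gen (inM U (Module.Dual ℂ E) (X x)) := by
      have hc : Commute (theta U E X) (gen (inM U (Module.Dual ℂ E) (X x))) := theta_comm X _
      exact (hc.pow_left _).eq.symm
    rw [h]
    simp only [even_two, Even.neg_pow, one_pow, one_smul, mul_smul_comm, ← mul_assoc, ← pow_succ']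
    push_cast
    module

/-- Contracting with x turns one factor θ(X) into the vector X(x). The element c is untouched, as it
involves no generator of the first copy of E^*. -/
theorem theta_pow_mul_eq_zero (X : E →ₗ[ℂ] MSp U E) {q : ℕ} {c : EA (MSp U E)}
    (h : theta U E X ^ (q + 1) * ExteriorAlgebra.map (inM U (Module.Dual ℂ E)) c = 0) (x : E) :
    theta U E X ^ q * ExteriorAlgebra.map (inM U (Module.Dual ℂ E)) (gen (X x) * c) = 0 := by
  have h1 := congrArg (con (ev1 x)) h
  rw [map_zero, con_mul, con_theta_pow, con_map_eq_zero _ _ (fun v => by rfl), mul_zero, add_zero,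
    smul_mul_assoc, smul_eq_zero] at h1
  rw [map_mul, ExteriorAlgebra.map_apply_ι, ← mul_assoc]
  exact h1.resolve_left (Nat.cast_ne_zero.2 (Nat.succ_ne_zero q))

theorem map_inM_injective : Function.Injective
    (ExteriorAlgebra.map (inM U (Module.Dual ℂ E))) := by
  let p : QE U E →ₗ[ℂ] MSp U E := LinearMap.id.prodMap (LinearMap.snd ℂ _ _)
  refine Function.LeftInverse.injective (g := ExteriorAlgebra.map p) fun a => ?_
  rw [← AlgHom.comp_apply, ExteriorAlgebra.map_comp_map]
  have : p ∘ₗ inM U (Module.Dual ℂ E) = LinearMap.id := rfl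
  rw [this, ExteriorAlgebra.map_id]
  rfl

/-- After q contractions no factor θ(X) is left and the images of the chosen vectors appear as a
product. -/
theorem ιMulti_mul_eq_zero_of_theta_pow (X : E →ₗ[ℂ] MSp U E) {q : ℕ} {c : EA (MSp U E)}
    (h : theta U E X ^ q * ExteriorAlgebra.map (inM U (Module.Dual ℂ E)) c = 0) (x : Fin q → E) :
    ExteriorAlgebra.ιMulti ℂ q (X ∘ x) * c = 0 := by
  induction q generalizing c with
  | zero =>
    rw [pow_zero, one_mul] at h
    rw [map_inM_injective (h.trans (map_zero _).symm), mul_zero]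
  | succ q ih =>
    have h1 := ih (theta_pow_mul_eq_zero X h (x 0)) (fun i => x i.succ)
    rw [← mul_assoc, ← gen_mul_involute, involute_of_mem (ιMulti_mem _), mul_smul_comm,
      smul_mul_assoc, smul_eq_zero] at h1
    rw [ιMulti_succ_eq]
    exact h1.resolve_left (pow_ne_zero _ (by norm_num))

theorem exists_sum_smulRight {N : Type*} [AddCommGroup N] [Module ℂ N] [FiniteDimensional ℂ N]
    (X : E →ₗ[ℂ] N) :
    ∃ (β : Fin (Module.finrank ℂ (LinearMap.range X)) → Module.Dual ℂ E)
      (m : Fin (Module.finrank ℂ (LinearMap.range X)) → N), X = ∑ i, (β i).smulRight (m i) := by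
  let b := Module.finBasis ℂ (LinearMap.range X)
  refine ⟨fun i => b.coord i ∘ₗ X.rangeRestrict, fun i => b i, LinearMap.ext fun x => ?_⟩
  rw [LinearMap.sum_apply]
  have := congrArg Subtype.val (b.sum_repr (X.rangeRestrict x))
  rw [Submodule.coe_sum] at this
  exact this.symm

/-- The powers of the symbol detect the rank. -/
theorem theta_pow_eq_zero_iff (X : E →ₗ[ℂ] MSp U E) (p : ℕ) :
    theta U E X ^ p = 0 ↔ Module.finrank ℂ (LinearMap.range X) < p := by
  constructor
  · intro h
    by_contra! hp
    have hli : LinearIndependent ℂ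
        (fun i : Fin p => ((Module.finBasis ℂ (LinearMap.range X) (Fin.castLE hp i) :
          LinearMap.range X) : MSp U E)) :=
      ((Module.finBasis ℂ (LinearMap.range X)).linearIndependent.comp _
        (Fin.castLE_injective hp)).map' (LinearMap.range X).subtype (Submodule.ker_subtype _)
    have hx : ∀ i : Fin p, ∃ x, X x = ((Module.finBasis ℂ (LinearMap.range X) (Fin.castLE hp i) :
          LinearMap.range X) : MSp U E) := fun i => (Module.finBasis ℂ (LinearMap.range X) _).2
    choose x hx using hx
    -- The x_i have linearly independent images, so the product of these images cannot vanish.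
    have h1 := ιMulti_mul_eq_zero_of_theta_pow X (c := 1) (by rw [map_one, mul_one, h]) x
    rw [mul_one] at h1
    refine ιMulti_ne_zero ?_ h1
    have : X ∘ x = _ := funext hx
    rw [this]
    exact hli
  · intro h
    obtain ⟨β, m, hX⟩ := exists_sum_smulRight X
    -- A homomorphism of rank r is a sum of r homomorphisms whose symbols have square zero, so the
    -- power r + 1 vanishes.
    have h1 := (sum_pow_of_sq_zero (List.ofFn fun i => theta U E ((β i).smulRight (m i))) (by
      intro a ha
      obtain ⟨i, rfl⟩ := (List.mem_ofFn' _ _).1 ha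
      exact theta_smulRight_sq _ _) (by
      intro a ha
      obtain ⟨i, rfl⟩ := (List.mem_ofFn' _ _).1 ha
      exact theta_comm _)).2
    rw [List.sum_ofFn, ← map_sum, ← hX, List.length_ofFn] at h1
    obtain ⟨c, rfl⟩ := Nat.exists_eq_add_of_lt h
    rw [show Module.finrank ℂ (LinearMap.range X) + c + 1 =
      (Module.finrank ℂ (LinearMap.range X) + 1) + c by ring, pow_add, h1, zero_mul]

theorem symbols_eq_bot {p : ℕ} (hp : Module.finrank ℂ E < p) :
    symbols U (Module.Dual ℂ E) p = ⊥ := by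
  rw [eq_bot_iff]
  refine (symbols_le_span_pow p).trans (Submodule.span_le.2 ?_)
  rintro _ ⟨X, -, rfl⟩
  exact (theta_pow_eq_zero_iff X p).2 ((LinearMap.finrank_range_le X).trans_lt hp)

end Rank

/-! ### The last normal space. -/

section Top

variable {U D : Type*} [AddCommGroup U] [Module ℂ U] [AddCommGroup D] [Module ℂ D]
  [FiniteDimensional ℂ U] [FiniteDimensional ℂ D]

variable (U D) in
/-- The rearrangement of the summands of `QSp U D`. -/
def qEquiv : (D × (D × U)) ≃ₗ[ℂ] QSp U D where
  toFun x := (x.2.2, x.1, x.2.1)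
  invFun y := (y.2.1, y.2.2, y.1)
  map_add' _ _ := rfl
  map_smul' _ _ := rfl
  left_inv _ := rfl
  right_inv _ := rfl

variable (U D) in
/-- The inclusion of `D × U`, with the second copy of `D`. -/
abbrev inN : D × U →ₗ[ℂ] QSp U D := (qEquiv U D).toLinearMap ∘ₗ LinearMap.inr ℂ D (D × U)

theorem map_injective_of_equiv {W W' : Type*} [AddCommGroup W] [Module ℂ W] [AddCommGroup W']
    [Module ℂ W'] (e : W ≃ₗ[ℂ] W') : Function.Bijective (ExteriorAlgebra.map e.toLinearMap) := by
  refine Function.bijective_iff_has_inverse.2 ⟨ExteriorAlgebra.map e.symm.toLinearMap,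
    fun a => ?_, fun a => ?_⟩
  · rw [← AlgHom.comp_apply, ExteriorAlgebra.map_comp_map, LinearEquiv.symm_comp,
      ExteriorAlgebra.map_id]
    rfl
  · rw [← AlgHom.comp_apply, ExteriorAlgebra.map_comp_map, LinearEquiv.comp_symm,
      ExteriorAlgebra.map_id]
    rfl

/-- Multiplication with a volume element. -/
def topMul (ν : EA D) (k : ℕ) : Ext k (D × U) →ₗ[ℂ] EA (QSp U D) :=
  LinearMap.mulLeft ℂ (ExteriorAlgebra.map (in1 U D) ν) ∘ₗ
    (ExteriorAlgebra.map (inN U D)).toLinearMap ∘ₗ toEA k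

theorem topMul_apply (ν : EA D) (k : ℕ) (y : Ext k (D × U)) : topMul ν k y =
    ExteriorAlgebra.map (in1 U D) ν * ExteriorAlgebra.map (inN U D) (toEA k y) := rfl

theorem map_qEquiv_mulProd (ν : EA D) (y : EA (D × U)) :
    ExteriorAlgebra.map (qEquiv U D).toLinearMap (mulProd D (D × U) (ν ⊗ₜ y)) =
      ExteriorAlgebra.map (in1 U D) ν * ExteriorAlgebra.map (inN U D) y := by
  rw [mulProd_tmul, map_mul, ← AlgHom.comp_apply, ExteriorAlgebra.map_comp_map, ← AlgHom.comp_apply,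
    ExteriorAlgebra.map_comp_map]
  rfl

/-- The decomposition Λ(D ⊕ (D ⊕ U)) = ΛD ⊗ Λ(D ⊕ U) lets a functional that is nonzero on ν cancel
it. -/
theorem topMul_injective {ν : EA D} (hν : ν ≠ 0) (k : ℕ) :
    Function.Injective (topMul (U := U) ν k) := by
  intro y z h
  rw [topMul_apply, topMul_apply, ← map_qEquiv_mulProd, ← map_qEquiv_mulProd] at h
  have h1 := mulProd_injective ((map_injective_of_equiv _).1 h)
  rw [← sub_eq_zero, ← TensorProduct.tmul_sub] at h1
  obtain ⟨l, hl⟩ : ∃ l : Module.Dual ℂ (EA D), l ν ≠ 0 := by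
    by_contra! h2
    exact hν ((Module.forall_dual_apply_eq_zero_iff ℂ ν).1 h2)
  have h3 := congrArg (TensorProduct.lid ℂ _ ∘ LinearMap.rTensor (EA (D × U)) l) h1
  simp only [Function.comp_apply, LinearMap.rTensor_tmul, TensorProduct.lid_tmul, map_zero,
    smul_eq_zero, hl, false_or, sub_eq_zero] at h3
  exact toEA_injective _ h3

theorem exists_smul_eq_of_top {k : ℕ} (hk : Module.finrank ℂ D = k) {ν : EA D}
    (hν : ν ∈ ⋀[ℂ]^k D) (h0 : ν ≠ 0) {a : EA D} (ha : a ∈ ⋀[ℂ]^k D) : ∃ c : ℂ, a = c • ν := by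
  have h1 : Module.finrank ℂ (⋀[ℂ]^k D) = 1 := by
    rw [exteriorPower.finrank_eq, hk, Nat.choose_self]
  obtain ⟨c, hc⟩ := (finrank_eq_one_iff_of_nonzero' (⟨ν, hν⟩ : ⋀[ℂ]^k D)
    (fun h => h0 (congrArg Subtype.val h))).1 h1 ⟨a, ha⟩
  exact ⟨c, (congrArg Subtype.val hc).symm⟩

/-- An element with k = dim D generators in the first copy of D is divisible by its volume element,
and the condition on the shift becomes empty. -/
theorem range_topMul {k : ℕ} (hk : Module.finrank ℂ D = k) {ν : EA D} (hν : ν ∈ ⋀[ℂ]^k D)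
    (h0 : ν ≠ 0) : LinearMap.range (topMul (U := U) ν k) = symbols U D k := by
  refine le_antisymm ?_ ?_
  · rintro _ ⟨y, rfl⟩
    -- The shift only creates vectors of the first copy of D, and the volume element kills them.
    have hd : ∀ b : D, ExteriorAlgebra.map (in1 U D) ν * gen (in1 U D b) = 0 := fun b => by
      rw [← ExteriorAlgebra.map_apply_ι, ← map_mul]
      have h : ν * gen b ∈ ⋀[ℂ]^(k + 1) D := mul_mem_pow hν (gen_mem b)
      rw [pow_eq_bot (by omega), Submodule.mem_bot] at h
      rw [h, map_zero]
    refine mem_symbols.2 ⟨?_, ?_, ?_⟩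
    · rw [two_mul]
      exact mul_mem_pow (map_mem _ hν) (map_mem _ (toEA_mem y))
    · rw [topMul_apply, der_mul, der_map_eq_self (in1 U D) _ (fun _ => rfl),
        der_map_eq_zero (inN U D) _ (fun _ => rfl), mul_zero, add_zero, der_id_of_mem hν, map_smul,
        smul_mul_assoc]
    · rw [topMul_apply, der_mul, der_map_eq_zero (in1 U D) _ (fun _ => rfl), zero_mul, zero_add,
        ← sum_gen_mul_con Finset.univ (fun i => in1 U D (Module.finBasis ℂ D i))
          (fun i => (Module.finBasis ℂ D).coord i ∘ₗ LinearMap.snd ℂ D D ∘ₗ LinearMap.snd ℂ U _),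
        Finset.mul_sum]
      · refine Finset.sum_eq_zero fun i _ => ?_
        rw [← mul_assoc, hd, zero_mul]
      · rintro ⟨u, v, w⟩
        simp only [← map_smul, ← map_sum]
        exact congrArg (in1 U D) ((Module.finBasis ℂ D).sum_repr w).symm
  · intro t ht
    obtain ⟨h1, h2, -⟩ := mem_symbols.1 ht
    obtain ⟨s', rfl⟩ := (map_injective_of_equiv (qEquiv U D)).2 t
    obtain ⟨s, rfl⟩ := mulProd_surjective s'
    have key : ∀ s : EA D ⊗[ℂ] EA (D × U), der (pr1 U D)
        (ExteriorAlgebra.map (qEquiv U D).toLinearMap (mulProd D (D × U) s)) =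
        ExteriorAlgebra.map (qEquiv U D).toLinearMap (mulProd D (D × U)
          (LinearMap.rTensor _ (der LinearMap.id) s)) := by
      intro s
      induction s using TensorProduct.induction_on with
      | zero => simp
      | tmul a y =>
        rw [map_qEquiv_mulProd, LinearMap.rTensor_tmul, map_qEquiv_mulProd, der_mul,
          der_map_eq_self (in1 U D) _ (fun _ => rfl), der_map_eq_zero (inN U D) _ (fun _ => rfl),
          mul_zero, add_zero]
      | add s t hs ht => simp only [map_add, hs, ht]
    rw [key, ← map_smul, ← map_smul] at h2
    have h3 := mulProd_injective ((map_injective_of_equiv _).1 h2)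
    -- The counting derivation acts on component j as j, while the hypothesis says that it acts as
    -- k.
    have hj : ∀ j, j ≠ k → LinearMap.rTensor (EA (D × U)) (proj j) s = 0 := by
      intro j hj
      have h4 := congrArg (LinearMap.rTensor (EA (D × U)) (proj j)) h3
      rw [← LinearMap.rTensor_comp_apply, map_smul] at h4
      have e : (proj j ∘ₗ der LinearMap.id : EA D →ₗ[ℂ] EA D) = (j : ℂ) • proj j :=
        LinearMap.ext fun a => by
          rw [LinearMap.comp_apply, ← der_proj, der_id_of_mem (proj_mem _ _)]
          rfl
      rw [e, LinearMap.rTensor_smul, LinearMap.smul_apply] at h4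
      by_contra h
      exact hj (Nat.cast_injective (R := ℂ) (smul_left_injective ℂ h h4))
    have hs : s = LinearMap.rTensor (EA (D × U)) (proj k) s := by
      have h5 : LinearMap.rTensor (EA (D × U)) (∑ i ∈ Finset.range (k + 1), proj i) s = s := by
        rw [sum_proj D (by omega), LinearMap.rTensor_id, LinearMap.id_apply]
      rw [← h5]
      have h6 : LinearMap.rTensor (EA (D × U)) (∑ i ∈ Finset.range (k + 1), proj i) s =
          ∑ i ∈ Finset.range (k + 1), LinearMap.rTensor (EA (D × U)) (proj i) s := by
        rw [← LinearMap.coe_rTensorHom, map_sum, LinearMap.sum_apply]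
      conv_lhs => rw [h6]
      rw [Finset.sum_eq_single_of_mem k (by simp) fun j _ hjk => hj j hjk, h5]
    obtain ⟨y, hy⟩ : ∃ y, s = ν ⊗ₜ y := by
      rw [hs]
      generalize s = s
      induction s using TensorProduct.induction_on with
      | zero => exact ⟨0, by simp⟩
      | tmul a y =>
        obtain ⟨c, hc⟩ := exists_smul_eq_of_top hk hν h0 (proj_mem k a)
        exact ⟨c • y, by rw [LinearMap.rTensor_tmul, hc, TensorProduct.smul_tmul]⟩
      | add s t hs ht =>
        obtain ⟨y, hy⟩ := hs
        obtain ⟨z, hz⟩ := ht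
        exact ⟨y + z, by rw [map_add, hy, hz, TensorProduct.tmul_add]⟩
    refine ⟨ofEA (proj k y) (proj_mem k y), ?_⟩
    rw [topMul_apply, toEA_ofEA, map_proj, ← proj_mul_of_mem (map_mem _ hν), ← map_qEquiv_mulProd,
      ← hy, ← two_mul, proj_of_mem h1]

theorem topMul_rep {G : Type*} [Group G] (ρ : Representation ℂ G U) (σ : Representation ℂ G D)
    {ν : EA D} (g : G) (hν : ExteriorAlgebra.map (σ g) ν = ν) (k : ℕ) (y : Ext k (D × U)) :
    topMul ν k (extRep (σ.prod ρ) k g y) = ExteriorAlgebra.map (actQ ρ σ g) (topMul ν k y) := by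
  rw [topMul_apply, topMul_apply, toEA_extRep, map_mul]
  conv_lhs => rw [← hν]
  rw [map_map_comm (g := actQ ρ σ g) (f := σ g), map_map_comm (g := actQ ρ σ g) (f := σ.prod ρ g)]
  · exact LinearMap.ext fun v => by simp [actQ, qEquiv]
  · exact LinearMap.ext fun v => by simp [actQ]

end Top


/-! ## The Fock space isomorphism -/

section Fock

variable (U E : Type*) [AddCommGroup U] [Module ℂ U] [AddCommGroup E] [Module ℂ E]

/-- The split symplectic space `U ⊕ E ⊕ E^*`. -/
abbrev VSp : Type _ := U × (E × Module.Dual ℂ E)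

/-- The inclusion of `E`. -/
abbrev inE : E →ₗ[ℂ] VSp U E := LinearMap.inr ℂ U _ ∘ₗ LinearMap.inl ℂ E _

/-- The projection to `E`. -/
abbrev prE : VSp U E →ₗ[ℂ] E := LinearMap.fst ℂ E _ ∘ₗ LinearMap.snd ℂ U _

/-- The inclusion of `U × E^*`. -/
abbrev inMV : MSp U E →ₗ[ℂ] VSp U E := LinearMap.id.prodMap (LinearMap.inr ℂ E _)

/-- The projection to `U × E^*`. -/
abbrev prMV : VSp U E →ₗ[ℂ] MSp U E := LinearMap.id.prodMap (LinearMap.snd ℂ E _)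

/-- The projection to `U × E^*`, with the second copy of `E^*`. -/
abbrev prMQ : QE U E →ₗ[ℂ] MSp U E := LinearMap.id.prodMap (LinearMap.snd ℂ _ _)

/-- The projection to the first copy of `E^*`. -/
abbrev prD : QE U E →ₗ[ℂ] Module.Dual ℂ E := LinearMap.fst ℂ _ _ ∘ₗ LinearMap.snd ℂ U _

/-- Creation and annihilation operators. -/
def fockOp : QE U E →ₗ[ℂ] Module.End ℂ (EA (VSp U E)) where
  toFun q := con (prD U E q ∘ₗ prE U E) + LinearMap.mulLeft ℂ (gen (inMV U E (prMQ U E q)))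
  map_add' q r := by
    refine LinearMap.ext fun a => ?_
    simp only [map_add, LinearMap.add_comp, LinearMap.add_apply, LinearMap.mulLeft_apply, add_mul]
    abel
  map_smul' c q := by
    refine LinearMap.ext fun a => ?_
    simp only [map_smul, LinearMap.smul_comp, LinearMap.add_apply, LinearMap.mulLeft_apply,
      smul_mul_assoc, LinearMap.smul_apply, RingHom.id_apply, smul_add]

variable {U E}

theorem fockOp_apply (q : QE U E) (a : EA (VSp U E)) : fockOp U E q a =
    con (prD U E q ∘ₗ prE U E) a + gen (inMV U E (prMQ U E q)) * a := rfl

/-- Contractions act along E only and multiplications use U ⊕ E^* only, so the two anticommute. This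
is what lets the exterior algebra act. -/
theorem fockOp_sq (q : QE U E) : fockOp U E q * fockOp U E q = 0 := by
  refine LinearMap.ext fun a => ?_
  have h : (prD U E q ∘ₗ prE U E) (inMV U E (prMQ U E q)) = 0 := map_zero (prD U E q)
  rw [Module.End.mul_apply, fockOp_apply, fockOp_apply, map_add, con_con, con_gen_mul, mul_add,
    gen_mul_gen_self_mul, h, zero_smul, LinearMap.zero_apply]
  abel

variable (U E) in
/-- The action of the exterior algebra on the Fock space. -/
def fockRep : EA (QE U E) →ₐ[ℂ] Module.End ℂ (EA (VSp U E)) :=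
  ExteriorAlgebra.lift ℂ ⟨fockOp U E, fockOp_sq⟩

theorem fockRep_gen (q : QE U E) : fockRep U E (gen q) = fockOp U E q :=
  ExteriorAlgebra.lift_ι_apply ..

variable {k : ℕ} (b : Module.Basis (Fin k) ℂ E)

variable (U) in
/-- The vacuum vector `e_1 ∧ ⋯ ∧ e_k`. -/
def vacuum : EA (VSp U E) := ExteriorAlgebra.ιMulti ℂ k fun i => inE U E (b i)

variable (U) in
/-- The Fock space isomorphism. -/
def fock : EA (QE U E) →ₗ[ℂ] EA (VSp U E) :=
  LinearMap.applyₗ (vacuum U b) ∘ₗ (fockRep U E).toLinearMap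

@[simp]
theorem fock_one : fock U b 1 = vacuum U b := by
  change fockRep U E 1 (vacuum U b) = _
  rw [map_one]
  rfl

@[simp]
theorem fock_gen_mul (q : QE U E) (t : EA (QE U E)) :
    fock U b (gen q * t) = fockOp U E q (fock U b t) := by
  change fockRep U E (gen q * t) (vacuum U b) = _
  rw [map_mul, fockRep_gen]
  rfl

theorem vacuum_mem : vacuum U b ∈ ⋀[ℂ]^k (VSp U E) := ιMulti_mem _

theorem gen_mul_ιMulti_self {W : Type*} [AddCommGroup W] [Module ℂ W] {n : ℕ} (v : Fin n → W)
    (w : W) (hw : w ∈ Submodule.span ℂ (Set.range v)) : gen w * ExteriorAlgebra.ιMulti ℂ n v = 0 := by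
  induction hw using Submodule.span_induction with
  | mem w hw =>
    obtain ⟨i, rfl⟩ := hw
    have h : ExteriorAlgebra.ιMulti ℂ (n + 1) (Matrix.vecCons (v i) v) =
        gen (v i) * ExteriorAlgebra.ιMulti ℂ n v := ExteriorAlgebra.ιMulti_succ_apply ..
    rw [← h]
    exact AlternatingMap.map_eq_zero_of_eq _ _ (i := 0) (j := i.succ) (by simp)
      (Fin.succ_ne_zero i).symm
  | zero => rw [map_zero, zero_mul]
  | add x y _ _ hx hy => rw [map_add, add_mul, hx, hy, add_zero]
  | smul c x _ hx => rw [map_smul, smul_mul_assoc, hx, smul_zero]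

theorem gen_inE_mul_vacuum (x : E) : gen (inE U E x) * vacuum U b = 0 := by
  refine gen_mul_ιMulti_self _ _ ?_
  have h : Submodule.span ℂ (Set.range fun i => inE U E (b i)) = (⊤ : Submodule ℂ E).map (inE U E) := by
    rw [← b.span_eq, Submodule.map_span, ← Set.range_comp]
    rfl
  rw [h]
  exact ⟨x, trivial, rfl⟩

/-- Multiplication by x ∈ E corresponds to contraction in the first copy of E^*: both give zero on
the vacuum and both have the same commutation rule with the generators. -/
theorem fock_con_ev1 (x : E) (t : EA (QE U E)) :
    fock U b (con (ev1 x) t) = gen (inE U E x) * fock U b t := by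
  induction t using EA.ind with
  | one => rw [con_one, map_zero, fock_one, gen_inE_mul_vacuum]
  | smul r a ha => simp only [map_smul, ha, mul_smul_comm]
  | add a c ha hc => simp only [map_add, ha, hc, mul_add]
  | mul q a ha =>
    have h1 : (prD U E q ∘ₗ prE U E) (inE U E x) = ev1 x q := rfl
    rw [con_gen_mul, map_sub, map_smul, fock_gen_mul, fock_gen_mul, ha, fockOp_apply, fockOp_apply,
      con_gen_mul, h1, gen_mul_gen_mul, mul_add, gen_mul_gen_mul]
    abel

theorem con_prU_fock (α : Module.Dual ℂ U) (t : EA (QE U E)) :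
    con (α ∘ₗ LinearMap.fst ℂ U _) (fock U b t) = fock U b (con (α ∘ₗ LinearMap.fst ℂ U _) t) := by
  induction t using EA.ind with
  | one =>
    rw [con_one, map_zero, fock_one]
    exact con_ιMulti_eq_zero _ _ fun i => map_zero α
  | smul r a ha => simp only [map_smul, ha]
  | add a c ha hc => simp only [map_add, ha, hc]
  | mul q a ha =>
    have h1 : (α ∘ₗ LinearMap.fst ℂ U (E × Module.Dual ℂ E)) (inMV U E (prMQ U E q)) =
      (α ∘ₗ LinearMap.fst ℂ U (Module.Dual ℂ E × Module.Dual ℂ E)) q := rfl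
    rw [fock_gen_mul, fockOp_apply, map_add, con_comm, con_gen_mul, ha, con_gen_mul, map_sub,
      map_smul, fock_gen_mul, fockOp_apply, h1]
    abel

theorem gen_inMV_mul_fock (m : MSp U E) (t : EA (QE U E)) :
    gen (inMV U E m) * fock U b t = fock U b (gen (inM U (Module.Dual ℂ E) m) * t) := by
  have h : prD U E (inM U (Module.Dual ℂ E) m) ∘ₗ prE U E = 0 := by
    have : prD U E (inM U (Module.Dual ℂ E) m) = 0 := rfl
    rw [this, LinearMap.zero_comp]
  rw [fock_gen_mul, fockOp_apply, h, map_zero, LinearMap.zero_apply, zero_add]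
  rfl

theorem con_prE_fock (β : Module.Dual ℂ E) (t : EA (QE U E)) :
    con (β ∘ₗ prE U E) (fock U b t) = fock U b (gen (in1 U (Module.Dual ℂ E) β) * t) := by
  have h : inMV U E (prMQ U E (in1 U (Module.Dual ℂ E) β)) = 0 := rfl
  rw [fock_gen_mul, fockOp_apply, h, map_zero, zero_mul, add_zero]
  rfl

/-- Contractions empty the vacuum one vector at a time, each by a covector that vanishes on the
remaining ones. -/
theorem one_mem_of_ιMulti_mem {R : Submodule ℂ (EA (VSp U E))}
    (hR : ∀ (β : Module.Dual ℂ E), ∀ a ∈ R, con (β ∘ₗ prE U E) a ∈ R) {n : ℕ} (v : Fin n → E)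
    (hv : LinearIndependent ℂ v) (h : ExteriorAlgebra.ιMulti ℂ n (fun i => inE U E (v i)) ∈ R) :
    (1 : EA (VSp U E)) ∈ R := by
  induction n with
  | zero => rwa [ExteriorAlgebra.ιMulti_zero_apply] at h
  | succ n ih =>
    obtain ⟨h1, h2⟩ := linearIndependent_finSucc.1 hv
    obtain ⟨α, h3, h4⟩ := Submodule.exists_le_ker_of_notMem h2
    have h5 : ∀ i, α (v (Fin.succ i)) = 0 := fun i =>
      h4 (Submodule.subset_span ⟨i, rfl⟩)
    have h6 := hR α _ h
    have h7 : (α ∘ₗ prE U E) (inE U E (v 0)) = α (v 0) := rfl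
    rw [ιMulti_succ_eq, con_gen_mul, con_ιMulti_eq_zero (fun i => inE U E (v (Fin.succ i))) (α ∘ₗ prE U E) h5, mul_zero, sub_zero, h7,
      Submodule.smul_mem_iff _ h3] at h6
    exact ih _ h1 h6

variable [FiniteDimensional ℂ U] [FiniteDimensional ℂ E]

/-- The image contains 1 and is stable under multiplication by E (a contraction upstairs) and by U ⊕
E^*. -/
theorem fock_surjective : Function.Surjective (fock U b) := by
  have h1 : (1 : EA (VSp U E)) ∈ LinearMap.range (fock U b) := by
    refine one_mem_of_ιMulti_mem ?_ b b.linearIndependent ⟨1, fock_one b⟩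
    rintro β _ ⟨t, rfl⟩
    exact ⟨_, (con_prE_fock b β t).symm⟩
  intro a
  change a ∈ LinearMap.range (fock U b)
  induction a using EA.ind with
  | one => exact h1
  | smul r a ha => exact Submodule.smul_mem _ _ ha
  | add a c ha hc => exact add_mem ha hc
  | mul v a ha =>
    obtain ⟨t, rfl⟩ := ha
    have hv : v = inE U E (prE U E v) + inMV U E (prMV U E v) := by
      refine Prod.ext ?_ (Prod.ext ?_ ?_) <;> simp
    rw [hv, map_add, add_mul, ← fock_con_ev1, gen_inMV_mul_fock]
    exact add_mem ⟨_, rfl⟩ ⟨_, rfl⟩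

theorem fock_bijective : Function.Bijective (fock U b) := by
  refine ⟨(LinearMap.injective_iff_surjective_of_finrank_eq_finrank ?_).2 (fock_surjective b),
    fock_surjective b⟩
  rw [finrank_EA, finrank_EA]
  simp [Module.finrank_prod, Subspace.dual_finrank_eq]

/-- The weights of the Fock space isomorphism. -/
theorem fock_der (t : EA (QE U E)) :
    der LinearMap.id (fock U b t) =
      fock U b ((k : ℂ) • t + der LinearMap.id t - (2 : ℂ) • der (pr1 U (Module.Dual ℂ E)) t) := by
  induction t using EA.ind with
  | one =>
    simp only [der_one, fock_one, der_id_of_mem (vacuum_mem b), add_zero, smul_zero, sub_zero,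
      map_smul]
  | smul r a ih => simp only [map_smul, map_add, map_sub] at ih ⊢; rw [ih]; module
  | add a c ih ih' => simp only [map_smul, map_add, map_sub] at ih ih' ⊢; rw [ih, ih']; module
  | mul q a ha =>
    have h1 := con_der (prD U E q ∘ₗ prE U E) LinearMap.id (fock U b a)
    have h2 : fock U b (gen (pr1 U (Module.Dual ℂ E) q) * a) =
        con (prD U E q ∘ₗ prE U E) (fock U b a) := (con_prE_fock b _ a).symm
    rw [LinearMap.comp_id, ← sub_eq_iff_eq_add] at h1
    rw [fock_gen_mul, fockOp_apply, map_add, ← h1, der_gen_mul, der_gen_mul, der_gen_mul,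
      LinearMap.id_apply, LinearMap.id_apply, ha]
    simp only [map_add, map_sub, map_smul, smul_add, mul_add, h2, fock_gen_mul, fockOp_apply,
      mul_sub, mul_smul_comm]
    module

/-- Elements of `Λ^k` have twice as many generators as generators of the first kind. -/
theorem two_smul_der_pr1 {t : EA (QE U E)} (ht : fock U b t ∈ ⋀[ℂ]^k (VSp U E)) :
    (2 : ℂ) • der (pr1 U (Module.Dual ℂ E)) t = der LinearMap.id t := by
  have h := fock_der b t
  rw [der_id_of_mem ht, ← map_smul] at h
  have h2 := (fock_bijective b).1 h
  rw [eq_comm, sub_eq_iff_eq_add, add_right_inj] at h2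
  exact h2.symm

/-- Equivariance of the Fock space isomorphism. -/
theorem fock_map (gV : VSp U E →ₗ[ℂ] VSp U E) (gQ : QE U E →ₗ[ℂ] QE U E) (δ : ℂ)
    (h1 : ∀ q, gV (inMV U E (prMQ U E q)) = inMV U E (prMQ U E (gQ q)))
    (h2 : ∀ q v, prD U E (gQ q) (prE U E (gV v)) = prD U E q (prE U E v))
    (h3 : ExteriorAlgebra.map gV (vacuum U b) = δ • vacuum U b) (t : EA (QE U E)) :
    ExteriorAlgebra.map gV (fock U b t) = δ • fock U b (ExteriorAlgebra.map gQ t) := by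
  induction t using EA.ind with
  | one => rw [map_one (ExteriorAlgebra.map gQ), fock_one, h3]
  | smul r a ha => simp only [map_smul, ha, smul_comm δ r]
  | add a c ha hc => simp only [map_add, ha, hc, smul_add]
  | mul q a ha =>
    have e : (prD U E (gQ q) ∘ₗ prE U E) ∘ₗ gV = prD U E q ∘ₗ prE U E := LinearMap.ext (h2 q)
    rw [fock_gen_mul, fockOp_apply, map_add, map_mul, ← e, ← map_con, ha,
      ExteriorAlgebra.map_apply_ι, h1, map_mul, ExteriorAlgebra.map_apply_ι, fock_gen_mul,
      fockOp_apply, map_smul, mul_smul_comm, smul_add]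

end Fock

/-! ### The contraction with the symplectic form in Fock coordinates. -/

section FockContraction

variable {U E : Type*} [AddCommGroup U] [Module ℂ U] [AddCommGroup E] [Module ℂ E]
  [FiniteDimensional ℂ U] [FiniteDimensional ℂ E]

variable (E) in
/-- The symplectic form on `U ⊕ E ⊕ E^*`. -/
def splitForm (ωU : LinearMap.BilinForm ℂ U) : LinearMap.BilinForm ℂ (VSp U E) :=
  LinearMap.mk₂ ℂ (fun v w => ωU v.1 w.1 + w.2.2 v.2.1 - v.2.2 w.2.1)
    (fun v v' w => by simp; ring) (fun c v w => by simp; ring)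
    (fun v v' w => by simp; ring) (fun c v w => by simp; ring)

@[simp]
theorem splitForm_apply (ωU : LinearMap.BilinForm ℂ U) (v w : VSp U E) :
    splitForm E ωU v w = ωU v.1 w.1 + w.2.2 v.2.1 - v.2.2 w.2.1 := rfl

variable {ωU : LinearMap.BilinForm ℂ U}

theorem splitForm_alt (ha : ωU.IsAlt) : (splitForm E ωU).IsAlt := fun v => by
  simp [ha.self_eq_zero]

theorem splitForm_nondegenerate (ha : ωU.IsAlt) (hn : ωU.Nondegenerate) :
    (splitForm E ωU).Nondegenerate := by
  have key : ∀ v : VSp U E, (∀ w, splitForm E ωU v w = 0) → v = 0 := by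
    rintro ⟨u, x, f⟩ h
    have hu : u = 0 := hn.1 u fun u' => by simpa using h (u', 0, 0)
    have hx : x = 0 := (Module.forall_dual_apply_eq_zero_iff ℂ x).1 fun f' => by
      simpa using h (0, 0, f')
    have hf : f = 0 := LinearMap.ext fun x' => by simpa using h (0, x', 0)
    rw [hu, hx, hf]
    rfl
  refine ⟨key, fun v h => key v fun w => ?_⟩
  rw [← (splitForm_alt ha).neg_eq, h, neg_zero]

variable {κ : Type*} [Fintype κ] [DecidableEq κ] {c : Module.Basis κ ℂ U} {c' : κ → U}

variable (E ωU c c') in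
/-- The contraction with the form of `U`. -/
def contrU : EA (QE U E) →ₗ[ℂ] EA (QE U E) :=
  -∑ i, con (ωU (c i) ∘ₗ LinearMap.fst ℂ U _) ∘ₗ con (ωU (c' i) ∘ₗ LinearMap.fst ℂ U _)

theorem contrU_apply (a : EA (QE U E)) : contrU E ωU c c' a =
    -∑ i, con (ωU (c i) ∘ₗ LinearMap.fst ℂ U _) (con (ωU (c' i) ∘ₗ LinearMap.fst ℂ U _) a) := by
  simp [contrU]

theorem contrU_proj (n : ℕ) (a : EA (QE U E)) :
    proj n (contrU E ωU c c' a) = contrU E ωU c c' (proj (n + 2) a) := by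
  rw [contrU_apply, contrU_apply, map_neg, map_sum]
  simp only [← con_proj_succ]

theorem contrU_gen_mul (ha : ωU.IsAlt) (hn : ωU.Nondegenerate)
    (h : ∀ i j, ωU (c i) (c' j) = if i = j then 1 else 0) (q : QE U E) (a : EA (QE U E)) :
    contrU E ωU c c' (gen q * a) = gen q * contrU E ωU c c' a +
      (2 : ℂ) • con (ωU q.1 ∘ₗ LinearMap.fst ℂ U _) a := by
  have hL : ∀ v : U, ωU v ∘ₗ LinearMap.fst ℂ U (Module.Dual ℂ E × Module.Dual ℂ E) =
      ((LinearMap.fst ℂ U (Module.Dual ℂ E × Module.Dual ℂ E)).dualMap ∘ₗ ωU) v := fun v => rfl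
  have key : ∀ i, con (ωU (c i) ∘ₗ LinearMap.fst ℂ U _)
      (con (ωU (c' i) ∘ₗ LinearMap.fst ℂ U _) (gen q * a)) =
      con (ωU (ωU (c' i) q.1 • c i) ∘ₗ LinearMap.fst ℂ U _) a -
        con (ωU (ωU (c i) q.1 • c' i) ∘ₗ LinearMap.fst ℂ U _) a +
        gen q * con (ωU (c i) ∘ₗ LinearMap.fst ℂ U _)
          (con (ωU (c' i) ∘ₗ LinearMap.fst ℂ U _) a) := fun i => by
    simp only [map_smul, LinearMap.smul_comp, con_gen_mul, map_sub, LinearMap.smul_apply]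
    simp only [LinearMap.comp_apply, LinearMap.fst_apply]
    abel
  rw [contrU_apply, contrU_apply, Finset.sum_congr rfl fun i _ => key i, Finset.sum_add_distrib,
    Finset.sum_sub_distrib, ← Finset.mul_sum]
  have e1 : ∑ i, con (ωU (ωU (c' i) q.1 • c i) ∘ₗ LinearMap.fst ℂ U _) a =
      -con (ωU q.1 ∘ₗ LinearMap.fst ℂ U _) a := by
    have : ∑ i, ωU (c' i) q.1 • c i = -q.1 := by
      have : ∀ i, ωU (c' i) q.1 • c i = -(ωU q.1 (c' i) • c i) := fun i => by
        rw [← ha.neg_eq q.1 (c' i), neg_smul]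
      simp_rw [this]
      rw [Finset.sum_neg_distrib, sum_dual_left h]
    simp only [hL]
    rw [← LinearMap.neg_apply, ← map_neg, ← map_neg, ← this]
    simp only [map_sum, LinearMap.sum_apply]
  have e2 : ∑ i, con (ωU (ωU (c i) q.1 • c' i) ∘ₗ LinearMap.fst ℂ U _) a =
      con (ωU q.1 ∘ₗ LinearMap.fst ℂ U _) a := by
    simp only [hL]
    conv_rhs => rw [← sum_dual_right hn h q.1]
    simp only [map_sum, LinearMap.sum_apply]
  rw [e1, e2, two_smul]
  noncomm_ring

theorem contr_con_comm {W : Type*} [AddCommGroup W] [Module ℂ W] {ω : LinearMap.BilinForm ℂ W}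
    {κ : Type*} [Fintype κ] [DecidableEq κ] {b : Module.Basis κ ℂ W} {b' : κ → W}
    (α : Module.Dual ℂ W) (a : EA W) :
    contr ω b b' (con α a) = con α (contr ω b b' a) := by
  rw [contr_apply, contr_apply, map_neg, map_sum]
  congr 1
  refine Finset.sum_congr rfl fun i _ => ?_
  rw [con_comm _ α, map_neg, con_comm _ α, neg_neg]

/-- The contraction on `U ⊕ E ⊕ E^*` in terms of the Fock space isomorphism. -/
theorem contr_fock (ha : ωU.IsAlt) (hn : ωU.Nondegenerate)
    (h : ∀ i j, ωU (c i) (c' j) = if i = j then 1 else 0)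
    {κ₀ : Type*} [Fintype κ₀] [DecidableEq κ₀] {d : Module.Basis κ₀ ℂ (VSp U E)}
    {d' : κ₀ → VSp U E} (hd : ∀ i j, splitForm E ωU (d i) (d' j) = if i = j then 1 else 0)
    {k : ℕ} (b : Module.Basis (Fin k) ℂ E) (t : EA (QE U E)) :
    contr (splitForm E ωU) d d' (fock U b t) =
      fock U b (contrU E ωU c c' t - (2 : ℂ) • der (shift U (Module.Dual ℂ E)) t) := by
  have ha' := splitForm_alt (E := E) ha
  have hn' := splitForm_nondegenerate (E := E) ha hn
  induction t using EA.ind with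
  | one =>
    have h0 : contrU E ωU c c' 1 = 0 := by simp [contrU_apply]
    rw [fock_one, h0, der_one, smul_zero, sub_zero, map_zero]
    exact contr_ιMulti ha' hn' hd _ fun i j => by simp
  | smul r a ih => simp only [map_smul, map_sub] at ih ⊢; rw [ih]; module
  | add a c ih ih' => simp only [map_smul, map_add, map_sub] at ih ih' ⊢; rw [ih, ih']; module
  | mul q a ih =>
    -- The covector of a generator has a U-part, which gives the contraction on U, and an E^*-part,
    -- which is contraction along E; the latter is a generator of the first copy, hence the shift.
    have e1 : splitForm E ωU (inMV U E (prMQ U E q)) =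
        ωU q.1 ∘ₗ LinearMap.fst ℂ U _ - q.2.2 ∘ₗ prE U E := by
      refine LinearMap.ext fun w => ?_
      simp
    have e2 : shift U (Module.Dual ℂ E) q = in1 U _ q.2.2 := rfl
    rw [fock_gen_mul, fockOp_apply, map_add, contr_con_comm, contr_gen_mul ha' hn' hd, ih, e1,
      map_sub con, LinearMap.sub_apply, con_prU_fock, contrU_gen_mul ha hn h,
      der_gen_mul, e2]
    simp only [map_add, map_sub, map_smul, smul_add, smul_sub]
    rw [← con_prE_fock, fock_gen_mul, fock_gen_mul, fockOp_apply, fockOp_apply]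
    simp only [mul_sub, mul_smul_comm, smul_add]
    module

end FockContraction


/-! ## The splitting of `V` given by an isotropic flag -/

namespace IsotropicFlag

variable {V : Type*} [AddCommGroup V] [Module ℂ V] [FiniteDimensional ℂ V] (S : IsotropicFlag V)

/-- The pairing `F → E^*`. -/
def pairF : S.F →ₗ[ℂ] Module.Dual ℂ S.E :=
  S.E.subtype.dualMap ∘ₗ S.ω.flip ∘ₗ S.F.subtype

theorem pairF_apply (y : S.F) (x : S.E) : S.pairF y x = S.ω x y := rfl

theorem E_le_perp : S.E ≤ S.perp := fun x hx y hy => S.isotropic_E y hy x hx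

theorem exists_eq_form (f : Module.Dual ℂ V) : ∃ v, ∀ x, S.ω x v = f x := by
  have h : Function.Injective S.ω.flip := by
    rw [injective_iff_map_eq_zero]
    exact fun v hv => S.nondeg.2 v fun x => LinearMap.congr_fun hv x
  obtain ⟨v, hv⟩ := (LinearMap.injective_iff_surjective_of_finrank_eq_finrank
    (Subspace.dual_finrank_eq (K := ℂ) (V := V)).symm).1 h f
  exact ⟨v, fun x => LinearMap.congr_fun hv x⟩

/-- Injective because F meets E^⊥ trivially. For surjectivity a form on E is extended to V and
represented by a vector, whose E^⊥-component is invisible on E. -/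
theorem pairF_bijective : Function.Bijective S.pairF := by
  constructor
  · rw [injective_iff_map_eq_zero]
    intro y hy
    have h1 : (y : V) ∈ S.perp := fun x hx => LinearMap.congr_fun hy ⟨x, hx⟩
    have h2 : (y : V) ∈ S.perp ⊓ S.F := ⟨h1, y.2⟩
    rw [S.compl.inf_eq_bot] at h2
    exact Subtype.ext ((Submodule.mem_bot ℂ).1 h2)
  · intro f
    obtain ⟨g, hg⟩ := f.exists_extend
    obtain ⟨v, hv⟩ := S.exists_eq_form g
    have h : v ∈ S.perp ⊔ S.F := by rw [S.compl.sup_eq_top]; trivial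
    obtain ⟨p, hp, y, hy, rfl⟩ := Submodule.mem_sup.1 h
    refine ⟨⟨y, hy⟩, LinearMap.ext fun x => ?_⟩
    have h3 := hv x
    rw [map_add, show S.ω x p = 0 from hp x x.2, zero_add] at h3
    rw [pairF_apply, h3, ← hg]
    rfl

/-- The isomorphism `E^* ≃ F`, as a map to `V`. -/
def dualIncl : Module.Dual ℂ S.E →ₗ[ℂ] V :=
  S.F.subtype ∘ₗ (LinearEquiv.ofBijective S.pairF S.pairF_bijective).symm.toLinearMap

theorem dualIncl_mem (f : Module.Dual ℂ S.E) : S.dualIncl f ∈ S.F :=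
  ((LinearEquiv.ofBijective S.pairF S.pairF_bijective).symm f).2

@[simp]
theorem form_dualIncl (x : S.E) (f : Module.Dual ℂ S.E) : S.ω x (S.dualIncl f) = f x :=
  LinearMap.congr_fun ((LinearEquiv.ofBijective S.pairF S.pairF_bijective).apply_symm_apply f) x

theorem dualIncl_eq {y : V} (hy : y ∈ S.F) {f : Module.Dual ℂ S.E} (h : ∀ x : S.E, S.ω x y = f x) :
    S.dualIncl f = y := by
  have : S.pairF ⟨y, hy⟩ = f := LinearMap.ext h
  rw [← this]
  exact congrArg Subtype.val ((LinearEquiv.ofBijective S.pairF S.pairF_bijective).symm_apply_apply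
    ⟨y, hy⟩)

theorem form_dualIncl_left (x : S.E) (f : Module.Dual ℂ S.E) : S.ω (S.dualIncl f) x = -f x := by
  rw [← S.alt.neg_eq, form_dualIncl]

/-- The projection of `E^⊥` to `E^⊥ ∩ F^⊥` along `E`. -/
def perpProj : S.perp →ₗ[ℂ] V :=
  S.perp.subtype + S.E.subtype ∘ₗ (Module.evalEquiv ℂ S.E).symm.toLinearMap ∘ₗ
    S.dualIncl.dualMap ∘ₗ S.ω.flip ∘ₗ S.perp.subtype

/-- The functional β ↦ ω(β, y) on E^* ≃ F is evaluation at some x ∈ E; adding this x makes y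
orthogonal to F. -/
theorem exists_perpProj (y : S.perp) : ∃ x : S.E, S.perpProj y = y + x ∧
    ∀ β, β x = S.ω (S.dualIncl β) y :=
  ⟨(Module.evalEquiv ℂ S.E).symm (S.dualIncl.dualMap (S.ω.flip y)), rfl, fun _ =>
    Module.apply_evalEquiv_symm_apply ..⟩

theorem perpProj_eq {y : S.perp} {x : S.E} (h : ∀ β, S.ω (S.dualIncl β) y = β x) :
    S.perpProj y = y + x := by
  obtain ⟨x', h1, h2⟩ := S.exists_perpProj y
  have : x' = x := by
    rw [← sub_eq_zero, ← Module.forall_dual_apply_eq_zero_iff ℂ]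
    intro β
    rw [map_sub, h2, h, sub_self]
  rw [h1, this]

/-- The inclusion of `U` as `E^⊥ ∩ F^⊥`. -/
def inclU : S.U →ₗ[ℂ] V := (S.E.submoduleOf S.perp).liftQ S.perpProj fun y hy => by
  have h := S.perpProj_eq (y := y) (x := -⟨y, hy⟩) fun _ => by
    rw [map_neg]
    exact S.form_dualIncl_left ⟨y, hy⟩ _
  rw [LinearMap.mem_ker, h]
  simp

theorem inclU_mk (y : S.perp) : S.inclU (Submodule.Quotient.mk y) = S.perpProj y := rfl

theorem inclU_mem (u : S.U) : S.inclU u ∈ S.perp := by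
  induction u using Submodule.Quotient.induction_on with
  | _ y =>
    obtain ⟨x, h, -⟩ := S.exists_perpProj y
    rw [inclU_mk, h]
    exact add_mem y.2 (S.E_le_perp x.2)

theorem mk_inclU (u : S.U) : Submodule.Quotient.mk ⟨S.inclU u, S.inclU_mem u⟩ = u := by
  induction u using Submodule.Quotient.induction_on with
  | _ y =>
    obtain ⟨x, h, -⟩ := S.exists_perpProj y
    rw [Submodule.Quotient.eq]
    change S.inclU (Submodule.Quotient.mk y) - y ∈ S.E
    rw [inclU_mk, h, add_sub_cancel_left]
    exact x.2

theorem form_dualIncl_inclU (β : Module.Dual ℂ S.E) (u : S.U) :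
    S.ω (S.dualIncl β) (S.inclU u) = 0 := by
  induction u using Submodule.Quotient.induction_on with
  | _ y =>
    obtain ⟨x, h, h2⟩ := S.exists_perpProj y
    rw [inclU_mk, h, map_add, form_dualIncl_left, h2, add_neg_cancel]

theorem inclU_mk_eq {y : S.perp} (h : ∀ β, S.ω (S.dualIncl β) y = 0) :
    S.inclU (Submodule.Quotient.mk y) = y := by
  rw [inclU_mk, S.perpProj_eq (x := 0) fun β => by rw [h, map_zero]]
  simp

theorem form_inclU (u u' : S.U) : S.ω (S.inclU u) (S.inclU u') = S.formU u u' := by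
  conv_rhs => rw [← S.mk_inclU u, ← S.mk_inclU u', formU_mk]

theorem formU_alt : S.formU.IsAlt := fun u => by rw [← form_inclU, S.alt.self_eq_zero]

/-- The map `U ⊕ E ⊕ E^* → V`. -/
def split : VSp S.U S.E →ₗ[ℂ] V :=
  S.inclU.coprod (S.E.subtype.coprod S.dualIncl)

theorem split_apply (v : VSp S.U S.E) :
    S.split v = S.inclU v.1 + (v.2.1 + S.dualIncl v.2.2) := rfl

theorem form_split (v w : VSp S.U S.E) :
    S.ω (S.split v) (S.split w) = splitForm S.E S.formU v w := by
  have h1 : ∀ (x : S.E) (u : S.U), S.ω x (S.inclU u) = 0 := fun x u => S.inclU_mem u x x.2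
  have h2 : ∀ (x : S.E) (u : S.U), S.ω (S.inclU u) x = 0 := fun x u => by
    rw [← S.alt.neg_eq, h1, neg_zero]
  have h3 : ∀ (β : Module.Dual ℂ S.E) (u : S.U), S.ω (S.inclU u) (S.dualIncl β) = 0 := fun β u => by
    rw [← S.alt.neg_eq, form_dualIncl_inclU, neg_zero]
  have h4 : ∀ x y : S.E, S.ω x y = 0 := fun x y => S.isotropic_E x x.2 y y.2
  have h5 : ∀ f g, S.ω (S.dualIncl f) (S.dualIncl g) = 0 := fun f g =>
    S.isotropic_F _ (S.dualIncl_mem f) _ (S.dualIncl_mem g)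
  simp only [split_apply, map_add, LinearMap.add_apply, h1, h2, h3, h4, h5, form_dualIncl_inclU,
    form_dualIncl, form_dualIncl_left, form_inclU, splitForm_apply]
  ring

theorem split_bijective : Function.Bijective S.split := by
  constructor
  · rw [injective_iff_map_eq_zero]
    rintro ⟨u, x, f⟩ h
    have hf : f = 0 := LinearMap.ext fun x' => by
      have h2 := S.form_split (0, x', 0) (u, x, f)
      rw [h, map_zero] at h2
      simpa using h2.symm
    have hx : x = 0 := (Module.forall_dual_apply_eq_zero_iff ℂ x).1 fun f' => by
      have h2 := S.form_split (u, x, f) (0, 0, f')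
      rw [h, map_zero] at h2
      simpa using h2.symm
    subst hf hx
    rw [split_apply, map_zero, Submodule.coe_zero, add_zero, add_zero] at h
    have h3 := S.mk_inclU u
    have h4 : (⟨S.inclU u, S.inclU_mem u⟩ : S.perp) = 0 := Subtype.ext h
    rw [h4] at h3
    rw [← h3]
    rfl
  · intro v
    have h : v ∈ S.perp ⊔ S.F := by rw [S.compl.sup_eq_top]; trivial
    obtain ⟨p, hp, y, hy, rfl⟩ := Submodule.mem_sup.1 h
    obtain ⟨x, hx, -⟩ := S.exists_perpProj ⟨p, hp⟩
    refine ⟨(Submodule.Quotient.mk ⟨p, hp⟩, -x, S.pairF ⟨y, hy⟩), ?_⟩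
    rw [split_apply, inclU_mk, hx, S.dualIncl_eq hy fun x => rfl]
    simp

/-- The isometry `U ⊕ E ⊕ E^* ≃ V`. -/
def splitEquiv : VSp S.U S.E ≃ₗ[ℂ] V := LinearEquiv.ofBijective S.split S.split_bijective

theorem formU_nondegenerate : S.formU.Nondegenerate := by
  have key : ∀ u, (∀ u', S.formU u u' = 0) → u = 0 := fun u h => by
    have h2 : S.split (u, 0, 0) = 0 := S.nondeg.1 _ fun v => by
      obtain ⟨w, rfl⟩ := S.split_bijective.2 v
      rw [form_split]
      simp [h]
    exact congrArg Prod.fst (S.split_bijective.1 (h2.trans (map_zero _).symm))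
  exact ⟨key, fun u h => key u fun u' => by rw [← S.formU_alt.neg_eq, h, neg_zero]⟩

theorem finrank_U_add : Module.finrank ℂ S.U + 2 * Module.finrank ℂ S.E = Module.finrank ℂ V := by
  rw [← S.splitEquiv.finrank_eq, Module.finrank_prod, Module.finrank_prod,
    Subspace.dual_finrank_eq]
  ring

theorem repV_dualIncl (h : S.H) (f : Module.Dual ℂ S.E) :
    S.repV h (S.dualIncl f) = S.dualIncl (S.repE.dual h f) := by
  refine (S.dualIncl_eq ?_ fun x => ?_).symm
  · have h1 : S.F.map (S.repV h) = S.F := h.2.2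
    rw [← h1]
    exact ⟨_, S.dualIncl_mem f, rfl⟩
  · have e : S.repV h (S.repV h⁻¹ x) = x := by
      rw [← Module.End.mul_apply, ← map_mul]; simp
    have e2 : S.repV h⁻¹ x = (S.repE h⁻¹ x : S.E) := rfl
    rw [← e, repV_form, e2, form_dualIncl]
    rfl

/-- The image of U is E^⊥ ∩ F^⊥, which is preserved because E, F and the form are. -/
theorem repV_inclU (h : S.H) (u : S.U) : S.repV h (S.inclU u) = S.inclU (S.repU h u) := by
  have e : S.repU h u = Submodule.Quotient.mk
      ⟨S.repV h (S.inclU u), S.le_comap_perp h (S.inclU_mem u)⟩ := by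
    conv_lhs => rw [← S.mk_inclU u]
    rfl
  rw [e, S.inclU_mk_eq]
  intro β
  have e1 : S.dualIncl β = S.repV h (S.dualIncl (S.repE.dual h⁻¹ β)) := by
    rw [repV_dualIncl, ← Module.End.mul_apply, ← map_mul, mul_inv_cancel, map_one]
    rfl
  rw [e1, repV_form, form_dualIncl_inclU]

/-- The action of `H` on `U ⊕ E ⊕ E^*`. -/
def repSplit : Representation ℂ S.H (VSp S.U S.E) := S.repU.prod (S.repE.prod S.repE.dual)

theorem repV_split (h : S.H) (v : VSp S.U S.E) :
    S.repV h (S.split v) = S.split (S.repSplit h v) := by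
  rw [split_apply, map_add, map_add, repV_inclU, repV_dualIncl]
  rfl

/-- The symplectic automorphism of `V` given by one of `U ⊕ E ⊕ E^*`. -/
def ofSplit (g : VSp S.U S.E ≃ₗ[ℂ] VSp S.U S.E)
    (hg : ∀ v w, splitForm S.E S.formU (g v) (g w) = splitForm S.E S.formU v w) : spGroup S.ω :=
  ⟨S.splitEquiv.symm.trans (g.trans S.splitEquiv), fun x y => by
    obtain ⟨v, rfl⟩ := S.splitEquiv.surjective x
    obtain ⟨w, rfl⟩ := S.splitEquiv.surjective y
    change S.ω (S.split (g (S.splitEquiv.symm (S.splitEquiv v))))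
      (S.split (g (S.splitEquiv.symm (S.splitEquiv w)))) = S.ω (S.split v) (S.split w)
    rw [LinearEquiv.symm_apply_apply, LinearEquiv.symm_apply_apply, form_split, form_split, hg]⟩

theorem ofSplit_split (g : VSp S.U S.E ≃ₗ[ℂ] VSp S.U S.E)
    (hg : ∀ v w, splitForm S.E S.formU (g v) (g w) = splitForm S.E S.formU v w)
    (v : VSp S.U S.E) : spRep S.ω (S.ofSplit g hg) (S.split v) = S.split (g v) := by
  change S.splitEquiv (g (S.splitEquiv.symm (S.splitEquiv v))) = _
  rw [LinearEquiv.symm_apply_apply]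
  rfl

theorem map_F_eq {z : spGroup S.ω} {g : Module.Dual ℂ S.E ≃ₗ[ℂ] Module.Dual ℂ S.E}
    (h : ∀ f, spRep S.ω z (S.dualIncl f) = S.dualIncl (g f)) : S.F.map (spRep S.ω z) = S.F := by
  have hF : S.F = LinearMap.range S.dualIncl := by
    refine le_antisymm (fun y hy => ⟨_, S.dualIncl_eq hy (f := S.pairF ⟨y, hy⟩) fun x => rfl⟩) ?_
    rintro _ ⟨f, rfl⟩
    exact S.dualIncl_mem f
  rw [hF, LinearMap.range_eq_map, ← Submodule.map_comp]
  have : spRep S.ω z ∘ₗ S.dualIncl = S.dualIncl ∘ₗ g.toLinearMap := LinearMap.ext h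
  rw [this, Submodule.map_comp, ← LinearMap.range_eq_map, LinearEquiv.range]

/-- The block diagonal map with blocks g, f and the inverse transpose of f on U, E and E^*. -/
theorem exists_mem_H (f : SpecialLinearGroup ℂ S.E) (g : spGroup S.formU) :
    ∃ h : S.H, (∀ x, S.repE h x = f x) ∧ ∀ u, S.repU h u = spRep S.formU g u := by
  set m : VSp S.U S.E ≃ₗ[ℂ] VSp S.U S.E :=
    LinearEquiv.prodCongr g.1 (LinearEquiv.prodCongr f.1 f.1.symm.dualMap) with hm
  have hm' : ∀ v w, splitForm S.E S.formU (m v) (m w) = splitForm S.E S.formU v w := fun v w => by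
    have h1 : ∀ (x : S.E) (α : Module.Dual ℂ S.E), f.1.symm.dualMap α (f.1 x) = α x := fun x α => by
      rw [LinearEquiv.dualMap_apply, LinearEquiv.symm_apply_apply]
    have h2 : ∀ u u', S.formU (g.1 u) (g.1 u') = S.formU u u' := g.2
    change S.formU (g.1 v.1) (g.1 w.1) + f.1.symm.dualMap w.2.2 (f.1 v.2.1) -
      f.1.symm.dualMap v.2.2 (f.1 w.2.1) = _
    rw [h1, h1, h2]
    rfl
  have hE : ∀ x : S.E, spRep S.ω (S.ofSplit m hm') x = (f x : S.E) := fun x => by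
    have := S.ofSplit_split m hm' (0, x, 0)
    have e : m (0, x, 0) = (0, f x, 0) := by
      refine Prod.ext (map_zero g.1) (Prod.ext rfl (map_zero f.1.symm.dualMap))
    rw [e] at this
    simpa [split_apply] using this
  refine ⟨⟨S.ofSplit m hm', ⟨f, hE⟩, ?_⟩, fun x => ?_, fun u => ?_⟩
  · refine S.map_F_eq (g := f.1.symm.dualMap) fun α => ?_
    have := S.ofSplit_split m hm' (0, 0, α)
    have e : m (0, 0, α) = (0, 0, f.1.symm.dualMap α) :=
      Prod.ext (map_zero g.1) (Prod.ext (map_zero f.1) rfl)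
    rw [e] at this
    simpa [split_apply] using this
  · exact Subtype.ext (hE x)
  · have h1 := S.repV_split ⟨S.ofSplit m hm', ⟨f, hE⟩, S.map_F_eq (g := f.1.symm.dualMap) fun α => by
      have := S.ofSplit_split m hm' (0, 0, α)
      have e : m (0, 0, α) = (0, 0, f.1.symm.dualMap α) :=
        Prod.ext (map_zero g.1) (Prod.ext (map_zero f.1) rfl)
      rw [e] at this
      simpa [split_apply] using this⟩ (u, 0, 0)
    have h2 := h1.symm.trans (S.ofSplit_split m hm' (u, 0, 0))
    exact congrArg Prod.fst (S.split_bijective.1 h2)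

/-- The action on F is dual to the one on E, so the actions on E and U determine all of V. -/
theorem H_ext {h h' : S.H} (hE : ∀ x, S.repE h x = S.repE h' x)
    (hU : ∀ u, S.repU h u = S.repU h' u) : h = h' := by
  have hd : ∀ f, S.repE.dual h f = S.repE.dual h' f := fun f => LinearMap.ext fun x => by
    have e : S.repE h (S.repE h'⁻¹ x) = x := by
      rw [hE, ← Module.End.mul_apply, ← map_mul]; simp
    have e2 : S.repE h⁻¹ x = S.repE h'⁻¹ x := by
      conv_lhs => rw [← e]
      rw [← Module.End.mul_apply, ← map_mul]; simp
    exact congrArg f e2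
  refine Subtype.ext (Subtype.ext (LinearEquiv.ext fun v => ?_))
  obtain ⟨w, rfl⟩ := S.split_bijective.2 v
  change S.repV h _ = S.repV h' _
  rw [repV_split, repV_split]
  exact congrArg S.split (Prod.ext (hU _) (Prod.ext (hE _) (hd _)))

theorem det_repE (h : S.H) : LinearMap.det (S.repE h) = 1 := by
  obtain ⟨⟨a, ha⟩, -⟩ := h.2
  have : S.repE h = (a : S.E ≃ₗ[ℂ] S.E).toLinearMap := LinearMap.ext fun x => Subtype.ext (ha x)
  rw [this]
  exact SpecialLinearGroup.det_eq_one a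

/-- A symplectic automorphism with weights `0`, `1`, `-1` on `U`, `E`, `F`. -/
theorem spRep_split_of_weights {t : ℂˣ} {z : spGroup S.ω}
    (h1 : ∀ x ∈ S.E, spRep S.ω z x = (t : ℂ) • x)
    (h2 : ∀ x ∈ S.perp ⊓ S.ω.orthogonal S.F, spRep S.ω z x = x)
    (h3 : ∀ x ∈ S.F, spRep S.ω z x = ((t⁻¹ : ℂˣ) : ℂ) • x) (v : VSp S.U S.E) :
    spRep S.ω z (S.split v) = S.split (v.1, (t : ℂ) • v.2.1, ((t⁻¹ : ℂˣ) : ℂ) • v.2.2) := by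
  have h4 : S.inclU v.1 ∈ S.ω.orthogonal S.F := fun y hy => by
    have := S.form_dualIncl_inclU (S.pairF ⟨y, hy⟩) v.1
    rwa [S.dualIncl_eq hy fun x => rfl] at this
  rw [split_apply, map_add, map_add, h1 _ v.2.1.2, h2 _ ⟨S.inclU_mem _, h4⟩,
    h3 _ (S.dualIncl_mem _), split_apply, map_smul]
  rfl

/-- The definition of `gradedTangent` quantifies over all such z; their existence is what gives that
condition its content. -/
theorem exists_weights (t : ℂˣ) : ∃ z : spGroup S.ω,
    (∀ x ∈ S.E, spRep S.ω z x = (t : ℂ) • x) ∧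
    (∀ x ∈ S.perp ⊓ S.ω.orthogonal S.F, spRep S.ω z x = x) ∧
    (∀ x ∈ S.F, spRep S.ω z x = ((t⁻¹ : ℂˣ) : ℂ) • x) := by
  set m : VSp S.U S.E ≃ₗ[ℂ] VSp S.U S.E :=
    LinearEquiv.prodCongr (LinearEquiv.refl ℂ _) (LinearEquiv.prodCongr
      (LinearEquiv.smulOfUnit t) (LinearEquiv.smulOfUnit t⁻¹)) with hm
  have hm' : ∀ v w, splitForm S.E S.formU (m v) (m w) = splitForm S.E S.formU v w := fun v w => by
    change S.formU v.1 w.1 + ((t⁻¹ : ℂˣ) : ℂ) • w.2.2 ((t : ℂ) • v.2.1) -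
      ((t⁻¹ : ℂˣ) : ℂ) • v.2.2 ((t : ℂ) • w.2.1) = _
    simp
  have h0 : ((t⁻¹ : ℂˣ) : ℂ) • (0 : Module.Dual ℂ S.E) = 0 := smul_zero _
  have h0' : (t : ℂ) • (0 : S.E) = 0 := smul_zero _
  refine ⟨S.ofSplit m hm', fun x hx => ?_, fun x hx => ?_, fun x hx => ?_⟩
  · have := S.ofSplit_split m hm' (0, ⟨x, hx⟩, 0)
    have e : m (0, ⟨x, hx⟩, 0) = (0, (t : ℂ) • ⟨x, hx⟩, 0) :=
      Prod.ext rfl (Prod.ext rfl h0)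
    rw [e] at this
    simpa [split_apply] using this
  · have h1 : S.inclU (Submodule.Quotient.mk ⟨x, hx.1⟩) = x := S.inclU_mk_eq fun β =>
      hx.2 _ (S.dualIncl_mem β)
    have := S.ofSplit_split m hm' (Submodule.Quotient.mk ⟨x, hx.1⟩, 0, 0)
    have e : m (Submodule.Quotient.mk ⟨x, hx.1⟩, 0, 0) = (Submodule.Quotient.mk ⟨x, hx.1⟩, 0, 0) :=
      Prod.ext rfl (Prod.ext h0' h0)
    rw [e, split_apply, h1] at this
    simpa using this
  · have h1 : S.dualIncl (S.pairF ⟨x, hx⟩) = x := S.dualIncl_eq hx fun _ => rfl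
    have := S.ofSplit_split m hm' (0, 0, S.pairF ⟨x, hx⟩)
    have e : m (0, 0, S.pairF ⟨x, hx⟩) = (0, 0, ((t⁻¹ : ℂˣ) : ℂ) • S.pairF ⟨x, hx⟩) :=
      Prod.ext rfl (Prod.ext h0' rfl)
    rw [e, split_apply, split_apply, map_smul, h1] at this
    simpa using this

end IsotropicFlag


/-! ## Coordinates on `Λ^{⟨k⟩} V` -/

/-- Linear forms on N reduce this to scalar-valued alternating maps of top degree, which are
multiples of the determinant. -/
theorem alternating_map_basis {E N : Type*} [AddCommGroup E] [Module ℂ E] [AddCommGroup N]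
    [Module ℂ N] {k : ℕ} (f : E [⋀^Fin k]→ₗ[ℂ] N) (b : Module.Basis (Fin k) ℂ E) (g : E →ₗ[ℂ] E) :
    f (g ∘ b) = LinearMap.det g • f b := by
  rw [← sub_eq_zero, ← Module.forall_dual_apply_eq_zero_iff ℂ]
  intro l
  have h := (l.compAlternatingMap f).eq_smul_basis_det b
  have h1 : (l.compAlternatingMap f) (g ∘ b) = LinearMap.det g * (l.compAlternatingMap f) b := by
    conv_lhs => rw [h]
    rw [AlternatingMap.smul_apply, Module.Basis.det_comp, b.det_self]
    simp [mul_comm]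
  rw [map_sub, map_smul, sub_eq_zero]
  exact h1

theorem map_vacuum {U E : Type*} [AddCommGroup U] [Module ℂ U] [AddCommGroup E] [Module ℂ E] {k : ℕ}
    (b : Module.Basis (Fin k) ℂ E) (gV : VSp U E →ₗ[ℂ] VSp U E) (gE : E →ₗ[ℂ] E)
    (h : ∀ x, gV (inE U E x) = inE U E (gE x)) :
    ExteriorAlgebra.map gV (vacuum U b) = LinearMap.det gE • vacuum U b := by
  have h1 := alternating_map_basis ((ExteriorAlgebra.ιMulti ℂ k).compLinearMap (inE U E)) b gE
  rw [vacuum, ExteriorAlgebra.map_apply_ιMulti]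
  refine Eq.trans ?_ h1
  refine congrArg (ExteriorAlgebra.ιMulti ℂ k) (funext fun i => ?_)
  exact h (b i)

section Parity

variable {U D : Type*} [AddCommGroup U] [Module ℂ U] [AddCommGroup D] [Module ℂ D]
  [FiniteDimensional ℂ U] [FiniteDimensional ℂ D]

/-- The number of generators of the first copy is an integer, so its double is even. -/
theorem eq_zero_of_der_pr1_odd {n : ℕ} (hn : Odd n) {t : EA (QSp U D)}
    (h : (2 : ℂ) • der (pr1 U D) t = (n : ℂ) • t) : t = 0 := by
  obtain ⟨s, rfl⟩ := triMul_bijective.2 t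
  rw [der_pr1_triMul, ← map_smul (triMul U D), ← map_smul (triMul U D)] at h
  have h1 := triMul_bijective.1 h
  have h2 : ∀ d p e, triProj d p e s = 0 := fun d p e => by
    have h3 := congrArg (triProj d p e) h1
    rw [map_smul, map_smul, triProj_pr1, smul_smul, ← sub_eq_zero, ← sub_smul, smul_eq_zero] at h3
    refine h3.resolve_left fun h4 => ?_
    rw [sub_eq_zero] at h4
    have h5 : 2 * p = n := by exact_mod_cast h4
    obtain ⟨m, hm⟩ := hn
    omega
  rw [sum_triProj (n := Module.finrank ℂ U + Module.finrank ℂ D + 1) (by omega) (by omega) s]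
  simp [h2]

end Parity

namespace IsotropicFlag

variable {V : Type*} [AddCommGroup V] [Module ℂ V] [FiniteDimensional ℂ V] (S : IsotropicFlag V)

instance : FiniteDimensional ℂ S.U := inferInstance

/-- A basis dual to the chosen basis of `V`. -/
def dualFamily : Fin (Module.finrank ℂ V) → V :=
  (exists_dual_family S.alt S.nondeg (Module.finBasis ℂ V)).choose

theorem dualFamily_spec (i j : Fin (Module.finrank ℂ V)) :
    S.ω (Module.finBasis ℂ V i) (S.dualFamily j) = if i = j then 1 else 0 :=
  (exists_dual_family S.alt S.nondeg (Module.finBasis ℂ V)).choose_spec i j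

/-- A basis dual to the chosen basis of `U`. -/
def dualFamilyU : Fin (Module.finrank ℂ S.U) → S.U :=
  (exists_dual_family S.formU_alt S.formU_nondegenerate (Module.finBasis ℂ S.U)).choose

theorem dualFamilyU_spec (i j : Fin (Module.finrank ℂ S.U)) :
    S.formU (Module.finBasis ℂ S.U i) (S.dualFamilyU j) = if i = j then 1 else 0 :=
  (exists_dual_family S.formU_alt S.formU_nondegenerate (Module.finBasis ℂ S.U)).choose_spec i j

/-- The contraction with the form of `U` on the exterior algebra of symbols. -/
abbrev contrSymbol : EA (QE S.U S.E) →ₗ[ℂ] EA (QE S.U S.E) :=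
  contrU S.E S.formU (Module.finBasis ℂ S.U) S.dualFamilyU

/-- The primitive part of `Λ^k V`. -/
abbrev prim (k : ℕ) : Submodule ℂ (Ext k V) := primitive S.ω (Module.finBasis ℂ V) S.dualFamily k

variable {k : ℕ} (b : Module.Basis (Fin k) ℂ S.E)

include b in
-- The bound on the degree holds because dim U + 2k = dim V.
theorem prim_mkQ_bijective :
    Function.Bijective ((omegaWedge S.ω k).mkQ ∘ₗ (S.prim k).subtype) := by
  refine primitive_mkQ_bijective S.alt S.nondeg S.dualFamily_spec ?_
  have h1 := S.finrank_U_add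
  rw [Module.finrank_eq_card_basis b, Fintype.card_fin] at h1
  rw [Fintype.card_fin]
  omega

theorem map_split_bijective : Function.Bijective (ExteriorAlgebra.map S.split) :=
  map_injective_of_equiv S.splitEquiv

/-- The coordinates of an element of `Λ^{⟨k⟩} V`: the Fock space description of its primitive
representative. -/
def coord : RedExt S.ω k →ₗ[ℂ] EA (QE S.U S.E) :=
  (LinearEquiv.ofBijective (fock S.U b) (fock_bijective b)).symm.toLinearMap ∘ₗ
    (LinearEquiv.ofBijective (ExteriorAlgebra.map S.split).toLinearMap
      S.map_split_bijective).symm.toLinearMap ∘ₗ toEA k ∘ₗ (S.prim k).subtype ∘ₗ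
    (LinearEquiv.ofBijective _ (S.prim_mkQ_bijective b)).symm.toLinearMap

theorem exists_primitive (w : RedExt S.ω k) : ∃ x ∈ S.prim k, (omegaWedge S.ω k).mkQ x = w ∧
    ExteriorAlgebra.map S.split (fock S.U b (S.coord b w)) = toEA k x := by
  obtain ⟨x, rfl⟩ := (S.prim_mkQ_bijective b).2 w
  refine ⟨x, x.2, rfl, ?_⟩
  have h : (LinearEquiv.ofBijective _ (S.prim_mkQ_bijective b)).symm
      (((omegaWedge S.ω k).mkQ ∘ₗ (S.prim k).subtype) x) = x :=
    (LinearEquiv.ofBijective _ (S.prim_mkQ_bijective b)).symm_apply_apply x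
  have e : fock S.U b (S.coord b (((omegaWedge S.ω k).mkQ ∘ₗ (S.prim k).subtype) x)) =
      (LinearEquiv.ofBijective (ExteriorAlgebra.map S.split).toLinearMap
      S.map_split_bijective).symm (toEA k x) := by
    conv_rhs => rw [← h]
    exact (LinearEquiv.ofBijective (fock S.U b) (fock_bijective b)).apply_symm_apply _
  rw [e]
  exact (LinearEquiv.ofBijective (ExteriorAlgebra.map S.split).toLinearMap
    S.map_split_bijective).apply_symm_apply _

theorem coord_eq {x : Ext k V} (hx : x ∈ S.prim k) {t : EA (QE S.U S.E)}
    (h : ExteriorAlgebra.map S.split (fock S.U b t) = toEA k x) :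
    S.coord b ((omegaWedge S.ω k).mkQ x) = t := by
  obtain ⟨y, hy, h1, h2⟩ := S.exists_primitive b ((omegaWedge S.ω k).mkQ x)
  have h3 : (⟨y, hy⟩ : S.prim k) = ⟨x, hx⟩ := (S.prim_mkQ_bijective b).1 h1
  have h4 : y = x := congrArg Subtype.val h3
  subst h4
  exact (fock_bijective b).1 (S.map_split_bijective.1 (h2.trans h.symm))

theorem coord_injective : Function.Injective (S.coord b) := by
  intro w w' h
  obtain ⟨x, -, rfl, h2⟩ := S.exists_primitive b w
  obtain ⟨x', -, rfl, h2'⟩ := S.exists_primitive b w'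
  rw [h, h2'] at h2
  rw [toEA_injective k h2]

theorem fock_coord_mem (w : RedExt S.ω k) :
    fock S.U b (S.coord b w) ∈ ⋀[ℂ]^k (VSp S.U S.E) := by
  obtain ⟨x, -, -, h⟩ := S.exists_primitive b w
  have h1 : fock S.U b (S.coord b w) =
      ExteriorAlgebra.map S.splitEquiv.symm.toLinearMap (toEA k x) := by
    rw [← h, ← AlgHom.comp_apply, ExteriorAlgebra.map_comp_map]
    have : S.splitEquiv.symm.toLinearMap ∘ₗ S.split = LinearMap.id :=
      LinearMap.ext fun v => S.splitEquiv.symm_apply_apply v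
    rw [this, ExteriorAlgebra.map_id]
    rfl
  rw [h1]
  exact map_mem _ (toEA_mem x)

theorem two_smul_der_pr1_coord (w : RedExt S.ω k) :
    (2 : ℂ) • der (pr1 S.U (Module.Dual ℂ S.E)) (S.coord b w) =
      der LinearMap.id (S.coord b w) :=
  two_smul_der_pr1 b (S.fock_coord_mem b w)

/-- Primitivity in V, rewritten by `contr_fock`. The left side lowers the degree by two and the
right side keeps it; this couples consecutive components. -/
theorem contrSymbol_coord (w : RedExt S.ω k) : S.contrSymbol (S.coord b w) =
    (2 : ℂ) • der (shift S.U (Module.Dual ℂ S.E)) (S.coord b w) := by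
  obtain ⟨x, hx, -, h⟩ := S.exists_primitive b w
  have ha' := splitForm_alt (E := S.E) S.formU_alt
  have hn' := splitForm_nondegenerate (E := S.E) S.formU_alt S.formU_nondegenerate
  obtain ⟨d', hd⟩ := exists_dual_family ha' hn' (Module.finBasis ℂ (VSp S.U S.E))
  rw [mem_primitive, ← h, map_contr ha' hn' hd S.alt S.nondeg S.dualFamily_spec S.split
    S.form_split, contr_fock S.formU_alt S.formU_nondegenerate S.dualFamilyU_spec hd] at hx
  have h1 := (fock_bijective b).1 ((S.map_split_bijective.1 (hx.trans (map_zero _).symm)).trans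
    (map_zero _).symm)
  exact sub_eq_zero.1 h1

theorem mem_prim_of_map {x : Ext k V} (hx : x ∈ S.prim k) (z : spGroup S.ω) :
    extRep (spRep S.ω) k z x ∈ S.prim k := by
  rw [mem_primitive] at hx ⊢
  rw [toEA_extRep, map_contr S.alt S.nondeg S.dualFamily_spec S.alt S.nondeg S.dualFamily_spec _
    (spRep_form S.ω z), hx, map_zero]

/-- Equivariance of the coordinates. -/
theorem coord_rep (z : spGroup S.ω) (gV : VSp S.U S.E →ₗ[ℂ] VSp S.U S.E)
    (gQ : QE S.U S.E →ₗ[ℂ] QE S.U S.E) (δ : ℂ)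
    (hz : ∀ v, spRep S.ω z (S.split v) = S.split (gV v))
    (h1 : ∀ q, gV (inMV S.U S.E (prMQ S.U S.E q)) = inMV S.U S.E (prMQ S.U S.E (gQ q)))
    (h2 : ∀ q v, prD S.U S.E (gQ q) (prE S.U S.E (gV v)) = prD S.U S.E q (prE S.U S.E v))
    (h3 : ExteriorAlgebra.map gV (vacuum S.U b) = δ • vacuum S.U b) (w : RedExt S.ω k) :
    S.coord b (redExtRep (spRep S.ω) S.ω (spRep_form S.ω) k z w) =
      δ • ExteriorAlgebra.map gQ (S.coord b w) := by
  obtain ⟨x, hx, h4, h⟩ := S.exists_primitive b w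
  have e : redExtRep (spRep S.ω) S.ω (spRep_form S.ω) k z w =
      (omegaWedge S.ω k).mkQ (extRep (spRep S.ω) k z x) := by
    rw [← h4]
    rfl
  rw [e]
  refine S.coord_eq b (S.mem_prim_of_map hx z) ?_
  rw [map_smul, ← fock_map b gV gQ δ h1 h2 h3, toEA_extRep, ← h]
  exact map_map_comm (LinearMap.ext hz) _

theorem coord_repRed (h : S.H) (w : RedExt S.ω k) : S.coord b (S.repRed k h w) =
    ExteriorAlgebra.map (actQ S.repU S.repE.dual h) (S.coord b w) := by
  have h1 : ∀ (β : Module.Dual ℂ S.E) (x : S.E), S.repE.dual h β (S.repE h x) = β x := fun β x => by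
    change β (S.repE h⁻¹ (S.repE h x)) = _
    rw [← Module.End.mul_apply, ← map_mul]
    simp
  have h2 := S.coord_rep b h.1 (S.repSplit h) (actQ S.repU S.repE.dual h) 1
    (S.repV_split h) (fun q => ?_) (fun q v => h1 _ _) ?_ w
  · rw [one_smul] at h2
    exact h2
  · refine Prod.ext rfl (Prod.ext (map_zero (S.repE h)) rfl)
  · rw [map_vacuum b _ (S.repE h), S.det_repE]
    exact fun x => Prod.ext (map_zero (S.repU h)) (Prod.ext rfl (map_zero (S.repE.dual h)))

/-- The map with weights `1`, `a`, `c` on `U`, `A`, `C`. -/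
def scale (U A C : Type*) [AddCommGroup U] [Module ℂ U] [AddCommGroup A] [Module ℂ A]
    [AddCommGroup C] [Module ℂ C] (a c : ℂ) : U × (A × C) →ₗ[ℂ] U × (A × C) :=
  LinearMap.id.prodMap ((a • LinearMap.id).prodMap (c • LinearMap.id))

theorem scale_apply {U A C : Type*} [AddCommGroup U] [Module ℂ U] [AddCommGroup A] [Module ℂ A]
    [AddCommGroup C] [Module ℂ C] (a c : ℂ) (v : U × (A × C)) :
    scale U A C a c v = (v.1, a • v.2.1, c • v.2.2) := rfl

/-- The vacuum is scaled by t^k. Contracting against E and multiplying by E^* both have weight -1,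
so the two copies of E^* are scaled alike. -/
theorem coord_weights {t : ℂˣ} {z : spGroup S.ω}
    (h1 : ∀ x ∈ S.E, spRep S.ω z x = (t : ℂ) • x)
    (h2 : ∀ x ∈ S.perp ⊓ S.ω.orthogonal S.F, spRep S.ω z x = x)
    (h3 : ∀ x ∈ S.F, spRep S.ω z x = ((t⁻¹ : ℂˣ) : ℂ) • x) (w : RedExt S.ω k) :
    S.coord b (redExtRep (spRep S.ω) S.ω (spRep_form S.ω) k z w) =
      (t : ℂ) ^ k • ExteriorAlgebra.map (scale _ _ _ ((t⁻¹ : ℂˣ) : ℂ) ((t⁻¹ : ℂˣ) : ℂ))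
        (S.coord b w) := by
  have hz := S.spRep_split_of_weights h1 h2 h3
  have ht : ((t⁻¹ : ℂˣ) : ℂ) * (t : ℂ) = 1 := t.inv_mul
  generalize ((t⁻¹ : ℂˣ) : ℂ) = c at hz ht ⊢
  generalize (t : ℂ) = a at hz ht ⊢
  refine S.coord_rep b z (scale _ _ _ a c) (scale _ _ _ c c) _ hz (fun q => ?_) (fun q v => ?_) ?_ w
  · exact Prod.ext rfl (Prod.ext (smul_zero a : a • (0 : S.E) = 0) rfl)
  · change (c • q.2.1) (a • v.2.1) = q.2.1 v.2.1
    rw [LinearMap.smul_apply, map_smul, smul_smul, ht, one_smul]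
  · rw [map_vacuum b _ (a • LinearMap.id) fun x => ?_]
    · rw [LinearMap.det_smul, LinearMap.det_id, mul_one, Module.finrank_eq_card_basis b,
        Fintype.card_fin]
    · exact Prod.ext rfl (Prod.ext rfl (smul_zero c : c • (0 : Module.Dual ℂ S.E) = 0))

/-- The coordinates of a decomposable element. -/
theorem fock_coord_wedge (v : Fin k → VSp S.U S.E)
    (hv : ∀ i j, splitForm S.E S.formU (v i) (v j) = 0) :
    fock S.U b (S.coord b ((omegaWedge S.ω k).mkQ (wedge k fun i => S.split (v i)))) =
      ExteriorAlgebra.ιMulti ℂ k v := by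
  obtain ⟨t, ht⟩ := (fock_bijective (U := S.U) b).2 (ExteriorAlgebra.ιMulti ℂ k v)
  have h1 : wedge k (fun i => S.split (v i)) ∈ S.prim k := by
    rw [mem_primitive]
    exact contr_ιMulti S.alt S.nondeg S.dualFamily_spec _ fun i j => by rw [form_split, hv]
  rw [S.coord_eq b h1 (t := t), ht]
  rw [ht, ExteriorAlgebra.map_apply_ιMulti]
  rfl

theorem coord_point : S.coord b (S.point b) = 1 := by
  refine (fock_bijective b).1 ?_
  have h := S.fock_coord_wedge b (fun i => inE S.U S.E (b i)) fun i j => by simp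
  have e : (fun i => S.split (inE S.U S.E (b i))) = fun i => (b i : V) := by
    funext i
    rw [split_apply]
    simp
  rw [e] at h
  rw [fock_one]
  exact h

end IsotropicFlag


/-! ## Holomorphic curves in finite-dimensional spaces -/

section Curves

variable {W W' : Type*} [AddCommGroup W] [Module ℂ W] [AddCommGroup W'] [Module ℂ W']

/-- A curve that is holomorphic at `0`. -/
def IsHol (γ : ℂ → W) : Prop := ∀ l : Module.Dual ℂ W, AnalyticAt ℂ (fun s => l (γ s)) 0

theorem IsHol.comp {γ : ℂ → W} (h : IsHol γ) (f : W →ₗ[ℂ] W') : IsHol fun s => f (γ s) :=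
  fun l => h (l ∘ₗ f)

theorem HasDer.comp {γ : ℂ → W} {j : ℕ} {w : W} (h : HasDer γ j w) (f : W →ₗ[ℂ] W') :
    HasDer (fun s => f (γ s)) j (f w) := fun l => h (l ∘ₗ f)

theorem HasDer.unique {γ : ℂ → W} {j : ℕ} {w w' : W} (h : HasDer γ j w) (h' : HasDer γ j w') :
    w = w' := by
  rw [← sub_eq_zero, ← Module.forall_dual_apply_eq_zero_iff ℂ]
  intro l
  rw [map_sub, ← h l, ← h' l, sub_self]

theorem IsHol.smul_const {a : ℂ → ℂ} (h : AnalyticAt ℂ a 0) (w : W) : IsHol fun s => a s • w :=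
  fun l => by
    simp only [map_smul, smul_eq_mul]
    exact h.mul analyticAt_const

theorem IsHol.add {γ δ : ℂ → W} (h : IsHol γ) (h' : IsHol δ) : IsHol fun s => γ s + δ s :=
  fun l => by
    simp only [map_add]
    exact (h l).add (h' l)

theorem IsHol.sum {κ : Type*} (t : Finset κ) {γ : κ → ℂ → W} (h : ∀ i, IsHol (γ i)) :
    IsHol fun s => ∑ i ∈ t, γ i s := fun l => by
  simp only [map_sum]
  exact Finset.analyticAt_fun_sum _ fun i _ => h i l

theorem isHol_const (w : W) : IsHol fun _ => w := fun _ => analyticAt_const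

theorem IsHol.multilinear [FiniteDimensional ℂ W] {n : ℕ}
    (f : MultilinearMap ℂ (fun _ : Fin n => W) W') {γ : Fin n → ℂ → W} (h : ∀ i, IsHol (γ i)) :
    IsHol fun s => f fun i => γ i s := by
  set e := Module.finBasis ℂ W
  have key : ∀ s, f (fun i => γ i s) =
      ∑ r : Fin n → Fin (Module.finrank ℂ W), (∏ i, e.coord (r i) (γ i s)) • f fun i => e (r i) := by
    intro s
    conv_lhs => rw [show (fun i => γ i s) = fun i => ∑ j, e.coord j (γ i s) • e j from
      funext fun i => (e.sum_repr _).symm]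
    rw [f.map_sum]
    exact Finset.sum_congr rfl fun r _ => f.map_smul_univ (fun i => e.coord (r i) (γ i s))
      fun i => e (r i)
  simp only [key]
  exact IsHol.sum _ fun r => IsHol.smul_const
    (Finset.analyticAt_fun_prod _ fun i _ => h i (e.coord (r i))) _

theorem IsHol.exists_hasDer [FiniteDimensional ℂ W] {γ : ℂ → W} (h : IsHol γ) (j : ℕ) :
    ∃ w, HasDer γ j w := by
  set e := Module.finBasis ℂ W
  refine ⟨∑ i, iteratedDeriv j (fun s => e.coord i (γ s)) 0 • e i, fun l => ?_⟩
  have key : ∀ s, l (γ s) = ∑ i, e.coord i (γ s) * l (e i) := fun s => by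
    conv_lhs => rw [← e.sum_repr (γ s)]
    rw [map_sum]
    exact Finset.sum_congr rfl fun i _ => by rw [map_smul]; rfl
  have h2 : ∀ i ∈ Finset.univ, ContDiffAt ℂ j (fun s => e.coord i (γ s) * l (e i)) 0 := fun i _ =>
    ((h (e.coord i)).mul analyticAt_const).contDiffAt
  simp only [key]
  rw [iteratedDeriv_fun_sum h2, map_sum]
  refine Finset.sum_congr rfl fun i _ => ?_
  rw [iteratedDeriv_mul_const_field, map_smul, smul_eq_mul]

/-- The coordinates are divided by s through their divided slopes, whose value at 0 is the
derivative. -/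
theorem IsHol.exists_smul [FiniteDimensional ℂ W] {γ : ℂ → W} (h : IsHol γ) (h0 : γ 0 = 0) :
    ∃ δ : ℂ → W, IsHol δ ∧ (∀ s, γ s = s • δ s) ∧ HasDer γ 1 (δ 0) := by
  set e := Module.finBasis ℂ W
  have hd : ∀ i, AnalyticAt ℂ (dslope (fun s => e.coord i (γ s)) 0) 0 := fun i => by
    obtain ⟨p, hp⟩ := h (e.coord i)
    exact ⟨_, hp.has_fpower_series_dslope_fslope⟩
  have hs : ∀ s, γ s = s • ∑ i, dslope (fun s => e.coord i (γ s)) 0 s • e i := fun s => by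
    conv_lhs => rw [← e.sum_repr (γ s)]
    rw [Finset.smul_sum]
    refine Finset.sum_congr rfl fun i _ => ?_
    have h1 := sub_smul_dslope (fun s => e.coord i (γ s)) 0 s
    simp only [sub_zero, h0, map_zero] at h1
    rw [smul_smul, ← smul_eq_mul, h1]
    rfl
  refine ⟨fun s => ∑ i, dslope (fun s => e.coord i (γ s)) 0 s • e i,
    IsHol.sum _ fun i => IsHol.smul_const (hd i) _, hs, fun l => ?_⟩
  have key : ∀ s, l (γ s) = ∑ i, e.coord i (γ s) * l (e i) := fun s => by
    conv_lhs => rw [← e.sum_repr (γ s)]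
    rw [map_sum]
    exact Finset.sum_congr rfl fun i _ => by rw [map_smul]; rfl
  have h2 : ∀ i ∈ Finset.univ, DifferentiableAt ℂ (fun s => e.coord i (γ s) * l (e i)) 0 :=
    fun i _ => ((h (e.coord i)).mul analyticAt_const).differentiableAt
  rw [iteratedDeriv_one]
  simp only [key]
  rw [deriv_fun_sum h2, map_sum]
  refine Finset.sum_congr rfl fun i _ => ?_
  rw [deriv_mul_const (h (e.coord i)).differentiableAt, map_smul, smul_eq_mul, dslope_same]

/-- In Leibniz's formula at 0 only the term that differentiates s^q exactly q times survives. -/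
theorem iteratedDeriv_pow_mul {k : ℂ → ℂ} (hk : AnalyticAt ℂ k 0) {j q : ℕ} (hj : j ≤ q) :
    iteratedDeriv j (fun s => s ^ q * k s) 0 = if j = q then (q.factorial : ℂ) * k 0 else 0 := by
  have h1 : ContDiffAt ℂ j (fun s : ℂ => s ^ q) 0 := (contDiff_id.pow q).contDiffAt
  rw [iteratedDeriv_fun_mul h1 hk.contDiffAt]
  simp only [iteratedDeriv_pow]
  rw [Finset.sum_range_succ, Finset.sum_eq_zero, zero_add]
  · split_ifs with h
    · subst h
      simp [Nat.descFactorial_self]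
    · rw [zero_pow (by omega)]
      simp
  · intro i hi
    rw [Finset.mem_range] at hi
    rw [zero_pow (by omega)]
    simp

variable {A : Type*} [Ring A] [Algebra ℂ A] [FiniteDimensional ℂ A]

theorem IsHol.pow {γ : ℂ → A} (h : IsHol γ) (q : ℕ) : IsHol fun s => γ s ^ q := by
  have := IsHol.multilinear (MultilinearMap.mkPiAlgebraFin ℂ q A) (γ := fun _ => γ) fun _ => h
  simpa [MultilinearMap.mkPiAlgebraFin_apply] using this

/-- The derivatives of `c^{1-q} f^q / q!` at a zero of `f`. -/
theorem hasDer_of_pow {f g : ℂ → A} {c : ℂ → ℂ} {q : ℕ} (hf : IsHol f) (hc : AnalyticAt ℂ c 0)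
    (hf0 : f 0 = 0) (hc0 : c 0 = 1)
    (h : ∀ᶠ s in 𝓝 (0 : ℂ), ((q.factorial : ℂ) * c s ^ (q - 1)) • g s = f s ^ q) :
    (∀ j < q, HasDer g j 0) ∧ ∀ w, HasDer f 1 w → HasDer g q (w ^ q) := by
  obtain ⟨δ, hδ, hs, hd⟩ := hf.exists_smul hf0
  have hq : (q.factorial : ℂ) ≠ 0 := Nat.cast_ne_zero.2 q.factorial_ne_zero
  have hne : ∀ᶠ s in 𝓝 (0 : ℂ), c s ≠ 0 := hc.continuousAt.eventually_ne (by rw [hc0]; exact one_ne_zero)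
  have hk : ∀ l : Module.Dual ℂ A, AnalyticAt ℂ (fun s => l (δ s ^ q) /
      ((q.factorial : ℂ) * c s ^ (q - 1))) 0 := fun l => by
    refine (hδ.pow q l).div (analyticAt_const.mul (hc.pow _)) ?_
    rw [hc0, one_pow, mul_one]
    exact hq
  -- Writing f = sδ exhibits g as s^q times a holomorphic function whose value at 0 is δ(0)^q / q!.
  have hl : ∀ l : Module.Dual ℂ A, (fun s => l (g s)) =ᶠ[𝓝 0]
      fun s => s ^ q * (l (δ s ^ q) / ((q.factorial : ℂ) * c s ^ (q - 1))) := fun l => by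
    filter_upwards [h, hne] with s h1 h2
    have h3 := congrArg l h1
    rw [hs, smul_pow, map_smul, map_smul, smul_eq_mul, smul_eq_mul] at h3
    have h4 : (q.factorial : ℂ) * c s ^ (q - 1) ≠ 0 := mul_ne_zero hq (pow_ne_zero _ h2)
    rw [← mul_div_assoc, eq_div_iff h4, mul_comm, h3]
  constructor
  · intro j hj l
    rw [((hl l).iteratedDeriv j).eq_of_nhds, iteratedDeriv_pow_mul (hk l) hj.le, if_neg hj.ne,
      map_zero]
  · intro w hw l
    rw [((hl l).iteratedDeriv q).eq_of_nhds, iteratedDeriv_pow_mul (hk l) le_rfl, if_pos rfl, hc0,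
      hw.unique hd, one_pow, mul_one, mul_div_cancel₀ _ hq]

end Curves


/-! ## Coordinates of decomposable elements -/

section Exponential

variable {U E : Type*} [AddCommGroup U] [Module ℂ U] [AddCommGroup E] [Module ℂ E]
  [FiniteDimensional ℂ U] [FiniteDimensional ℂ E]

/-- Counting generators of the first copy is contracting and multiplying back; by hypothesis each
contraction is multiplication by a value of Y. -/
theorem der_pr1_eq_theta_mul {Y : E →ₗ[ℂ] MSp U E} {t : EA (QE U E)}
    (h : ∀ x, con (ev1 x) t = gen (inM U (Module.Dual ℂ E) (Y x)) * t) :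
    der (pr1 U (Module.Dual ℂ E)) t = theta U E Y * t := by
  rw [← sum_gen_mul_con Finset.univ
    (fun i => in1 U (Module.Dual ℂ E) ((Module.finBasis ℂ E).coord i))
    (fun i => ev1 (Module.finBasis ℂ E i)) _ (fun v => ?_), theta_apply, Finset.sum_mul]
  · exact Finset.sum_congr rfl fun i _ => by rw [h, mul_assoc]
  · have h1 : v.2.1 = ∑ i, v.2.1 (Module.finBasis ℂ E i) • (Module.finBasis ℂ E).coord i := by
      refine (Module.finBasis ℂ E).ext fun j => ?_
      simp
    change in1 U (Module.Dual ℂ E) v.2.1 = _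
    conv_lhs => rw [h1]
    rw [map_sum]
    exact Finset.sum_congr rfl fun i _ => by rw [map_smul]; rfl

/-- The differential equation of the exponential, degree by degree: half the degree operator
multiplies t by θ(Y), so t = exp θ(Y) times its constant term. -/
theorem factorial_smul_proj {Y : E →ₗ[ℂ] MSp U E} {t : EA (QE U E)}
    (h : ∀ x, con (ev1 x) t = gen (inM U (Module.Dual ℂ E) (Y x)) * t)
    (h2 : (2 : ℂ) • der (pr1 U (Module.Dual ℂ E)) t = der LinearMap.id t) (q : ℕ) :
    (q.factorial : ℂ) • proj (2 * q) t = theta U E Y ^ q * proj 0 t := by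
  induction q with
  | zero => simp
  | succ q ih =>
    have h3 := congrArg (proj (2 + 2 * q)) h2
    rw [map_smul, der_pr1_eq_theta_mul h, proj_mul_of_mem (theta_mem_two Y), ← der_proj,
      der_id_of_mem (proj_mem _ _)] at h3
    have h4 : ((q + 1 : ℕ) : ℂ) • proj (2 * (q + 1)) t = theta U E Y * proj (2 * q) t := by
      have h5 : (2 : ℂ) ≠ 0 := two_ne_zero
      refine smul_right_injective _ h5 ?_
      beta_reduce
      rw [h3, smul_smul, show 2 * (q + 1) = 2 + 2 * q by ring]
      congr 1
      push_cast
      ring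
    rw [Nat.factorial_succ, mul_comm, Nat.cast_mul, mul_smul, h4, ← mul_smul_comm, ih, pow_succ',
      mul_assoc]

/-- Vectors of a plane annihilate its product of basis vectors; in Fock coordinates the E-part of
such a vector is a contraction and the rest a multiplication. -/
theorem graph_con {k : ℕ} (b : Module.Basis (Fin k) ℂ E) {t : EA (QE U E)} {Y : E →ₗ[ℂ] MSp U E}
    (h : ∀ x, gen (inE U E x - inMV U E (Y x)) * fock U b t = 0) (x : E) :
    con (ev1 x) t = gen (inM U (Module.Dual ℂ E) (Y x)) * t := by
  have h1 := h x
  rw [map_sub, sub_mul, ← fock_con_ev1, gen_inMV_mul_fock, ← map_sub] at h1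
  exact sub_eq_zero.1 ((fock_bijective b).1 (h1.trans (map_zero _).symm))

/-- A subspace that meets `U ⊕ E^*` trivially is a graph. -/
theorem exists_graph {k : ℕ} (b : Module.Basis (Fin k) ℂ E) {t : EA (QE U E)}
    {v : Fin k → VSp U E} (hv : LinearIndependent ℂ v)
    (ht : fock U b t = ExteriorAlgebra.ιMulti ℂ k v) {c : ℂ} (hc : c ≠ 0) (h0 : proj 0 t = c • 1) :
    ∃ Y : E →ₗ[ℂ] MSp U E, ∀ x, gen (inE U E x - inMV U E (Y x)) * fock U b t = 0 := by
  set R := Submodule.span ℂ (Set.range v) with hR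
  have hmul : ∀ r ∈ R, gen r * fock U b t = 0 := fun r hr => by
    rw [ht]
    exact gen_mul_ιMulti_self v r hr
  -- A vector of R inside U ⊕ E^* would multiply t to zero, but the component of degree one of that
  -- product is c times the vector.
  have hinj : Function.Injective (prE U E ∘ₗ R.subtype) := by
    rw [injective_iff_map_eq_zero]
    rintro ⟨⟨u, x, f⟩, hr⟩ h
    change x = 0 at h
    subst h
    have h1 := hmul _ hr
    have h2 : ((u, 0, f) : VSp U E) = inMV U E (u, f) := rfl
    rw [h2, gen_inMV_mul_fock] at h1
    have h3 := (fock_bijective b).1 (h1.trans (map_zero _).symm)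
    have h4 := congrArg (proj (0 + 1)) h3
    rw [proj_succ_gen_mul, h0, map_zero, mul_smul_comm, mul_one, smul_eq_zero] at h4
    have h5 : ((u, f) : MSp U E) = 0 := inM_injective
      (gen_injective (((h4.resolve_left hc).trans (map_zero gen).symm) |>.trans
        (congrArg gen (map_zero (inM U (Module.Dual ℂ E))).symm)))
    exact Subtype.ext (congrArg (inMV U E) h5)
  have hdim : Module.finrank ℂ R = Module.finrank ℂ E := by
    rw [hR, finrank_span_eq_card hv, Module.finrank_eq_card_basis b]
  let e : R ≃ₗ[ℂ] E := LinearEquiv.ofBijective _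
    ⟨hinj, (LinearMap.injective_iff_surjective_of_finrank_eq_finrank hdim).1 hinj⟩
  refine ⟨-(prMV U E ∘ₗ R.subtype ∘ₗ e.symm.toLinearMap), fun x => ?_⟩
  have h1 : prE U E (e.symm x : VSp U E) = x := e.apply_symm_apply x
  have h2 : inE U E x - inMV U E ((-(prMV U E ∘ₗ R.subtype ∘ₗ e.symm.toLinearMap)) x) =
      (e.symm x : VSp U E) := by
    rw [LinearMap.neg_apply, map_neg, sub_neg_eq_add]
    have h3 : ∀ r : VSp U E, prE U E r = x → inE U E x + inMV U E (prMV U E r) = r := by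
      rintro r rfl
      refine Prod.ext ?_ (Prod.ext ?_ ?_) <;> simp
    exact h3 _ h1
  rw [h2]
  exact hmul _ (e.symm x).2

/-- The isotropic graph tangent to a given symmetric homomorphism. -/
def quadCorrection (ωU : LinearMap.BilinForm ℂ U) (X : E →ₗ[ℂ] MSp U E) : E →ₗ[ℂ] MSp U E :=
  LinearMap.inr ℂ U (Module.Dual ℂ E) ∘ₗ
    ((-(1 / 2 : ℂ)) • ωU.compl₁₂ (LinearMap.fst ℂ U _ ∘ₗ X) (LinearMap.fst ℂ U _ ∘ₗ X) :
      E →ₗ[ℂ] Module.Dual ℂ E)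

/-- The terms linear in s cancel by the symmetry of X; the term s² ω_U is split evenly between the
two arguments, whence the factor -1/2 in `quadCorrection`. -/
theorem splitForm_graph {ωU : LinearMap.BilinForm ℂ U} (ha : ωU.IsAlt) {X : E →ₗ[ℂ] MSp U E}
    (hX : X ∈ symHom U E) (s : ℂ) (x y : E) :
    splitForm E ωU (inE U E x - inMV U E (s • X x + s ^ 2 • quadCorrection ωU X x))
      (inE U E y - inMV U E (s • X y + s ^ 2 • quadCorrection ωU X y)) = 0 := by
  have h1 := mem_symHom.1 hX x y
  have h2 := ha.neg_eq (X x).1 (X y).1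
  simp only [splitForm_apply, quadCorrection]
  simp
  rw [h1, ← h2]
  ring

end Exponential


/-! ## The osculating spaces -/

namespace IsotropicFlag

variable {V : Type*} [AddCommGroup V] [Module ℂ V] [FiniteDimensional ℂ V] (S : IsotropicFlag V)
  {k : ℕ} (b : Module.Basis (Fin k) ℂ S.E)

instance {W : Type*} [AddCommGroup W] [Module ℂ W] [FiniteDimensional ℂ W] :
    FiniteDimensional ℂ (EA W) :=
  Module.finite_of_finrank_pos (by rw [finrank_EA]; positivity)

/-- The component of degree `n` of the coordinates. -/
def comp (n : ℕ) : RedExt S.ω k →ₗ[ℂ] EA (QE S.U S.E) := proj n ∘ₗ S.coord b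

theorem comp_apply (n : ℕ) (w : RedExt S.ω k) : S.comp b n w = proj n (S.coord b w) := rfl

theorem comp_mem (n : ℕ) (w : RedExt S.ω k) : S.comp b n w ∈ ⋀[ℂ]^n (QE S.U S.E) := proj_mem _ _

theorem eq_of_comp {w w' : RedExt S.ω k} (h : ∀ n, S.comp b n w = S.comp b n w') : w = w' :=
  S.coord_injective b (eq_of_proj h)

/-- The degree of the coordinates is twice the number of generators of the first copy of E^*. -/
theorem comp_odd {n : ℕ} (hn : Odd n) (w : RedExt S.ω k) : S.comp b n w = 0 := by
  refine eq_zero_of_der_pr1_odd hn ?_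
  rw [comp_apply, der_proj, ← map_smul, two_smul_der_pr1_coord, ← der_proj,
    der_id_of_mem (proj_mem _ _)]

theorem comp_point {n : ℕ} (hn : n ≠ 0) : S.comp b n (S.point b) = 0 := by
  rw [comp_apply, coord_point, proj_one n hn]

/-- The leading coefficient. -/
def lead : RedExt S.ω k →ₗ[ℂ] ℂ := ExteriorAlgebra.algebraMapInv.toLinearMap ∘ₗ S.comp b 0

theorem comp_zero (w : RedExt S.ω k) : S.comp b 0 w = S.lead b w • 1 := by
  obtain ⟨c, hc⟩ := mem_zero_iff.1 (S.comp_mem b 0 w)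
  have : S.lead b w = c := by
    change ExteriorAlgebra.algebraMapInv (S.comp b 0 w) = c
    rw [hc, map_smul, map_one, smul_eq_mul, mul_one]
  rw [this, hc]

theorem lead_point : S.lead b (S.point b) = 1 := by
  change ExteriorAlgebra.algebraMapInv (proj 0 (S.coord b (S.point b))) = 1
  rw [coord_point, proj_of_mem one_mem_zero, map_one]

/-- The shift of the component of degree 2p is half the contraction of the one of degree 2p + 2, so
a leading term is killed by the shift. -/
theorem comp_mem_symbols {p : ℕ} {w : RedExt S.ω k} (h : S.comp b (2 * p + 2) w = 0) :
    S.comp b (2 * p) w ∈ symbols S.U (Module.Dual ℂ S.E) p := by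
  refine mem_symbols.2 ⟨S.comp_mem b _ w, ?_, ?_⟩
  · refine smul_right_injective _ (two_ne_zero (α := ℂ)) ?_
    beta_reduce
    rw [comp_apply, der_proj, ← map_smul, two_smul_der_pr1_coord, ← der_proj,
      der_id_of_mem (proj_mem _ _), smul_smul]
    push_cast
    rfl
  · refine smul_right_injective _ (two_ne_zero (α := ℂ)) ?_
    beta_reduce
    rw [comp_apply, der_proj, ← map_smul, ← contrSymbol_coord, contrU_proj]
    rw [comp_apply] at h
    rw [h, map_zero, smul_zero]

theorem exists_eq_split (v : Fin k → V) : ∃ u : Fin k → VSp S.U S.E, v = fun i => S.split (u i) :=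
  ⟨fun i => S.splitEquiv.symm (v i), funext fun i => (S.splitEquiv.apply_symm_apply (v i)).symm⟩

/-- A nonzero leading coefficient makes the plane a graph over E, and the coordinates of a graph are
exponential. -/
theorem isoCone_exp {w : RedExt S.ω k} (hw : w ∈ isoCone S.ω k) (h0 : S.lead b w ≠ 0) :
    ∃ Y : S.E →ₗ[ℂ] MSp S.U S.E, ∀ q, (q.factorial : ℂ) • S.comp b (2 * q) w =
      S.lead b w • theta S.U S.E Y ^ q := by
  obtain ⟨v, hv, hiso, rfl⟩ := hw
  obtain ⟨u, rfl⟩ := S.exists_eq_split v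
  have hu : LinearIndependent ℂ u := LinearIndependent.of_comp S.split hv
  have h1 := S.fock_coord_wedge b u fun i j => by rw [← form_split, hiso]
  obtain ⟨Y, hY⟩ := exists_graph b hu h1 h0 (S.comp_zero b _)
  refine ⟨Y, fun q => ?_⟩
  have h2 := factorial_smul_proj (graph_con b hY) (S.two_smul_der_pr1_coord b _) q
  have h3 := S.comp_zero b ((omegaWedge S.ω k).mkQ (wedge k fun i => S.split (u i)))
  rw [comp_apply] at h3
  rw [comp_apply, h2, h3, mul_smul_comm, mul_one]

variable {γ : ℂ → RedExt S.ω k}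

/-- Eliminating Y from the exponential formula gives q! c^{q-1} γ_{2q} = γ_2^q with c the leading
coefficient. This avoids any regularity of Y in the parameter. -/
theorem arc_hasDer (hγ : IsArc (isoCone S.ω k) (S.point b) γ) {q : ℕ} (hq : 1 ≤ q) :
    (∀ j < q, HasDer (fun s => S.comp b (2 * q) (γ s)) j 0) ∧
    ∀ w, HasDer γ 1 w → HasDer (fun s => S.comp b (2 * q) (γ s)) q (S.comp b 2 w ^ q) := by
  have hH : IsHol γ := hγ.analytic
  have hc : AnalyticAt ℂ (fun s => S.lead b (γ s)) 0 := hH (S.lead b)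
  have hc0 : S.lead b (γ 0) = 1 := by rw [hγ.base, lead_point]
  have h := hasDer_of_pow (f := fun s => S.comp b 2 (γ s)) (g := fun s => S.comp b (2 * q) (γ s))
    (q := q) (hH.comp _) hc (by rw [hγ.base, S.comp_point b two_ne_zero]) hc0 ?_
  · exact ⟨h.1, fun w hw => h.2 _ (hw.comp _)⟩
  · have hne := hc.continuousAt.eventually_ne (by rw [hc0]; exact one_ne_zero)
    filter_upwards [hγ.mem, hne] with s h1 h2
    obtain ⟨Y, hY⟩ := S.isoCone_exp b h1 h2
    have h3 := hY 1
    rw [Nat.factorial_one, Nat.cast_one, one_smul, mul_one, pow_one] at h3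
    rw [h3, smul_pow, mul_comm, mul_smul, hY q, smul_smul, ← pow_succ, Nat.sub_add_cancel hq]

/-- The curve of graphs of sX plus its quadratic correction stays isotropic and has symbol θ(X). -/
theorem exists_arc {X : S.E →ₗ[ℂ] MSp S.U S.E} (hX : X ∈ symHom S.U S.E) :
    ∃ γ w, IsArc (isoCone S.ω k) (S.point b) γ ∧ HasDer γ 1 w ∧
      S.comp b 2 w = theta S.U S.E X := by
  set u : ℂ → Fin k → VSp S.U S.E := fun s i => inE S.U S.E (b i) -
    inMV S.U S.E (s • X (b i) + s ^ 2 • quadCorrection S.formU X (b i)) with hu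
  set γ : ℂ → RedExt S.ω k := fun s =>
    (omegaWedge S.ω k).mkQ (wedge k fun i => S.split (u s i)) with hγ
  have hiso : ∀ s i j, splitForm S.E S.formU (u s i) (u s j) = 0 := fun s i j =>
    splitForm_graph S.formU_alt hX s (b i) (b j)
  have hli : ∀ s, LinearIndependent ℂ (u s) := fun s => by
    refine LinearIndependent.of_comp (prE S.U S.E) ?_
    have : prE S.U S.E ∘ u s = b := by
      funext i
      simp [hu]
    rw [this]
    exact b.linearIndependent
  have hhol : IsHol γ := by
    have h1 : ∀ i, IsHol fun s => S.split (u s i) := fun i => by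
      have e : ∀ s, S.split (u s i) = S.split (inE S.U S.E (b i)) +
          (s • S.split (-inMV S.U S.E (X (b i))) +
          s ^ 2 • S.split (-inMV S.U S.E (quadCorrection S.formU X (b i)))) := fun s => by
        rw [← map_smul, ← map_smul, ← map_add, ← map_add]
        congr 1
        simp only [hu, map_add, map_smul, smul_neg]
        abel
      simp only [e]
      exact (isHol_const _).add ((IsHol.smul_const analyticAt_id _).add
        (IsHol.smul_const (analyticAt_id.pow 2) _))
    exact (IsHol.multilinear (wedge k).toMultilinearMap h1).comp (omegaWedge S.ω k).mkQ
  have hbase : γ 0 = S.point b := by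
    have : (fun i => S.split (u 0 i)) = fun i => (b i : V) := by
      funext i
      simp [hu, split_apply]
    simp only [hγ, this]
    rfl
  have harc : IsArc (isoCone S.ω k) (S.point b) γ := ⟨hhol, hbase, Filter.Eventually.of_forall
    fun s => ⟨fun i => S.split (u s i), (hli s).map' S.split
      (LinearMap.ker_eq_bot.2 S.split_bijective.1), fun i j => by rw [form_split, hiso], rfl⟩⟩
  obtain ⟨w, hw⟩ := hhol.exists_hasDer 1
  refine ⟨γ, w, harc, hw, ?_⟩
  have hexp : ∀ s, S.comp b 2 (γ s) = S.lead b (γ s) • theta S.U S.E (s • X +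
      s ^ 2 • quadCorrection S.formU X) := fun s => by
    have h1 := S.fock_coord_wedge b (u s) (hiso s)
    have h2 : ∀ x, gen (inE S.U S.E x - inMV S.U S.E ((s • X + s ^ 2 • quadCorrection S.formU X) x))
        * fock S.U b (S.coord b (γ s)) = 0 := fun x => by
      rw [h1]
      refine gen_mul_ιMulti_self _ _ ?_
      set L : S.E →ₗ[ℂ] VSp S.U S.E := inE S.U S.E -
        inMV S.U S.E ∘ₗ (s • X + s ^ 2 • quadCorrection S.formU X) with hL
      have h3 : Set.range (u s) = L '' Set.range b := by
        rw [← Set.range_comp]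
        rfl
      rw [h3, ← Submodule.map_span, b.span_eq]
      exact ⟨x, trivial, rfl⟩
    have h4 := factorial_smul_proj (graph_con b h2) (S.two_smul_der_pr1_coord b _) 1
    have h5 := S.comp_zero b (γ s)
    rw [comp_apply] at h5
    rw [h5, Nat.factorial_one, Nat.cast_one, one_smul, mul_one, pow_one, mul_smul_comm,
      mul_one] at h4
    exact h4
  refine HasDer.unique (hw.comp (S.comp b 2)) fun l => ?_
  have hc : AnalyticAt ℂ (fun s => S.lead b (γ s)) 0 := hhol (S.lead b)
  have e : ∀ s, l (S.comp b 2 (γ s)) = s ^ 1 * (S.lead b (γ s) * (l (theta S.U S.E X) +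
      s * l (theta S.U S.E (quadCorrection S.formU X)))) := fun s => by
    rw [hexp, map_smul, map_add, map_smul, map_smul, map_add, map_smul, map_smul]
    simp only [smul_eq_mul]
    ring
  simp only [e]
  have hk : AnalyticAt ℂ (fun s => S.lead b (γ s) * (l (theta S.U S.E X) +
      s * l (theta S.U S.E (quadCorrection S.formU X)))) 0 :=
    hc.mul (analyticAt_const.add (analyticAt_id.mul analyticAt_const))
  rw [iteratedDeriv_pow_mul hk le_rfl, if_pos rfl, hbase, lead_point]
  simp

/-- The osculating spaces are given by the degree of the coordinates. -/
theorem comp_eq_zero_of_mem_osc {p : ℕ} {w : RedExt S.ω k}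
    (hw : w ∈ osc (isoCone S.ω k) (S.point b) p) {n : ℕ} (hn : 2 * p < n) : S.comp b n w = 0 := by
  induction hw using Submodule.span_induction with
  | mem w hw =>
    obtain ⟨γ, j, hγ, hj, hw⟩ := hw
    rcases Nat.even_or_odd' n with ⟨q, rfl | rfl⟩
    · exact HasDer.unique (hw.comp _) ((S.arc_hasDer b hγ (q := q) (by omega)).1 j (by omega))
    · exact S.comp_odd b ⟨q, rfl⟩ w
  | zero => exact map_zero _
  | add x y _ _ hx hy => rw [map_add, hx, hy, add_zero]
  | smul c x _ hx => rw [map_smul, hx, smul_zero]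

theorem osc_mono {W : Type*} [AddCommGroup W] [Module ℂ W] (C : Set W) (v : W) {p q : ℕ}
    (h : p ≤ q) : osc C v p ≤ osc C v q :=
  Submodule.span_mono fun _ ⟨γ, j, h1, h2, h3⟩ => ⟨γ, j, h1, h2.trans h, h3⟩

/-- The powers θ(X)^p are leading terms of p-th derivatives of curves, and they span the model. -/
theorem exists_mem_osc_comp_eq {p : ℕ} {t : EA (QE S.U S.E)} (hp : 1 ≤ p)
    (ht : t ∈ symbols S.U (Module.Dual ℂ S.E) p) :
    ∃ w ∈ osc (isoCone S.ω k) (S.point b) p, S.comp b (2 * p) w = t := by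
  have h : symbols S.U (Module.Dual ℂ S.E) p ≤
      (osc (isoCone S.ω k) (S.point b) p).map (S.comp b (2 * p)) := by
    refine (symbols_le_span_pow p).trans (Submodule.span_le.2 ?_)
    rintro _ ⟨X, hX, rfl⟩
    obtain ⟨γ, w₁, hγ, h1, h2⟩ := S.exists_arc b hX
    obtain ⟨w, hw⟩ := IsHol.exists_hasDer (γ := γ) hγ.analytic p
    refine ⟨w, Submodule.subset_span ⟨γ, p, hγ, le_rfl, hw⟩, ?_⟩
    rw [← h2]
    exact HasDer.unique (hw.comp _) ((S.arc_hasDer b hγ hp).2 w₁ h1)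
  obtain ⟨w, hw, h2⟩ := h ht
  exact ⟨w, hw, h2⟩

/-- For the converse, subtracting an osculating vector with the same leading term lowers the degree;
since odd components vanish, it drops by two. -/
theorem mem_osc_iff {p : ℕ} {w : RedExt S.ω k} : w ∈ osc (isoCone S.ω k) (S.point b) p ↔
    ∀ n, 2 * p < n → S.comp b n w = 0 := by
  refine ⟨fun hw n hn => S.comp_eq_zero_of_mem_osc b hw hn, fun h => ?_⟩
  induction p generalizing w with
  | zero =>
    have h1 : w = S.lead b w • S.point b := by
      refine S.eq_of_comp b fun n => ?_
      rcases Nat.eq_zero_or_pos n with rfl | hn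
      · rw [map_smul, comp_zero, comp_zero, lead_point, one_smul]
      · rw [h n (by omega), map_smul, S.comp_point b hn.ne', smul_zero]
    obtain ⟨γ, -, hγ, -, -⟩ := S.exists_arc b (symHom S.U S.E).zero_mem
    rw [h1]
    refine Submodule.smul_mem _ _ (Submodule.subset_span ⟨γ, 0, hγ, le_rfl, fun l => ?_⟩)
    rw [iteratedDeriv_zero, hγ.base]
  | succ p ih =>
    have h1 := S.comp_mem_symbols b (h (2 * (p + 1) + 2) (by omega))
    obtain ⟨w', hw', h2⟩ := S.exists_mem_osc_comp_eq b (by omega) h1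
    have h3 : w - w' ∈ osc (isoCone S.ω k) (S.point b) p := by
      refine ih fun n hn => ?_
      rw [map_sub]
      rcases Nat.lt_or_ge (2 * (p + 1)) n with h4 | h4
      · rw [h n h4, S.comp_eq_zero_of_mem_osc b hw' h4, sub_zero]
      · rcases Nat.lt_or_ge n (2 * (p + 1)) with h5 | h5
        · have h6 : Odd n := ⟨p, by omega⟩
          rw [S.comp_odd b h6, S.comp_odd b h6, sub_zero]
        · rw [le_antisymm h4 h5, h2, sub_self]
    rw [← sub_add_cancel w w']
    exact add_mem (osc_mono _ _ (Nat.le_succ p) h3) hw'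

/-- The symbol of an element of the normal space. -/
def symbolMap (p : ℕ) (hp : 1 ≤ p) : S.N b p →ₗ[ℂ] EA (QE S.U S.E) :=
  Submodule.liftQ _ (S.comp b (2 * p) ∘ₗ (osc (isoCone S.ω k) (S.point b) p).subtype)
    fun w hw => S.comp_eq_zero_of_mem_osc b (p := p - 1) hw (by omega)

variable {p : ℕ} (hp : 1 ≤ p)

theorem symbolMap_nmk (w : osc (isoCone S.ω k) (S.point b) p) :
    S.symbolMap b p hp (nmk (isoCone S.ω k) (S.point b) p w) = S.comp b (2 * p) w := rfl

theorem nmk_surjective {W : Type*} [AddCommGroup W] [Module ℂ W] (C : Set W) (v : W) (p : ℕ) :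
    Function.Surjective (nmk C v p) := Submodule.mkQ_surjective _

theorem symbolMap_injective : Function.Injective (S.symbolMap b p hp) := by
  rw [injective_iff_map_eq_zero]
  intro x hx
  obtain ⟨w, rfl⟩ := nmk_surjective _ _ _ x
  rw [symbolMap_nmk] at hx
  refine (Submodule.Quotient.mk_eq_zero _).2 ?_
  change (w : RedExt S.ω k) ∈ osc (isoCone S.ω k) (S.point b) (p - 1)
  rw [mem_osc_iff]
  intro n hn
  rcases Nat.lt_or_ge (2 * p) n with h1 | h1
  · exact S.comp_eq_zero_of_mem_osc b w.2 h1
  · rcases Nat.lt_or_ge n (2 * p) with h2 | h2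
    · exact S.comp_odd b ⟨p - 1, by omega⟩ _
    · rw [le_antisymm h1 h2, hx]

theorem range_symbolMap : LinearMap.range (S.symbolMap b p hp) =
    symbols S.U (Module.Dual ℂ S.E) p := by
  refine le_antisymm ?_ fun t ht => ?_
  · rintro _ ⟨x, rfl⟩
    obtain ⟨w, rfl⟩ := nmk_surjective _ _ _ x
    rw [symbolMap_nmk]
    exact S.comp_mem_symbols b (S.comp_eq_zero_of_mem_osc b w.2 (by omega))
  · obtain ⟨w, hw, h⟩ := S.exists_mem_osc_comp_eq b hp ht
    exact ⟨nmk _ _ _ ⟨w, hw⟩, h⟩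

theorem symbolMap_rep (h : S.H) (x : S.N b p) : S.symbolMap b p hp (S.repN b p h x) =
    ExteriorAlgebra.map (actQ S.repU S.repE.dual h) (S.symbolMap b p hp x) := by
  obtain ⟨w, rfl⟩ := nmk_surjective _ _ _ x
  have h1 := S.coord_repRed b h w
  rw [symbolMap_nmk, comp_apply, map_proj, ← h1]
  rfl

/-- Every tangent vector is the derivative of a curve. -/
theorem exists_arc_nmk (t : S.N b 1) : ∃ (γ : ℂ → RedExt S.ω k)
    (w : osc (isoCone S.ω k) (S.point b) 1), IsArc (isoCone S.ω k) (S.point b) γ ∧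
      HasDer γ 1 (w : RedExt S.ω k) ∧ nmk (isoCone S.ω k) (S.point b) 1 w = t := by
  have h1 : S.symbolMap b 1 le_rfl t ∈ symbols S.U (Module.Dual ℂ S.E) 1 := by
    rw [← S.range_symbolMap b le_rfl]
    exact ⟨t, rfl⟩
  obtain ⟨X, hX, h2⟩ := exists_theta_eq h1
  obtain ⟨γ, w, hγ, hw, h3⟩ := S.exists_arc b hX
  refine ⟨γ, ⟨w, Submodule.subset_span ⟨γ, 1, hγ, le_rfl, hw⟩⟩, hγ, hw, ?_⟩
  refine S.symbolMap_injective b le_rfl ?_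
  rw [symbolMap_nmk, ← h2, ← h3]

theorem symbolMap_arc {γ : ℂ → RedExt S.ω k} (hγ : IsArc (isoCone S.ω k) (S.point b) γ)
    {t : osc (isoCone S.ω k) (S.point b) 1} {w : osc (isoCone S.ω k) (S.point b) p}
    (ht : HasDer γ 1 (t : RedExt S.ω k)) (hw : HasDer γ p (w : RedExt S.ω k)) :
    S.symbolMap b p hp (nmk _ _ p w) = S.symbolMap b 1 le_rfl (nmk _ _ 1 t) ^ p :=
  HasDer.unique (hw.comp (S.comp b (2 * p))) ((S.arc_hasDer b hγ hp).2 _ ht)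

theorem symbolMap_fundForm {F : MultilinearMap ℂ (fun _ : Fin p => S.N b 1) (S.N b p)}
    (hF : IsFundForm (isoCone S.ω k) (S.point b) p F) (t : S.N b 1) :
    S.symbolMap b p hp (F fun _ => t) = S.symbolMap b 1 le_rfl t ^ p := by
  obtain ⟨γ, w₁, hγ, h1, rfl⟩ := S.exists_arc_nmk b t
  obtain ⟨w, hw⟩ := IsHol.exists_hasDer (γ := γ) hγ.analytic p
  rw [hF.2 γ w₁ ⟨w, Submodule.subset_span ⟨γ, p, hγ, le_rfl, hw⟩⟩ hγ h1 hw]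
  exact S.symbolMap_arc b hp hγ h1 hw

include hp in
theorem mem_baseLocus_iff {F : MultilinearMap ℂ (fun _ : Fin p => S.N b 1) (S.N b p)}
    (hF : IsFundForm (isoCone S.ω k) (S.point b) p F) (x : ℙ ℂ (S.N b 1)) :
    x ∈ baseLocus F ↔ S.symbolMap b 1 le_rfl x.rep ^ p = 0 := by
  rw [← S.symbolMap_fundForm b hp hF, LinearMap.map_eq_zero_iff _ (S.symbolMap_injective b hp)]
  exact Module.forall_dual_apply_eq_zero_iff ℂ _

include hp in
theorem exists_isFundForm : ∃ F, IsFundForm (isoCone S.ω k) (S.point b) p F := by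
  -- The form is the product of symbols followed by a left inverse of the symbol map. Its values off
  -- the image do not matter: along curves the product is the symbol of a p-th derivative.
  obtain ⟨g, hg⟩ := (S.symbolMap b p hp).exists_leftInverse_of_injective
    (LinearMap.ker_eq_bot.2 (S.symbolMap_injective b hp))
  have hF : ∀ t : Fin p → S.N b 1, g.compMultilinearMap ((MultilinearMap.mkPiAlgebraFin ℂ p
      (EA (QE S.U S.E))).compLinearMap fun _ => S.symbolMap b 1 le_rfl) t =
      g (List.ofFn fun i => S.symbolMap b 1 le_rfl (t i)).prod := fun t => rfl
  refine ⟨g.compMultilinearMap ((MultilinearMap.mkPiAlgebraFin ℂ p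
      (EA (QE S.U S.E))).compLinearMap fun _ => S.symbolMap b 1 le_rfl), fun σ t => ?_,
    fun γ t w hγ ht hw => ?_⟩
  · rw [hF, hF]
    congr 1
    have h1 := Equiv.Perm.ofFn_comp_perm σ fun i => S.symbolMap b 1 le_rfl (t i)
    refine List.Perm.prod_eq' h1 ?_
    refine List.pairwise_of_forall_mem_list fun x hx y _ => ?_
    obtain ⟨i, rfl⟩ := (List.mem_ofFn' _ _).1 hx
    have h2 : S.symbolMap b 1 le_rfl (t (σ i)) ∈ symbols S.U (Module.Dual ℂ S.E) 1 := by
      rw [← S.range_symbolMap b le_rfl]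
      exact ⟨_, rfl⟩
    exact even_comm (mem_symbols.1 h2).1 y
  · rw [hF]
    have h1 : (List.ofFn fun _ : Fin p => S.symbolMap b 1 le_rfl (nmk _ _ 1 t)).prod =
        S.symbolMap b 1 le_rfl (nmk _ _ 1 t) ^ p := by
      rw [List.ofFn_const, List.prod_replicate]
    rw [h1, ← S.symbolMap_arc b hp hγ ht hw]
    exact LinearMap.congr_fun hg _

end IsotropicFlag


/-! ## The normal spaces as modules -/

section RepEquiv

variable {G : Type*} [Group G]

/-- Two modules embedded equivariantly in one space with the same image are isomorphic; the ambient
space here will be the exterior algebra of Q. -/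
theorem equiv_of_range_eq {M N A : Type*} [AddCommMonoid M] [Module ℂ M] [AddCommMonoid N]
    [Module ℂ N] [AddCommMonoid A] [Module ℂ A] {ρ : Representation ℂ G M}
    {σ : Representation ℂ G N} {α : G → A →ₗ[ℂ] A} {f : M →ₗ[ℂ] A} {g : N →ₗ[ℂ] A}
    (hf : Function.Injective f) (hg : Function.Injective g)
    (h : LinearMap.range f = LinearMap.range g) (hfe : ∀ s x, f (ρ s x) = α s (f x))
    (hge : ∀ s x, g (σ s x) = α s (g x)) : ∃ e : ρ.Equiv σ, ∀ x, g (e x) = f x := by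
  let e : M ≃ₗ[ℂ] N := (LinearEquiv.ofInjective f hf).trans ((LinearEquiv.ofEq _ _ h).trans
    (LinearEquiv.ofInjective g hg).symm)
  have he : ∀ x, g (e x) = f x := fun x => congrArg Subtype.val
    ((LinearEquiv.ofInjective g hg).apply_symm_apply (LinearEquiv.ofEq _ _ h
      (LinearEquiv.ofInjective f hf x)))
  refine ⟨Representation.Equiv.mk e fun s => LinearMap.ext fun x => hg ?_, he⟩
  change g (e (ρ s x)) = g (σ s (e x))
  rw [he, hfe, hge, he]

theorem directSum_reindex {T J : Type*} (τ : T ≃ J) {M : J → Type*} [∀ j, AddCommGroup (M j)]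
    [∀ j, Module ℂ (M j)] (ρ : ∀ j, Representation ℂ G (M j)) :
    Nonempty ((Representation.directSum fun t => ρ (τ t)).Equiv (Representation.directSum ρ)) := by
  classical
  have h : DirectSum.toModule ℂ T (⨁ j, M j) (fun t => DirectSum.lof ℂ J M (τ t)) =
      (DirectSum.lequivCongrLeft ℂ (M := M) τ.symm).symm.toLinearMap := by
    refine DirectSum.linearMap_ext ℂ fun t => LinearMap.ext fun x => ?_
    change DirectSum.toModule ℂ T (⨁ j, M j) (fun t => DirectSum.lof ℂ J M (τ t))
      (DirectSum.lof ℂ T (fun t => M (τ t)) t x) = _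
    rw [DirectSum.toModule_lof]
    exact (DirectSum.lequivCongrLeft_symm_lof ℂ (h := τ.symm) (M := M) (k := t) (x := x)).symm
  refine directSum_equiv_of_bijective (fun t => DirectSum.lof ℂ J M (τ t)) ?_ fun t g x => ?_
  · rw [h]
    exact (DirectSum.lequivCongrLeft ℂ (M := M) τ.symm).symm.bijective
  · exact (DirectSum.lmap_lof (fun j => ρ j g) (τ t) x).symm

theorem directSum_sigma {J : Type*} {I : J → Type*} {M : ∀ j, I j → Type*}
    [∀ j i, AddCommGroup (M j i)] [∀ j i, Module ℂ (M j i)] {N : J → Type*}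
    [∀ j, AddCommGroup (N j)] [∀ j, Module ℂ (N j)] {ρ : ∀ j i, Representation ℂ G (M j i)}
    {σ : ∀ j, Representation ℂ G (N j)}
    (h : ∀ j, Nonempty ((Representation.directSum (ρ j)).Equiv (σ j))) :
    Nonempty ((Representation.directSum fun s : Σ j, I j => ρ s.1 s.2).Equiv
      (Representation.directSum σ)) := by
  classical
  have e := fun j => (h j).some
  let f : ∀ s : Σ j, I j, M s.1 s.2 →ₗ[ℂ] ⨁ j, N j := fun s =>
    DirectSum.lof ℂ J N s.1 ∘ₗ (e s.1).toLinearEquiv.toLinearMap ∘ₗ DirectSum.lof ℂ _ (M s.1) s.2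
  let g : (⨁ j, N j) →ₗ[ℂ] ⨁ s : Σ j, I j, M s.1 s.2 := DirectSum.toModule ℂ J _ fun j =>
    DirectSum.toModule ℂ (I j) _ (fun i => DirectSum.lof ℂ (Σ j, I j)
      (fun s => M s.1 s.2) ⟨j, i⟩) ∘ₗ (e j).toLinearEquiv.symm.toLinearMap
  have hg : ∀ j x, g (DirectSum.lof ℂ J N j ((e j).toLinearEquiv x)) =
      DirectSum.toModule ℂ (I j) _ (fun i => DirectSum.lof ℂ (Σ j, I j)
        (fun s => M s.1 s.2) ⟨j, i⟩) x := fun j x => by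
    simp only [g, DirectSum.toModule_lof]
    exact congrArg (DirectSum.toModule ℂ (I j) _ fun i => DirectSum.lof ℂ (Σ j, I j)
      (fun s => M s.1 s.2) ⟨j, i⟩) ((e j).toLinearEquiv.symm_apply_apply x)
  refine directSum_equiv_of_bijective f (Function.bijective_iff_has_inverse.2 ⟨g, ?_, ?_⟩)
    fun s t x => ?_
  · intro x
    induction x using DirectSum.induction_on with
    | zero => simp only [map_zero]
    | of s x =>
      change g (DirectSum.toModule ℂ _ _ f (DirectSum.lof ℂ _ (fun s : Σ j, I j => M s.1 s.2) s x)) =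
        DirectSum.lof ℂ _ (fun s : Σ j, I j => M s.1 s.2) s x
      rw [DirectSum.toModule_lof]
      change g (DirectSum.lof ℂ J N s.1 ((e s.1).toLinearEquiv (DirectSum.lof ℂ _ (M s.1) s.2 x))) = _
      rw [hg, DirectSum.toModule_lof]
    | add x y hx hy => simp only [map_add, hx, hy]
  · intro x
    induction x using DirectSum.induction_on with
    | zero => simp only [map_zero]
    | of j x =>
      obtain ⟨y, rfl⟩ := (e j).toLinearEquiv.surjective x
      change DirectSum.toModule ℂ _ _ f (g (DirectSum.lof ℂ J N j ((e j).toLinearEquiv y))) =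
        DirectSum.lof ℂ J N j ((e j).toLinearEquiv y)
      rw [hg]
      induction y using DirectSum.induction_on with
      | zero => simp only [map_zero]
      | of i y =>
        change DirectSum.toModule ℂ _ _ f (DirectSum.toModule ℂ (I j) _ (fun i => DirectSum.lof ℂ
          (Σ j, I j) (fun s => M s.1 s.2) ⟨j, i⟩) (DirectSum.lof ℂ (I j) (M j) i y)) = _
        rw [DirectSum.toModule_lof, DirectSum.toModule_lof]
        rfl
      | add x y hx hy => simp only [map_add, hx, hy]
    | add x y hx hy => simp only [map_add, hx, hy]
  · have h1 : (e s.1).toLinearEquiv (Representation.directSum (ρ s.1) t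
        (DirectSum.lof ℂ _ (M s.1) s.2 x)) =
        σ s.1 t ((e s.1).toLinearEquiv (DirectSum.lof ℂ _ (M s.1) s.2 x)) :=
      Representation.IntertwiningMap.isIntertwining _ _ (e s.1).toIntertwiningMap t _
    have h2 : Representation.directSum (ρ s.1) t (DirectSum.lof ℂ _ (M s.1) s.2 x) =
        DirectSum.lof ℂ _ (M s.1) s.2 (ρ s.1 s.2 t x) := DirectSum.lmap_lof ..
    rw [h2] at h1
    change DirectSum.lof ℂ J N s.1 ((e s.1).toLinearEquiv (DirectSum.lof ℂ _ (M s.1) s.2 _)) =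
      DirectSum.lmap (fun j => σ j t) (DirectSum.lof ℂ J N s.1 _)
    rw [h1, DirectSum.lmap_lof]
    rfl

theorem directSum_tprod {I : Type*} {M : I → Type*} [∀ i, AddCommGroup (M i)]
    [∀ i, Module ℂ (M i)] {L N : Type*} [AddCommGroup L] [Module ℂ L] [AddCommGroup N] [Module ℂ N]
    {ρ : ∀ i, Representation ℂ G (M i)} {σ : Representation ℂ G L} (τ : Representation ℂ G N)
    (h : Nonempty ((Representation.directSum ρ).Equiv σ)) :
    Nonempty ((Representation.directSum fun i => (ρ i).tprod τ).Equiv (σ.tprod τ)) := by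
  classical
  obtain ⟨e⟩ := h
  have h1 : DirectSum.toModule ℂ I (L ⊗[ℂ] N) (fun i => LinearMap.rTensor N
      (e.toLinearEquiv.toLinearMap ∘ₗ DirectSum.lof ℂ I M i)) =
      ((TensorProduct.directSumLeft ℂ ℂ M N).symm.trans
        (LinearEquiv.rTensor N e.toLinearEquiv)).toLinearMap := by
    refine DirectSum.linearMap_ext ℂ fun i => TensorProduct.ext' fun x y => ?_
    change DirectSum.toModule ℂ I (L ⊗[ℂ] N) _ (DirectSum.lof ℂ I (fun i => M i ⊗[ℂ] N) i (x ⊗ₜ y)) =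
      LinearEquiv.rTensor N e.toLinearEquiv ((TensorProduct.directSumLeft ℂ ℂ M N).symm
        (DirectSum.lof ℂ I (fun i => M i ⊗[ℂ] N) i (x ⊗ₜ y)))
    rw [DirectSum.toModule_lof, TensorProduct.directSumLeft_symm_lof_tmul]
    rfl
  refine directSum_equiv_of_bijective (fun i => LinearMap.rTensor N
      (e.toLinearEquiv.toLinearMap ∘ₗ DirectSum.lof ℂ I M i)) ?_ fun i g x => ?_
  · rw [h1]
    exact LinearEquiv.bijective _
  · have h2 : ∀ y, e.toLinearEquiv (DirectSum.lof ℂ I M i (ρ i g y)) =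
        σ g (e.toLinearEquiv (DirectSum.lof ℂ I M i y)) := fun y => by
      have h3 : Representation.directSum ρ g (DirectSum.lof ℂ _ M i y) =
        DirectSum.lof ℂ _ M i (ρ i g y) := DirectSum.lmap_lof ..
      rw [← h3]
      exact Representation.IntertwiningMap.isIntertwining _ _ e.toIntertwiningMap g _
    induction x using TensorProduct.induction_on with
    | zero => simp only [map_zero]
    | tmul x y =>
      change e.toLinearEquiv (DirectSum.lof ℂ I M i (ρ i g x)) ⊗ₜ[ℂ] τ g y = _
      rw [h2]
      rfl
    | add x y hx hy => simp only [map_add, hx, hy]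

end RepEquiv

section SymbolRep

variable {U D : Type*} [AddCommGroup U] [Module ℂ U] [AddCommGroup D] [Module ℂ D]
  [FiniteDimensional ℂ U] [FiniteDimensional ℂ D] {G : Type*} [Group G]
  (ρ : Representation ℂ G U) (σ : Representation ℂ G D)

theorem symbolSum_rep (p : ℕ) (g : G) (x) :
    symbolSum U D p (Representation.directSum (fun q : {q : ℕ × ℕ // q.1 + q.2 = p} =>
      (extRep ρ q.1.1).tprod (schurRep σ q.1.1 q.1.2)) g x) =
      ExteriorAlgebra.map (actQ ρ σ g) (symbolSum U D p x) := by
  induction x using DirectSum.induction_on with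
  | zero => simp only [map_zero]
  | of q x =>
    change symbolSum U D p (DirectSum.lmap (fun q : {q : ℕ × ℕ // q.1 + q.2 = p} =>
      (extRep ρ q.1.1).tprod (schurRep σ q.1.1 q.1.2) g) (DirectSum.lof ℂ _
        (fun q : {q : ℕ × ℕ // q.1 + q.2 = p} => Ext q.1.1 U ⊗[ℂ] Schur D q.1.1 q.1.2) q x)) =
      ExteriorAlgebra.map (actQ ρ σ g) (symbolSum U D p (DirectSum.lof ℂ _ _ q x))
    rw [DirectSum.lmap_lof, symbolSum, DirectSum.toModule_lof, DirectSum.toModule_lof,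
      symbolPart_rep]
  | add x y hx hy => simp only [map_add, hx, hy]

end SymbolRep

/-- The index set of the decomposition into irreducible modules. -/
def tripleEquiv (p m : ℕ) :
    {q : ℕ × ℕ × ℕ // q.1 + q.2.1 + q.2.2 = p ∧ q.2.2 ≤ q.2.1 ∧ q.1 + q.2.2 ≤ m} ≃
      Σ j : {q : ℕ × ℕ // q.1 + q.2 = p}, {q : ℕ × ℕ // q.1 + 2 * q.2 = j.1.1 ∧ q.1 + q.2 ≤ m} where
  -- The piece Λ^{⟨a⟩}U sits in Λ^d U with d = a + 2c, and e = b - c; the condition c ≤ b makes the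
  -- truncated subtraction exact.
  toFun q := ⟨⟨(q.1.1 + 2 * q.1.2.2, q.1.2.1 - q.1.2.2), by have := q.2; dsimp only; omega⟩,
    ⟨(q.1.1, q.1.2.2), rfl, q.2.2.2⟩⟩
  invFun s := ⟨(s.2.1.1, s.1.1.2 + s.2.1.2, s.2.1.2), by
    have h1 := s.1.2
    have h2 := s.2.2
    dsimp only
    omega⟩
  left_inv q := by
    obtain ⟨⟨a, b, c⟩, h1, h2, h3⟩ := q
    simp only [Subtype.mk.injEq, Prod.mk.injEq, true_and, and_true]
    dsimp only at h2
    omega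
  right_inv s := by
    obtain ⟨⟨⟨d, e⟩, h⟩, ⟨⟨a, c⟩, h1, h2⟩⟩ := s
    dsimp only at h1 h2 h
    subst h1
    simp

namespace IsotropicFlag

variable {V : Type*} [AddCommGroup V] [Module ℂ V] [FiniteDimensional ℂ V] (S : IsotropicFlag V)
  {k : ℕ} (b : Module.Basis (Fin k) ℂ S.E)

theorem normal_equiv {p : ℕ} (hp : 1 ≤ p) : Nonempty ((S.repN b p).Equiv (Representation.directSum
    fun q : {q : ℕ × ℕ // q.1 + q.2 = p} =>
      (extRep S.repU q.1.1).tprod (schurRep S.repE.dual q.1.1 q.1.2))) := by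
  obtain ⟨e, -⟩ := equiv_of_range_eq (ρ := S.repN b p) (σ := Representation.directSum
    fun q : {q : ℕ × ℕ // q.1 + q.2 = p} =>
      (extRep S.repU q.1.1).tprod (schurRep S.repE.dual q.1.1 q.1.2))
    (α := fun h => (ExteriorAlgebra.map (actQ S.repU S.repE.dual h)).toLinearMap)
    (S.symbolMap_injective b hp) (symbolSum_injective p)
    (by rw [range_symbolMap, range_symbolSum]) (S.symbolMap_rep b hp)
    (symbolSum_rep S.repU S.repE.dual p)
  exact ⟨e⟩

theorem normal_equiv_reduced {p m : ℕ} (hp : 1 ≤ p) (hm : Module.finrank ℂ S.U = 2 * m) :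
    Nonempty ((S.repN b p).Equiv (Representation.directSum
      fun q : {q : ℕ × ℕ × ℕ // q.1 + q.2.1 + q.2.2 = p ∧ q.2.2 ≤ q.2.1 ∧ q.1 + q.2.2 ≤ m} =>
        (redExtRep S.repU S.formU S.repU_form q.1.1).tprod
          (schurRep S.repE.dual (q.1.1 + 2 * q.1.2.2) (q.1.2.1 - q.1.2.2)))) := by
  obtain ⟨e₁⟩ := S.normal_equiv b hp
  obtain ⟨e₂⟩ := directSum_sigma (J := {q : ℕ × ℕ // q.1 + q.2 = p})
    (σ := fun q => (extRep S.repU q.1.1).tprod (schurRep S.repE.dual q.1.1 q.1.2)) fun j =>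
    directSum_tprod (schurRep S.repE.dual j.1.1 j.1.2)
      (lefschetz_equiv S.formU_alt S.formU_nondegenerate hm S.repU S.repU_form j.1.1)
  obtain ⟨e₃⟩ := directSum_reindex (tripleEquiv p m) (fun s =>
    (redExtRep S.repU S.formU S.repU_form s.2.1.1).tprod
      (schurRep S.repE.dual s.1.1.1 s.1.1.2))
  exact ⟨e₁.trans (e₂.symm.trans e₃.symm)⟩

theorem det_dual_repE (h : S.H) : LinearMap.det (S.repE.dual h) = 1 := by
  have : S.repE.dual h = (S.repE h⁻¹).dualMap := rfl
  rw [this, LinearMap.det_dualMap, S.det_repE]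

include b in
theorem finrank_E : Module.finrank ℂ S.E = k := by
  rw [Module.finrank_eq_card_basis b, Fintype.card_fin]

/-- Multiplication by the volume element of E^* is equivariant because H acts on E with determinant
one. -/
theorem normal_top_equiv (hk : 1 ≤ k) :
    Nonempty ((S.repN b k).Equiv (extRep (S.repE.dual.prod S.repU) k)) := by
  set ν : EA (Module.Dual ℂ S.E) := ExteriorAlgebra.ιMulti ℂ k b.dualBasis with hν
  have h0 : ν ≠ 0 := ιMulti_ne_zero b.dualBasis.linearIndependent
  have hd : Module.finrank ℂ (Module.Dual ℂ S.E) = k := by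
    rw [Subspace.dual_finrank_eq, S.finrank_E b]
  have hinv : ∀ h, ExteriorAlgebra.map (S.repE.dual h) ν = ν := fun h => by
    rw [hν, ExteriorAlgebra.map_apply_ιMulti]
    refine (alternating_map_basis (ExteriorAlgebra.ιMulti ℂ k) b.dualBasis _).trans ?_
    rw [S.det_dual_repE, one_smul]
  obtain ⟨e, -⟩ := equiv_of_range_eq (ρ := S.repN b k) (σ := extRep (S.repE.dual.prod S.repU) k)
    (α := fun h => (ExteriorAlgebra.map (actQ S.repU S.repE.dual h)).toLinearMap)
    (S.symbolMap_injective b hk) (topMul_injective (U := S.U) h0 k)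
    (by rw [range_symbolMap, range_topMul hd (ιMulti_mem _) h0]) (S.symbolMap_rep b hk)
    (fun h => topMul_rep S.repU S.repE.dual h (hinv h) k)
  exact ⟨e⟩

theorem normal_subsingleton {p : ℕ} (hp : k < p) : Subsingleton (S.N b p) := by
  have hp' : 1 ≤ p := by omega
  refine ⟨fun x y => S.symbolMap_injective b hp' ?_⟩
  have h : ∀ x, S.symbolMap b p hp' x = 0 := fun x => by
    have h1 : S.symbolMap b p hp' x ∈ symbols S.U (Module.Dual ℂ S.E) p := by
      rw [← S.range_symbolMap b hp']
      exact ⟨x, rfl⟩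
    rw [symbols_eq_bot (by rw [S.finrank_E b]; exact hp)] at h1
    exact (Submodule.mem_bot ℂ).1 h1
  rw [h, h]

theorem normal_top_nontrivial (hk : 1 ≤ k) : Nontrivial (S.N b k) := by
  obtain ⟨e⟩ := S.normal_top_equiv b hk
  have h : Nontrivial (Ext k (Module.Dual ℂ S.E × S.U)) := by
    refine ⟨wedge k fun i => (b.dualBasis i, 0), 0, fun h => ?_⟩
    have h1 : LinearIndependent ℂ fun i => ((b.dualBasis i, 0) : Module.Dual ℂ S.E × S.U) :=
      b.dualBasis.linearIndependent.map' (LinearMap.inl ℂ _ S.U)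
        (LinearMap.ker_eq_bot.2 LinearMap.inl_injective)
    exact ιMulti_ne_zero h1 ((congrArg (toEA k) h).trans (map_zero _))
  exact e.toLinearEquiv.toEquiv.nontrivial

end IsotropicFlag


/-! ## The tangent space and the base loci -/

section ThetaMap

variable {U E : Type*} [AddCommGroup U] [Module ℂ U] [AddCommGroup E] [Module ℂ E]
  [FiniteDimensional ℂ U] [FiniteDimensional ℂ E]

theorem hom_induction {N : Type*} [AddCommGroup N] [Module ℂ N] [FiniteDimensional ℂ N]
    {P : (E →ₗ[ℂ] N) → Prop} (h : ∀ (β : Module.Dual ℂ E) (m : N), P (β.smulRight m)) (h0 : P 0)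
    (hadd : ∀ X Y, P X → P Y → P (X + Y)) (X : E →ₗ[ℂ] N) : P X := by
  obtain ⟨β, m, hX⟩ := exists_sum_smulRight X
  rw [hX]
  exact Finset.sum_induction _ P hadd h0 fun i _ => h _ _

theorem map_theta (gQ : QE U E →ₗ[ℂ] QE U E) (gD : Module.Dual ℂ E →ₗ[ℂ] Module.Dual ℂ E)
    (gE : E →ₗ[ℂ] E) (gM : MSp U E →ₗ[ℂ] MSp U E)
    (h1 : ∀ β, gQ (in1 U (Module.Dual ℂ E) β) = in1 U (Module.Dual ℂ E) (gD β))
    (h2 : ∀ m, gQ (inM U (Module.Dual ℂ E) m) = inM U (Module.Dual ℂ E) (gM m))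
    (h3 : ∀ β, gD β = β ∘ₗ gE) (X : E →ₗ[ℂ] MSp U E) :
    ExteriorAlgebra.map gQ (theta U E X) = theta U E (gM ∘ₗ X ∘ₗ gE) := by
  induction X using hom_induction with
  | h β m =>
    have e : gM ∘ₗ β.smulRight m ∘ₗ gE = (gD β).smulRight (gM m) := LinearMap.ext fun x => by
      simp [h3]
    rw [e, theta_smulRight, theta_smulRight, map_mul, ExteriorAlgebra.map_apply_ι,
      ExteriorAlgebra.map_apply_ι, h1, h2]
  | h0 => simp
  | hadd X Y hX hY =>
    rw [map_add, map_add, hX, hY, LinearMap.add_comp, LinearMap.comp_add, map_add]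

variable (U E) in
/-- An element of `(E^* ⊗ U) ⊕ S² E^*` as a homomorphism `E → U ⊕ E^*`. -/
def toHom : (Module.Dual ℂ E ⊗[ℂ] U) × symForms E →ₗ[ℂ] E →ₗ[ℂ] MSp U E where
  toFun t := (dualTensorHom ℂ E U t.1).prod (t.2 : E →ₗ[ℂ] Module.Dual ℂ E)
  map_add' s t := LinearMap.ext fun x => by simp
  map_smul' c t := LinearMap.ext fun x => by simp

theorem toHom_apply (t : (Module.Dual ℂ E ⊗[ℂ] U) × symForms E) (x : E) :
    toHom U E t x = (dualTensorHom ℂ E U t.1 x, (t.2 : E →ₗ[ℂ] Module.Dual ℂ E) x) := rfl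

theorem toHom_mem (t : (Module.Dual ℂ E ⊗[ℂ] U) × symForms E) : toHom U E t ∈ symHom U E :=
  t.2.2

theorem dualTensorHom_bijective : Function.Bijective (dualTensorHom ℂ E U) :=
  (dualTensorHomEquiv ℂ E U).bijective

theorem toHom_injective : Function.Injective (toHom U E) := by
  intro s t h
  refine Prod.ext (dualTensorHom_bijective.1 (LinearMap.ext fun x => ?_))
    (Subtype.ext (LinearMap.ext fun x => ?_))
  · exact congrArg Prod.fst (LinearMap.congr_fun h x)
  · exact congrArg Prod.snd (LinearMap.congr_fun h x)

theorem range_toHom : LinearMap.range (toHom U E) = symHom U E := by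
  refine le_antisymm ?_ fun X hX => ?_
  · rintro _ ⟨t, rfl⟩
    exact toHom_mem t
  · obtain ⟨A, hA⟩ := dualTensorHom_bijective.2 (LinearMap.fst ℂ U _ ∘ₗ X)
    refine ⟨(A, ⟨LinearMap.snd ℂ U _ ∘ₗ X, hX⟩), LinearMap.ext fun x => ?_⟩
    rw [toHom_apply, hA]
    rfl

variable (U E) in
/-- The symbol of an element of the model of the tangent space. -/
def modelMap : (Module.Dual ℂ E ⊗[ℂ] U) × symForms E →ₗ[ℂ] EA (QE U E) := theta U E ∘ₗ toHom U E

theorem modelMap_apply (t : (Module.Dual ℂ E ⊗[ℂ] U) × symForms E) :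
    modelMap U E t = theta U E (toHom U E t) := rfl

theorem modelMap_injective : Function.Injective (modelMap U E) :=
  theta_injective.comp toHom_injective

theorem range_modelMap : LinearMap.range (modelMap U E) = symbols U (Module.Dual ℂ E) 1 := by
  rw [modelMap, LinearMap.range_comp, range_toHom]
  refine le_antisymm ?_ fun t ht => ?_
  · rintro _ ⟨X, hX, rfl⟩
    exact theta_mem_symbols hX
  · obtain ⟨X, hX, rfl⟩ := exists_theta_eq ht
    exact ⟨X, hX, rfl⟩

/-- A symbol e ∧ u has one factor in E^* and a symbol e ∧ f has two; this separates T_1 from T_2. -/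
theorem map_scale_modelMap (c : ℂ) (A : Module.Dual ℂ E ⊗[ℂ] U) (B : symForms E) :
    ExteriorAlgebra.map (IsotropicFlag.scale U (Module.Dual ℂ E) (Module.Dual ℂ E) c c)
      (modelMap U E (A, B)) = modelMap U E (c • A, c ^ 2 • B) := by
  rw [modelMap_apply, map_theta _ (c • LinearMap.id) (c • LinearMap.id)
    (LinearMap.id.prodMap (c • LinearMap.id)), modelMap_apply]
  · congr 1
    refine LinearMap.ext fun x => ?_
    change _ = (dualTensorHom ℂ E U (c • A) x, c ^ 2 • (B : E →ₗ[ℂ] Module.Dual ℂ E) x)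
    change (dualTensorHom ℂ E U A (c • x), c • (B : E →ₗ[ℂ] Module.Dual ℂ E) (c • x)) = _
    rw [map_smul, map_smul, map_smul, LinearMap.smul_apply, smul_smul, pow_two]
  · intro β
    rw [IsotropicFlag.scale_apply]
    exact Prod.ext rfl (Prod.ext rfl (smul_zero c))
  · intro m
    rw [IsotropicFlag.scale_apply]
    exact Prod.ext rfl (Prod.ext (smul_zero c) rfl)
  · intro β
    exact LinearMap.ext fun x => by simp

end ThetaMap

theorem eq_zero_of_smul_eq {M : Type*} [AddCommGroup M] [Module ℂ M] {a c : ℂ} (h : a ≠ c) {x : M}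
    (hx : a • x = c • x) : x = 0 := by
  rw [← sub_eq_zero, ← sub_smul, smul_eq_zero] at hx
  exact hx.resolve_left (sub_ne_zero.2 h)

namespace IsotropicFlag

variable {V : Type*} [AddCommGroup V] [Module ℂ V] [FiniteDimensional ℂ V] (S : IsotropicFlag V)

theorem toHom_repT (h : S.H) (t : S.TModel) : toHom S.U S.E (S.repT h t) =
    (S.repU h).prodMap (S.repE.dual h) ∘ₗ toHom S.U S.E t ∘ₗ S.repE h⁻¹ := by
  obtain ⟨A, B⟩ := t
  refine LinearMap.ext fun x => Prod.ext ?_ rfl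
  change dualTensorHom ℂ S.E S.U (S.repE.dual.tprod S.repU h A) x =
    S.repU h (dualTensorHom ℂ S.E S.U A (S.repE h⁻¹ x))
  induction A using TensorProduct.induction_on with
  | zero => simp only [map_zero, LinearMap.zero_apply]
  | tmul β u =>
    rw [Representation.tprod_apply, TensorProduct.map_tmul, dualTensorHom_apply,
      dualTensorHom_apply, map_smul]
    rfl
  | add A A' hA hA' => simp only [map_add, LinearMap.add_apply, hA, hA']

theorem modelMap_repT (h : S.H) (t : S.TModel) : modelMap S.U S.E (S.repT h t) =
    ExteriorAlgebra.map (actQ S.repU S.repE.dual h) (modelMap S.U S.E t) := by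
  rw [modelMap_apply, modelMap_apply, map_theta _ (S.repE.dual h) (S.repE h⁻¹)
    ((S.repU h).prodMap (S.repE.dual h)), toHom_repT]
  · exact fun β => Prod.ext (map_zero (S.repU h)) (Prod.ext rfl (map_zero (S.repE.dual h)))
  · exact fun m => Prod.ext rfl (Prod.ext (map_zero (S.repE.dual h)) rfl)
  · exact fun β => rfl

variable {k : ℕ} (b : Module.Basis (Fin k) ℂ S.E)

theorem exists_tangentEquiv : ∃ Θ : (S.repN b 1).Equiv S.repT,
    ∀ x, modelMap S.U S.E (Θ x) = S.symbolMap b 1 le_rfl x := by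
  have h1 : LinearMap.range (S.symbolMap b 1 le_rfl) = LinearMap.range (modelMap S.U S.E) := by
    rw [range_symbolMap, range_modelMap]
  have h2 : ∀ h x, S.symbolMap b 1 le_rfl (S.repN b 1 h x) =
      (ExteriorAlgebra.map (actQ S.repU S.repE.dual h)).toLinearMap (S.symbolMap b 1 le_rfl x) :=
    S.symbolMap_rep b le_rfl
  have h3 : ∀ h x, modelMap S.U S.E (S.repT h x) =
      (ExteriorAlgebra.map (actQ S.repU S.repE.dual h)).toLinearMap (modelMap S.U S.E x) :=
    S.modelMap_repT
  have h4 : Function.Injective (modelMap S.U S.E) := modelMap_injective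
  obtain ⟨Θ, hΘ⟩ := equiv_of_range_eq (S.symbolMap_injective b le_rfl) h4 h1 h2 h3
  exact ⟨Θ, hΘ⟩

/-- Removing a multiple of the base point makes the coordinates homogeneous of degree two, so that
the one-parameter group scales the lift itself. -/
theorem exists_coord_eq (t : S.TModel) : ∃ w : osc (isoCone S.ω k) (S.point b) 1,
    S.coord b w = modelMap S.U S.E t ∧
      S.symbolMap b 1 le_rfl (nmk _ _ 1 w) = modelMap S.U S.E t := by
  have h1 : modelMap S.U S.E t ∈ symbols S.U (Module.Dual ℂ S.E) 1 := by
    rw [← range_modelMap]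
    exact ⟨t, rfl⟩
  obtain ⟨w, hw, h2⟩ := S.exists_mem_osc_comp_eq b le_rfl h1
  have h3 : S.point b ∈ osc (isoCone S.ω k) (S.point b) 1 := by
    rw [mem_osc_iff]
    exact fun n hn => S.comp_point b (by omega)
  have h4 : w - S.lead b w • S.point b ∈ osc (isoCone S.ω k) (S.point b) 1 :=
    sub_mem hw (Submodule.smul_mem _ _ h3)
  have h5 : S.comp b 2 (w - S.lead b w • S.point b) = modelMap S.U S.E t := by
    rw [map_sub, map_smul, S.comp_point b two_ne_zero, smul_zero, sub_zero]
    exact h2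
  refine ⟨⟨_, h4⟩, eq_of_proj fun n => ?_, h5⟩
  have h6 := (mem_symbols.1 h1).1
  rcases Nat.lt_or_ge 2 n with hn | hn
  · rw [proj_of_mem_ne h6 (by omega)]
    exact S.comp_eq_zero_of_mem_osc b h4 (by omega)
  · interval_cases n
    · rw [proj_of_mem_ne h6 (by omega)]
      change S.comp b 0 _ = 0
      rw [comp_zero, map_sub, map_smul, lead_point, smul_eq_mul, mul_one, sub_self, zero_smul]
    · rw [proj_of_mem_ne h6 (by omega)]
      exact S.comp_odd b ⟨0, rfl⟩ _
    · rw [proj_of_mem h6]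
      exact h5

variable {S b} in
theorem mem_gradedTangent_of {Θ : (S.repN b 1).Equiv S.repT}
    (hΘ : ∀ x, modelMap S.U S.E (Θ x) = S.symbolMap b 1 le_rfl x) {i : ℕ} {t : S.TModel}
    (ht : ∀ c : ℂ, (c • t.1, c ^ 2 • t.2) = c ^ i • t) :
    t ∈ (S.gradedTangent b i).map Θ.toLinearMap := by
  obtain ⟨w, h1, h2⟩ := S.exists_coord_eq b t
  refine ⟨nmk _ _ 1 w, ⟨w, fun a z hz1 hz2 hz3 => ?_, rfl⟩, ?_⟩
  · refine S.coord_injective b ?_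
    rw [S.coord_weights b hz1 hz2 hz3, h1, map_scale_modelMap, ht, map_smul, map_smul, h1,
      smul_smul]
    rfl
  · refine modelMap_injective ?_
    rw [← h2]
    exact hΘ _

variable {S b} in
theorem of_mem_gradedTangent {Θ : (S.repN b 1).Equiv S.repT}
    (hΘ : ∀ x, modelMap S.U S.E (Θ x) = S.symbolMap b 1 le_rfl x) {i : ℕ} {t : S.TModel}
    (ht : t ∈ (S.gradedTangent b i).map Θ.toLinearMap) (a : ℂˣ) :
    (((a⁻¹ : ℂˣ) : ℂ) • t.1, ((a⁻¹ : ℂˣ) : ℂ) ^ 2 • t.2) = ((a⁻¹ : ℂˣ) : ℂ) ^ i • t := by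
  obtain ⟨_, ⟨w, hw, rfl⟩, rfl⟩ := ht
  obtain ⟨z, hz1, hz2, hz3⟩ := S.exists_weights a
  have h1 := congrArg (S.comp b 2) (hw a z hz1 hz2 hz3)
  rw [comp_apply, S.coord_weights b hz1 hz2 hz3, map_smul, ← map_proj, ← comp_apply, map_smul] at h1
  have h2 : modelMap S.U S.E (Θ (nmk _ _ 1 w)) = S.comp b 2 w := hΘ _
  change (((a⁻¹ : ℂˣ) : ℂ) • (Θ (nmk _ _ 1 w)).1, ((a⁻¹ : ℂˣ) : ℂ) ^ 2 • (Θ (nmk _ _ 1 w)).2) =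
    ((a⁻¹ : ℂˣ) : ℂ) ^ i • Θ (nmk _ _ 1 w)
  generalize Θ (nmk _ _ 1 w) = y at h2
  refine modelMap_injective ?_
  have h4 := map_scale_modelMap ((a⁻¹ : ℂˣ) : ℂ) y.1 y.2
  rw [Prod.mk.eta] at h4
  rw [← h2, h4, Units.val_mul, mul_smul, Units.val_pow_eq_pow_val,
    Units.val_pow_eq_pow_val] at h1
  have h3 := smul_right_injective _ (pow_ne_zero k a.ne_zero) h1
  rw [map_smul]
  exact h3

variable {S b} in
theorem gradedTangent_one {Θ : (S.repN b 1).Equiv S.repT}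
    (hΘ : ∀ x, modelMap S.U S.E (Θ x) = S.symbolMap b 1 le_rfl x) :
    (S.gradedTangent b 1).map Θ.toLinearMap =
      LinearMap.range (LinearMap.inl ℂ (Module.Dual ℂ S.E ⊗[ℂ] S.U) (symForms S.E)) := by
  refine le_antisymm (fun t ht => ?_) ?_
  · have h1 := congrArg Prod.snd (of_mem_gradedTangent hΘ ht (Units.mk0 2 two_ne_zero))
    have h2 : t.2 = 0 := eq_zero_of_smul_eq (M := symForms S.E) (a := (2 : ℂ)⁻¹ ^ 2) (c := 2⁻¹ ^ 1) (by norm_num) h1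
    exact ⟨t.1, Prod.ext rfl h2.symm⟩
  · rintro _ ⟨A, rfl⟩
    refine mem_gradedTangent_of hΘ fun c => ?_
    refine Prod.ext (by simp) (by simp)

variable {S b} in
theorem gradedTangent_two {Θ : (S.repN b 1).Equiv S.repT}
    (hΘ : ∀ x, modelMap S.U S.E (Θ x) = S.symbolMap b 1 le_rfl x) :
    (S.gradedTangent b 2).map Θ.toLinearMap =
      LinearMap.range (LinearMap.inr ℂ (Module.Dual ℂ S.E ⊗[ℂ] S.U) (symForms S.E)) := by
  refine le_antisymm (fun t ht => ?_) ?_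
  · have h1 := congrArg Prod.fst (of_mem_gradedTangent hΘ ht (Units.mk0 2 two_ne_zero))
    have h2 : t.1 = 0 := eq_zero_of_smul_eq (M := Module.Dual ℂ S.E ⊗[ℂ] S.U) (a := (2 : ℂ)⁻¹) (c := 2⁻¹ ^ 2) (by norm_num) h1
    exact ⟨t.2, Prod.ext h2.symm rfl⟩
  · rintro _ ⟨A, rfl⟩
    refine mem_gradedTangent_of hΘ fun c => ?_
    refine Prod.ext (by simp) (by simp)

/-- The rank of a tangent vector. -/
def rank (t : S.TModel) : ℕ := Module.finrank ℂ (LinearMap.range (toHom S.U S.E t))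

theorem modelMap_pow_eq_zero_iff (t : S.TModel) (p : ℕ) :
    modelMap S.U S.E t ^ p = 0 ↔ S.rank t < p := theta_pow_eq_zero_iff _ p

/-- The tangent directions of rank at most `r`. -/
def rankLocus (r : ℕ) : Set (ℙ ℂ S.TModel) := {y | S.rank y.rep ≤ r}

/-- Independence of the representative follows from the description of the rank by vanishing powers,
which are homogeneous. -/
theorem mk_mem_rankLocus {r : ℕ} {t : S.TModel} (ht : t ≠ 0) :
    Projectivization.mk ℂ t ht ∈ S.rankLocus r ↔ S.rank t ≤ r := by
  obtain ⟨a, ha⟩ := Projectivization.exists_smul_eq_mk_rep ℂ t ht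
  change S.rank (Projectivization.mk ℂ t ht).rep ≤ r ↔ _
  rw [← ha, ← Nat.lt_succ_iff, ← Nat.lt_succ_iff, ← modelMap_pow_eq_zero_iff,
    ← modelMap_pow_eq_zero_iff, Units.smul_def, map_smul, smul_pow, smul_eq_zero]
  exact or_iff_right (pow_ne_zero _ a.ne_zero)

variable {S b} in
theorem image_baseLocus {Θ : (S.repN b 1).Equiv S.repT}
    (hΘ : ∀ x, modelMap S.U S.E (Θ x) = S.symbolMap b 1 le_rfl x) {p : ℕ} (hp : 1 ≤ p)
    {F : MultilinearMap ℂ (fun _ : Fin p => S.N b 1) (S.N b p)}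
    (hF : IsFundForm (isoCone S.ω k) (S.point b) p F) :
    Projectivization.map Θ.toLinearMap Θ.injective '' baseLocus F = S.rankLocus (p - 1) := by
  have key : ∀ x : ℙ ℂ (S.N b 1), Projectivization.map Θ.toLinearMap Θ.injective x ∈
      S.rankLocus (p - 1) ↔ x ∈ baseLocus F := fun x => by
    rw [S.mem_baseLocus_iff b hp hF, ← hΘ, modelMap_pow_eq_zero_iff]
    conv_lhs => rw [← x.mk_rep, Projectivization.map_mk, mk_mem_rankLocus]
    change S.rank (Θ x.rep) ≤ p - 1 ↔ _
    omega
  ext y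
  constructor
  · rintro ⟨x, hx, rfl⟩
    exact (key x).2 hx
  · intro hy
    obtain ⟨v, hv⟩ : ∃ v, Θ v = y.rep := Θ.toLinearEquiv.surjective y.rep
    have hv0 : v ≠ 0 := fun h => y.rep_nonzero (by rw [← hv, h]; exact map_zero Θ.toLinearEquiv)
    have h1 : Projectivization.map Θ.toLinearMap Θ.injective (Projectivization.mk ℂ v hv0) = y := by
      rw [Projectivization.map_mk]
      conv_rhs => rw [← y.mk_rep]
      congr 1
    exact ⟨_, (key _).1 (h1 ▸ hy), h1⟩

end IsotropicFlag


/-! ## Zariski closures of the loci of bounded rank -/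

section Zariski

variable {W N : Type*} [AddCommGroup W] [Module ℂ W] [AddCommGroup N] [Module ℂ N]

theorem subset_zariskiClosure (Z : Set (ℙ ℂ W)) : Z ⊆ zariskiClosure Z := fun x hx _ _ h => h x hx

theorem form_smul {d : ℕ} (M : MultilinearMap ℂ (fun _ : Fin d => W) N) (c : ℂ) (w : W) :
    M (fun _ => c • w) = c ^ d • M fun _ => w := by
  rw [M.map_smul_univ (fun _ => c) fun _ => w]
  simp

theorem form_mk_rep_eq_zero_iff {d : ℕ} (M : MultilinearMap ℂ (fun _ : Fin d => W) N) {w : W}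
    (hw : w ≠ 0) : M (fun _ => (Projectivization.mk ℂ w hw).rep) = 0 ↔ M (fun _ => w) = 0 := by
  obtain ⟨a, ha⟩ := Projectivization.exists_smul_eq_mk_rep ℂ w hw
  rw [← ha]
  change M (fun _ => (a : ℂ) • w) = 0 ↔ _
  rw [form_smul, smul_eq_zero]
  exact or_iff_right (pow_ne_zero _ a.ne_zero)

theorem exists_dual_apply_ne_zero {w : W} (hw : w ≠ 0) : ∃ l : Module.Dual ℂ W, l w ≠ 0 := by
  by_contra! h
  exact hw ((Module.forall_dual_apply_eq_zero_iff ℂ _).1 h)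

theorem IsHol.eventually_ne {γ : ℂ → W} (h : IsHol γ) (h0 : γ 0 ≠ 0) :
    ∀ᶠ s in 𝓝[≠] (0 : ℂ), γ s ≠ 0 := by
  obtain ⟨l, hl⟩ := exists_dual_apply_ne_zero h0
  have h1 := (h l).continuousAt.eventually_ne hl
  refine (h1.filter_mono nhdsWithin_le_nhds).mono fun s hs h2 => hs ?_
  rw [h2, map_zero]

theorem isHol_add_smul (u v : W) : IsHol fun s : ℂ => u + s • v :=
  (isHol_const u).add (IsHol.smul_const analyticAt_id v)

theorem eventually_add_smul_ne (u : W) {v : W} (hv : v ≠ 0) :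
    ∀ᶠ s in 𝓝[≠] (0 : ℂ), u + s • v ≠ 0 := by
  rcases eq_or_ne u 0 with rfl | hu
  · filter_upwards [self_mem_nhdsWithin] with s hs
    rw [zero_add]
    exact smul_ne_zero hs hv
  · refine (isHol_add_smul u v).eventually_ne ?_
    rwa [zero_smul, add_zero]

/-- A polynomial that is nonzero at the limit of a holomorphic curve is nonzero on nearby points of
the curve, which lie in Z. -/
theorem mem_zariskiClosure_of_path [FiniteDimensional ℂ W] {Z : Set (ℙ ℂ W)} {x : ℙ ℂ W}
    {γ : ℂ → W} (hγ : IsHol γ) (h0 : γ 0 = x.rep)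
    (h : ∀ᶠ s in 𝓝[≠] (0 : ℂ), ∃ hs : γ s ≠ 0, Projectivization.mk ℂ (γ s) hs ∈ Z) :
    x ∈ zariskiClosure Z := by
  intro d M hM
  have h1 : IsHol fun s => M fun _ => γ s := IsHol.multilinear M fun _ => hγ
  by_contra hc
  have h2 := h1.eventually_ne (by rwa [h0])
  obtain ⟨s, ⟨hs, h3⟩, h4⟩ := (h.and h2).exists
  exact h4 ((form_mk_rep_eq_zero_iff M hs).1 (hM _ h3))

end Zariski

/-! ### Normal form of tangent vectors of given rank. -/

section NormalForm

variable {U E : Type*} [AddCommGroup U] [Module ℂ U] [AddCommGroup E] [Module ℂ E]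
  [FiniteDimensional ℂ U] [FiniteDimensional ℂ E]

theorem toHom_sum_tmul_sq {ι : Type*} [Fintype ι] (f : ι → Module.Dual ℂ E) (u : ι → U)
    (d : ι → ℂ) : toHom U E (∑ j, (f j ⊗ₜ[ℂ] u j, d j • sq (f j))) =
      ∑ j, (f j).smulRight ((u j, d j • f j) : MSp U E) := by
  rw [map_sum]
  refine Finset.sum_congr rfl fun j _ => LinearMap.ext fun x => Prod.ext rfl ?_
  exact smul_comm (d j) (f j x) (f j)

theorem finrank_range_toHom_sum_le {r : ℕ} (f : Fin r → Module.Dual ℂ E) (u : Fin r → U)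
    (d : Fin r → ℂ) : Module.finrank ℂ (LinearMap.range
      (toHom U E (∑ j, (f j ⊗ₜ[ℂ] u j, d j • sq (f j))))) ≤ r := by
  have h : LinearMap.range (toHom U E (∑ j, (f j ⊗ₜ[ℂ] u j, d j • sq (f j)))) ≤
      Submodule.span ℂ (Set.range fun j => ((u j, d j • f j) : MSp U E)) := by
    rintro _ ⟨x, rfl⟩
    rw [toHom_sum_tmul_sq, LinearMap.sum_apply]
    exact sum_mem fun j _ => Submodule.smul_mem _ _ (Submodule.subset_span ⟨j, rfl⟩)
  refine (Submodule.finrank_mono h).trans ?_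
  simpa [Set.finrank] using
    finrank_range_le_card (R := ℂ) (fun j => ((u j, d j • f j) : MSp U E))

/-- On a complement of the kernel, whose dimension is the rank, the symmetric form has an orthogonal
basis. Its dual basis gives the f_j, its images in U the u_j and its squares the d_j. -/
theorem exists_sum_tmul_sq (t : (Module.Dual ℂ E ⊗[ℂ] U) × symForms E) {r : ℕ}
    (hr : Module.finrank ℂ (LinearMap.range (toHom U E t)) ≤ r) :
    ∃ (f : Fin r → Module.Dual ℂ E) (u : Fin r → U) (d : Fin r → ℂ),
      t = ∑ j, (f j ⊗ₜ[ℂ] u j, d j • sq (f j)) := by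
  obtain ⟨C, hC⟩ := (LinearMap.ker (toHom U E t)).exists_isCompl
  have h1 : Module.finrank ℂ C = Module.finrank ℂ (LinearMap.range (toHom U E t)) := by
    have h2 := Submodule.finrank_add_eq_of_isCompl hC
    have h3 := (toHom U E t).finrank_range_add_finrank_ker
    omega
  obtain ⟨q, rfl⟩ := Nat.exists_eq_add_of_le (h1 ▸ hr)
  let B : LinearMap.BilinForm ℂ C := (t.2 : E →ₗ[ℂ] Module.Dual ℂ E).domRestrict₁₂ C C
  have hB : LinearMap.IsSymm B := ⟨fun x y => t.2.2 x y⟩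
  have : Invertible (2 : ℂ) := invertibleOfNonzero two_ne_zero
  obtain ⟨v, hv⟩ := LinearMap.BilinForm.exists_orthogonal_basis hB
  let π : E →ₗ[ℂ] C := C.projectionOnto _ hC.symm
  have hπ : ∀ x, toHom U E t x = toHom U E t (π x) := fun x => by
    rw [← sub_eq_zero, ← map_sub, ← LinearMap.mem_ker]
    rw [← Submodule.ker_projectionOnto hC.symm, LinearMap.mem_ker, map_sub,
      Submodule.projectionOnto_apply_left]
    exact sub_self (π x)
  let f := fun j => v.coord j ∘ₗ π
  let u := fun j => dualTensorHom ℂ E U t.1 (v j)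
  let d := fun j => B (v j) (v j)
  have hBv : ∀ j, (t.2 : E →ₗ[ℂ] Module.Dual ℂ E) (v j) = d j • f j := fun j => by
    refine LinearMap.ext fun y => ?_
    have h2 : (t.2 : E →ₗ[ℂ] Module.Dual ℂ E) (v j) y = B (v j) (π y) := by
      rw [t.2.2]
      have h3 : (t.2 : E →ₗ[ℂ] Module.Dual ℂ E) y = (t.2 : E →ₗ[ℂ] Module.Dual ℂ E) (π y) :=
        congrArg Prod.snd (hπ y)
      rw [h3]
      exact t.2.2 _ _
    rw [h2]
    conv_lhs => rw [← v.sum_repr (π y), map_sum]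
    rw [Finset.sum_eq_single j]
    · rw [map_smul, smul_eq_mul, mul_comm]
      rfl
    · intro i _ hi
      rw [map_smul, show B (v j) (v i) = 0 from hv hi.symm, smul_zero]
    · exact fun h => absurd (Finset.mem_univ j) h
  have h4 : t = ∑ j, (f j ⊗ₜ[ℂ] u j, d j • sq (f j)) := by
    refine toHom_injective ?_
    rw [toHom_sum_tmul_sq]
    refine LinearMap.ext fun x => ?_
    rw [hπ]
    conv_lhs => rw [← v.sum_repr (π x)]
    rw [LinearMap.sum_apply, Submodule.coe_sum, map_sum]
    refine Finset.sum_congr rfl fun j _ => ?_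
    rw [Submodule.coe_smul, map_smul, toHom_apply, hBv]
    rfl
  -- Zero terms pad the sum from the rank up to r.
  refine ⟨Fin.append f 0, Fin.append u 0, Fin.append d 0, ?_⟩
  rw [Fin.sum_univ_add]
  simp only [Fin.append_left, Fin.append_right, Pi.zero_apply, zero_smul, TensorProduct.tmul_zero]
  rw [← h4]
  simp

end NormalForm

namespace IsotropicFlag

variable {V : Type*} [AddCommGroup V] [Module ℂ V] [FiniteDimensional ℂ V] (S : IsotropicFlag V)

/-- The locus is cut out by the forms l(θ^{r+1}) of degree r + 1. -/
theorem zariskiClosure_subset_rankLocus {Z : Set (ℙ ℂ S.TModel)} {r : ℕ} (hZ : Z ⊆ S.rankLocus r) :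
    zariskiClosure Z ⊆ S.rankLocus r := by
  intro x hx
  have key : ∀ y : ℙ ℂ S.TModel, y ∈ S.rankLocus r ↔ modelMap S.U S.E y.rep ^ (r + 1) = 0 :=
    fun y => by rw [modelMap_pow_eq_zero_iff, Nat.lt_succ_iff]; rfl
  rw [key, ← Module.forall_dual_apply_eq_zero_iff ℂ]
  intro l
  have h := hx (r + 1) (l.compMultilinearMap ((MultilinearMap.mkPiAlgebraFin ℂ (r + 1)
    (EA (QE S.U S.E))).compLinearMap fun _ => modelMap S.U S.E)) fun y hy => by
      have h1 := (key y).1 (hZ hy)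
      rw [LinearMap.compMultilinearMap_apply, MultilinearMap.compLinearMap_apply,
        MultilinearMap.mkPiAlgebraFin_apply_const, h1, map_zero]
  rwa [LinearMap.compMultilinearMap_apply, MultilinearMap.compLinearMap_apply,
    MultilinearMap.mkPiAlgebraFin_apply_const] at h

theorem rank_sum_le {r : ℕ} (f : Fin r → Module.Dual ℂ S.E) (u : Fin r → S.U) (d : Fin r → ℂ) :
    S.rank (∑ j, (f j ⊗ₜ[ℂ] u j, d j • sq (f j))) ≤ r := finrank_range_toHom_sum_le f u d

/-- In the normal form, adding s ∑ f_j² moves every d_j to d_j + s, which is nonzero for small s ≠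
0; a square root σ_j of it is absorbed by f_j ↦ σ_j f_j and u_j ↦ u_j / σ_j. -/
theorem zariskiClosure_sumLocus (r : ℕ) : zariskiClosure (S.sumLocus r) = S.rankLocus r := by
  refine Set.Subset.antisymm (S.zariskiClosure_subset_rankLocus ?_) fun x hx => ?_
  · rintro _ ⟨e, u, h, rfl⟩
    rw [mk_mem_rankLocus, prod_mk_sum]
    simpa using S.rank_sum_le e u fun _ => 1
  · obtain ⟨f, u, d, ht⟩ := exists_sum_tmul_sq x.rep hx
    have h1 : x.rep + (0 : ℂ) • ∑ j, (0, sq (f j)) = x.rep := by rw [zero_smul, add_zero]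
    have hol := isHol_add_smul x.rep (∑ j, ((0, sq (f j)) : S.TModel))
    refine mem_zariskiClosure_of_path hol h1 ?_
    have h2 := hol.eventually_ne (by rw [h1]; exact x.rep_nonzero)
    have h3 : ∀ᶠ s in 𝓝[≠] (0 : ℂ), ∀ j, d j + s ≠ 0 := Filter.eventually_all.2 fun j => by
      simpa using eventually_add_smul_ne (d j) (one_ne_zero (α := ℂ))
    filter_upwards [h2, h3] with s hs hd
    choose σ hσ using fun j => IsAlgClosed.exists_pow_nat_eq (d j + s) (n := 2) two_pos
    have hσ0 : ∀ j, σ j ≠ 0 := fun j h => hd j (by rw [← hσ, h]; norm_num)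
    have h4 : x.rep + s • ∑ j, ((0, sq (f j)) : S.TModel) =
        (∑ j, (σ j • f j) ⊗ₜ[ℂ] ((σ j)⁻¹ • u j), ∑ j, sq (σ j • f j)) := by
      rw [prod_mk_sum, ht, Finset.smul_sum, ← Finset.sum_add_distrib]
      refine Finset.sum_congr rfl fun j _ => ?_
      rw [TensorProduct.smul_tmul, smul_smul, mul_inv_cancel₀ (hσ0 j), one_smul]
      refine Prod.ext ?_ (Subtype.ext (LinearMap.ext fun y => LinearMap.ext fun z => ?_))
      · change f j ⊗ₜ[ℂ] u j + s • (0 : Module.Dual ℂ S.E ⊗[ℂ] S.U) = _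
        rw [smul_zero, add_zero]
      · change d j * (f j y * f j z) + s * (f j y * f j z) = σ j * f j y * (σ j * f j z)
        linear_combination (-(f j y * f j z)) * hσ j
    exact ⟨hs, fun j => σ j • f j, fun j => (σ j)⁻¹ • u j, h4 ▸ hs, by congr 1⟩

theorem exists_tmul_sq {x : ℙ ℂ S.TModel} (hx : x ∈ S.rankLocus 1) :
    ∃ (f : Module.Dual ℂ S.E) (u : S.U) (d : ℂ), f ≠ 0 ∧ x.rep = (f ⊗ₜ[ℂ] u, d • sq f) := by
  obtain ⟨f, u, d, ht⟩ := exists_sum_tmul_sq x.rep hx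
  rw [Fin.sum_univ_one] at ht
  refine ⟨f 0, u 0, d 0, fun h => x.rep_nonzero ?_, ht⟩
  rw [ht, h]
  refine Prod.ext (TensorProduct.zero_tmul _ _) (Subtype.ext (LinearMap.ext fun y =>
    LinearMap.ext fun z => ?_))
  change d 0 * (0 * 0) = 0
  ring

theorem tmul_sq_mem_rankLocus {f : Module.Dual ℂ S.E} {u : S.U} {d : ℂ}
    (h : ((f ⊗ₜ[ℂ] u, d • sq f) : S.TModel) ≠ 0) : Projectivization.mk ℂ _ h ∈ S.rankLocus 1 := by
  rw [mk_mem_rankLocus]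
  simpa using S.rank_sum_le (fun _ : Fin 1 => f) (fun _ => u) fun _ => d

theorem openOrbit_subset : S.openOrbit ⊆ S.rankLocus 1 := by
  rintro _ ⟨e, u, h, -, -, rfl⟩
  have h1 := S.tmul_sq_mem_rankLocus (f := e) (u := u) (d := 1) (by rwa [one_smul])
  simpa only [one_smul] using h1

theorem tmul_sq_mem_openOrbit {f : Module.Dual ℂ S.E} {u : S.U} {d : ℂ} (hf : f ≠ 0) (hu : u ≠ 0)
    (hd : d ≠ 0) (h : ((f ⊗ₜ[ℂ] u, d • sq f) : S.TModel) ≠ 0) :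
    Projectivization.mk ℂ _ h ∈ S.openOrbit := by
  obtain ⟨σ, hσ⟩ := IsAlgClosed.exists_pow_nat_eq d (n := 2) two_pos
  have hσ0 : σ ≠ 0 := fun h => hd (by rw [← hσ, h]; norm_num)
  have h4 : ((f ⊗ₜ[ℂ] u, d • sq f) : S.TModel) = ((σ • f) ⊗ₜ[ℂ] (σ⁻¹ • u), sq (σ • f)) := by
    rw [TensorProduct.smul_tmul, smul_smul, mul_inv_cancel₀ hσ0, one_smul]
    refine Prod.ext rfl (Subtype.ext (LinearMap.ext fun y => LinearMap.ext fun z => ?_))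
    change d * (f y * f z) = σ * f y * (σ * f z)
    linear_combination (-(f y * f z)) * hσ
  exact ⟨σ • f, σ⁻¹ • u, h4 ▸ h, smul_ne_zero hσ0 hf, smul_ne_zero (inv_ne_zero hσ0) hu,
    by congr 1⟩

/-- Moving f ⊗ u ⊕ d f² in the direction f ⊗ u₀ ⊕ f² with u₀ ≠ 0 makes both u and d nonzero at once.
-/
theorem zariskiClosure_openOrbit [Nontrivial S.U] : zariskiClosure S.openOrbit = S.rankLocus 1 := by
  refine Set.Subset.antisymm (S.zariskiClosure_subset_rankLocus S.openOrbit_subset) fun x hx => ?_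
  obtain ⟨f, u, d, hf, ht⟩ := S.exists_tmul_sq hx
  obtain ⟨u₀, hu₀⟩ := exists_ne (0 : S.U)
  have h1 : x.rep + (0 : ℂ) • ((f ⊗ₜ[ℂ] u₀, sq f) : S.TModel) = x.rep := by
    rw [zero_smul, add_zero]
  have hol := isHol_add_smul x.rep ((f ⊗ₜ[ℂ] u₀, sq f) : S.TModel)
  refine mem_zariskiClosure_of_path hol h1 ?_
  have h2 := hol.eventually_ne (by rw [h1]; exact x.rep_nonzero)
  filter_upwards [h2, eventually_add_smul_ne u hu₀,
    eventually_add_smul_ne d (one_ne_zero (α := ℂ))] with s hs hu hd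
  have h4 : x.rep + s • ((f ⊗ₜ[ℂ] u₀, sq f) : S.TModel) =
      (f ⊗ₜ[ℂ] (u + s • u₀), (d + s • (1 : ℂ)) • sq f) := by
    rw [ht, TensorProduct.tmul_add, TensorProduct.tmul_smul, smul_eq_mul, mul_one, add_smul]
    rfl
  have h5 := S.tmul_sq_mem_openOrbit hf hu hd (h4 ▸ hs)
  refine ⟨hs, ?_⟩
  convert h5 using 2

end IsotropicFlag


/-! ## Orbits -/

section Transitivity

variable {W : Type*} [AddCommGroup W] [Module ℂ W]

/-- A vector space is not the union of two hyperplanes. -/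
theorem exists_ne_zero_of_dual {e e' : Module.Dual ℂ W} (he : e ≠ 0) (he' : e' ≠ 0) :
    ∃ x, e x ≠ 0 ∧ e' x ≠ 0 := by
  obtain ⟨x, hx⟩ : ∃ x, e x ≠ 0 := by
    by_contra! h
    exact he (LinearMap.ext h)
  obtain ⟨y, hy⟩ : ∃ y, e' y ≠ 0 := by
    by_contra! h
    exact he' (LinearMap.ext h)
  by_cases h1 : e' x = 0
  · by_cases h2 : e y = 0
    · exact ⟨x + y, by simpa [h2] using hx, by simpa [h1] using hy⟩
    · exact ⟨y, h2, hy⟩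
  · exact ⟨x, hx, h1⟩

/-- With e(z) and e'(z) nonzero, f = id + e(z)^{-1}(e' - e) ⊗ z is invertible and satisfies e ∘ f =
e'. The scalar c, a root of 1/det f of order dim W, makes the determinant one. -/
theorem exists_specialLinear_comp_eq [FiniteDimensional ℂ W] {e e' : Module.Dual ℂ W} (he : e ≠ 0)
    (he' : e' ≠ 0) : ∃ (c : ℂ) (a : SpecialLinearGroup ℂ W), c ≠ 0 ∧ ∀ x, e (a x) = c * e' x := by
  obtain ⟨z, hz, hz'⟩ := exists_ne_zero_of_dual he he'
  let f : W →ₗ[ℂ] W := LinearMap.id + ((e z)⁻¹ • (e' - e)).smulRight z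
  have hf : ∀ x, f x = x + ((e z)⁻¹ * (e' x - e x)) • z := fun x => rfl
  have hef : ∀ x, e (f x) = e' x := fun x => by
    rw [hf, map_add, map_smul, smul_eq_mul]
    field_simp
    ring
  have hinj : Function.Injective f := by
    rw [injective_iff_map_eq_zero]
    intro x hx
    have h1 : e' x = 0 := by rw [← hef, hx, map_zero]
    have h2 := congrArg e' hx
    rw [hf, map_add, map_smul, h1, map_zero, zero_add, smul_eq_mul, mul_eq_zero] at h2
    have h3 := h2.resolve_right hz'
    rwa [hf, h1, h3, zero_smul, add_zero] at hx
  have hdet : LinearMap.det f ≠ 0 :=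
    (LinearEquiv.isUnit_det' (LinearEquiv.ofInjectiveEndo f hinj)).ne_zero
  have : Nontrivial W := nontrivial_of_ne z 0 fun h => hz (by rw [h, map_zero])
  obtain ⟨c, hc⟩ := IsAlgClosed.exists_pow_nat_eq (LinearMap.det f)⁻¹
    (Module.finrank_pos (R := ℂ) (M := W))
  have hc0 : c ≠ 0 := by
    rintro rfl
    rw [zero_pow Module.finrank_pos.ne'] at hc
    exact inv_ne_zero hdet hc.symm
  have hinj' : Function.Injective (c • f) := fun x y h => hinj (smul_right_injective W hc0 h)
  refine ⟨c, ⟨LinearEquiv.ofInjectiveEndo (c • f) hinj', Units.ext ?_⟩, hc0, fun x => ?_⟩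
  · rw [LinearEquiv.coe_det]
    change LinearMap.det (c • f) = 1
    rw [LinearMap.det_smul, hc, inv_mul_cancel₀ hdet]
  · change e (c • f x) = _
    rw [map_smul, hef, smul_eq_mul]

variable {ω : LinearMap.BilinForm ℂ W}

theorem exists_transvection (hω : ω.IsAlt) (a : W) (c : ℂ) :
    ∃ g : spGroup ω, ∀ x, spRep ω g x = x + (c * ω x a) • a := by
  let T : ℂ → W →ₗ[ℂ] W := fun c => LinearMap.id + (c • ω.flip a).smulRight a
  have hT : ∀ c x, T c x = x + (c * ω x a) • a := fun c x => rfl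
  have hTT : ∀ c, T c ∘ₗ T (-c) = LinearMap.id := fun c => LinearMap.ext fun x => by
    rw [LinearMap.comp_apply, hT, hT, map_add, LinearMap.add_apply, map_smul, LinearMap.smul_apply,
      hω a, smul_zero, add_zero, add_assoc, ← add_smul]
    simp
  refine ⟨⟨LinearEquiv.ofLinearMap (T c) (T (-c)) (hTT c) ?_, fun x y => ?_⟩, fun x => rfl⟩
  · simpa using hTT (-c)
  · change ω (T c x) (T c y) = _
    rw [hT, hT]
    simp only [map_add, LinearMap.add_apply, map_smul, LinearMap.smul_apply, hω a, smul_eq_mul]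
    rw [← LinearMap.IsAlt.neg hω y a]
    ring

/-- A transvection along y - x takes x to y when ω(x, y) ≠ 0. In general two of them are composed,
through a vector that pairs nontrivially with both u and v. -/
theorem exists_spGroup_apply_eq (hω : ω.IsAlt) (hnd : ω.Nondegenerate) {u v : W} (hu : u ≠ 0)
    (hv : v ≠ 0) : ∃ g : spGroup ω, spRep ω g u = v := by
  have key : ∀ {x y : W}, ω x y ≠ 0 → ∃ g : spGroup ω, spRep ω g x = y := fun {x y} h => by
    obtain ⟨g, hg⟩ := exists_transvection hω (y - x) (ω x y)⁻¹
    refine ⟨g, ?_⟩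
    rw [hg, map_sub, hω x, sub_zero, inv_mul_cancel₀ h, one_smul, add_sub_cancel]
  have hne : ∀ {x : W}, x ≠ 0 → ω x ≠ 0 := fun {x} hx h =>
    hx (hnd.1 x fun y => by rw [h, LinearMap.zero_apply])
  obtain ⟨w, hw, hw'⟩ := exists_ne_zero_of_dual (hne hu) (hne hv)
  obtain ⟨g, hg⟩ := key hw
  obtain ⟨g', hg'⟩ := key (x := w) (y := v) (by rw [← LinearMap.IsAlt.neg hω]; exact neg_ne_zero.2 hw')
  exact ⟨g' * g, by rw [map_mul, Module.End.mul_apply, hg, hg']⟩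

end Transitivity

section Projective

variable {W : Type*} [AddCommGroup W] [Module ℂ W]

theorem mk_eq_mk_of_smul {v w : W} (hv : v ≠ 0) (hw : w ≠ 0) {c : ℂ} (h : c • w = v) :
    Projectivization.mk ℂ v hv = Projectivization.mk ℂ w hw :=
  (Projectivization.mk_eq_mk_iff' ℂ v w hv hw).2 ⟨c, h⟩

theorem map_mk_rep_eq_zero_iff {N : Type*} [AddCommGroup N] [Module ℂ N] (f : W →ₗ[ℂ] N) {w : W}
    (hw : w ≠ 0) : f (Projectivization.mk ℂ w hw).rep = 0 ↔ f w = 0 := by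
  obtain ⟨a, ha⟩ := Projectivization.exists_smul_eq_mk_rep ℂ w hw
  rw [← ha]
  change f ((a : ℂ) • w) = 0 ↔ _
  rw [map_smul, smul_eq_zero]
  exact or_iff_right a.ne_zero

theorem isProjOrbit_of {G : Type*} [Group G] {ρ : Representation ℂ G W} {O : Set (ℙ ℂ W)} {v : W}
    (hv : v ≠ 0)
    (h : ∀ y, y ∈ O ↔ ∃ (g : G) (hg : ρ g v ≠ 0), y = Projectivization.mk ℂ (ρ g v) hg) :
    IsProjOrbit ρ O := by
  refine ⟨Projectivization.mk ℂ v hv, Set.ext fun y => (h y).trans ?_⟩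
  have h0 : ∀ g, ρ g v ≠ 0 := fun g hg => hv (by
    rw [← Representation.inv_self_apply ρ g v, hg, map_zero])
  refine exists_congr fun g => ?_
  rw [Projectivization.submodule_mk, Submodule.map_span, Set.image_singleton,
    ← Projectivization.submodule_mk _ (h0 g), Projectivization.submodule_injective.eq_iff]
  exact ⟨fun ⟨_, h⟩ => h, fun h => ⟨h0 g, h⟩⟩

/-- Products of two linear forms are all the equations needed, besides those of the rank locus, to
close the orbits and the boundary. -/
theorem mul_eq_zero_of_mem_zariskiClosure {Z : Set (ℙ ℂ W)} {x : ℙ ℂ W} (hx : x ∈ zariskiClosure Z)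
    (l l' : Module.Dual ℂ W) (h : ∀ y ∈ Z, l y.rep * l' y.rep = 0) : l x.rep * l' x.rep = 0 := by
  have h1 := hx 2 ((MultilinearMap.mkPiAlgebra ℂ (Fin 2) ℂ).compLinearMap ![l, l'])
  simp only [MultilinearMap.compLinearMap_apply, MultilinearMap.mkPiAlgebra_apply,
    Fin.prod_univ_two, Matrix.cons_val_zero, Matrix.cons_val_one] at h1
  exact h1 h

theorem isZariskiClosed_of {Z : Set (ℙ ℂ W)} (h : zariskiClosure Z ⊆ Z) : IsZariskiClosed Z :=
  h.antisymm (subset_zariskiClosure Z)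

end Projective

theorem sq_smul {E : Type*} [AddCommGroup E] [Module ℂ E] (c : ℂ) (e : Module.Dual ℂ E) :
    sq (c • e) = c ^ 2 • sq e :=
  Subtype.ext (LinearMap.ext fun y => LinearMap.ext fun z => by
    change c * e y * (c * e z) = c ^ 2 * (e y * e z)
    ring)

theorem sq_ne_zero_of {E : Type*} [AddCommGroup E] [Module ℂ E] {e : Module.Dual ℂ E}
    (he : e ≠ 0) : sq e ≠ 0 := by
  obtain ⟨x, hx, -⟩ := exists_ne_zero_of_dual he he
  intro h
  have h1 : e x * e x = 0 := LinearMap.congr_fun (LinearMap.congr_fun (congrArg Subtype.val h) x) x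
  exact hx (mul_self_eq_zero.1 h1)

theorem dual_tmul_ne_zero {E U : Type*} [AddCommGroup E] [Module ℂ E] [AddCommGroup U] [Module ℂ U]
    {e : Module.Dual ℂ E} {u : U} (he : e ≠ 0) (hu : u ≠ 0) : e ⊗ₜ[ℂ] u ≠ 0 := by
  obtain ⟨x, hx, -⟩ := exists_ne_zero_of_dual he he
  intro h
  have h1 := LinearMap.congr_fun (congrArg (dualTensorHom ℂ E U) h) x
  rw [dualTensorHom_apply, map_zero, LinearMap.zero_apply] at h1
  exact smul_ne_zero hx hu h1

namespace IsotropicFlag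

variable {V : Type*} [AddCommGroup V] [Module ℂ V] [FiniteDimensional ℂ V] (S : IsotropicFlag V)

theorem repT_tmul (h : S.H) (e : Module.Dual ℂ S.E) (u : S.U) (B : symForms S.E) :
    S.repT h (e ⊗ₜ[ℂ] u, B) = (S.repE.dual h e ⊗ₜ[ℂ] S.repU h u, symRep S.repE h B) := rfl

theorem symRep_sq (h : S.H) (e : Module.Dual ℂ S.E) :
    symRep S.repE h (sq e) = sq (S.repE.dual h e) := rfl

/-- The scalar c, forced by the determinant condition, is chosen before u and u', so that u' may
depend on it. -/
theorem exists_H_map_eq {e e' : Module.Dual ℂ S.E} (he : e ≠ 0) (he' : e' ≠ 0) :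
    ∃ c : ℂ, c ≠ 0 ∧ ∀ u u' : S.U, u ≠ 0 → u' ≠ 0 →
      ∃ h : S.H, S.repE.dual h e = c • e' ∧ S.repU h u = u' := by
  obtain ⟨c, a, hc, ha⟩ := exists_specialLinear_comp_eq he he'
  refine ⟨c, hc, fun u u' hu hu' => ?_⟩
  obtain ⟨g, hg⟩ := exists_spGroup_apply_eq S.formU_alt S.formU_nondegenerate hu' hu
  obtain ⟨h, h1, h2⟩ := S.exists_mem_H a g
  refine ⟨h⁻¹, LinearMap.ext fun x => ?_, ?_⟩
  · change e (S.repE h⁻¹⁻¹ x) = c * e' x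
    rw [inv_inv, h1, ha]
  · rw [← hg, ← h2, Representation.inv_self_apply]

theorem dual_ne_zero (h : S.H) {e : Module.Dual ℂ S.E} (he : e ≠ 0) : S.repE.dual h e ≠ 0 :=
  fun h0 => he (by rw [← Representation.inv_self_apply S.repE.dual h e, h0, map_zero])

theorem repU_ne_zero (h : S.H) {u : S.U} (hu : u ≠ 0) : S.repU h u ≠ 0 :=
  fun h0 => hu (by rw [← Representation.inv_self_apply S.repU h u, h0, map_zero])

theorem model_ne_zero_of_fst {t : S.TModel} (h : t.1 ≠ 0) : t ≠ 0 := fun h0 => h (by rw [h0]; rfl)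

theorem model_ne_zero_of_snd {t : S.TModel} (h : t.2 ≠ 0) : t ≠ 0 := fun h0 => h (by rw [h0]; rfl)

theorem isProjOrbit_openOrbit [Nontrivial S.U] [Nontrivial S.E] :
    IsProjOrbit S.repT S.openOrbit := by
  obtain ⟨e₀, he₀⟩ := exists_ne (0 : Module.Dual ℂ S.E)
  obtain ⟨u₀, hu₀⟩ := exists_ne (0 : S.U)
  refine isProjOrbit_of (v := (e₀ ⊗ₜ[ℂ] u₀, sq e₀))
    (S.model_ne_zero_of_snd (sq_ne_zero_of he₀)) fun y => ⟨?_, ?_⟩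
  · rintro ⟨e, u, h, he, hu, rfl⟩
    obtain ⟨c, hc, hH⟩ := S.exists_H_map_eq he₀ he
    -- Sending u₀ to cu balances the two components: both e ⊗ u and e² acquire the factor c².
    obtain ⟨g, h1, h2⟩ := hH u₀ (c • u) hu₀ (smul_ne_zero hc hu)
    have h3 : S.repT g (e₀ ⊗ₜ[ℂ] u₀, sq e₀) = c ^ 2 • ((e ⊗ₜ[ℂ] u, sq e) : S.TModel) := by
      rw [repT_tmul, symRep_sq, h1, h2, sq_smul, TensorProduct.smul_tmul_smul, ← pow_two]
      rfl
    have h4 : S.repT g (e₀ ⊗ₜ[ℂ] u₀, sq e₀) ≠ 0 := h3 ▸ smul_ne_zero (pow_ne_zero 2 hc) h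
    exact ⟨g, h4, (mk_eq_mk_of_smul h4 h h3.symm).symm⟩
  · rintro ⟨g, hg, rfl⟩
    exact ⟨_, _, hg, S.dual_ne_zero g he₀, S.repU_ne_zero g hu₀, rfl⟩

theorem isProjOrbit_Y₁ [Nontrivial S.U] [Nontrivial S.E] : IsProjOrbit S.repT S.Y₁ := by
  obtain ⟨e₀, he₀⟩ := exists_ne (0 : Module.Dual ℂ S.E)
  obtain ⟨u₀, hu₀⟩ := exists_ne (0 : S.U)
  have h0 : ∀ g, S.repT g (e₀ ⊗ₜ[ℂ] u₀, 0) = (S.repE.dual g e₀ ⊗ₜ[ℂ] S.repU g u₀, 0) := fun g => by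
    rw [repT_tmul, map_zero]
  refine isProjOrbit_of (v := (e₀ ⊗ₜ[ℂ] u₀, 0))
    (S.model_ne_zero_of_fst (dual_tmul_ne_zero he₀ hu₀)) fun y => ⟨?_, ?_⟩
  · rintro ⟨e, u, h, rfl⟩
    have he : e ≠ 0 := fun he => h (by rw [he, TensorProduct.zero_tmul]; rfl)
    have hu : u ≠ 0 := fun hu => h (by rw [hu, TensorProduct.tmul_zero]; rfl)
    obtain ⟨c, hc, hH⟩ := S.exists_H_map_eq he₀ he
    obtain ⟨g, h1, h2⟩ := hH u₀ u hu₀ hu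
    have h3 : S.repT g (e₀ ⊗ₜ[ℂ] u₀, 0) = c • ((e ⊗ₜ[ℂ] u, 0) : S.TModel) := by
      rw [h0, h1, h2]
      exact Prod.ext rfl (smul_zero c : c • (0 : symForms S.E) = 0).symm
    have h4 : S.repT g (e₀ ⊗ₜ[ℂ] u₀, 0) ≠ 0 := h3 ▸ smul_ne_zero hc h
    exact ⟨g, h4, (mk_eq_mk_of_smul h4 h h3.symm).symm⟩
  · rintro ⟨g, hg, rfl⟩
    exact ⟨_, _, h0 g ▸ hg, by congr 1⟩

theorem isProjOrbit_Y₂ [Nontrivial S.U] [Nontrivial S.E] : IsProjOrbit S.repT S.Y₂ := by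
  obtain ⟨e₀, he₀⟩ := exists_ne (0 : Module.Dual ℂ S.E)
  obtain ⟨u₀, hu₀⟩ := exists_ne (0 : S.U)
  have h0 : ∀ g, S.repT g (0, sq e₀) = (0, sq (S.repE.dual g e₀)) := fun g =>
    Prod.ext (map_zero (S.repE.dual.tprod S.repU g)) rfl
  refine isProjOrbit_of (v := (0, sq e₀))
    (S.model_ne_zero_of_snd (sq_ne_zero_of he₀)) fun y => ⟨?_, ?_⟩
  · rintro ⟨e, h, rfl⟩
    have he : e ≠ 0 := fun he => h (by
      rw [he, ← zero_smul ℂ (0 : Module.Dual ℂ S.E), sq_smul, zero_pow two_ne_zero, zero_smul]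
      rfl)
    obtain ⟨c, hc, hH⟩ := S.exists_H_map_eq he₀ he
    obtain ⟨g, h1, -⟩ := hH u₀ u₀ hu₀ hu₀
    have h3 : S.repT g (0, sq e₀) = c ^ 2 • ((0, sq e) : S.TModel) := by
      rw [h0, h1, sq_smul]
      exact Prod.ext (smul_zero (c ^ 2) : c ^ 2 • (0 : Module.Dual ℂ S.E ⊗[ℂ] S.U) = 0).symm rfl
    have h4 : S.repT g (0, sq e₀) ≠ 0 := h3 ▸ smul_ne_zero (pow_ne_zero 2 hc) h
    exact ⟨g, h4, (mk_eq_mk_of_smul h4 h h3.symm).symm⟩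
  · rintro ⟨g, hg, rfl⟩
    exact ⟨_, h0 g ▸ hg, by congr 1⟩

theorem mk_rep_fst_eq_zero_iff {t : S.TModel} (ht : t ≠ 0) :
    (Projectivization.mk ℂ t ht).rep.1 = 0 ↔ t.1 = 0 := by
  have h := map_mk_rep_eq_zero_iff (W := S.TModel)
    (LinearMap.fst ℂ (Module.Dual ℂ S.E ⊗[ℂ] S.U) (symForms S.E)) ht
  exact h

theorem mk_rep_snd_eq_zero_iff {t : S.TModel} (ht : t ≠ 0) :
    (Projectivization.mk ℂ t ht).rep.2 = 0 ↔ t.2 = 0 := by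
  have h := map_mk_rep_eq_zero_iff (W := S.TModel) (N := symForms S.E)
    (LinearMap.snd ℂ (Module.Dual ℂ S.E ⊗[ℂ] S.U) (symForms S.E)) ht
  exact h

theorem mem_Y₁_iff {x : ℙ ℂ S.TModel} : x ∈ S.Y₁ ↔ x ∈ S.rankLocus 1 ∧ x.rep.2 = 0 := by
  constructor
  · rintro ⟨e, u, h, rfl⟩
    refine ⟨?_, (S.mk_rep_snd_eq_zero_iff h).2 rfl⟩
    have h1 := S.tmul_sq_mem_rankLocus (f := e) (u := u) (d := 0) (by rwa [zero_smul])
    simpa only [zero_smul] using h1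
  · rintro ⟨h, h2⟩
    obtain ⟨f, u, d, -, ht⟩ := S.exists_tmul_sq h
    have h3 : x.rep = (f ⊗ₜ[ℂ] u, 0) := Prod.ext (congrArg Prod.fst ht :) h2
    refine ⟨f, u, h3 ▸ x.rep_nonzero, ?_⟩
    conv_lhs => rw [← x.mk_rep]
    congr 1

theorem mem_Y₂_iff {x : ℙ ℂ S.TModel} : x ∈ S.Y₂ ↔ x ∈ S.rankLocus 1 ∧ x.rep.1 = 0 := by
  constructor
  · rintro ⟨e, h, rfl⟩
    refine ⟨?_, (S.mk_rep_fst_eq_zero_iff h).2 rfl⟩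
    have h1 := S.tmul_sq_mem_rankLocus (f := e) (u := 0) (d := 1)
      (by rwa [one_smul, TensorProduct.tmul_zero])
    simpa only [one_smul, TensorProduct.tmul_zero] using h1
  · rintro ⟨h, h2⟩
    obtain ⟨f, u, d, -, ht⟩ := S.exists_tmul_sq h
    obtain ⟨σ, hσ⟩ := IsAlgClosed.exists_pow_nat_eq d (n := 2) two_pos
    have h3 : x.rep = (0, sq (σ • f)) :=
      Prod.ext h2 (by rw [sq_smul, hσ]; exact (congrArg Prod.snd ht :))
    refine ⟨σ • f, h3 ▸ x.rep_nonzero, ?_⟩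
    conv_lhs => rw [← x.mk_rep]
    congr 1

/-- In the form f ⊗ u ⊕ d f² with f ≠ 0, the first component vanishes only for u = 0 and the second
only for d = 0. -/
theorem mem_openOrbit_iff {x : ℙ ℂ S.TModel} :
    x ∈ S.openOrbit ↔ x ∈ S.rankLocus 1 ∧ x.rep.1 ≠ 0 ∧ x.rep.2 ≠ 0 := by
  constructor
  · intro hx
    refine ⟨S.openOrbit_subset hx, ?_⟩
    obtain ⟨e, u, h, he, hu, rfl⟩ := hx
    rw [Ne, Ne, mk_rep_fst_eq_zero_iff, mk_rep_snd_eq_zero_iff]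
    exact ⟨dual_tmul_ne_zero he hu, sq_ne_zero_of he⟩
  · rintro ⟨h, h1, h2⟩
    obtain ⟨f, u, d, hf, ht⟩ := S.exists_tmul_sq h
    have hu : u ≠ 0 := fun hu => h1 (by rw [ht, hu]; exact TensorProduct.tmul_zero _ _)
    have hd : d ≠ 0 := fun hd => h2 (by rw [ht, hd]; exact zero_smul ℂ (sq f))
    have h3 := S.tmul_sq_mem_openOrbit hf hu hd (ht ▸ x.rep_nonzero)
    rw [← x.mk_rep]
    convert h3 using 2

theorem rankLocus_diff_openOrbit : S.rankLocus 1 \ S.openOrbit = S.Y₁ ∪ S.Y₂ := by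
  ext x
  rw [Set.mem_sdiff, Set.mem_union, mem_Y₁_iff, mem_Y₂_iff, mem_openOrbit_iff]
  tauto

theorem disjoint_Y₁_Y₂ : Disjoint S.Y₁ S.Y₂ := by
  rw [Set.disjoint_left]
  intro x h1 h2
  exact x.rep_nonzero (Prod.ext (S.mem_Y₂_iff.1 h2).2 (S.mem_Y₁_iff.1 h1).2)

theorem isZariskiClosed_Y₁ : IsZariskiClosed S.Y₁ := by
  refine isZariskiClosed_of fun x hx => S.mem_Y₁_iff.2
    ⟨S.zariskiClosure_subset_rankLocus (fun y hy => (S.mem_Y₁_iff.1 hy).1) hx, ?_⟩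
  by_contra h0
  obtain ⟨l, hl⟩ := exists_dual_apply_ne_zero (W := symForms S.E) h0
  refine hl (mul_self_eq_zero.1 (mul_eq_zero_of_mem_zariskiClosure hx (l ∘ₗ LinearMap.snd ℂ _ _)
    (l ∘ₗ LinearMap.snd ℂ _ _) fun y hy => ?_))
  change l y.rep.2 * l y.rep.2 = 0
  rw [(S.mem_Y₁_iff.1 hy).2, map_zero, mul_zero]

theorem isZariskiClosed_Y₂ : IsZariskiClosed S.Y₂ := by
  refine isZariskiClosed_of fun x hx => S.mem_Y₂_iff.2
    ⟨S.zariskiClosure_subset_rankLocus (fun y hy => (S.mem_Y₂_iff.1 hy).1) hx, ?_⟩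
  by_contra h0
  obtain ⟨l, hl⟩ := exists_dual_apply_ne_zero (W := Module.Dual ℂ S.E ⊗[ℂ] S.U) h0
  refine hl (mul_self_eq_zero.1 (mul_eq_zero_of_mem_zariskiClosure hx (l ∘ₗ LinearMap.fst ℂ _ _)
    (l ∘ₗ LinearMap.fst ℂ _ _) fun y hy => ?_))
  change l y.rep.1 * l y.rep.1 = 0
  rw [(S.mem_Y₂_iff.1 hy).2, map_zero, mul_zero]

/-- Inside the rank locus the union is cut out by products of a linear form on T_1 and one on T_2.
-/
theorem isZariskiClosed_Y₁_union_Y₂ : IsZariskiClosed (S.Y₁ ∪ S.Y₂) := by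
  refine isZariskiClosed_of fun x hx => ?_
  have h1 : x ∈ S.rankLocus 1 := S.zariskiClosure_subset_rankLocus
    (Set.union_subset (fun y hy => (S.mem_Y₁_iff.1 hy).1) fun y hy => (S.mem_Y₂_iff.1 hy).1) hx
  rw [Set.mem_union, mem_Y₁_iff, mem_Y₂_iff]
  by_contra! hc
  obtain ⟨l, hl⟩ : ∃ l : Module.Dual ℂ (Module.Dual ℂ S.E ⊗[ℂ] S.U), l x.rep.1 ≠ 0 :=
    exists_dual_apply_ne_zero (hc.2 h1)
  obtain ⟨l', hl'⟩ : ∃ l : Module.Dual ℂ (symForms S.E), l x.rep.2 ≠ 0 :=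
    exists_dual_apply_ne_zero (W := symForms S.E) (hc.1 h1)
  refine mul_ne_zero hl hl' (mul_eq_zero_of_mem_zariskiClosure hx (l ∘ₗ LinearMap.fst ℂ _ _)
    (l' ∘ₗ LinearMap.snd ℂ _ _) fun y hy => ?_)
  change l y.rep.1 * l' y.rep.2 = 0
  rcases hy with hy | hy
  · rw [(S.mem_Y₁_iff.1 hy).2, map_zero, mul_zero]
  · rw [(S.mem_Y₂_iff.1 hy).2, map_zero, zero_mul]

end IsotropicFlag


/-! ## The Segre and Veronese embeddings -/

section Regular

variable {W W' X : Type*} [AddCommGroup W] [Module ℂ W] [AddCommGroup W'] [Module ℂ W']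

theorem mk_eq_of_mem_submodule {p : ℙ ℂ W} {w : W} (hw : w ≠ 0) (h : w ∈ p.submodule) :
    Projectivization.mk ℂ w hw = p := by
  conv_rhs => rw [← p.mk_rep]
  rw [← p.mk_rep, Projectivization.submodule_mk, Submodule.mem_span_singleton] at h
  obtain ⟨c, hc⟩ := h
  exact mk_eq_mk_of_smul hw p.rep_nonzero hc

theorem rep_mem_submodule (p : ℙ ℂ W) : p.rep ∈ p.submodule := by
  have h : p.submodule = ℂ ∙ p.rep := by
    conv_lhs => rw [← p.mk_rep, Projectivization.submodule_mk]
  rw [h]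
  exact Submodule.mem_span_singleton_self _

theorem map_mk_rep_mem_iff (q : W →ₗ[ℂ] W') {w : W} (hw : w ≠ 0) (Q : Submodule ℂ W') :
    q (Projectivization.mk ℂ w hw).rep ∈ Q ↔ q w ∈ Q := by
  obtain ⟨a, ha⟩ := Projectivization.exists_smul_eq_mk_rep ℂ w hw
  rw [← ha]
  change q ((a : ℂ) • w) ∈ Q ↔ _
  rw [map_smul]
  exact Q.smul_mem_iff a.ne_zero

/-- A linear map that sends each point into the line of its image defines f wherever it does not
vanish. -/
theorem isRegular_of_linear {r : X → ℙ ℂ W} {f : X → ℙ ℂ W'}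
    (h : ∀ x, ∃ q : W →ₗ[ℂ] W', q (r x).rep ≠ 0 ∧ ∀ y, q (r y).rep ∈ (f y).submodule) :
    IsRegular r f := by
  intro x
  obtain ⟨q, h1, h2⟩ := h x
  exact ⟨1, MultilinearMap.ofSubsingleton ℂ W W' 0 q, h1,
    fun y hy => (mk_eq_of_mem_submodule hy (h2 y)).symm⟩

theorem isRegularProd_of_bilinear {A B : Type*} [AddCommGroup A] [Module ℂ A] [AddCommGroup B]
    [Module ℂ B] {f : ℙ ℂ A × ℙ ℂ B → ℙ ℂ W'} (β : A →ₗ[ℂ] B →ₗ[ℂ] W')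
    (h0 : ∀ x : ℙ ℂ A × ℙ ℂ B, β x.1.rep x.2.rep ≠ 0)
    (h : ∀ x, β x.1.rep x.2.rep ∈ (f x).submodule) : IsRegularProd f := fun x =>
  ⟨1, 1, MultilinearMap.ofSubsingleton ℂ A _ 0
    ((MultilinearMap.ofSubsingletonₗ ℂ ℂ B W' (0 : Fin 1)).toLinearMap ∘ₗ β), h0 x,
    fun y hy => (mk_eq_of_mem_submodule hy (h y)).symm⟩

end Regular

/-- The symmetric product of two linear forms. -/
def symProd (E : Type*) [AddCommGroup E] [Module ℂ E] :
    MultilinearMap ℂ (fun _ : Fin 2 => Module.Dual ℂ E) (symForms E) where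
  toFun m := ⟨(m 0).smulRight (m 1) + (m 1).smulRight (m 0), fun x y => by
    simp only [LinearMap.add_apply, LinearMap.smulRight_apply, LinearMap.smul_apply, smul_eq_mul]
    ring⟩
  map_update_add' m i e e' := by
    refine Subtype.ext (LinearMap.ext fun x => LinearMap.ext fun y => ?_)
    fin_cases i <;> simp <;> ring
  map_update_smul' m i c e := by
    refine Subtype.ext (LinearMap.ext fun x => LinearMap.ext fun y => ?_)
    fin_cases i <;> simp <;> ring

theorem symProd_self {E : Type*} [AddCommGroup E] [Module ℂ E] (e : Module.Dual ℂ E) :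
    symProd E (fun _ => e) = (2 : ℂ) • sq e :=
  Subtype.ext (two_smul ℂ (LinearMap.smulRight e e)).symm

namespace IsotropicFlag

variable {V : Type*} [AddCommGroup V] [Module ℂ V] [FiniteDimensional ℂ V] (S : IsotropicFlag V)

theorem segre_ne_zero (x : ℙ ℂ (Module.Dual ℂ S.E) × ℙ ℂ S.U) :
    ((x.1.rep ⊗ₜ[ℂ] x.2.rep, 0) : S.TModel) ≠ 0 :=
  S.model_ne_zero_of_fst (dual_tmul_ne_zero x.1.rep_nonzero x.2.rep_nonzero)

/-- The contraction of `E^* ⊗ U` with a linear form on `U`. -/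
def contractU (l : Module.Dual ℂ S.U) : S.TModel →ₗ[ℂ] Module.Dual ℂ S.E :=
  (TensorProduct.rid ℂ (Module.Dual ℂ S.E)).toLinearMap ∘ₗ
    LinearMap.lTensor (Module.Dual ℂ S.E) l ∘ₗ LinearMap.fst ℂ _ _

theorem contractU_tmul (l : Module.Dual ℂ S.U) (e : Module.Dual ℂ S.E) (u : S.U)
    (B : symForms S.E) : S.contractU l (e ⊗ₜ[ℂ] u, B) = l u • e :=
  TensorProduct.rid_tmul (M := Module.Dual ℂ S.E) (R := ℂ) e (l u)

/-- The contraction of `E^* ⊗ U` with a vector of `E`. -/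
def contractE (z : S.E) : S.TModel →ₗ[ℂ] S.U :=
  (TensorProduct.lid ℂ S.U).toLinearMap ∘ₗ
    LinearMap.rTensor S.U (Module.Dual.eval ℂ S.E z) ∘ₗ LinearMap.fst ℂ _ _

theorem contractE_tmul (z : S.E) (e : Module.Dual ℂ S.E) (u : S.U)
    (B : symForms S.E) : S.contractE z (e ⊗ₜ[ℂ] u, B) = e z • u :=
  TensorProduct.lid_tmul (M := S.U) (R := ℂ) u (e z)

/-- The contraction of `S² E^*` with a vector of `E`. -/
def contractSym (z : S.E) : S.TModel →ₗ[ℂ] Module.Dual ℂ S.E :=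
  LinearMap.applyₗ z ∘ₗ (symForms S.E).subtype ∘ₗ LinearMap.snd ℂ _ _

theorem contractSym_sq (z : S.E) (A : Module.Dual ℂ S.E ⊗[ℂ] S.U) (e : Module.Dual ℂ S.E) :
    S.contractSym z (A, sq e) = e z • e := rfl

/-- The Segre map. -/
def segre (x : ℙ ℂ (Module.Dual ℂ S.E) × ℙ ℂ S.U) : S.Y₁ :=
  ⟨Projectivization.mk ℂ _ (S.segre_ne_zero x), _, _, S.segre_ne_zero x, rfl⟩

/-- Contracting e ⊗ u with l gives l(u)e, so these linear maps are local inverses of the Segre map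
on the factor ℙ(E^*); contractions with vectors of E serve the factor ℙ(U) and the Veronese map. -/
theorem exists_contractU_ne (x : ℙ ℂ (Module.Dual ℂ S.E) × ℙ ℂ S.U) : ∃ l,
    S.contractU l (S.segre x : ℙ ℂ S.TModel).rep ≠ 0 := by
  obtain ⟨l, hl⟩ := exists_dual_apply_ne_zero x.2.rep_nonzero
  refine ⟨l, (map_mk_rep_eq_zero_iff (W := S.TModel) (S.contractU l)
    (S.segre_ne_zero x)).not.2 ?_⟩
  rw [contractU_tmul]
  exact smul_ne_zero hl x.1.rep_nonzero

theorem contractU_mem (l : Module.Dual ℂ S.U) (x : ℙ ℂ (Module.Dual ℂ S.E) × ℙ ℂ S.U) :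
    S.contractU l (S.segre x : ℙ ℂ S.TModel).rep ∈ x.1.submodule := by
  refine (map_mk_rep_mem_iff (W := S.TModel) (S.contractU l) (S.segre_ne_zero x) _).2 ?_
  rw [contractU_tmul]
  exact Submodule.smul_mem _ _ (rep_mem_submodule x.1)

theorem exists_contractE_ne (x : ℙ ℂ (Module.Dual ℂ S.E) × ℙ ℂ S.U) : ∃ z,
    S.contractE z (S.segre x : ℙ ℂ S.TModel).rep ≠ 0 := by
  obtain ⟨z, hz, -⟩ := exists_ne_zero_of_dual x.1.rep_nonzero x.1.rep_nonzero
  refine ⟨z, (map_mk_rep_eq_zero_iff (W := S.TModel) (S.contractE z)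
    (S.segre_ne_zero x)).not.2 ?_⟩
  rw [contractE_tmul]
  exact smul_ne_zero hz x.2.rep_nonzero

theorem contractE_mem (z : S.E) (x : ℙ ℂ (Module.Dual ℂ S.E) × ℙ ℂ S.U) :
    S.contractE z (S.segre x : ℙ ℂ S.TModel).rep ∈ x.2.submodule := by
  refine (map_mk_rep_mem_iff (W := S.TModel) (S.contractE z) (S.segre_ne_zero x) _).2 ?_
  rw [contractE_tmul]
  exact Submodule.smul_mem _ _ (rep_mem_submodule x.2)

theorem segre_bijective : Function.Bijective S.segre := by
  refine ⟨fun x y h => Prod.ext ?_ ?_, ?_⟩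
  · obtain ⟨l, hl⟩ := S.exists_contractU_ne x
    rw [← mk_eq_of_mem_submodule hl (S.contractU_mem l x)]
    exact mk_eq_of_mem_submodule hl (by rw [h]; exact S.contractU_mem l y)
  · obtain ⟨z, hz⟩ := S.exists_contractE_ne x
    rw [← mk_eq_of_mem_submodule hz (S.contractE_mem z x)]
    exact mk_eq_of_mem_submodule hz (by rw [h]; exact S.contractE_mem z y)
  · rintro ⟨_, e, u, h, rfl⟩
    have he : e ≠ 0 := fun he => h (by rw [he, TensorProduct.zero_tmul]; rfl)
    have hu : u ≠ 0 := fun hu => h (by rw [hu, TensorProduct.tmul_zero]; rfl)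
    obtain ⟨a, ha⟩ := Projectivization.exists_smul_eq_mk_rep ℂ e he
    obtain ⟨c, hc⟩ := Projectivization.exists_smul_eq_mk_rep ℂ u hu
    refine ⟨(Projectivization.mk ℂ e he, Projectivization.mk ℂ u hu), Subtype.ext ?_⟩
    refine mk_eq_mk_of_smul _ h (c := (a : ℂ) * c) ?_
    rw [← ha, ← hc]
    change _ = (((a : ℂ) • e) ⊗ₜ[ℂ] ((c : ℂ) • u), 0)
    rw [TensorProduct.smul_tmul_smul]
    exact Prod.ext rfl (smul_zero _ : ((a : ℂ) * c) • (0 : symForms S.E) = 0)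

theorem exists_segre : ∃ φ : ℙ ℂ (Module.Dual ℂ S.E) × ℙ ℂ S.U ≃ S.Y₁,
    IsRegularProd (fun x => (φ x : ℙ ℂ S.TModel)) ∧
    IsRegular (fun y : S.Y₁ => (y : ℙ ℂ S.TModel)) (fun y => (φ.symm y).1) ∧
    IsRegular (fun y : S.Y₁ => (y : ℙ ℂ S.TModel)) (fun y => (φ.symm y).2) ∧
    ∀ x, (φ x : ℙ ℂ S.TModel).submodule =
      ℂ ∙ ((x.1.rep ⊗ₜ[ℂ] x.2.rep, 0) : S.TModel) := by
  have h0 : ∀ x, (S.segre x : ℙ ℂ S.TModel).submodule =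
      ℂ ∙ ((x.1.rep ⊗ₜ[ℂ] x.2.rep, 0) : S.TModel) := fun x =>
    Projectivization.submodule_mk _ (S.segre_ne_zero x)
  have key : ∀ y, S.segre ((Equiv.ofBijective S.segre S.segre_bijective).symm y) = y :=
    (Equiv.ofBijective S.segre S.segre_bijective).apply_symm_apply
  refine ⟨Equiv.ofBijective S.segre S.segre_bijective, ?_, ?_, ?_, h0⟩
  · refine isRegularProd_of_bilinear ((TensorProduct.mk ℂ (Module.Dual ℂ S.E) S.U).compr₂
      (LinearMap.inl ℂ (Module.Dual ℂ S.E ⊗[ℂ] S.U) (symForms S.E))) S.segre_ne_zero fun x => ?_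
    change _ ∈ (S.segre x : ℙ ℂ S.TModel).submodule
    rw [h0]
    exact Submodule.mem_span_singleton_self _
  · refine isRegular_of_linear fun y => ?_
    obtain ⟨l, hl⟩ := S.exists_contractU_ne ((Equiv.ofBijective S.segre S.segre_bijective).symm y)
    rw [key] at hl
    refine ⟨S.contractU l, hl, fun y' => ?_⟩
    have h := S.contractU_mem l ((Equiv.ofBijective S.segre S.segre_bijective).symm y')
    rwa [key] at h
  · refine isRegular_of_linear fun y => ?_
    obtain ⟨z, hz⟩ := S.exists_contractE_ne ((Equiv.ofBijective S.segre S.segre_bijective).symm y)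
    rw [key] at hz
    refine ⟨S.contractE z, hz, fun y' => ?_⟩
    have h := S.contractE_mem z ((Equiv.ofBijective S.segre S.segre_bijective).symm y')
    rwa [key] at h

theorem veronese_ne_zero (x : ℙ ℂ (Module.Dual ℂ S.E)) : ((0, sq x.rep) : S.TModel) ≠ 0 :=
  S.model_ne_zero_of_snd (sq_ne_zero_of x.rep_nonzero)

/-- The Veronese map. -/
def veronese (x : ℙ ℂ (Module.Dual ℂ S.E)) : S.Y₂ :=
  ⟨Projectivization.mk ℂ _ (S.veronese_ne_zero x), _, S.veronese_ne_zero x, rfl⟩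

theorem exists_contractSym_ne (x : ℙ ℂ (Module.Dual ℂ S.E)) : ∃ z,
    S.contractSym z (S.veronese x : ℙ ℂ S.TModel).rep ≠ 0 := by
  obtain ⟨z, hz, -⟩ := exists_ne_zero_of_dual x.rep_nonzero x.rep_nonzero
  refine ⟨z, (map_mk_rep_eq_zero_iff (W := S.TModel) (S.contractSym z)
    (S.veronese_ne_zero x)).not.2 ?_⟩
  rw [contractSym_sq]
  exact smul_ne_zero hz x.rep_nonzero

theorem contractSym_mem (z : S.E) (x : ℙ ℂ (Module.Dual ℂ S.E)) :
    S.contractSym z (S.veronese x : ℙ ℂ S.TModel).rep ∈ x.submodule := by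
  refine (map_mk_rep_mem_iff (W := S.TModel) (S.contractSym z) (S.veronese_ne_zero x) _).2 ?_
  rw [contractSym_sq]
  exact Submodule.smul_mem _ _ (rep_mem_submodule x)

theorem veronese_bijective : Function.Bijective S.veronese := by
  refine ⟨fun x y h => ?_, ?_⟩
  · obtain ⟨z, hz⟩ := S.exists_contractSym_ne x
    rw [← mk_eq_of_mem_submodule hz (S.contractSym_mem z x)]
    exact mk_eq_of_mem_submodule hz (by rw [h]; exact S.contractSym_mem z y)
  · rintro ⟨_, e, h, rfl⟩
    have he : e ≠ 0 := fun he => h (by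
      rw [he, ← zero_smul ℂ (0 : Module.Dual ℂ S.E), sq_smul, zero_pow two_ne_zero, zero_smul]
      rfl)
    obtain ⟨a, ha⟩ := Projectivization.exists_smul_eq_mk_rep ℂ e he
    refine ⟨Projectivization.mk ℂ e he, Subtype.ext ?_⟩
    refine mk_eq_mk_of_smul _ h (c := (a : ℂ) ^ 2) ?_
    rw [← ha]
    change _ = (0, sq ((a : ℂ) • e))
    rw [sq_smul]
    exact Prod.ext (smul_zero _ : (a : ℂ) ^ 2 • (0 : Module.Dual ℂ S.E ⊗[ℂ] S.U) = 0) rfl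

theorem exists_veronese : ∃ ψ : ℙ ℂ (Module.Dual ℂ S.E) ≃ S.Y₂,
    IsRegular id (fun x => (ψ x : ℙ ℂ S.TModel)) ∧
    IsRegular (fun y : S.Y₂ => (y : ℙ ℂ S.TModel)) ψ.symm ∧
    ∀ x, (ψ x : ℙ ℂ S.TModel).submodule = ℂ ∙ ((0, sq x.rep) : S.TModel) := by
  have h0 : ∀ x, (S.veronese x : ℙ ℂ S.TModel).submodule = ℂ ∙ ((0, sq x.rep) : S.TModel) :=
    fun x => Projectivization.submodule_mk _ (S.veronese_ne_zero x)
  have key : ∀ y, S.veronese ((Equiv.ofBijective S.veronese S.veronese_bijective).symm y) = y :=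
    (Equiv.ofBijective S.veronese S.veronese_bijective).apply_symm_apply
  refine ⟨Equiv.ofBijective S.veronese S.veronese_bijective, fun x => ?_, ?_, h0⟩
  -- The symmetric product restricts to 2e² on the diagonal; the factor 2 is harmless projectively.
  · let q := (LinearMap.inr ℂ (Module.Dual ℂ S.E ⊗[ℂ] S.U) (symForms S.E)).compMultilinearMap
      (symProd S.E)
    have hq : ∀ e, q (fun _ => e) = (2 : ℂ) • ((0, sq e) : S.TModel) := fun e => by
      change (0, symProd S.E fun _ => e) = _
      rw [symProd_self]
      exact Prod.ext (smul_zero _ : (2 : ℂ) • (0 : Module.Dual ℂ S.E ⊗[ℂ] S.U) = 0).symm rfl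
    refine ⟨2, q, ?_, fun y hy => (mk_eq_mk_of_smul hy (S.veronese_ne_zero y) (hq y.rep).symm).symm⟩
    rw [hq]
    exact smul_ne_zero two_ne_zero (S.veronese_ne_zero x)
  · refine isRegular_of_linear fun y => ?_
    obtain ⟨z, hz⟩ := S.exists_contractSym_ne
      ((Equiv.ofBijective S.veronese S.veronese_bijective).symm y)
    rw [key] at hz
    refine ⟨S.contractSym z, hz, fun y' => ?_⟩
    have h := S.contractSym_mem z ((Equiv.ofBijective S.veronese S.veronese_bijective).symm y')
    rwa [key] at h

end IsotropicFlag

end SympGrass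

end

/-! ### The theorem. -/

open SympGrass in
theorem proposition5p4 {V : Type*} [AddCommGroup V] [Module ℂ V] [FiniteDimensional ℂ V]
    (n k : ℕ) (hk : 1 ≤ k) (hkn : k < n) (hV : Module.finrank ℂ V = 2 * n)
    (S : IsotropicFlag V) (b : Module.Basis (Fin k) ℂ S.E) :
    -- the group `H` is `SL(E) × Sp(U)`, with `dim U = 2n - 2k`
    Module.finrank ℂ S.U = 2 * (n - k) ∧
    S.formU.IsAlt ∧ S.formU.Nondegenerate ∧
    (∀ h : S.H, LinearMap.det (S.repE h) = 1 ∧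
      ∀ u u', S.formU (S.repU h u) (S.repU h u') = S.formU u u') ∧
    (∀ (f : SpecialLinearGroup ℂ S.E) (g : spGroup S.formU),
      ∃! h : S.H, (∀ x, S.repE h x = f x) ∧ ∀ u, S.repU h u = spRep S.formU g u) ∧
    -- the normal spaces as `H`-modules
    (∀ p, 1 ≤ p → Nonempty ((S.repN b p).Equiv (Representation.directSum
      fun q : {q : ℕ × ℕ // q.1 + q.2 = p} =>
        (extRep S.repU q.1.1).tprod (schurRep S.repE.dual q.1.1 q.1.2)))) ∧
    (∀ p, 1 ≤ p → Nonempty ((S.repN b p).Equiv (Representation.directSum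
      fun q : {q : ℕ × ℕ × ℕ // q.1 + q.2.1 + q.2.2 = p ∧ q.2.2 ≤ q.2.1 ∧
          q.1 + q.2.2 ≤ n - k} =>
        (redExtRep S.repU S.formU S.repU_form q.1.1).tprod
          (schurRep S.repE.dual (q.1.1 + 2 * q.1.2.2) (q.1.2.1 - q.1.2.2))))) ∧
    -- the length of the normal graduation and its last term
    (∀ p, k < p → Subsingleton (S.N b p)) ∧
    Nontrivial (S.N b k) ∧
    Nonempty ((S.repN b k).Equiv (extRep (S.repE.dual.prod S.repU) k)) ∧
    -- the tangent space as an `H`-module, and the base loci in its projectivisation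
    (∃ Θ : (S.repN b 1).Equiv S.repT,
      (S.gradedTangent b 1).map Θ.toLinearMap =
        LinearMap.range (LinearMap.inl ℂ (Module.Dual ℂ S.E ⊗[ℂ] S.U) (symForms S.E)) ∧
      (S.gradedTangent b 2).map Θ.toLinearMap =
        LinearMap.range (LinearMap.inr ℂ (Module.Dual ℂ S.E ⊗[ℂ] S.U) (symForms S.E)) ∧
      (∀ p, 2 ≤ p → ∃ F, IsFundForm (isoCone S.ω k) (S.point b) p F) ∧
      (∀ p, 2 ≤ p → ∀ F, IsFundForm (isoCone S.ω k) (S.point b) p F →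
        Projectivization.map Θ.toLinearMap Θ.injective '' baseLocus F =
          zariskiClosure (S.sumLocus (p - 1))) ∧
      (∀ F, IsFundForm (isoCone S.ω k) (S.point b) 2 F →
        Projectivization.map Θ.toLinearMap Θ.injective '' baseLocus F =
          zariskiClosure S.openOrbit)) ∧
    -- the orbit structure of the base locus of the second fundamental form
    IsProjOrbit S.repT S.openOrbit ∧
    IsZariskiClosed (zariskiClosure S.openOrbit \ S.openOrbit) ∧
    zariskiClosure S.openOrbit \ S.openOrbit = S.Y₁ ∪ S.Y₂ ∧
    Disjoint S.Y₁ S.Y₂ ∧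
    (IsProjOrbit S.repT S.Y₁ ∧ IsZariskiClosed S.Y₁) ∧
    (IsProjOrbit S.repT S.Y₂ ∧ IsZariskiClosed S.Y₂) ∧
    -- the Segre and Veronese isomorphisms
    (∃ φ : ℙ ℂ (Module.Dual ℂ S.E) × ℙ ℂ S.U ≃ S.Y₁,
      IsRegularProd (fun x => (φ x : ℙ ℂ S.TModel)) ∧
      IsRegular (fun y : S.Y₁ => (y : ℙ ℂ S.TModel)) (fun y => (φ.symm y).1) ∧
      IsRegular (fun y : S.Y₁ => (y : ℙ ℂ S.TModel)) (fun y => (φ.symm y).2) ∧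
      ∀ x, (φ x : ℙ ℂ S.TModel).submodule =
        ℂ ∙ ((x.1.rep ⊗ₜ[ℂ] x.2.rep, 0) : S.TModel)) ∧
    (∃ ψ : ℙ ℂ (Module.Dual ℂ S.E) ≃ S.Y₂,
      IsRegular id (fun x => (ψ x : ℙ ℂ S.TModel)) ∧
      IsRegular (fun y : S.Y₂ => (y : ℙ ℂ S.TModel)) ψ.symm ∧
      ∀ x, (ψ x : ℙ ℂ S.TModel).submodule = ℂ ∙ ((0, sq x.rep) : S.TModel)) := by
  have hU : Module.finrank ℂ S.U = 2 * (n - k) := by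
    have h := S.finrank_U_add
    rw [S.finrank_E b, hV] at h
    omega
  have : Nontrivial S.U := Module.nontrivial_of_finrank_pos (R := ℂ) (by omega)
  have : Nontrivial S.E := Module.nontrivial_of_finrank_pos (R := ℂ) (by
    rw [S.finrank_E b]
    omega)
  obtain ⟨Θ, hΘ⟩ := S.exists_tangentEquiv b
  refine ⟨hU, S.formU_alt, S.formU_nondegenerate, fun h => ⟨S.det_repE h, S.repU_form h⟩,
    fun f g => ?_, fun p hp => S.normal_equiv b hp, fun p hp => S.normal_equiv_reduced b hp hU,
    fun p hp => S.normal_subsingleton b hp, S.normal_top_nontrivial b hk, S.normal_top_equiv b hk,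
    ⟨Θ, IsotropicFlag.gradedTangent_one hΘ, IsotropicFlag.gradedTangent_two hΘ,
      fun p hp => S.exists_isFundForm b (by omega), fun p hp F hF => ?_, fun F hF => ?_⟩,
    S.isProjOrbit_openOrbit, ?_, ?_, S.disjoint_Y₁_Y₂, ⟨S.isProjOrbit_Y₁, S.isZariskiClosed_Y₁⟩,
    ⟨S.isProjOrbit_Y₂, S.isZariskiClosed_Y₂⟩, S.exists_segre, S.exists_veronese⟩
  · obtain ⟨h, h1, h2⟩ := S.exists_mem_H f g
    refine ⟨h, ⟨h1, h2⟩, fun h' hh' => S.H_ext (fun x => ?_) fun u => ?_⟩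
    · rw [hh'.1, h1]
    · rw [hh'.2, h2]
  · rw [S.zariskiClosure_sumLocus, IsotropicFlag.image_baseLocus hΘ (by omega) hF]
  · rw [S.zariskiClosure_openOrbit, IsotropicFlag.image_baseLocus hΘ (by omega) hF]
  · rw [S.zariskiClosure_openOrbit, S.rankLocus_diff_openOrbit]
    exact S.isZariskiClosed_Y₁_union_Y₂
  · rw [S.zariskiClosure_openOrbit, S.rankLocus_diff_openOrbit]
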